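/- Notation. $\langle x\rangle=(1+x^2)^{1/2}$. For $\nu\in\mathbb N=\{0,1,2,\dots\}$ let $I_\nu=[\pi\nu,\pi(\nu+2)]$ and $I^e_\nu=[\pi(\nu-1),\pi(\nu+3)]$. For $p\in(1,\infty)$, $s>0$ and an integrable $g:I^e_\nu\to\mathbb C$ put $\|g\|_{\tilde H^{s,p}(I^e_\nu)}^p=\sum_{2\kappa\in\mathbb Z}\big(\langle \kappa\rangle^{s}|\hat g_\kappa|\big)^p$ with $\hat g_\kappa=\frac1{4\pi}\int_{I^e_\nu}g(t)e^{-i\kappa t}\,dt$, and for $f$ on $I_\nu$ put $\|f\|_{\mathcal H^s_p(I_\nu)}=\inf\|g\|_{\tilde H^{s,p}(I^e_\nu)}$ over all extensions $g$ of $f$ to $I^e_\nu$ (equality a.e. on $I_\nu$). For a sequence $R=(R_k)_{k\in\mathbb Z}$ of functions on $(0,\infty)$ put $\|R\|_{X^s_p}^p=\sup_{\nu\ge0}\sum_{k\in\mathbb Z}\|(\nu+1)R_k\|_{\mathcal H^s_p(I_\nu)}^p$, and for $T>0$ let $X^s_p(T)$ be the space of sequences of functions on $(T,\infty)$ that are restrictions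 of sequences of finite $X^s_p$ norm. For $k\in\mathbb Z$ let $NR_k$ be the set of $j=(j_1,j_2,j_3)\in\mathbb Z^3$ with $k=j_1-j_2+j_3$ and $m_{k,j}:=k^2-j_1^2+j_2^2-j_3^2\neq0$, and let $\Lambda_{k,j}=|\alpha_k|^2-|\alpha_{j_1}|^2+|\alpha_{j_2}|^2-|\alpha_{j_3}|^2$. Fix a sign $\sigma\in\{1,-1\}$. The integral system on $(T,\infty)$, $T\ge0$, is: for all $k\in\mathbb Z$ and $t>T$, $$R_k(t)=\frac{\sigma i}{8\pi}\Big(\sum_{j\in NR_k}\int_t^{\infty}\frac{e^{-im_{k,j}\tau}}{\tau}e^{i\frac{\Lambda_{k,j}}{8\pi}\log 4\tau}(R_{j_1}+\alpha_{j_1})\overline{(R_{j_2}+\alpha_{j_2})}(R_{j_3}+\alpha_{j_3})\,d\tau-\int_t^\infty\frac1\tau\big(|R_k+\alpha_k|^2-|\alpha_k|^2\big)(R_k+\alpha_k)\,d\tau\Big),\qquad(\ast)$$ where the integrals are limits of $\int_t^b$ as $b\to\infty$ and the sum over $NR_k$ converges unconditionally (the convergence is part of the notion of solution). Theorem. Let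 $p\in(1,\infty)$ and $\max\{1/p,1-1/p\}<s<1$. (i) For every $T>0$ there is $\delta>0$ such that for every $\alpha\in l^p(\mathbb Z)$ with $\|\alpha\|_{l^p}<\delta$ the system $(\ast)$ on $(T,\infty)$ has a unique solution $R$ in $X^s_p(T)$. (ii) There is $\delta>0$ such that for every $A$ there is $T_0>0$ such that for all $T\ge T_0$ and all $\alpha\in l^p(\mathbb Z)$ with $\|\alpha\|_{l^p}\le A$ and $\|\alpha\|_{l^\infty}<\delta$ the system $(\ast)$ on $(T,\infty)$ has a unique solution $R$ in $X^s_p(T)$. (iii) Let $p=2$ and $1/2<s<1$. There is $\delta>0$ such that for every $\alpha\in l^2(\mathbb Z)$ with $\|\alpha\|_{l^\infty}<\delta$ the system $(\ast)$ on $(0,\infty)$ has a unique solution $R$ whose restriction to $(T,\infty)$ belongs to $X^s_2(T)$ for every $T>0$. -/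

import Mathlib

open Set Filter Topology MeasureTheory
open scoped ENNReal

noncomputable section

namespace DeltaNLS

/-! ### The function spaces -/

/-- The window `I_ν = [πν, π(ν+2)]`. -/
def window (ν : ℕ) : Set ℝ := Icc (Real.pi * ν) (Real.pi * (ν + 2))

/-- Left end point of the enlarged window `I_ν^e = [π(ν-1), π(ν+3)]`, of length `4π`. -/
def extLeft (ν : ℕ) : ℝ := Real.pi * ((ν : ℝ) - 1)

/-- Right end point of the enlarged window `I_ν^e`. -/
def extRight (ν : ℕ) : ℝ := Real.pi * ((ν : ℝ) + 3)

theorem extLeft_lt_extRight (ν : ℕ) : extLeft ν < extRight ν := by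
  unfold extLeft extRight
  nlinarith [Real.pi_pos]

/-- The bracket `⟨x⟩ = (1 + x²)^{1/2}`. -/
def bracket (x : ℝ) : ℝ := Real.sqrt (1 + x ^ 2)

/-- The norm of `H̃^{s,p}(I_ν^e)`. The integer `h` stands for the half-integer frequency `h / 2`:
`fourierCoeffOn _ f h` is `(4π)⁻¹ ∫_{I_ν^e} f(t) e^{-iht/2} dt`. -/
def extNorm (s p : ℝ) (ν : ℕ) (f : ℝ → ℂ) : ℝ≥0∞ :=
  (∑' h : ℤ, (ENNReal.ofReal (bracket ((h : ℝ) / 2) ^ s) *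
    ‖fourierCoeffOn (extLeft_lt_extRight ν) f h‖ₑ) ^ p) ^ (1 / p)

/-- The norm of `𝓗^s_p(I_ν)`: the infimum of the `H̃^{s,p}(I_ν^e)` norms of the (integrable)
extensions to `I_ν^e`; it is `∞` if there is no extension of finite norm.
Functions are identified when they agree almost everywhere. -/
def windowNorm (s p : ℝ) (ν : ℕ) (f : ℝ → ℂ) : ℝ≥0∞ :=
  ⨅ (g : ℝ → ℂ) (_ : IntegrableOn g (Icc (extLeft ν) (extRight ν)))
    (_ : g =ᵐ[volume.restrict (window ν)] f), extNorm s p ν g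

/-- The norm of `X^s_p`. -/
def xNorm (s p : ℝ) (R : ℤ → ℝ → ℂ) : ℝ≥0∞ :=
  ⨆ ν : ℕ, (∑' k : ℤ, windowNorm s p ν (fun t => ((ν : ℂ) + 1) * R k t) ^ p) ^ (1 / p)

/-- The norm of `X^s_p(T)`, as a function of the restrictions of the `R k` to `(T, ∞)`. -/
def xNormOn (s p T : ℝ) (R : ℤ → ℝ → ℂ) : ℝ≥0∞ :=
  ⨅ (Q : ℤ → ℝ → ℂ) (_ : ∀ k, EqOn (Q k) (R k) (Ioi T)), xNorm s p Q

/-- The restriction of `R` to `(T, ∞)` belongs to `X^s_p(T)`. -/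
def MemX (s p T : ℝ) (R : ℤ → ℝ → ℂ) : Prop := xNormOn s p T R < ∞

/-! ### The integral system -/

/-- `k² - j₁² + j₂² - j₃²`. -/
def resonance (k : ℤ) (j : ℤ × ℤ × ℤ) : ℤ := k ^ 2 - j.1 ^ 2 + j.2.1 ^ 2 - j.2.2 ^ 2

/-- The non-resonant triples `NR_k`. -/
def nonRes (k : ℤ) : Set (ℤ × ℤ × ℤ) :=
  {j | k = j.1 - j.2.1 + j.2.2 ∧ resonance k j ≠ 0}

/-- `|α_k|² - |α_{j₁}|² + |α_{j₂}|² - |α_{j₃}|²`. -/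
def phaseShift (α : ℤ → ℂ) (k : ℤ) (j : ℤ × ℤ × ℤ) : ℝ :=
  ‖α k‖ ^ 2 - ‖α j.1‖ ^ 2 + ‖α j.2.1‖ ^ 2 - ‖α j.2.2‖ ^ 2

/-- The contribution of one triple to the cubic non-resonant part of the integrand. -/
def cubicTerm (α : ℤ → ℂ) (R : ℤ → ℝ → ℂ) (k : ℤ) (j : ℤ × ℤ × ℤ) (τ : ℝ) : ℂ :=
  1 / (τ : ℂ) * Complex.exp (-(Complex.I * (resonance k j : ℂ) * (τ : ℂ))) *
    Complex.exp (Complex.I * ((phaseShift α k j / (8 * Real.pi) * Real.log (4 * τ) : ℝ) : ℂ)) *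
    ((R j.1 τ + α j.1) * (starRingEnd ℂ) (R j.2.1 τ + α j.2.1) * (R j.2.2 τ + α j.2.2))

/-- The resonant part of the integrand. -/
def selfTerm (α : ℤ → ℂ) (R : ℤ → ℝ → ℂ) (k : ℤ) (τ : ℝ) : ℂ :=
  1 / (τ : ℂ) * ((‖R k τ + α k‖ ^ 2 - ‖α k‖ ^ 2 : ℝ) : ℂ) * (R k τ + α k)

/-- The (conditionally convergent) integral of `f` over `(t, ∞)` exists and equals `J`. -/
def HasImproperIntegral (f : ℝ → ℂ) (t : ℝ) (J : ℂ) : Prop :=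
  (∀ b : ℝ, t ≤ b → IntervalIntegrable f volume t b) ∧
    Tendsto (fun b : ℝ => ∫ τ in t..b, f τ) atTop (𝓝 J)

/-- `R` solves the integral system on `(T, ∞)` with asymptotic state `α`; `σ = ±1` is the sign
in front of the integral. The integral of the sum over the non-resonant triples is the
(unconditionally convergent) sum of the integrals. -/
def IsSolution (σ : ℝ) (α : ℤ → ℂ) (T : ℝ) (R : ℤ → ℝ → ℂ) : Prop :=
  ∀ k : ℤ, ∀ t : ℝ, T < t → ∃ (J : nonRes k → ℂ) (S D : ℂ),
    (∀ j : nonRes k, HasImproperIntegral (cubicTerm α R k j) t (J j)) ∧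
    HasSum J S ∧
    HasImproperIntegral (selfTerm α R k) t D ∧
    R k t = (σ : ℂ) * (Complex.I / (8 * (Real.pi : ℂ))) * (S - D)

end DeltaNLS

end

/-! Put A = R + α. With x = k - j₁ and y = k - j₃ the resonance function is 2xy, so the non-resonant
terms carry e^{-2ixyτ}/τ with x, y ≠ 0, times a phase e^{iλ log 4τ} with |λ| ≤ 1. On a window each
A_k is a series of modes e^{iht/2}. A product of three modes has index h₁ - h₂ + h₃ - 4xy, and for a
prescribed index n the divisor bound leaves only O(⟨h₁ - h₂ + h₃ - n⟩^ε) pairs (x, y). Hölder's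
inequality then bounds the product by three norms with a loss ⟨n⟩^ε (`freqSum_le`). Integration in
time gains almost a full power of the frequency (`exists_window_fourier`, `timeKer_bound`), which
beats s + ε because s < 1. Hence the Duhamel map is locally Lipschitz (`RepOn.exists_duh_sub`), with
a constant `oscB` that is small on short intervals and O(1/ν) on the whole window of index ν.

Near infinity a half-line integral is cut into the rest of the current window and a tiling by later
windows. Since R = O(1/ν), every term containing R contributes O(1/ν²), which is summable. The term
with three constants is also O(1/ν²), because e^{-2ixyτ} has mean zero over a window
(`norm_integral_phi_window_le`), and the resonant integrand contains |A|² - |α|². The later windows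
contribute something independent of t, and the current window contributes a smaller quantity. This
suggests the norm behind `TailRep`: constants of size N/ν plus a remainder of size ρN/ν. For small ρ
and then large ν, every part of the Lipschitz constant is small except the resonant one, which is
diagonal in k and bounded by ‖α‖_∞². So smallness in ℓ^∞ suffices for a contraction
(`TailRep.exists_fullduh_sub`, `exists_tail`); this gives (ii).

Smaller times are reached by finitely many short local steps (`exists_continuation`). Each step
enlarges the ℓ^p norm by at most a fixed factor, which small data absorb in (i). For p = 2 the
quadrilinear form is real by symmetry and the constant in front of the integral is imaginary. Hence
finite truncations conserve the ℓ² norm, local solutions do not increase it (`exists_local_lpN_le`),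
and the number of steps is irrelevant; this gives (iii).

For uniqueness, an element of X^s_p(T) agrees almost everywhere with Fourier series on the windows;
the equation makes a solution continuous, so the agreement is everywhere (`IsSolution.good`). The
contraction identifies two solutions near infinity and local uniqueness carries this backward
(`backward_unique`). -/

noncomputable section
namespace DeltaNLS

/-! ### The `ℓ^p` functional on extended nonnegative families -/

/-- The `ℓ^p` norm of a family of extended nonnegative reals. -/
def lpN {ι : Type*} (p : ℝ) (f : ι → ℝ≥0∞) : ℝ≥0∞ := (∑' i, f i ^ p) ^ (1 / p)

section lpN
variable {ι κ : Type*} {p q : ℝ}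

theorem lpN_rpow (hp : 0 < p) (f : ι → ℝ≥0∞) : lpN p f ^ p = ∑' i, f i ^ p := by
  rw [lpN, ← ENNReal.rpow_mul, one_div_mul_cancel hp.ne', ENNReal.rpow_one]

theorem lpN_le_iff (hp : 0 < p) {f : ι → ℝ≥0∞} {B : ℝ≥0∞} :
    lpN p f ≤ B ↔ ∑' i, f i ^ p ≤ B ^ p := by
  rw [← ENNReal.rpow_le_rpow_iff hp, lpN_rpow hp]

theorem lpN_mono (hp : 0 < p) {f g : ι → ℝ≥0∞} (h : ∀ i, f i ≤ g i) : lpN p f ≤ lpN p g := by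
  rw [lpN_le_iff hp, lpN_rpow hp]
  exact ENNReal.tsum_le_tsum fun i => ENNReal.rpow_le_rpow (h i) hp.le

theorem le_lpN (hp : 0 < p) (f : ι → ℝ≥0∞) (i : ι) : f i ≤ lpN p f := by
  rw [← ENNReal.rpow_le_rpow_iff hp, lpN_rpow hp]
  exact ENNReal.le_tsum (f := fun i => f i ^ p) i

theorem lpN_const_mul (hp : 0 < p) (c : ℝ≥0∞) (f : ι → ℝ≥0∞) :
    lpN p (fun i => c * f i) = c * lpN p f := by
  have h : lpN p (fun i => c * f i) ^ p = (c * lpN p f) ^ p := by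
    rw [lpN_rpow hp, ENNReal.mul_rpow_of_nonneg _ _ hp.le, lpN_rpow hp, ← ENNReal.tsum_mul_left]
    exact tsum_congr fun i => ENNReal.mul_rpow_of_nonneg _ _ hp.le
  exact (ENNReal.rpow_left_injective hp.ne') h

theorem lpN_zero (hp : 0 < p) : lpN p (fun _ : ι => 0) = 0 := by
  simp [lpN, ENNReal.zero_rpow_of_pos hp, hp]

theorem lpN_single [DecidableEq ι] (hp : 0 < p) (i₀ : ι) (c : ℝ≥0∞) :
    lpN p (fun i => if i = i₀ then c else 0) = c := by
  have h : lpN p (fun i => if i = i₀ then c else 0) ^ p = c ^ p := by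
    rw [lpN_rpow hp, tsum_eq_single i₀]
    · simp
    · intro i hi
      simp [hi, ENNReal.zero_rpow_of_pos hp]
  exact (ENNReal.rpow_left_injective hp.ne') h

/-- Together with `finset_le_lpN` this transfers the finite-sum Minkowski and Hölder inequalities to
arbitrary families. -/
theorem lpN_finset_le (hp : 0 < p) {f : ι → ℝ≥0∞} {B : ℝ≥0∞}
    (h : ∀ s : Finset ι, (∑ i ∈ s, f i ^ p) ^ (1 / p) ≤ B) : lpN p f ≤ B := by
  rw [lpN_le_iff hp, ENNReal.tsum_eq_iSup_sum]
  refine iSup_le fun s => ?_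
  have := ENNReal.rpow_le_rpow (h s) hp.le
  rwa [← ENNReal.rpow_mul, one_div_mul_cancel hp.ne', ENNReal.rpow_one] at this

theorem finset_le_lpN (hp : 0 < p) (f : ι → ℝ≥0∞) (s : Finset ι) :
    (∑ i ∈ s, f i ^ p) ^ (1 / p) ≤ lpN p f :=
  ENNReal.rpow_le_rpow (ENNReal.sum_le_tsum s) (by positivity)

theorem lpN_add_le (hp : 1 ≤ p) (f g : ι → ℝ≥0∞) :
    lpN p (fun i => f i + g i) ≤ lpN p f + lpN p g := by
  have hp0 : 0 < p := by linarith
  refine lpN_finset_le hp0 fun s => (ENNReal.Lp_add_le s f g hp).trans ?_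
  exact add_le_add (finset_le_lpN hp0 f s) (finset_le_lpN hp0 g s)

theorem lpN_finset_sum_le (hp : 1 ≤ p) (f : κ → ι → ℝ≥0∞) (s : Finset κ) :
    lpN p (fun i => ∑ n ∈ s, f n i) ≤ ∑ n ∈ s, lpN p (f n) := by
  classical
  induction s using Finset.induction_on with
  | empty => simp [lpN_zero (by linarith : 0 < p)]
  | insert a s ha ih =>
    simp only [Finset.sum_insert ha]
    exact (lpN_add_le hp _ _).trans (by gcongr)

/-- Minkowski's inequality for infinite sums. -/
theorem lpN_tsum_le (hp : 1 ≤ p) (f : κ → ι → ℝ≥0∞) :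
    lpN p (fun i => ∑' n, f n i) ≤ ∑' n, lpN p (f n) := by
  have hp0 : 0 < p := by linarith
  refine lpN_finset_le hp0 fun t => ?_
  have hlim : Tendsto (fun s : Finset κ => (∑ i ∈ t, (∑ n ∈ s, f n i) ^ p) ^ (1 / p)) atTop
      (𝓝 ((∑ i ∈ t, (∑' n, f n i) ^ p) ^ (1 / p))) := by
    refine (ENNReal.continuous_rpow_const.tendsto _).comp ?_
    refine tendsto_finsetSum _ fun i _ => ?_
    exact (ENNReal.continuous_rpow_const.tendsto _).comp ENNReal.summable.hasSum
  refine le_of_tendsto hlim (Eventually.of_forall fun s => ?_)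
  calc _ ≤ lpN p (fun i => ∑ n ∈ s, f n i) := finset_le_lpN hp0 _ t
    _ ≤ ∑ n ∈ s, lpN p (f n) := lpN_finset_sum_le hp f s
    _ ≤ _ := ENNReal.sum_le_tsum s

/-- Hölder's inequality. -/
theorem tsum_mul_le_lpN (h : p.HolderConjugate q) (f g : ι → ℝ≥0∞) :
    ∑' i, f i * g i ≤ lpN p f * lpN q g := by
  rw [ENNReal.tsum_eq_iSup_sum]
  refine iSup_le fun s => (ENNReal.inner_le_Lp_mul_Lq s f g h).trans ?_
  exact mul_le_mul' (finset_le_lpN h.pos f s) (finset_le_lpN h.symm.pos g s)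

/-- Schur's test. -/
theorem lpN_schur (h : p.HolderConjugate q) (K : ι → κ → ℝ≥0∞) (g : κ → ℝ≥0∞) {C : ℝ≥0∞}
    (hrow : ∀ i, ∑' j, K i j ≤ C) (hcol : ∀ j, ∑' i, K i j ≤ C) :
    lpN p (fun i => ∑' j, K i j * g j) ≤ C * lpN p g := by
  have hp := h.pos
  have hq := h.symm.pos
  rw [lpN_le_iff hp, ENNReal.mul_rpow_of_nonneg _ _ hp.le, lpN_rpow hp]
  have hpq : 1 / q * p = p - 1 := by
    have := h.one_div_add_one_div
    have hp' := hp.ne'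
    have hq' := hq.ne'
    field_simp at this ⊢
    linarith
  -- Hölder with K = K^{1/q} · K^{1/p}: the first factor is absorbed by the row sums, the column
  -- sums enter after summation in i.
  have key : ∀ i, (∑' j, K i j * g j) ^ p ≤ C ^ (p - 1) * ∑' j, K i j * g j ^ p := by
    intro i
    have h1 : ∑' j, K i j * g j ≤
        lpN q (fun j => K i j ^ (1 / q)) * lpN p (fun j => K i j ^ (1 / p) * g j) := by
      refine le_trans (le_of_eq (tsum_congr fun j => ?_)) (tsum_mul_le_lpN h.symm _ _)
      rw [← mul_assoc, ← ENNReal.rpow_add_of_nonneg _ _ (by positivity) (by positivity),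
        h.symm.one_div_add_one_div, div_one, ENNReal.rpow_one]
    calc (∑' j, K i j * g j) ^ p
        ≤ (lpN q (fun j => K i j ^ (1 / q)) * lpN p (fun j => K i j ^ (1 / p) * g j)) ^ p :=
          ENNReal.rpow_le_rpow h1 hp.le
      _ = (∑' j, K i j) ^ (p - 1) * ∑' j, K i j * g j ^ p := by
          rw [ENNReal.mul_rpow_of_nonneg _ _ hp.le, lpN_rpow hp, lpN, ← ENNReal.rpow_mul, hpq]
          congr 1
          · congr 1
            refine tsum_congr fun j => ?_
            rw [← ENNReal.rpow_mul, one_div_mul_cancel hq.ne', ENNReal.rpow_one]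
          · refine tsum_congr fun j => ?_
            rw [ENNReal.mul_rpow_of_nonneg _ _ hp.le, ← ENNReal.rpow_mul,
              one_div_mul_cancel hp.ne', ENNReal.rpow_one]
      _ ≤ _ := by
          gcongr
          · linarith [h.lt]
          · exact hrow i
  calc ∑' i, (∑' j, K i j * g j) ^ p ≤ ∑' i, C ^ (p - 1) * ∑' j, K i j * g j ^ p :=
        ENNReal.tsum_le_tsum key
    _ = C ^ (p - 1) * ∑' j, ∑' i, K i j * g j ^ p := by
        rw [ENNReal.tsum_mul_left, ENNReal.tsum_comm]
    _ ≤ C ^ (p - 1) * ∑' j, C * g j ^ p := by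
        gcongr with j
        rw [ENNReal.tsum_mul_right]
        gcongr
        exact hcol j
    _ = C ^ p * ∑' j, g j ^ p := by
        rw [ENNReal.tsum_mul_left, ← mul_assoc]
        congr 1
        -- The law C^{p-1} · C = C^p follows from `ENNReal.rpow_add` only for 0 < C < ∞.
        rcases eq_or_ne C 0 with rfl | h0
        · simp [ENNReal.zero_rpow_of_pos hp]
        rcases eq_or_ne C ⊤ with rfl | ht
        · rw [ENNReal.top_rpow_of_pos hp, ENNReal.mul_top]
          rw [ENNReal.top_rpow_of_pos (by linarith [h.lt])]
          simp
        nth_rewrite 2 [← ENNReal.rpow_one C]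
        rw [← ENNReal.rpow_add _ _ h0 ht]
        congr 1
        ring

end lpN

/-! ### Weights -/

/-- `⟨h/2⟩`. -/
def w (h : ℤ) : ℝ := bracket ((h : ℝ) / 2)

theorem one_le_w (h : ℤ) : 1 ≤ w h := by
  unfold w bracket
  rw [Real.one_le_sqrt]
  nlinarith [sq_nonneg ((h : ℝ) / 2)]

theorem w_pos (h : ℤ) : 0 < w h := by linarith [one_le_w h]

theorem w_zero : w 0 = 1 := by simp [w, bracket]

theorem w_neg (h : ℤ) : w (-h) = w h := by
  simp only [w, bracket]; push_cast; ring_nf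

theorem w_sub_comm (a b : ℤ) : w (a - b) = w (b - a) := by
  rw [← w_neg, neg_sub]

theorem abs_le_w (h : ℤ) : |(h : ℝ)| / 2 ≤ w h := by
  unfold w bracket
  refine Real.le_sqrt_of_sq_le ?_
  rw [div_pow, sq_abs]; nlinarith

theorem w_le (h : ℤ) : w h ≤ 1 + |(h : ℝ)| / 2 := by
  unfold w bracket
  rw [Real.sqrt_le_left (by positivity)]
  have := sq_abs (h : ℝ)
  nlinarith [abs_nonneg (h : ℝ)]

theorem w_le_abs {h : ℤ} (hh : h ≠ 0) : w h ≤ 3 / 2 * |(h : ℝ)| := by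
  have : (1 : ℝ) ≤ |(h : ℝ)| := by exact_mod_cast Int.one_le_abs hh
  linarith [w_le h]

theorem w_add_le (a b : ℤ) : w (a + b) ≤ w a + w b := by
  simp only [w, bracket]
  have ha := Real.sqrt_nonneg (1 + ((a : ℝ) / 2) ^ 2)
  have hb := Real.sqrt_nonneg (1 + ((b : ℝ) / 2) ^ 2)
  rw [Real.sqrt_le_left (by positivity)]
  have ha2 := Real.sq_sqrt (by positivity : 0 ≤ 1 + ((a : ℝ) / 2) ^ 2)
  have hb2 := Real.sq_sqrt (by positivity : 0 ≤ 1 + ((b : ℝ) / 2) ^ 2)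
  have hab : (a : ℝ) / 2 * (b / 2) ≤
      √(1 + ((a : ℝ) / 2) ^ 2) * √(1 + ((b : ℝ) / 2) ^ 2) := by
    rw [← Real.sqrt_mul (by positivity)]
    refine Real.le_sqrt_of_sq_le ?_
    nlinarith [sq_nonneg ((a : ℝ) / 2), sq_nonneg ((b : ℝ) / 2)]
  push_cast
  nlinarith

theorem w_add_le_mul (a b : ℤ) : w (a + b) ≤ 2 * (w a * w b) := by
  have := w_add_le a b
  nlinarith [one_le_w a, one_le_w b]

theorem w_sub_le (a b : ℤ) : w (a - b) ≤ w a + w b := by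
  have := w_add_le a (-b)
  rwa [w_neg, ← sub_eq_add_neg] at this

/-- The weight `⟨h/2⟩^r` as an extended nonnegative real. -/
def wt (r : ℝ) (h : ℤ) : ℝ≥0∞ := ENNReal.ofReal (w h ^ r)

theorem wt_ne_top (r : ℝ) (h : ℤ) : wt r h ≠ ⊤ := ENNReal.ofReal_ne_top

theorem wt_add (r r' : ℝ) (h : ℤ) : wt (r + r') h = wt r h * wt r' h := by
  rw [wt, Real.rpow_add (w_pos h), ENNReal.ofReal_mul (Real.rpow_nonneg (w_pos h).le r)]; rfl

theorem wt_rpow (r a : ℝ) (ha : 0 ≤ a) (h : ℤ) : wt r h ^ a = wt (r * a) h := by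
  rw [wt, wt, ENNReal.ofReal_rpow_of_nonneg (Real.rpow_nonneg (w_pos h).le r) ha,
    ← Real.rpow_mul (w_pos h).le]

theorem wt_exp_zero (h : ℤ) : wt 0 h = 1 := by simp [wt]

theorem wt_at_zero (r : ℝ) : wt r 0 = 1 := by simp [wt, w_zero]

theorem wt_mul_neg (r : ℝ) (h : ℤ) : wt r h * wt (-r) h = 1 := by
  rw [← wt_add, add_neg_cancel, wt_exp_zero]

theorem wt_neg_mul (r : ℝ) (h : ℤ) : wt (-r) h * wt r h = 1 := by
  rw [mul_comm, wt_mul_neg]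

theorem wt_mono {r r' : ℝ} (hr : r ≤ r') (h : ℤ) : wt r h ≤ wt r' h :=
  ENNReal.ofReal_le_ofReal (Real.rpow_le_rpow_of_exponent_le (one_le_w h) hr)

theorem tsum_wt_lt_top {u : ℝ} (hu : u < -1) : ∑' h : ℤ, wt u h < ⊤ := by
  have hs : Summable fun h : ℤ => w h ^ u := by
    have h1 : Summable fun h : ℤ => (2 : ℝ) ^ (-u) * |(h : ℝ)| ^ u := by
      have := (Real.summable_abs_int_rpow (b := -u) (by linarith)).mul_left ((2 : ℝ) ^ (-u))
      simpa using this
    have h2 : Summable fun h : ℤ => (if h = 0 then (1 : ℝ) else 0) := by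
      apply summable_of_ne_finset_zero (s := {0})
      intro b hb; simpa using hb
    refine (h1.add h2).of_nonneg_of_le (fun h => Real.rpow_nonneg (w_pos h).le u) fun h => ?_
    by_cases h0 : h = 0
    · subst h0
      simp only [w_zero, Real.one_rpow, if_true]
      have : 0 ≤ (2 : ℝ) ^ (-u) * |((0 : ℤ) : ℝ)| ^ u := by positivity
      linarith
    · simp only [h0, if_false, add_zero]
      have hpos : 0 < |(h : ℝ)| := by positivity
      calc w h ^ u ≤ (|(h : ℝ)| / 2) ^ u :=
            Real.rpow_le_rpow_of_nonpos (by positivity) (abs_le_w h) (by linarith)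
        _ = _ := by
            rw [Real.div_rpow hpos.le (by norm_num), Real.rpow_neg (by norm_num)]
            field_simp
  have := hs.tsum_ofReal_ne_top
  exact lt_top_iff_ne_top.2 this

theorem lpN_wt_lt_top {r u : ℝ} (hr : 0 < r) (hu : u * r < -1) : lpN r (wt u) < ⊤ := by
  rw [lpN]
  refine ENNReal.rpow_lt_top_of_nonneg (by positivity) (ne_of_lt ?_)
  simp only [wt_rpow _ _ hr.le]
  exact tsum_wt_lt_top hu

/-! ### The divisor bound -/

/-- The prime-power case of the divisor bound: (p^a)^ε ≥ 2^{aε} ≥ 1 + aε log 2, which dictates M =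
max(1, 1/(ε log 2)). -/
theorem add_one_le_mul_rpow {ε : ℝ} (hε : 0 < ε) :
    ∃ M : ℝ, 1 ≤ M ∧ ∀ (p a : ℕ), 2 ≤ p → (a + 1 : ℝ) ≤ M * ((p ^ a : ℕ) : ℝ) ^ ε := by
  have hl : 0 < ε * Real.log 2 := mul_pos hε (Real.log_pos (by norm_num))
  refine ⟨max 1 (1 / (ε * Real.log 2)), le_max_left _ _, fun p a hp => ?_⟩
  have h1 : 1 + a * (ε * Real.log 2) ≤ ((p ^ a : ℕ) : ℝ) ^ ε := by
    have h2 : ((2 : ℝ) ^ (a : ℝ)) ^ ε ≤ ((p ^ a : ℕ) : ℝ) ^ ε := by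
      refine Real.rpow_le_rpow (by positivity) ?_ hε.le
      rw [Real.rpow_natCast]; push_cast
      exact pow_le_pow_left₀ (by norm_num) (by exact_mod_cast hp) _
    refine le_trans ?_ h2
    rw [← Real.rpow_mul (by norm_num), Real.rpow_def_of_pos (by norm_num)]
    have := Real.add_one_le_exp (Real.log 2 * (a * ε))
    nlinarith
  have hM1 : (1 : ℝ) ≤ max 1 (1 / (ε * Real.log 2)) := le_max_left _ _
  have hM2 : 1 ≤ max 1 (1 / (ε * Real.log 2)) * (ε * Real.log 2) := by
    rw [← div_le_iff₀ hl]; exact le_max_right _ _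
  calc (a + 1 : ℝ) ≤ max 1 (1 / (ε * Real.log 2)) * (1 + a * (ε * Real.log 2)) := by
        have : (0 : ℝ) ≤ a := by positivity
        nlinarith
    _ ≤ _ := by gcongr

/-- By multiplicativity only prime powers matter. If p^ε ≥ 2, then a + 1 ≤ 2^a ≤ (p^a)^ε costs
nothing; each of the primes below P costs a factor M, whence the constant M^P. -/
theorem card_divisors_le_rpow {ε : ℝ} (hε : 0 < ε) :
    ∃ C : ℝ, 1 ≤ C ∧ ∀ n : ℕ, (n.divisors.card : ℝ) ≤ C * (n : ℝ) ^ ε := by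
  obtain ⟨M, hM1, hM⟩ := add_one_le_mul_rpow hε
  obtain ⟨P, hP⟩ := exists_nat_ge ((2 : ℝ) ^ (1 / ε))
  have hbig : ∀ p a : ℕ, P ≤ p → (a + 1 : ℝ) ≤ ((p ^ a : ℕ) : ℝ) ^ ε := by
    intro p a hp
    have h2 : (2 : ℝ) ≤ (p : ℝ) ^ ε := by
      have : ((2 : ℝ) ^ (1 / ε)) ^ ε ≤ (p : ℝ) ^ ε :=
        Real.rpow_le_rpow (by positivity) (hP.trans (by exact_mod_cast hp)) hε.le
      rwa [← Real.rpow_mul (by norm_num), one_div_mul_cancel hε.ne', Real.rpow_one] at this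
    have h3 : ((p ^ a : ℕ) : ℝ) ^ ε = ((p : ℝ) ^ ε) ^ a := by
      push_cast
      rw [← Real.rpow_natCast, ← Real.rpow_natCast, ← Real.rpow_mul (by positivity),
        ← Real.rpow_mul (by positivity), mul_comm]
    rw [h3]
    refine le_trans ?_ (pow_le_pow_left₀ (by norm_num) h2 a)
    exact_mod_cast Nat.lt_two_pow_self
  have key : ∀ n : ℕ, (n.divisors.card : ℝ) ≤
      M ^ (n.primeFactors.filter (· < P)).card * (n : ℝ) ^ ε := by
    intro n
    induction n using Nat.recOnPosPrimePosCoprime with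
    | zero => simp [Real.zero_rpow hε.ne']
    | one => simp
    | prime_pow p a hp ha =>
      rw [Nat.divisors_prime_pow hp, Nat.primeFactors_prime_pow ha.ne' hp]
      simp only [Finset.card_map, Finset.card_range]
      by_cases hpP : p < P
      · have : ({p} : Finset ℕ).filter (· < P) = {p} := by
          rw [Finset.filter_singleton, if_pos hpP]
        rw [this, Finset.card_singleton, pow_one]
        exact_mod_cast hM p a hp.two_le
      · have : ({p} : Finset ℕ).filter (· < P) = ∅ := by
          rw [Finset.filter_singleton, if_neg hpP]
        rw [this, Finset.card_empty, pow_zero, one_mul]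
        exact_mod_cast hbig p a (by omega)
    | coprime a b ha hb hab iha ihb =>
      rw [hab.card_divisors_mul, hab.primeFactors_mul, Finset.filter_union,
        Finset.card_union_of_disjoint (Finset.disjoint_filter_filter hab.disjoint_primeFactors),
        pow_add]
      push_cast
      rw [Real.mul_rpow (by positivity) (by positivity)]
      calc (a.divisors.card : ℝ) * b.divisors.card ≤ _ :=
            mul_le_mul iha ihb (by positivity) (by positivity)
        _ = _ := by ring
  refine ⟨M ^ P, one_le_pow₀ hM1, fun n => (key n).trans ?_⟩
  gcongr
  · calc (n.primeFactors.filter (· < P)).card ≤ (Finset.range P).card := by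
          refine Finset.card_le_card fun x hx => ?_
          rw [Finset.mem_filter] at hx
          exact Finset.mem_range.2 hx.2
      _ = P := Finset.card_range P

/-- The pairs `(k - j₁, k - j₃)` of the non-resonant triples, together with `(0, 0)`. -/
def pairs : Set (ℤ × ℤ) := {q | (q.1 ≠ 0 ∧ q.2 ≠ 0) ∨ (q.1 = 0 ∧ q.2 = 0)}

-- For n ≠ 0, x is a signed divisor of n and determines y = n/(4x). For n = 0 only the origin
-- remains, because `pairs` omits the rest of the coordinate axes.
open Classical in
theorem tsum_pairs_le {ε : ℝ} (hε : 0 < ε) :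
    ∃ C : ℝ≥0∞, C ≠ ⊤ ∧ ∀ n : ℤ,
      ∑' q : ℤ × ℤ, (if q ∈ pairs ∧ 4 * (q.1 * q.2) = n then (1 : ℝ≥0∞) else 0) ≤ C * wt ε n := by
  obtain ⟨C, hC1, hC⟩ := card_divisors_le_rpow hε
  refine ⟨ENNReal.ofReal (2 * C * 2 ^ ε), ENNReal.ofReal_ne_top, fun n => ?_⟩
  have hone : (1 : ℝ) ≤ 2 * C * 2 ^ ε := by
    have := Real.one_le_rpow (by norm_num : (1 : ℝ) ≤ 2) hε.le
    nlinarith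
  rcases eq_or_ne n 0 with rfl | hn
  · rw [wt_at_zero, mul_one, tsum_eq_single (0, 0)]
    · refine le_trans ?_ (ENNReal.ofReal_le_ofReal hone)
      rw [ENNReal.ofReal_one]
      split_ifs <;> simp
    · rintro ⟨x, y⟩ hxy
      rw [if_neg]
      rintro ⟨h1, h2⟩
      rcases h1 with h1 | h1
      · simp [h1.1, h1.2] at h2
      · exact hxy (Prod.ext h1.1 h1.2)
  · let D : Finset ℤ := n.natAbs.divisors.image (fun d : ℕ => (d : ℤ)) ∪
      n.natAbs.divisors.image (fun d : ℕ => -(d : ℤ))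
    have hDcard : (D.card : ℝ) ≤ 2 * C * (n.natAbs : ℝ) ^ ε := by
      have h1 : D.card ≤ n.natAbs.divisors.card + n.natAbs.divisors.card :=
        (Finset.card_union_le _ _).trans (add_le_add Finset.card_image_le Finset.card_image_le)
      have h2 : (D.card : ℝ) ≤ n.natAbs.divisors.card + n.natAbs.divisors.card := by
        exact_mod_cast h1
      linarith [hC n.natAbs]
    let S : Finset (ℤ × ℤ) := D.image fun x => (x, n / (4 * x))
    have hS : ∀ q : ℤ × ℤ, q ∉ S →
        (if q ∈ pairs ∧ 4 * (q.1 * q.2) = n then (1 : ℝ≥0∞) else 0) = 0 := by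
      rintro ⟨x, y⟩ hq
      rw [if_neg]
      rintro ⟨-, h2⟩
      simp only at h2
      have hx0 : x ≠ 0 := by rintro rfl; simp at h2; exact hn h2.symm
      refine hq (Finset.mem_image.2 ⟨x, ?_, ?_⟩)
      · have hd : x.natAbs ∈ n.natAbs.divisors := by
          rw [Nat.mem_divisors]
          refine ⟨Int.natAbs_dvd_natAbs.2 ⟨4 * y, by rw [← h2]; ring⟩, by simpa using hn⟩
        rcases Int.natAbs_eq x with hx | hx
        · exact Finset.mem_union_left _ (Finset.mem_image.2 ⟨_, hd, hx.symm⟩)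
        · exact Finset.mem_union_right _ (Finset.mem_image.2 ⟨_, hd, hx.symm⟩)
      · rw [← h2, show 4 * (x * y) = 4 * x * y by ring, Int.mul_ediv_cancel_left _ (by omega)]
    rw [tsum_eq_sum (s := S) (fun q hq => hS q hq)]
    calc ∑ q ∈ S, (if q ∈ pairs ∧ 4 * (q.1 * q.2) = n then (1 : ℝ≥0∞) else 0)
        ≤ ∑ q ∈ S, (1 : ℝ≥0∞) := Finset.sum_le_sum fun q _ => by split_ifs <;> simp
      _ = S.card := by simp
      _ ≤ D.card := by exact_mod_cast Finset.card_image_le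
      _ = ENNReal.ofReal D.card := by simp
      _ ≤ ENNReal.ofReal (2 * C * 2 ^ ε * w n ^ ε) := by
          refine ENNReal.ofReal_le_ofReal (hDcard.trans ?_)
          rw [mul_assoc (2 * C), ← Real.mul_rpow (by norm_num) (w_pos n).le]
          gcongr
          have := abs_le_w n
          rw [Nat.cast_natAbs, Int.cast_abs]
          linarith
      _ = _ := by rw [ENNReal.ofReal_mul (by positivity)]; rfl

/-! ### Submultiplicativity of the weights. -/

theorem wt_add_le {r : ℝ} (hr : 0 ≤ r) (a b : ℤ) :
    wt r (a + b) ≤ ENNReal.ofReal (2 ^ r) * (wt r a * wt r b) := by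
  have ha := w_pos a
  have hb := w_pos b
  rw [wt, wt, wt, ← ENNReal.ofReal_mul (by positivity), ← ENNReal.ofReal_mul (by positivity),
    ← Real.mul_rpow (by positivity) (by positivity), ← Real.mul_rpow (by positivity) (by positivity)]
  exact ENNReal.ofReal_le_ofReal (Real.rpow_le_rpow (w_pos _).le (w_add_le_mul a b) hr)

theorem wt_neg_arg (r : ℝ) (h : ℤ) : wt r (-h) = wt r h := by rw [wt, w_neg, wt]

theorem wt_comb_le {r : ℝ} (hr : 0 ≤ r) (a b c d : ℤ) :
    wt r (a - b + c - d) ≤ ENNReal.ofReal (2 ^ r) ^ 3 * (wt r a * wt r b * wt r c * wt r d) := by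
  have h1 := wt_add_le hr (a - b + c) (-d)
  have h2 := wt_add_le hr (a - b) c
  have h3 := wt_add_le hr a (-b)
  rw [wt_neg_arg, ← sub_eq_add_neg] at h1 h3
  calc _ ≤ _ := h1
    _ ≤ ENNReal.ofReal (2 ^ r) * ((ENNReal.ofReal (2 ^ r) * ((ENNReal.ofReal (2 ^ r) *
          (wt r a * wt r b)) * wt r c)) * wt r d) := by
        gcongr
        exact h2.trans (by gcongr)
    _ = _ := by ring

/-! ### Exponents -/

/-- Admissible exponents: `q` is dual to `p` and `ε` is a small loss. -/
structure Adm (s p q ε : ℝ) : Prop where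
  conj : p.HolderConjugate q
  pos : 0 < ε
  -- This puts ⟨h⟩^{-s+ε} in ℓ^q, with room for the divisor loss. The two bounds below leave room in
  -- the kernel of time integration.
  s_gt : 1 / q + ε < s
  s_lt : 4 * ε ≤ 1 - s
  eps_p : 4 * ε ≤ 1 / p

namespace Adm
variable {s p q ε : ℝ} (H : Adm s p q ε)
include H

theorem p_pos : 0 < p := H.conj.pos
theorem one_le_p : 1 ≤ p := H.conj.lt.le
theorem q_pos : 0 < q := H.conj.symm.pos
theorem s_pos : 0 < s := by have := H.s_gt; have := one_div_pos.2 H.q_pos; linarith [H.pos]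
theorem sum_inv : 1 / p + 1 / q = 1 := H.conj.one_div_add_one_div.trans (by norm_num)

end Adm

/-- Since 1/q = 1 - 1/p < s < 1, there is room on both sides of s; ε is the smallest of (1-s)/4,
(s-1/q)/2 and 1/(4p). -/
theorem exists_adm {s p : ℝ} (hp : 1 < p) (h1 : max (1 / p) (1 - 1 / p) < s) (h2 : s < 1) :
    ∃ q ε, Adm s p q ε := by
  have hc := Real.HolderConjugate.conjExponent hp
  have hs : 1 - 1 / p < s := (le_max_right _ _).trans_lt h1
  have hq : 1 / p.conjExponent = 1 - 1 / p := by
    have := hc.one_div_add_one_div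
    rw [div_one] at this
    linarith
  have hp0 : 0 < 1 / p := by positivity
  refine ⟨p.conjExponent, min ((1 - s) / 4) (min ((s - (1 - 1 / p)) / 2) (1 / p / 4)), hc, ?_,
    ?_, ?_, ?_⟩
  · refine lt_min (by linarith) (lt_min (by linarith) (by linarith))
  · have := (min_le_right ((1 - s) / 4) _).trans (min_le_left ((s - (1 - 1 / p)) / 2) (1 / p / 4))
    rw [hq]; linarith
  · have := min_le_left ((1 - s) / 4) (min ((s - (1 - 1 / p)) / 2) (1 / p / 4))
    linarith
  · have := (min_le_right ((1 - s) / 4) _).trans (min_le_right ((s - (1 - 1 / p)) / 2) (1 / p / 4))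
    linarith

/-! ### The trilinear estimate for Fourier coefficients -/

/-- The index set of the terms of the trilinear form: `((k - j₁, k - j₃), (h₁, h₂, h₃))`. -/
abbrev Idx := (ℤ × ℤ) × (ℤ × ℤ × ℤ)

/-- The frequency of a term, in units of `1/2`. -/
def freq (i : Idx) : ℤ := i.2.1 - i.2.2.1 + i.2.2.2 - 4 * (i.1.1 * i.1.2)

/-- The size of a term. -/
def amp (a b c : ℤ → ℤ → ℝ≥0∞) (k : ℤ) (i : Idx) : ℝ≥0∞ :=
  a (k - i.1.1) i.2.1 * b (k - i.1.1 - i.1.2) i.2.2.1 * c (k - i.1.2) i.2.2.2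

/-- The three shifted indices are independent: (k, x, y) ↦ (k - x, k - x - y, k - y) is a bijection
of ℤ³. -/
theorem tsum_shift_triple (α β γ : ℤ → ℝ≥0∞) :
    ∑' k : ℤ, ∑' q : ℤ × ℤ, α (k - q.1) * β (k - q.1 - q.2) * γ (k - q.2) =
      (∑' k, α k) * (∑' k, β k) * (∑' k, γ k) := by
  have h1 : ∀ k : ℤ, ∑' q : ℤ × ℤ, α (k - q.1) * β (k - q.1 - q.2) * γ (k - q.2) =
      ∑' q : ℤ × ℤ, α q.1 * β (q.1 + q.2 - k) * γ q.2 := by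
    intro k
    rw [← ((Equiv.subLeft k).prodCongr (Equiv.subLeft k)).tsum_eq
      (fun q : ℤ × ℤ => α q.1 * β (q.1 + q.2 - k) * γ q.2)]
    refine tsum_congr fun q => ?_
    simp only [Equiv.prodCongr_apply, Prod.map, Equiv.subLeft_apply]
    congr 3
    ring
  simp_rw [h1]
  rw [ENNReal.tsum_comm]
  have h2 : ∀ q : ℤ × ℤ, ∑' k : ℤ, α q.1 * β (q.1 + q.2 - k) * γ q.2 =
      α q.1 * γ q.2 * ∑' k, β k := by
    intro q
    rw [← (Equiv.subLeft (q.1 + q.2)).tsum_eq β, ← ENNReal.tsum_mul_left]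
    refine tsum_congr fun k => ?_
    simp only [Equiv.subLeft_apply]
    ring
  simp_rw [h2]
  rw [ENNReal.tsum_mul_right, ENNReal.tsum_prod' (f := fun q : ℤ × ℤ => α q.1 * γ q.2)]
  simp only [ENNReal.tsum_mul_left, ENNReal.tsum_mul_right]
  ring

theorem tsum_triple_mul (α β γ : ℤ → ℝ≥0∞) :
    ∑' h : ℤ × ℤ × ℤ, α h.1 * β h.2.1 * γ h.2.2 = (∑' k, α k) * (∑' k, β k) * (∑' k, γ k) := by
  rw [ENNReal.tsum_prod' (f := fun h : ℤ × ℤ × ℤ => α h.1 * β h.2.1 * γ h.2.2)]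
  simp_rw [ENNReal.tsum_prod' (f := fun h : ℤ × ℤ => α _ * β h.1 * γ h.2)]
  simp only [ENNReal.tsum_mul_left, ENNReal.tsum_mul_right]

/-- The norm of a family of coefficient sequences. -/
def lpW (s p : ℝ) (a : ℤ → ℤ → ℝ≥0∞) : ℝ≥0∞ := lpN p fun k => lpN p fun h => wt s h * a k h

open Classical in
/-- The sum of the sizes of the terms of given frequency, over the terms in `pairs`. -/
def freqSum (a b c : ℤ → ℤ → ℝ≥0∞) (k n : ℤ) : ℝ≥0∞ :=
  ∑' i : Idx, if i.1 ∈ pairs ∧ freq i = n then amp a b c k i else 0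

-- Hölder for fixed k and n. The ℓ^q norm of ⟨h₁⟩^{-s}⟨h₂⟩^{-s}⟨h₃⟩^{-s} over the terms of frequency
-- n is O(⟨n⟩^ε), by the divisor bound with exponent εq and ⟨h₁-h₂+h₃-n⟩ ≲ ⟨h₁⟩⟨h₂⟩⟨h₃⟩⟨n⟩. The ℓ^p
-- factor is then summed over n and k; each term has exactly one frequency, so the sum is at most
-- the product of the three norms.
open Classical in
theorem freqSum_le {s p q ε : ℝ} (H : Adm s p q ε) :
    ∃ C : ℝ≥0∞, C ≠ ⊤ ∧ ∀ a b c : ℤ → ℤ → ℝ≥0∞,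
      lpW (-ε) p (freqSum a b c) ≤ C * (lpW s p a * lpW s p b * lpW s p c) := by
  have hp := H.p_pos
  have hq := H.q_pos
  have hεq : 0 < ε * q := mul_pos H.pos hq
  obtain ⟨C₁, hC₁, hdiv⟩ := tsum_pairs_le hεq
  set S : ℝ≥0∞ := ∑' h, wt (-(s * q) + ε * q) h with hS
  have hSt : S ≠ ⊤ := by
    refine (tsum_wt_lt_top ?_).ne
    have h1 := mul_lt_mul_of_pos_right H.s_gt hq
    have h2 : 1 / q * q = 1 := one_div_mul_cancel hq.ne'
    nlinarith
  set C₂ : ℝ≥0∞ := C₁ * ENNReal.ofReal (2 ^ (ε * q)) ^ 3 * S ^ 3 with hC₂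
  have hC₂t : C₂ ≠ ⊤ := by
    refine ENNReal.mul_ne_top (ENNReal.mul_ne_top hC₁ ?_) ?_
    · exact ENNReal.pow_ne_top ENNReal.ofReal_ne_top
    · exact ENNReal.pow_ne_top hSt
  -- the weights
  have hwt : ∀ n : ℤ, ∑' i : Idx, (if i.1 ∈ pairs ∧ freq i = n then
      wt (-(s * q)) i.2.1 * wt (-(s * q)) i.2.2.1 * wt (-(s * q)) i.2.2.2 else 0) ≤
        C₂ * wt (ε * q) n := by
    intro n
    rw [ENNReal.tsum_prod' (f := fun i : Idx => if i.1 ∈ pairs ∧ freq i = n then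
      wt (-(s * q)) i.2.1 * wt (-(s * q)) i.2.2.1 * wt (-(s * q)) i.2.2.2 else 0), ENNReal.tsum_comm]
    have h1 : ∀ h : ℤ × ℤ × ℤ, ∑' x : ℤ × ℤ, (if x ∈ pairs ∧ freq (x, h) = n then
        wt (-(s * q)) h.1 * wt (-(s * q)) h.2.1 * wt (-(s * q)) h.2.2 else 0) ≤
        C₁ * ENNReal.ofReal (2 ^ (ε * q)) ^ 3 * wt (ε * q) n *
          (wt (-(s * q) + ε * q) h.1 * wt (-(s * q) + ε * q) h.2.1 *
            wt (-(s * q) + ε * q) h.2.2) := by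
      intro h
      have h2 : ∀ x : ℤ × ℤ, (if x ∈ pairs ∧ freq (x, h) = n then
          wt (-(s * q)) h.1 * wt (-(s * q)) h.2.1 * wt (-(s * q)) h.2.2 else 0) =
          (if x ∈ pairs ∧ 4 * (x.1 * x.2) = h.1 - h.2.1 + h.2.2 - n then 1 else 0) *
          (wt (-(s * q)) h.1 * wt (-(s * q)) h.2.1 * wt (-(s * q)) h.2.2) := by
        intro x
        have h3 : (freq (x, h) = n) ↔ (4 * (x.1 * x.2) = h.1 - h.2.1 + h.2.2 - n) := by
          simp only [freq]; constructor <;> intro h4 <;> linarith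
        rw [ite_mul, one_mul, zero_mul]
        simp only [h3]
      simp_rw [h2]
      rw [ENNReal.tsum_mul_right]
      simp only [wt_add]
      calc _ ≤ C₁ * (ENNReal.ofReal (2 ^ (ε * q)) ^ 3 * (wt (ε * q) h.1 * wt (ε * q) h.2.1 *
              wt (ε * q) h.2.2 * wt (ε * q) n)) *
              (wt (-(s * q)) h.1 * wt (-(s * q)) h.2.1 * wt (-(s * q)) h.2.2) := by
            gcongr
            exact (hdiv _).trans (by gcongr; exact wt_comb_le hεq.le _ _ _ _)
        _ = _ := by ring
    refine (ENNReal.tsum_le_tsum h1).trans ?_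
    rw [ENNReal.tsum_mul_left, tsum_triple_mul]
    simp only [← hS, hC₂]
    exact le_of_eq (by ring)
  set C : ℝ≥0∞ := C₂ ^ (1 / q) with hC
  have hCt : C ≠ ⊤ := ENNReal.rpow_ne_top_of_nonneg (by positivity) hC₂t
  refine ⟨C, hCt, fun a b c => ?_⟩
  -- pointwise Hölder
  have hpt : ∀ k n, wt (-ε) n * freqSum a b c k n ≤ C * lpN p (fun i : Idx =>
      if i.1 ∈ pairs ∧ freq i = n then amp (fun k h => wt s h * a k h)
        (fun k h => wt s h * b k h) (fun k h => wt s h * c k h) k i else 0) := by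
    intro k n
    set X : Idx → ℝ≥0∞ := fun i => if i.1 ∈ pairs ∧ freq i = n then
        amp (fun k h => wt s h * a k h)
        (fun k h => wt s h * b k h) (fun k h => wt s h * c k h) k i else 0 with hX
    have h1 : freqSum a b c k n ≤ lpN q (fun i : Idx => if i.1 ∈ pairs ∧ freq i = n then
        wt (-s) i.2.1 * wt (-s) i.2.2.1 * wt (-s) i.2.2.2 else 0) * lpN p X := by
      refine le_trans (le_of_eq (tsum_congr fun i => ?_)) (tsum_mul_le_lpN H.conj.symm _ _)
      simp only [hX, amp]
      split_ifs
      · calc _ = (wt (-s) i.2.1 * wt s i.2.1) * (wt (-s) i.2.2.1 * wt s i.2.2.1) *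
              (wt (-s) i.2.2.2 * wt s i.2.2.2) * (a (k - i.1.1) i.2.1 *
              b (k - i.1.1 - i.1.2) i.2.2.1 * c (k - i.1.2) i.2.2.2) := by
              simp only [wt_neg_mul, one_mul]
          _ = _ := by ring
      · simp
    have h2 : lpN q (fun i : Idx => if i.1 ∈ pairs ∧ freq i = n then
        wt (-s) i.2.1 * wt (-s) i.2.2.1 * wt (-s) i.2.2.2 else 0) ≤ C * wt ε n := by
      rw [lpN_le_iff hq, ENNReal.mul_rpow_of_nonneg _ _ hq.le, hC, ← ENNReal.rpow_mul,
        one_div_mul_cancel hq.ne', ENNReal.rpow_one, wt_rpow _ _ hq.le]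
      refine le_trans (le_of_eq (tsum_congr fun i => ?_)) (hwt n)
      split_ifs
      · simp only [ENNReal.mul_rpow_of_nonneg _ _ hq.le, wt_rpow _ _ hq.le, neg_mul]
      · exact ENNReal.zero_rpow_of_pos hq
    calc wt (-ε) n * freqSum a b c k n ≤ wt (-ε) n * ((C * wt ε n) * lpN p X) := by
          gcongr; exact h1.trans (by gcongr)
      _ = (wt (-ε) n * wt ε n) * (C * lpN p X) := by ring
      _ = C * lpN p X := by rw [wt_neg_mul, one_mul]
  -- summation
  have hsum : lpN p (fun k => lpN p fun n => lpN p (fun i : Idx =>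
      if i.1 ∈ pairs ∧ freq i = n then amp (fun k h => wt s h * a k h)
        (fun k h => wt s h * b k h) (fun k h => wt s h * c k h) k i else 0)) ≤
      lpW s p a * lpW s p b * lpW s p c := by
    rw [lpN_le_iff hp]
    simp only [lpN_rpow hp, lpW, ENNReal.mul_rpow_of_nonneg _ _ hp.le]
    rw [← tsum_shift_triple]
    refine ENNReal.tsum_le_tsum fun k => ?_
    rw [ENNReal.tsum_comm]
    rw [ENNReal.tsum_prod' (f := fun i : Idx => ∑' n, (if i.1 ∈ pairs ∧ freq i = n then
      amp (fun k h => wt s h * a k h)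
        (fun k h => wt s h * b k h) (fun k h => wt s h * c k h) k i else 0) ^ p)]
    refine ENNReal.tsum_le_tsum fun x => ?_
    rw [← tsum_triple_mul]
    refine ENNReal.tsum_le_tsum fun h => ?_
    rw [tsum_eq_single (freq (x, h))]
    · split_ifs
      · simp only [amp, ENNReal.mul_rpow_of_nonneg _ _ hp.le]
        exact le_rfl
      · simp [ENNReal.zero_rpow_of_pos hp]
    · intro n hn
      rw [if_neg (fun h' => hn h'.2.symm), ENNReal.zero_rpow_of_pos hp]
  calc lpW (-ε) p (freqSum a b c) ≤ lpN p (fun k => lpN p fun n => C * lpN p (fun i : Idx =>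
      if i.1 ∈ pairs ∧ freq i = n then amp (fun k h => wt s h * a k h)
        (fun k h => wt s h * b k h) (fun k h => wt s h * c k h) k i else 0)) :=
        lpN_mono hp fun k => lpN_mono hp fun n => hpt k n
    _ ≤ _ := by
        simp only [lpN_const_mul hp]
        gcongr

/-! ### The kernel of time integration on a window -/

/-- The majorant of the Fourier coefficients of `∫_t^{t₁} φ e^{inτ/2} dτ`. -/
def timeKer (ε : ℝ) (h n : ℤ) : ℝ≥0∞ :=
  wt (-1) h * (wt (-1 + ε) (h - n) + wt (-1 + ε) n * wt (-1) h)

/-- To be read with a = ⟨h⟩, b = ⟨n⟩, d = ⟨h-n⟩. If b ≤ 2a, then d ≤ 3a and the powers of a and b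
turn into powers of d, of total exponent s - 2 + 2ε ≤ -1 - ε. If b > 2a, then d ≥ b/2, and part of
the decay in b is handed over to a, leaving a product. -/
theorem near_kernel_le {s p q ε : ℝ} (H : Adm s p q ε) {a b d : ℝ} (ha : 1 ≤ a) (hb : 1 ≤ b)
    (hd : 1 ≤ d) (h1 : d ≤ a + b) (h2 : b ≤ a + d) :
    a ^ (s - 1) * b ^ ε * d ^ (-1 + ε) ≤
      6 * (d ^ (-1 - ε) + a ^ (-(1 / p + ε)) * b ^ (-(1 / q + ε))) := by
  have hε := H.pos
  have hs := H.s_lt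
  have hsp := H.s_pos
  have hpe := H.eps_p
  have hpq := H.sum_inv
  have hq1 : 0 < 1 / q := one_div_pos.2 H.q_pos
  have ha0 : 0 < a := by linarith
  have hb0 : 0 < b := by linarith
  have hd0 : 0 < d := by linarith
  rcases le_or_gt b (2 * a) with hba | hba
  · have e1 : b ^ ε ≤ 2 * a ^ ε := by
      calc b ^ ε ≤ (2 * a) ^ ε := Real.rpow_le_rpow hb0.le hba hε.le
        _ = 2 ^ ε * a ^ ε := Real.mul_rpow (by norm_num) ha0.le
        _ ≤ 2 ^ (1 : ℝ) * a ^ ε := by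
            gcongr
            · norm_num
            · linarith
        _ = 2 * a ^ ε := by rw [Real.rpow_one]
    have e2 : a ^ (s - 1 + ε) ≤ 3 * d ^ (s - 1 + ε) := by
      calc a ^ (s - 1 + ε) ≤ (d / 3) ^ (s - 1 + ε) :=
            Real.rpow_le_rpow_of_nonpos (by positivity) (by linarith) (by linarith)
        _ = 3 ^ (-(s - 1 + ε)) * d ^ (s - 1 + ε) := by
            rw [Real.div_rpow hd0.le (by norm_num), Real.rpow_neg (by norm_num)]
            field_simp
        _ ≤ 3 ^ (1 : ℝ) * d ^ (s - 1 + ε) := by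
            gcongr
            · norm_num
            · linarith
        _ = _ := by rw [Real.rpow_one]
    calc a ^ (s - 1) * b ^ ε * d ^ (-1 + ε) ≤ a ^ (s - 1) * (2 * a ^ ε) * d ^ (-1 + ε) := by gcongr
      _ = 2 * a ^ (s - 1 + ε) * d ^ (-1 + ε) := by rw [Real.rpow_add ha0]; ring
      _ ≤ 2 * (3 * d ^ (s - 1 + ε)) * d ^ (-1 + ε) := by gcongr
      _ = 6 * d ^ (s - 1 + ε + (-1 + ε)) := by rw [Real.rpow_add hd0 (s - 1 + ε)]; ring
      _ ≤ 6 * d ^ (-1 - ε) := by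
          gcongr
          linarith
      _ ≤ _ := by
          have : 0 ≤ a ^ (-(1 / p + ε)) * b ^ (-(1 / q + ε)) := by positivity
          linarith
  · have e1 : d ^ (-1 + ε) ≤ 2 * b ^ (-1 + ε) := by
      calc d ^ (-1 + ε) ≤ (b / 2) ^ (-1 + ε) :=
            Real.rpow_le_rpow_of_nonpos (by positivity) (by linarith) (by linarith)
        _ = 2 ^ (-(-1 + ε)) * b ^ (-1 + ε) := by
            rw [Real.div_rpow hb0.le (by norm_num), Real.rpow_neg (by norm_num)]
            field_simp
        _ ≤ 2 ^ (1 : ℝ) * b ^ (-1 + ε) := by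
            gcongr
            · norm_num
            · linarith
        _ = _ := by rw [Real.rpow_one]
    have e2 : b ^ (-(1 / p) + 3 * ε) ≤ a ^ (-(1 / p) + 3 * ε) :=
      Real.rpow_le_rpow_of_nonpos ha0 (by linarith) (by linarith)
    calc a ^ (s - 1) * b ^ ε * d ^ (-1 + ε) ≤ a ^ (s - 1) * b ^ ε * (2 * b ^ (-1 + ε)) := by gcongr
      _ = 2 * a ^ (s - 1) * (b ^ (-(1 / p) + 3 * ε) * b ^ (-(1 / q + ε))) := by
          rw [← Real.rpow_add hb0, show -(1 / p) + 3 * ε + -(1 / q + ε) = ε + (-1 + ε) by linarith,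
            Real.rpow_add hb0 ε (-1 + ε)]
          ring
      _ ≤ 2 * a ^ (s - 1) * (a ^ (-(1 / p) + 3 * ε) * b ^ (-(1 / q + ε))) := by gcongr
      _ = 2 * (a ^ (s - 1 + (-(1 / p) + 3 * ε)) * b ^ (-(1 / q + ε))) := by
          rw [Real.rpow_add ha0 (s - 1)]; ring
      _ ≤ 2 * (a ^ (-(1 / p + ε)) * b ^ (-(1 / q + ε))) := by
          gcongr
          linarith
      _ ≤ _ := by
          have h1 : 0 ≤ a ^ (-(1 / p + ε)) * b ^ (-(1 / q + ε)) := by positivity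
          have h2 : 0 ≤ d ^ (-1 - ε) := by positivity
          linarith

/-- With the outgoing weight ⟨h⟩^s and the incoming loss ⟨n⟩^ε the kernel is dominated by a
convolution with an ℓ¹ sequence plus a rank-one kernel. The second summand of `timeKer` is of rank
one from the start. -/
theorem timeKer_le {s p q ε : ℝ} (H : Adm s p q ε) (h n : ℤ) :
    wt s h * timeKer ε h n * wt ε n ≤
      7 * (wt (-1 - ε) (h - n) + wt (-(1 / p + ε)) h * wt (-(1 / q + ε)) n) := by
  have hε := H.pos
  have hs := H.s_lt
  have hsp := H.s_pos
  have hpe := H.eps_p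
  have hpq := H.sum_inv
  have hq1 : 0 < 1 / q := one_div_pos.2 H.q_pos
  have e1 : wt s h * timeKer ε h n * wt ε n =
      wt (s - 1) h * wt ε n * wt (-1 + ε) (h - n) + wt (s - 2) h * wt (-1 + 2 * ε) n := by
    rw [timeKer, show s - 2 = s + (-1) + (-1) by ring, show s - 1 = s + -1 by ring,
      show -1 + 2 * ε = -1 + ε + ε by ring]
    simp only [wt_add]
    ring
  rw [e1]
  have e2 : wt (s - 1) h * wt ε n * wt (-1 + ε) (h - n) ≤
      6 * (wt (-1 - ε) (h - n) + wt (-(1 / p + ε)) h * wt (-(1 / q + ε)) n) := by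
    have := near_kernel_le H (one_le_w h) (one_le_w n) (one_le_w (h - n)) (w_sub_le h n)
      (by have := w_sub_le h (h - n); rwa [sub_sub_cancel] at this)
    have h0 := w_pos h
    have hn := w_pos n
    have hd := w_pos (h - n)
    simp only [wt]
    rw [← ENNReal.ofReal_mul (by positivity), ← ENNReal.ofReal_mul (by positivity),
      ← ENNReal.ofReal_mul (by positivity), ← ENNReal.ofReal_add (by positivity) (by positivity),
      show (6 : ℝ≥0∞) = ENNReal.ofReal 6 by simp, ← ENNReal.ofReal_mul (by positivity)]
    exact ENNReal.ofReal_le_ofReal this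
  have e3 : wt (s - 2) h * wt (-1 + 2 * ε) n ≤ wt (-(1 / p + ε)) h * wt (-(1 / q + ε)) n := by
    gcongr
    · exact wt_mono (by linarith) h
    · exact wt_mono (by linarith) n
  calc _ ≤ 6 * (wt (-1 - ε) (h - n) + wt (-(1 / p + ε)) h * wt (-(1 / q + ε)) n) +
      (wt (-1 - ε) (h - n) + wt (-(1 / p + ε)) h * wt (-(1 / q + ε)) n) :=
        add_le_add e2 (e3.trans le_add_self)
    _ = _ := by ring

/-- Schur's test treats the convolution and Hölder the rank-one part. The three bounds serve the
norm of the integrated coefficients, their absolute summability, and integrals between fixed end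
points. -/
theorem timeKer_bound {s p q ε : ℝ} (H : Adm s p q ε) :
    ∃ C : ℝ≥0∞, C ≠ ⊤ ∧ ∀ F : ℤ → ℝ≥0∞,
      lpN p (fun h => wt s h * ∑' n, timeKer ε h n * F n) ≤ C * lpN p (fun n => wt (-ε) n * F n) ∧
      ∑' h, ∑' n, timeKer ε h n * F n ≤ C * lpN p (fun n => wt (-ε) n * F n) ∧
      ∑' n, wt (-1 + ε) n * F n ≤ C * lpN p (fun n => wt (-ε) n * F n) := by
  have hp := H.p_pos
  have hq := H.q_pos
  have hε := H.pos
  have hpe := H.eps_p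
  have hpq := H.sum_inv
  have hqq : 1 / q * q = 1 := one_div_mul_cancel hq.ne'
  have hpp : 1 / p * p = 1 := one_div_mul_cancel hp.ne'
  set C₁ := ∑' h, wt (-1 - ε) h with hC₁
  have hC₁t : C₁ ≠ ⊤ := (tsum_wt_lt_top (by linarith)).ne
  set C₂ := lpN p (wt (-(1 / p + ε))) with hC₂
  have hC₂t : C₂ ≠ ⊤ := (lpN_wt_lt_top hp (by nlinarith)).ne
  set C₃ := lpN q (wt (-(1 / q + ε))) with hC₃
  have hC₃t : C₃ ≠ ⊤ := (lpN_wt_lt_top hq (by nlinarith)).ne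
  set C₄ := lpN q (wt (-s)) with hC₄
  have hC₄t : C₄ ≠ ⊤ := by
    refine (lpN_wt_lt_top hq ?_).ne
    have := mul_lt_mul_of_pos_right H.s_gt hq
    nlinarith
  set C₅ := lpN q (wt (-1 + 2 * ε)) with hC₅
  have hC₅t : C₅ ≠ ⊤ := by
    refine (lpN_wt_lt_top hq ?_).ne
    have : -1 + 2 * ε ≤ -(1 / q + ε) := by linarith
    nlinarith
  set C := 7 * (C₁ + C₂ * C₃) with hC
  have hCt : C ≠ ⊤ := by
    refine ENNReal.mul_ne_top (by norm_num) (ENNReal.add_ne_top.2 ⟨hC₁t, ENNReal.mul_ne_top hC₂t hC₃t⟩)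
  have main : ∀ F : ℤ → ℝ≥0∞, lpN p (fun h => wt s h * ∑' n, timeKer ε h n * F n) ≤
      C * lpN p (fun n => wt (-ε) n * F n) := by
    intro F
    set g : ℤ → ℝ≥0∞ := fun n => wt (-ε) n * F n with hg
    have h1 : ∀ h, wt s h * ∑' n, timeKer ε h n * F n ≤
        7 * (∑' n, wt (-1 - ε) (h - n) * g n + wt (-(1 / p + ε)) h * (C₃ * lpN p g)) := by
      intro h
      calc wt s h * ∑' n, timeKer ε h n * F n
          = ∑' n, wt s h * timeKer ε h n * wt ε n * g n := by
            rw [← ENNReal.tsum_mul_left]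
            refine tsum_congr fun n => ?_
            simp only [hg]
            calc _ = wt s h * timeKer ε h n * (wt ε n * wt (-ε) n) * F n := by
                  rw [wt_mul_neg]; ring
              _ = _ := by ring
        _ ≤ ∑' n, 7 * (wt (-1 - ε) (h - n) * g n +
              wt (-(1 / p + ε)) h * (wt (-(1 / q + ε)) n * g n)) := by
            refine ENNReal.tsum_le_tsum fun n => ?_
            calc _ ≤ 7 * (wt (-1 - ε) (h - n) + wt (-(1 / p + ε)) h * wt (-(1 / q + ε)) n) * g n := by
                  exact mul_le_mul' (timeKer_le H h n) le_rfl
              _ = _ := by ring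
        _ = 7 * (∑' n, wt (-1 - ε) (h - n) * g n +
              wt (-(1 / p + ε)) h * ∑' n, wt (-(1 / q + ε)) n * g n) := by
            rw [ENNReal.tsum_mul_left, ENNReal.tsum_add, ENNReal.tsum_mul_left]
        _ ≤ _ := by
            gcongr
            exact tsum_mul_le_lpN H.conj.symm _ _
    refine (lpN_mono hp h1).trans ?_
    rw [lpN_const_mul hp, hC, mul_assoc]
    refine mul_le_mul' le_rfl ((lpN_add_le H.one_le_p _ _).trans ?_)
    rw [add_mul]
    refine add_le_add (lpN_schur H.conj _ _ (fun h => ?_) (fun n => ?_)) ?_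
    · rw [hC₁, ← (Equiv.subLeft h).tsum_eq (wt (-1 - ε))]
      exact le_of_eq (tsum_congr fun n => by simp)
    · rw [hC₁, ← (Equiv.subRight n).tsum_eq (wt (-1 - ε))]
      exact le_of_eq (tsum_congr fun n => by simp)
    · simp only [mul_comm (wt _ _)]
      rw [lpN_const_mul hp]
      exact le_of_eq (by ring)
  refine ⟨C + C₄ * C + C₅, ?_, fun F => ⟨?_, ?_, ?_⟩⟩
  · exact ENNReal.add_ne_top.2 ⟨ENNReal.add_ne_top.2 ⟨hCt, ENNReal.mul_ne_top hC₄t hCt⟩, hC₅t⟩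
  · refine (main F).trans (mul_le_mul' ?_ le_rfl)
    rw [add_assoc]; exact le_self_add
  · calc ∑' h, ∑' n, timeKer ε h n * F n
        = ∑' h, wt (-s) h * (wt s h * ∑' n, timeKer ε h n * F n) := by
          refine tsum_congr fun h => ?_
          rw [← mul_assoc, wt_neg_mul, one_mul]
      _ ≤ C₄ * (C * lpN p (fun n => wt (-ε) n * F n)) :=
          (tsum_mul_le_lpN H.conj.symm _ _).trans (mul_le_mul' le_rfl (main F))
      _ ≤ _ := by
          rw [← mul_assoc]
          exact mul_le_mul' (le_add_self.trans le_self_add) le_rfl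
  · calc ∑' n, wt (-1 + ε) n * F n = ∑' n, wt (-1 + 2 * ε) n * (wt (-ε) n * F n) := by
          refine tsum_congr fun n => ?_
          rw [← mul_assoc, ← wt_add]
          congr 2; ring
      _ ≤ C₅ * lpN p (fun n => wt (-ε) n * F n) := tsum_mul_le_lpN H.conj.symm _ _
      _ ≤ _ := mul_le_mul' le_add_self le_rfl

/-! ### Fourier series on the enlarged window -/

/-- The mode `e^{iht/2}`. -/
def ex (h : ℤ) (t : ℝ) : ℂ := Complex.exp (Complex.I * ((h : ℂ) / 2 * (t : ℂ)))

theorem norm_ex (h : ℤ) (t : ℝ) : ‖ex h t‖ = 1 := by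
  rw [ex, show Complex.I * ((h : ℂ) / 2 * (t : ℂ)) = ((h / 2 * t : ℝ) : ℂ) * Complex.I by
    push_cast; ring, Complex.norm_exp_ofReal_mul_I]

theorem enorm_ex (h : ℤ) (t : ℝ) : ‖ex h t‖ₑ = 1 := by
  rw [← ofReal_norm, norm_ex, ENNReal.ofReal_one]

theorem ex_add (h h' : ℤ) (t : ℝ) : ex (h + h') t = ex h t * ex h' t := by
  rw [ex, ex, ex, ← Complex.exp_add]; push_cast; ring_nf

theorem ex_zero (t : ℝ) : ex 0 t = 1 := by simp [ex]

theorem ex_neg (h : ℤ) (t : ℝ) : ex (-h) t = (starRingEnd ℂ) (ex h t) := by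
  rw [ex, ex, ← Complex.exp_conj]
  congr 1
  simp [Complex.conj_ofNat]
  ring

theorem continuous_ex (h : ℤ) : Continuous (ex h) := by unfold ex; fun_prop

theorem hasDerivAt_ex (h : ℤ) (t : ℝ) :
    HasDerivAt (ex h) (Complex.I * (h / 2) * ex h t) t := by
  have h1 : HasDerivAt (fun t : ℝ => Complex.I * ((h : ℂ) / 2 * (t : ℂ))) (Complex.I * (h / 2)) t := by
    have := ((hasDerivAt_id t).ofReal_comp.const_mul ((h : ℂ) / 2)).const_mul Complex.I
    simpa using this
  have := h1.cexp
  rw [mul_comm] at this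
  exact this

theorem ext_length (ν : ℕ) : extRight ν - extLeft ν = 4 * Real.pi := by
  unfold extLeft extRight; ring

theorem fourier_eq_ex (ν : ℕ) (n : ℤ) (t : ℝ) :
    fourier n (t : AddCircle (extRight ν - extLeft ν)) = ex n t := by
  rw [fourier_coe_apply, ext_length, ex]
  congr 1
  have : (Real.pi : ℂ) ≠ 0 := by exact_mod_cast Real.pi_ne_zero
  push_cast
  field_simp
  ring

theorem fourierCoeffOn_eq (ν : ℕ) (f : ℝ → ℂ) (n : ℤ) :
    fourierCoeffOn (extLeft_lt_extRight ν) f n =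
      (1 / (4 * Real.pi) : ℝ) • ∫ x in extLeft ν..extRight ν, ex (-n) x * f x := by
  rw [fourierCoeffOn_eq_integral]
  simp only [fourier_eq_ex, smul_eq_mul]
  rw [ext_length]

/-- Equal end values make the periodization continuous, so summable coefficients give the value at
every point and not only almost everywhere. -/
theorem hasSum_fourierCoeffOn (ν : ℕ) {g : ℝ → ℂ}
    (hg : ContinuousOn g (Icc (extLeft ν) (extRight ν))) (hLR : g (extLeft ν) = g (extRight ν))
    (hs : Summable (fourierCoeffOn (extLeft_lt_extRight ν) g)) {t : ℝ}
    (ht : t ∈ Ioc (extLeft ν) (extRight ν)) :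
    HasSum (fun h => fourierCoeffOn (extLeft_lt_extRight ν) g h * ex h t) (g t) := by
  have := Fact.mk (by linarith [extLeft_lt_extRight ν] : 0 < extRight ν - extLeft ν)
  have hc : Continuous (AddCircle.liftIoc (extRight ν - extLeft ν) (extLeft ν) g) :=
    AddCircle.liftIoc_continuous (by rw [add_sub_cancel]; exact hLR)
      (by rw [add_sub_cancel]; exact hg)
  have := has_pointwise_sum_fourier_series_of_summable (T := extRight ν - extLeft ν)
    (f := ⟨_, hc⟩) hs (t : AddCircle (extRight ν - extLeft ν))
  simp only [ContinuousMap.coe_mk, smul_eq_mul, fourier_eq_ex] at this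
  rwa [AddCircle.liftIoc_coe_apply (by rwa [add_sub_cancel])] at this

/-! ### Primitives of weights supported in a window -/

/-- Left end point of the window. -/
def winL (ν : ℕ) : ℝ := Real.pi * ν

/-- Right end point of the window. -/
def winR (ν : ℕ) : ℝ := Real.pi * (ν + 2)

theorem window_eq (ν : ℕ) : window ν = Icc (winL ν) (winR ν) := rfl

theorem extLeft_eq (ν : ℕ) : extLeft ν = winL ν - Real.pi := by unfold extLeft winL; ring
theorem extRight_eq (ν : ℕ) : extRight ν = winR ν + Real.pi := by unfold extRight winR; ring
theorem winR_eq (ν : ℕ) : winR ν = winL ν + 2 * Real.pi := by unfold winR winL; ring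

theorem winL_le_winR (ν : ℕ) : winL ν ≤ winR ν := by rw [winR_eq]; linarith [Real.pi_pos]

theorem winL_mem (ν : ℕ) : winL ν ∈ window ν := ⟨le_rfl, winL_le_winR ν⟩
theorem winR_mem (ν : ℕ) : winR ν ∈ window ν := ⟨winL_le_winR ν, le_rfl⟩

/-- A right continuous locally integrable function supported in a window. -/
structure IsWeight (ν : ℕ) (φ : ℝ → ℂ) : Prop where
  -- A primitive then has a right derivative everywhere, which is what integration by parts for
  -- Fourier coefficients needs; cut-off weights do jump.
  rc : ∀ x, ContinuousWithinAt φ (Ioi x) x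
  int : ∀ a b, IntervalIntegrable φ volume a b
  zero : ∀ x, x ∉ Ico (winL ν) (winR ν) → φ x = 0

theorem IsWeight.mul_continuous {ν : ℕ} {φ g : ℝ → ℂ} (h : IsWeight ν φ) (hg : Continuous g) :
    IsWeight ν (fun t => φ t * g t) where
  rc x := (h.rc x).mul hg.continuousWithinAt
  int a b := (h.int a b).mul_continuousOn hg.continuousOn
  zero x hx := by rw [h.zero x hx, zero_mul]

theorem norm_integral_ex_le {h : ℤ} (hh : h ≠ 0) (a b : ℝ) :
    ‖∫ t in a..b, ex h t‖ ≤ 4 / |(h : ℝ)| := by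
  have hI : Complex.I * ((h : ℂ) / 2) ≠ 0 := by simp [hh]
  have hd : ∀ t ∈ uIcc a b, HasDerivAt (fun t => (Complex.I * ((h : ℂ) / 2))⁻¹ * ex h t) (ex h t) t := by
    intro t _
    have := (hasDerivAt_ex h t).const_mul (Complex.I * ((h : ℂ) / 2))⁻¹
    rwa [← mul_assoc, inv_mul_cancel₀ hI, one_mul] at this
  rw [intervalIntegral.integral_eq_sub_of_hasDerivAt hd ((continuous_ex h).intervalIntegrable _ _),
    ← mul_sub, norm_mul, norm_inv, norm_mul, Complex.norm_I, one_mul, norm_div]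
  have h1 : ‖(h : ℂ)‖ = |(h : ℝ)| := by rw [Complex.norm_intCast]
  have h2 : ‖(2 : ℂ)‖ = 2 := by simp
  rw [h1, h2]
  have h3 : ‖ex h b - ex h a‖ ≤ 2 := by
    refine (norm_sub_le _ _).trans ?_
    rw [norm_ex, norm_ex]; norm_num
  have h4 : 0 < |(h : ℝ)| := by positivity
  calc (|(h : ℝ)| / 2)⁻¹ * ‖ex h b - ex h a‖ ≤ (|(h : ℝ)| / 2)⁻¹ * 2 := by gcongr
    _ = 4 / |(h : ℝ)| := by field_simp; norm_num

/-- The primitive t ↦ ∫_t^b φ is not periodic. It is continued to the enlarged window by a linear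
ramp from 0 up to its full value on the left margin, and by 0 on the right margin. The continuation
vanishes at both ends, so its coefficients are those of its derivative divided by the frequency: φ
produces β h, and the ramp produces β 0 with one more factor ⟨h⟩⁻¹. -/
theorem exists_window_fourier {ν : ℕ} {φ : ℝ → ℂ} (hφ : IsWeight ν φ) {β : ℤ → ℝ}
    (hβ : ∀ h : ℤ, ∀ t ∈ window ν, ∀ t' ∈ window ν, ‖∫ τ in t..t', φ τ * ex (-h) τ‖ ≤ β h) :
    ∃ K : ℤ → ℂ, (∀ h, ‖K h‖ ≤ 4 * ((w h)⁻¹ * (β h + β 0 * (w h)⁻¹))) ∧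
      (Summable (fun h => (w h)⁻¹ * (β h + β 0 * (w h)⁻¹)) → ∀ t ∈ window ν,
        HasSum (fun h => K h * ex h t) (∫ τ in t..winR ν, φ τ)) := by
  have hπ := Real.pi_pos
  set L := extLeft ν with hL
  set R := extRight ν with hR
  have hLa : L = winL ν - Real.pi := extLeft_eq ν
  have hRb : R = winR ν + Real.pi := extRight_eq ν
  have hab := winR_eq ν
  set a := winL ν
  set b := winR ν
  set F₀ : ℂ := ∫ τ in a..b, φ τ with hF₀
  have hβF : ∀ t ∈ window ν, ∀ t' ∈ window ν, ‖∫ τ in t..t', φ τ‖ ≤ β 0 := by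
    intro t ht t' ht'
    simpa [ex_zero] using hβ 0 t ht t' ht'
  have hβ0 : ∀ h, 0 ≤ β h := fun h => (norm_nonneg _).trans (hβ h a (winL_mem ν) a (winL_mem ν))
  set χ : ℝ → ℂ := (Ico L a).indicator fun _ => F₀ / Real.pi with hχ
  have hχi : ∀ x y, IntervalIntegrable χ volume x y := fun x y => by
    have h : IntervalIntegrable (fun _ => F₀ / (Real.pi : ℂ)) volume x y := intervalIntegrable_const
    exact ⟨h.1.indicator measurableSet_Ico, h.2.indicator measurableSet_Ico⟩
  have hχrc : ∀ x, ContinuousWithinAt χ (Ioi x) x := by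
    intro x
    by_cases hx : x ∈ Ico L a
    · have hev : χ =ᶠ[𝓝[>] x] fun _ => F₀ / Real.pi := by
        filter_upwards [Ioo_mem_nhdsGT hx.2] with y hy
        exact indicator_of_mem (show y ∈ Ico L a from ⟨hx.1.trans hy.1.le, hy.2⟩) _
      exact (continuousWithinAt_const).congr_of_eventuallyEq hev (indicator_of_mem hx _)
    · have hev : χ =ᶠ[𝓝[>] x] fun _ => 0 := by
        rcases lt_or_ge x L with h | h
        · filter_upwards [Ioo_mem_nhdsGT h] with y hy
          exact indicator_of_notMem (fun h' => absurd h'.1 (not_le.2 hy.2)) _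
        · have hxa : a ≤ x := not_lt.1 fun h' => hx ⟨h, h'⟩
          filter_upwards [self_mem_nhdsWithin] with y hy
          exact indicator_of_notMem (fun h' => absurd (h'.2.trans_le hxa) (not_lt.2 (le_of_lt hy))) _
      exact (continuousWithinAt_const).congr_of_eventuallyEq hev (indicator_of_notMem hx _)
  set ψ : ℝ → ℂ := fun t => χ t - φ t with hψ
  have hψi : ∀ x y, IntervalIntegrable ψ volume x y := fun x y => (hχi x y).sub (hφ.int x y)
  set g : ℝ → ℂ := fun t => ∫ τ in L..t, ψ τ with hg
  have hgc : Continuous g := intervalIntegral.continuous_primitive hψi L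
  have hgd : ∀ x, HasDerivWithinAt g (ψ x) (Ioi x) x := by
    intro x
    refine HasDerivWithinAt.mono (t := Ici x) ?_ Ioi_subset_Ici_self
    refine intervalIntegral.integral_hasDerivWithinAt_right (t := Ioi x) (hψi L x) ?_
      ((hχrc x).sub (hφ.rc x))
    refine ⟨univ, univ_mem, ?_⟩
    rw [Measure.restrict_univ]
    have hloc : LocallyIntegrable ψ := fun x =>
      ⟨Ioc (x - 1) (x + 1), Ioc_mem_nhds (by linarith) (by linarith),
        (hψi (x - 1) (x + 1)).1⟩
    exact hloc.aestronglyMeasurable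
  have hχL : ∀ t ∈ Icc L a, ∫ τ in L..t, χ τ = ((t - L) / Real.pi : ℝ) * F₀ := by
    intro t ht
    have : ∫ τ in L..t, χ τ = ∫ τ in L..t, F₀ / Real.pi := by
      refine intervalIntegral.integral_congr_ae ?_
      have : ∀ᵐ x : ℝ, x ≠ t := Measure.ae_ne volume t
      filter_upwards [this] with x hx hx'
      rw [uIoc_of_le ht.1] at hx'
      exact indicator_of_mem (show x ∈ Ico L a from
        ⟨hx'.1.le, (lt_of_le_of_ne hx'.2 hx).trans_le ht.2⟩) _
    rw [this, intervalIntegral.integral_const, Complex.real_smul]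
    push_cast
    ring
  have hχa : ∀ t, a ≤ t → ∫ τ in L..t, χ τ = F₀ := by
    intro t ht
    rw [← intervalIntegral.integral_add_adjacent_intervals (hχi L a) (hχi a t),
      hχL a ⟨by linarith, le_rfl⟩]
    have : ∫ τ in a..t, χ τ = ∫ τ in a..t, (0 : ℂ) := by
      refine intervalIntegral.integral_congr_ae (ae_of_all _ fun x hx' => ?_)
      rw [uIoc_of_le ht] at hx'
      exact indicator_of_notMem (fun h => absurd h.2 (not_lt.2 hx'.1.le)) _
    rw [this, intervalIntegral.integral_zero, hLa, add_zero]
    have : (winL ν - (winL ν - Real.pi)) / Real.pi = 1 := by field_simp; ring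
    rw [show a = winL ν from rfl, this]; simp
  have hφL : ∀ t ≤ a, ∀ f : ℝ → ℂ, ∫ τ in L..t, φ τ * f τ = 0 := by
    intro t ht f
    have : ∫ τ in L..t, φ τ * f τ = ∫ τ in L..t, (0 : ℂ) := by
      refine intervalIntegral.integral_congr_ae ?_
      have : ∀ᵐ x : ℝ, x ≠ a := Measure.ae_ne volume a
      filter_upwards [this] with x hx hx'
      rw [hφ.zero x, zero_mul]
      intro hxa
      have : x ≤ max L t := by rw [uIoc] at hx'; exact hx'.2
      have h2 : max L t ≤ a := max_le (by linarith) ht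
      exact hx (le_antisymm (this.trans h2) hxa.1)
    rw [this, intervalIntegral.integral_zero]
  have hφR : ∀ t, b ≤ t → ∀ f : ℝ → ℂ, ∫ τ in b..t, φ τ * f τ = 0 := by
    intro t ht f
    have : ∫ τ in b..t, φ τ * f τ = ∫ τ in b..t, (0 : ℂ) := by
      refine intervalIntegral.integral_congr_ae (ae_of_all _ fun x hx' => ?_)
      rw [uIoc_of_le ht] at hx'
      rw [hφ.zero x (fun hxa => absurd hxa.2 (not_lt.2 hx'.1.le)), zero_mul]
    rw [this, intervalIntegral.integral_zero]
  have hgsub : ∀ t, g t = (∫ τ in L..t, χ τ) - ∫ τ in L..t, φ τ := fun t =>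
    intervalIntegral.integral_sub (hχi L t) (hφ.int L t)
  have hφL1 : ∀ t ≤ a, ∫ τ in L..t, φ τ = 0 := fun t ht => by simpa using hφL t ht 1
  have hφR1 : ∀ t, b ≤ t → ∫ τ in b..t, φ τ = 0 := fun t ht => by simpa using hφR t ht 1
  have hgwin : ∀ t ∈ window ν, g t = ∫ τ in t..b, φ τ := by
    intro t ht
    rw [hgsub, hχa t ht.1, ← intervalIntegral.integral_add_adjacent_intervals (hφ.int L a)
      (hφ.int a t), hφL1 a le_rfl, zero_add, hF₀,
      ← intervalIntegral.integral_add_adjacent_intervals (hφ.int a t) (hφ.int t b)]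
    ring
  have hgright : ∀ t, b ≤ t → g t = 0 := by
    intro t ht
    rw [hgsub, hχa t (by linarith),
      ← intervalIntegral.integral_add_adjacent_intervals (hφ.int L b) (hφ.int b t), hφR1 t ht,
      ← intervalIntegral.integral_add_adjacent_intervals (hφ.int L a) (hφ.int a b),
      hφL1 a le_rfl, hF₀]
    ring
  have hgL : g L = 0 := by simp [hg]
  have hgR : g R = 0 := hgright R (by linarith)
  have hgbd : ∀ t ∈ Icc L R, ‖g t‖ ≤ β 0 := by
    intro t ht
    rcases le_or_gt t a with h1 | h1
    · rw [hgsub, hφL1 t h1, sub_zero, hχL t ⟨ht.1, h1⟩, norm_mul, Complex.norm_real,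
        Real.norm_eq_abs, abs_of_nonneg (div_nonneg (by linarith [ht.1]) hπ.le)]
      have h2 : (t - L) / Real.pi ≤ 1 := by rw [div_le_one hπ]; linarith
      have h3 : ‖F₀‖ ≤ β 0 := hβF a (winL_mem ν) b (winR_mem ν)
      calc (t - L) / Real.pi * ‖F₀‖ ≤ 1 * β 0 := by gcongr
        _ = β 0 := one_mul _
    · rcases le_or_gt t b with h2 | h2
      · rw [hgwin t ⟨h1.le, h2⟩]
        exact hβF t ⟨h1.le, h2⟩ b (winR_mem ν)
      · rw [hgright t h2.le, norm_zero]; exact hβ0 0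
  have hK : ∀ h, ‖fourierCoeffOn (extLeft_lt_extRight ν) g h‖ ≤
      4 * ((w h)⁻¹ * (β h + β 0 * (w h)⁻¹)) := by
    intro h
    rcases eq_or_ne h 0 with rfl | hh
    · rw [fourierCoeffOn_eq, norm_smul, w_zero, Real.norm_of_nonneg (by positivity)]
      have h1 : ‖∫ x in L..R, ex (-0) x * g x‖ ≤ β 0 * |R - L| := by
        refine intervalIntegral.norm_integral_le_of_norm_le_const fun x hx => ?_
        rw [uIoc_of_le (extLeft_lt_extRight ν).le] at hx
        rw [norm_mul, norm_ex, one_mul]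
        exact hgbd x ⟨hx.1.le, hx.2⟩
      rw [hL, hR, ext_length, abs_of_pos (by positivity)] at h1
      have h2 : 1 / (4 * Real.pi) * ‖∫ x in L..R, ex (-0) x * g x‖ ≤
          1 / (4 * Real.pi) * (β 0 * (4 * Real.pi)) := by gcongr
      have h3 : 1 / (4 * Real.pi) * (β 0 * (4 * Real.pi)) = β 0 := by field_simp
      have := hβ0 0
      linarith
    · have h1 := fourierCoeffOn_of_hasDeriv_right (extLeft_lt_extRight ν) (n := h) hh
        hgc.continuousOn (fun x _ => hgd x) (hψi L R)
      rw [show g (extRight ν) = 0 from hgR, show g (extLeft ν) = 0 from hgL, sub_self, mul_zero,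
        zero_sub] at h1
      have hint : ∫ x in L..R, ex (-h) x * ψ x =
          F₀ / Real.pi * (∫ x in L..a, ex (-h) x) - ∫ x in a..b, φ x * ex (-h) x := by
        have e1 : ∀ x y, IntervalIntegrable (fun x => ex (-h) x * χ x) volume x y := fun x y =>
          (hχi x y).continuousOn_mul (continuous_ex _).continuousOn
        have e2 : ∀ x y, IntervalIntegrable (fun x => φ x * ex (-h) x) volume x y := fun x y =>
          (hφ.int x y).mul_continuousOn (continuous_ex _).continuousOn
        have e3 : ∀ x, ex (-h) x * ψ x = ex (-h) x * χ x - φ x * ex (-h) x := fun x => by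
          simp only [hψ]; ring
        simp only [e3]
        rw [intervalIntegral.integral_sub (e1 L R) (e2 L R)]
        congr 1
        · rw [← intervalIntegral.integral_add_adjacent_intervals (e1 L a) (e1 a R)]
          have f1 : ∫ x in L..a, ex (-h) x * χ x = ∫ x in L..a, F₀ / Real.pi * ex (-h) x := by
            refine intervalIntegral.integral_congr_ae ?_
            have : ∀ᵐ x : ℝ, x ≠ a := Measure.ae_ne volume a
            filter_upwards [this] with x hx hx'
            rw [uIoc_of_le (by linarith)] at hx'
            rw [hχ, indicator_of_mem (show x ∈ Ico L a from
              ⟨hx'.1.le, (lt_of_le_of_ne hx'.2 hx)⟩), mul_comm]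
          have f2 : ∫ x in a..R, ex (-h) x * χ x = ∫ x in a..R, (0 : ℂ) := by
            refine intervalIntegral.integral_congr_ae (ae_of_all _ fun x hx' => ?_)
            rw [uIoc_of_le (by linarith)] at hx'
            rw [hχ, indicator_of_notMem (fun h => absurd h.2 (not_lt.2 hx'.1.le)), mul_zero]
          rw [f1, f2, intervalIntegral.integral_zero, add_zero,
            intervalIntegral.integral_const_mul]
        · rw [← intervalIntegral.integral_add_adjacent_intervals (e2 L b) (e2 b R),
            ← intervalIntegral.integral_add_adjacent_intervals (e2 L a) (e2 a b),
            hφL a le_rfl, hφR R (by linarith)]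
          ring
      have hhpos : 0 < |(h : ℝ)| := by positivity
      have h2 : ‖∫ x in L..R, ex (-h) x * ψ x‖ ≤ β 0 / Real.pi * (4 / |(h : ℝ)|) + β h := by
        rw [hint]
        refine (norm_sub_le _ _).trans (add_le_add ?_ (hβ h a (winL_mem ν) b (winR_mem ν)))
        rw [norm_mul, norm_div, Complex.norm_real, Real.norm_of_nonneg hπ.le]
        have f1 := norm_integral_ex_le (neg_ne_zero.2 hh) L a
        rw [Int.cast_neg, abs_neg] at f1
        have f2 : ‖F₀‖ ≤ β 0 := hβF a (winL_mem ν) b (winR_mem ν)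
        have f3 : 0 ≤ β 0 / Real.pi := div_nonneg (hβ0 0) hπ.le
        gcongr
      have hw : (w h)⁻¹ ≥ 2 / 3 * |(h : ℝ)|⁻¹ := by
        have := w_le_abs hh
        rw [ge_iff_le, show 2 / 3 * |(h : ℝ)|⁻¹ = (3 / 2 * |(h : ℝ)|)⁻¹ by
          rw [mul_inv]; norm_num]
        exact inv_anti₀ (w_pos h) this
      rw [h1, fourierCoeffOn_eq, norm_mul, norm_neg, norm_mul, norm_smul,
        Real.norm_of_nonneg (by positivity)]
      have h3 : ‖(1 : ℂ) / (-2 * Real.pi * Complex.I * h)‖ = 1 / (2 * Real.pi * |(h : ℝ)|) := by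
        rw [norm_div, norm_one, norm_mul, norm_mul, norm_mul, Complex.norm_I, mul_one, norm_neg,
          Complex.norm_ofNat, Complex.norm_real, Real.norm_of_nonneg hπ.le, Complex.norm_intCast]
      have h4 : ‖(R : ℂ) - (L : ℂ)‖ = 4 * Real.pi := by
        rw [← Complex.ofReal_sub, hR, hL, ext_length, Complex.norm_real,
          Real.norm_of_nonneg (by positivity)]
      rw [h3, h4]
      set x := |(h : ℝ)|⁻¹ with hx
      have hxpos : 0 < x := by positivity
      have h5 : 1 / (2 * Real.pi * |(h : ℝ)|) * (4 * Real.pi * (1 / (4 * Real.pi) *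
          ‖∫ x in L..R, ex (-h) x * ψ x‖)) ≤ 1 / (2 * Real.pi) * x *
            (β 0 / Real.pi * (4 * x) + β h) := by
        calc _ = 1 / (2 * Real.pi) * x * ‖∫ x in L..R, ex (-h) x * ψ x‖ := by
              rw [hx]; field_simp
          _ ≤ _ := by rw [div_eq_mul_inv 4] at h2; gcongr
      refine h5.trans ?_
      have hπ3 := Real.pi_gt_three
      have h6 : 1 / (2 * Real.pi) ≤ 1 / 6 := one_div_le_one_div_of_le (by norm_num) (by linarith)
      have h7 : β 0 / Real.pi ≤ β 0 / 3 := div_le_div_of_nonneg_left (hβ0 0) (by norm_num) hπ3.le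
      have hx' : x ≤ 3 / 2 * (w h)⁻¹ := by linarith
      have hw0 : 0 < (w h)⁻¹ := inv_pos.2 (w_pos h)
      have hb0 := hβ0 0
      have hbh := hβ0 h
      calc 1 / (2 * Real.pi) * x * (β 0 / Real.pi * (4 * x) + β h)
          ≤ 1 / 6 * (3 / 2 * (w h)⁻¹) * (β 0 / 3 * (4 * (3 / 2 * (w h)⁻¹)) + β h) := by gcongr
        _ ≤ _ := by
            have : 0 ≤ (w h)⁻¹ * (β h + β 0 * (w h)⁻¹) := by positivity
            nlinarith [mul_nonneg hw0.le hbh, mul_nonneg (mul_nonneg hw0.le hb0) hw0.le]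
  refine ⟨fourierCoeffOn (extLeft_lt_extRight ν) g, hK, fun hs t ht => ?_⟩
  rw [← hgwin t ht]
  refine hasSum_fourierCoeffOn ν hgc.continuousOn (by rw [← hL, ← hR, hgL, hgR]) ?_
    ⟨by linarith [show a ≤ t from ht.1], by linarith [show t ≤ b from ht.2]⟩
  exact Summable.of_norm_bounded (hs.mul_left 4) hK

/-! ### Time integration of sums of modes. -/

/-- The sum of the sizes of the terms of frequency `m`. -/
def levelSum {ι : Type} (z : ι → ℂ) (n : ι → ℤ) (m : ℤ) : ℝ≥0∞ :=
  ∑' i, if n i = m then ‖z i‖ₑ else 0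

theorem tsum_mul_levelSum {ι : Type} (z : ι → ℂ) (n : ι → ℤ) (G : ℤ → ℝ≥0∞) :
    ∑' m, G m * levelSum z n m = ∑' i, ‖z i‖ₑ * G (n i) := by
  simp only [levelSum, ← ENNReal.tsum_mul_left]
  rw [ENNReal.tsum_comm]
  refine tsum_congr fun i => ?_
  rw [tsum_eq_single (n i)]
  · simp [mul_comm]
  · intro m hm
    simp [hm.symm]

/-- The norm of a coefficient sequence. -/
def sN (s p : ℝ) (a : ℤ → ℂ) : ℝ≥0∞ := lpN p fun h => wt s h * ‖a h‖ₑ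

/-- Hölder with ⟨h⟩^{-s} ∈ ℓ^q. This is why functions of finite norm are continuous and can be
evaluated pointwise. -/
theorem tsum_enorm_le {s p q ε : ℝ} (H : Adm s p q ε) :
    ∃ C : ℝ≥0∞, C ≠ ⊤ ∧ ∀ a : ℤ → ℂ, ∑' h, ‖a h‖ₑ ≤ C * sN s p a := by
  refine ⟨lpN q (wt (-s)), (lpN_wt_lt_top H.q_pos ?_).ne, fun a => ?_⟩
  · have h1 := mul_lt_mul_of_pos_right H.s_gt H.q_pos
    have h2 : 1 / q * q = 1 := one_div_mul_cancel H.q_pos.ne'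
    nlinarith [H.pos, H.q_pos]
  · calc ∑' h, ‖a h‖ₑ = ∑' h, wt (-s) h * (wt s h * ‖a h‖ₑ) := by
          refine tsum_congr fun h => ?_
          rw [← mul_assoc, wt_neg_mul, one_mul]
      _ ≤ _ := tsum_mul_le_lpN H.conj.symm _ _

/-- `φ` is a weight on the window `ν` whose oscillatory integrals decay like `⟨h⟩^{ε-1}`. -/
structure OscWeight (ε : ℝ) (ν : ℕ) (B : ℝ) (φ : ℝ → ℂ) : Prop extends IsWeight ν φ where
  osc : ∀ h : ℤ, ∀ t ∈ window ν, ∀ t' ∈ window ν,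
    ‖∫ τ in t..t', φ τ * ex h τ‖ ≤ B * w h ^ (-1 + ε)

theorem OscWeight.nonneg {ε : ℝ} {ν : ℕ} {B : ℝ} {φ : ℝ → ℂ} (h : OscWeight ε ν B φ) : 0 ≤ B := by
  have := h.osc 0 _ (winL_mem ν) _ (winL_mem ν)
  simpa [w_zero] using this

theorem enorm_le_of_norm_le_rpow {z : ℂ} {B r : ℝ} (hB : 0 ≤ B) {h : ℤ} (hz : ‖z‖ ≤ B * w h ^ r) :
    ‖z‖ₑ ≤ ENNReal.ofReal B * wt r h := by
  rw [← ofReal_norm, wt, ← ENNReal.ofReal_mul hB]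
  exact ENNReal.ofReal_le_ofReal hz

/-- Multiplying the weight by a mode of index n translates its oscillatory bounds to B⟨h-n⟩^{-1+ε};
inserted in `exists_window_fourier` they give exactly `timeKer`. -/
theorem exists_coeff_single {s p q ε : ℝ} (H : Adm s p q ε) {ν : ℕ} {B : ℝ} {φ : ℝ → ℂ}
    (hφ : OscWeight ε ν B φ) (n : ℤ) :
    ∃ K : ℤ → ℂ, (∀ h, ‖K h‖ₑ ≤ ENNReal.ofReal (4 * B) * timeKer ε h n) ∧
      ∀ t ∈ window ν, HasSum (fun h => K h * ex h t) (∫ τ in t..winR ν, φ τ * ex n τ) := by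
  have hB := hφ.nonneg
  obtain ⟨K, hK1, hK2⟩ := exists_window_fourier (hφ.toIsWeight.mul_continuous (continuous_ex n))
    (β := fun h => B * w (h - n) ^ (-1 + ε)) (fun h t ht t' ht' => by
      have := hφ.osc (n - h) t ht t' ht'
      rw [w_sub_comm n h] at this
      simpa only [mul_assoc, ← ex_add, ← sub_eq_add_neg] using this)
  have hbd : ∀ h, ‖K h‖ₑ ≤ ENNReal.ofReal (4 * B) * timeKer ε h n := by
    intro h
    have hw := w_pos h
    have hw2 := w_pos (h - n)
    have hw3 := w_pos n
    have := hK1 h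
    rw [zero_sub, w_neg] at this
    simp only [timeKer, wt]
    rw [← ENNReal.ofReal_mul (by positivity), ← ENNReal.ofReal_add (by positivity) (by positivity),
      ← ENNReal.ofReal_mul (by positivity), ← ENNReal.ofReal_mul (by positivity), ← ofReal_norm]
    refine ENNReal.ofReal_le_ofReal (this.trans (le_of_eq ?_))
    rw [Real.rpow_neg_one]
    ring
  refine ⟨K, hbd, hK2 ?_⟩
  obtain ⟨C, hC, hCF⟩ := timeKer_bound H
  -- Summability in h comes from testing the kernel bound on the unit mass at n.
  have h1 := (hCF fun m => if m = n then 1 else 0).2.1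
  have hsingle : (fun m => wt (-ε) m * if m = n then 1 else 0) =
      fun m => if m = n then wt (-ε) n else 0 := by
    funext m; split_ifs with hm <;> simp [hm]
  rw [hsingle, lpN_single H.p_pos] at h1
  simp only [mul_ite, mul_one, mul_zero, tsum_ite_eq] at h1
  have hsum : ∑' h, ENNReal.ofReal (4 * B) * timeKer ε h n ≠ ⊤ := by
    rw [ENNReal.tsum_mul_left]
    exact ENNReal.mul_ne_top ENNReal.ofReal_ne_top
      (ne_top_of_le_ne_top (ENNReal.mul_ne_top hC (wt_ne_top _ _)) h1)
  have h2 := ENNReal.summable_toReal hsum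
  have h3 : ∀ h, (ENNReal.ofReal (4 * B) * timeKer ε h n).toReal =
      4 * ((w h)⁻¹ * (B * w (h - n) ^ (-1 + ε) + B * w (0 - n) ^ (-1 + ε) * (w h)⁻¹)) := by
    intro h
    have hw := w_pos h
    have hw2 := w_pos (h - n)
    have hw3 := w_pos n
    simp only [timeKer, wt]
    rw [← ENNReal.ofReal_mul (by positivity), ← ENNReal.ofReal_add (by positivity) (by positivity),
      ← ENNReal.ofReal_mul (by positivity), ← ENNReal.ofReal_mul (by positivity),
      ENNReal.toReal_ofReal (by positivity), Real.rpow_neg_one, zero_sub, w_neg]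
    ring
  simp only [h3] at h2
  exact (summable_mul_left_iff (by norm_num : (4 : ℝ) ≠ 0)).1 h2

/-- Time integration of a sum of modes with weights, on a window. -/
theorem exists_coeff_sum {s p q ε : ℝ} (H : Adm s p q ε) :
    ∃ C : ℝ≥0∞, C ≠ ⊤ ∧ ∀ (ν : ℕ) (ι : Type) (z : ι → ℂ) (n : ι → ℤ) (φ : ι → ℝ → ℂ) (B : ℝ),
      (∀ i, OscWeight ε ν B (φ i)) →
      lpN p (fun m => wt (-ε) m * levelSum z n m) ≠ ⊤ →
      ∃ e : ℤ → ℂ, sN s p e ≤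
          C * ENNReal.ofReal B * lpN p (fun m => wt (-ε) m * levelSum z n m) ∧
        Summable (fun h => ‖e h‖) ∧
        ∀ t ∈ window ν, Summable (fun i => z i * ∫ τ in t..winR ν, φ i τ * ex (n i) τ) ∧
          ∑' i, (z i * ∫ τ in t..winR ν, φ i τ * ex (n i) τ) = ∑' h, e h * ex h t := by
  obtain ⟨C, hC, hCF⟩ := timeKer_bound H
  refine ⟨4 * C, ENNReal.mul_ne_top (by norm_num) hC, fun ν ι z n φ B hφ hF => ?_⟩
  rcases isEmpty_or_nonempty ι with hι | ⟨⟨i₀⟩⟩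
  · refine ⟨0, ?_, by simp, fun t _ => ⟨summable_empty, by simp⟩⟩
    simp [sN, lpN_zero H.p_pos]
  have hB := (hφ i₀).nonneg
  choose K hK1 hK2 using fun i => exists_coeff_single H (hφ i) (n i)
  -- Terms are grouped by frequency with `levelSum`, and the kernel bound makes the double series
  -- over h and i absolutely convergent; this justifies the interchange at the end.
  have hfin : ∑' h, ∑' i, ‖z i * K i h‖ₑ ≠ ⊤ ∧ lpN p (fun h => wt s h * ∑' i, ‖z i * K i h‖ₑ) ≤
      4 * C * ENNReal.ofReal B * lpN p (fun m => wt (-ε) m * levelSum z n m) := by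
    have h1 : ∀ h, ∑' i, ‖z i * K i h‖ₑ ≤
        ENNReal.ofReal (4 * B) * ∑' m, timeKer ε h m * levelSum z n m := by
      intro h
      rw [tsum_mul_levelSum, ← ENNReal.tsum_mul_left]
      refine ENNReal.tsum_le_tsum fun i => ?_
      rw [enorm_mul]
      calc ‖z i‖ₑ * ‖K i h‖ₑ ≤ ‖z i‖ₑ * (ENNReal.ofReal (4 * B) * timeKer ε h (n i)) := by
            gcongr; exact hK1 i h
        _ = _ := by ring
    have h4 : ENNReal.ofReal (4 * B) = 4 * ENNReal.ofReal B := by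
      rw [ENNReal.ofReal_mul (by norm_num)]; simp
    constructor
    · refine ne_top_of_le_ne_top ?_ (ENNReal.tsum_le_tsum h1)
      rw [ENNReal.tsum_mul_left]
      exact ENNReal.mul_ne_top ENNReal.ofReal_ne_top
        (ne_top_of_le_ne_top (ENNReal.mul_ne_top hC hF) (hCF _).2.1)
    · calc _ ≤ lpN p (fun h => ENNReal.ofReal (4 * B) *
            (wt s h * ∑' m, timeKer ε h m * levelSum z n m)) := by
            refine lpN_mono H.p_pos fun h => ?_
            calc _ ≤ wt s h * (ENNReal.ofReal (4 * B) * ∑' m, timeKer ε h m * levelSum z n m) := by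
                  gcongr; exact h1 h
              _ = _ := by ring
        _ ≤ 4 * ENNReal.ofReal B * (C * lpN p (fun m => wt (-ε) m * levelSum z n m)) := by
            rw [lpN_const_mul H.p_pos, h4]
            gcongr
            exact (hCF _).1
        _ = _ := by ring
  have hen : ∑' x : ℤ × ι, ‖z x.2 * K x.2 x.1‖ₑ ≠ ⊤ := by
    rw [ENNReal.tsum_prod' (f := fun x : ℤ × ι => ‖z x.2 * K x.2 x.1‖ₑ)]
    exact hfin.1
  have hle : ∀ h, ‖∑' i, z i * K i h‖ₑ ≤ ∑' i, ‖z i * K i h‖ₑ := fun h => enorm_tsum_le_tsum_enorm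
  refine ⟨fun h => ∑' i, z i * K i h, ?_, ?_, fun t ht => ?_⟩
  · refine le_trans (lpN_mono H.p_pos fun h => ?_) hfin.2
    gcongr
    exact hle h
  · rw [← tsum_enorm_ne_top_iff_summable_norm]
    exact ne_top_of_le_ne_top hfin.1 (ENNReal.tsum_le_tsum hle)
  · have hsum : Summable fun x : ℤ × ι => z x.2 * K x.2 x.1 * ex x.1 t := by
      refine Summable.of_enorm ?_
      simpa only [enorm_mul, enorm_ex, mul_one] using hen
    have hz : ∀ i, ∑' h, z i * K i h * ex h t = z i * ∫ τ in t..winR ν, φ i τ * ex (n i) τ := by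
      intro i
      simp only [mul_assoc, tsum_mul_left]
      rw [(hK2 i t ht).tsum_eq]
    have hsum' : Summable (Function.uncurry fun i h => z i * K i h * ex h t) :=
      ((Equiv.prodComm ι ℤ).summable_iff (f := fun x : ℤ × ι => z x.2 * K x.2 x.1 * ex x.1 t)).2 hsum
    simp only [← hz]
    refine ⟨hsum'.prod, ?_⟩
    rw [← hsum'.tsum_comm]
    refine tsum_congr fun h => ?_
    rw [tsum_mul_right]

/-- Absolute summability of oscillatory integrals of a sum of modes. -/
theorem tsum_osc_le {s p q ε : ℝ} (H : Adm s p q ε) :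
    ∃ C : ℝ≥0∞, C ≠ ⊤ ∧ ∀ (ι : Type) (z : ι → ℂ) (n : ι → ℤ) (v : ι → ℂ) (B : ℝ), 0 ≤ B →
      (∀ i, ‖v i‖ ≤ B * w (n i) ^ (-1 + ε)) →
      ∑' i, ‖z i * v i‖ₑ ≤ C * ENNReal.ofReal B * lpN p (fun m => wt (-ε) m * levelSum z n m) := by
  obtain ⟨C, hC, hCF⟩ := timeKer_bound H
  refine ⟨C, hC, fun ι z n v B hB hv => ?_⟩
  calc ∑' i, ‖z i * v i‖ₑ ≤ ∑' i, ENNReal.ofReal B * (‖z i‖ₑ * wt (-1 + ε) (n i)) := by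
        refine ENNReal.tsum_le_tsum fun i => ?_
        rw [enorm_mul]
        calc _ ≤ ‖z i‖ₑ * (ENNReal.ofReal B * wt (-1 + ε) (n i)) := by
              gcongr; exact enorm_le_of_norm_le_rpow hB (hv i)
          _ = _ := by ring
    _ = ENNReal.ofReal B * ∑' m, wt (-1 + ε) m * levelSum z n m := by
        rw [ENNReal.tsum_mul_left, tsum_mul_levelSum]
    _ ≤ ENNReal.ofReal B * (C * lpN p (fun m => wt (-ε) m * levelSum z n m)) := by
        gcongr; exact (hCF _).2.2
    _ = _ := by ring

/-! ### Functions given by Fourier coefficients -/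

/-- The functions with Fourier coefficients `a`. -/
def ev (a : ℤ → ℤ → ℂ) (k : ℤ) (t : ℝ) : ℂ := ∑' h, a k h * ex h t

/-- The `ℓ^p` norm of a family of coefficient sequences. -/
def nE (s p : ℝ) (a : ℤ → ℤ → ℂ) : ℝ≥0∞ := lpN p fun k => sN s p (a k)

theorem sN_le_nE {s p : ℝ} (hp : 0 < p) (a : ℤ → ℤ → ℂ) (k : ℤ) : sN s p (a k) ≤ nE s p a :=
  le_lpN hp _ k

theorem summable_norm_of_sN {s p q ε : ℝ} (H : Adm s p q ε) {a : ℤ → ℂ} (ha : sN s p a ≠ ⊤) :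
    Summable fun h => ‖a h‖ := by
  obtain ⟨C, hC, hCa⟩ := tsum_enorm_le H
  rw [← tsum_enorm_ne_top_iff_summable_norm]
  exact ne_top_of_le_ne_top (ENNReal.mul_ne_top hC ha) (hCa a)

theorem summable_mul_ex {a : ℤ → ℂ} (ha : Summable fun h => ‖a h‖) (t : ℝ) :
    Summable fun h => ‖a h * ex h t‖ := by simpa [norm_ex] using ha

theorem continuous_ev {a : ℤ → ℤ → ℂ} {k : ℤ} (ha : Summable fun h => ‖a k h‖) :
    Continuous (ev a k) := by
  refine continuous_tsum (fun h => (continuous_const.mul (continuous_ex h))) ha fun h t => ?_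
  rw [norm_mul, norm_ex, mul_one]

theorem enorm_ev_le {s p q ε : ℝ} (H : Adm s p q ε) :
    ∃ C : ℝ≥0∞, C ≠ ⊤ ∧ ∀ (a : ℤ → ℤ → ℂ) k t, ‖ev a k t‖ₑ ≤ C * sN s p (a k) := by
  obtain ⟨C, hC, hCa⟩ := tsum_enorm_le H
  refine ⟨C, hC, fun a k t => (enorm_tsum_le_tsum_enorm).trans ?_⟩
  simpa only [enorm_mul, enorm_ex, mul_one] using hCa (a k)

/-! ### The trilinear integrals on a window -/

/-- The integrand of the trilinear integrals. -/
def trm (ψ : ℤ → ℤ × ℤ → ℝ → ℂ) (f g h : ℤ → ℝ → ℂ) (k : ℤ) (q : ℤ × ℤ) (τ : ℝ) : ℂ :=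
  ψ k q τ * ex (-(4 * (q.1 * q.2))) τ *
    (f (k - q.1) τ * (starRingEnd ℂ) (g (k - q.1 - q.2) τ) * h (k - q.2) τ)

/-- The amplitudes of the modes of a trilinear integrand. -/
def zt (a b c : ℤ → ℤ → ℂ) (k : ℤ) (i : Idx) : ℂ :=
  a (k - i.1.1) i.2.1 * (starRingEnd ℂ) (b (k - i.1.1 - i.1.2) i.2.2.1) * c (k - i.1.2) i.2.2.2

theorem enorm_zt (a b c : ℤ → ℤ → ℂ) (k : ℤ) (i : Idx) :
    ‖zt a b c k i‖ₑ = amp (fun k h => ‖a k h‖ₑ) (fun k h => ‖b k h‖ₑ) (fun k h => ‖c k h‖ₑ) k i := by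
  simp only [zt, amp, enorm_mul, RCLike.enorm_conj]

theorem summable_zt {a b c : ℤ → ℤ → ℂ} (ha : ∀ k, Summable fun h => ‖a k h‖)
    (hb : ∀ k, Summable fun h => ‖b k h‖) (hc : ∀ k, Summable fun h => ‖c k h‖) (k : ℤ)
    (q : ℤ × ℤ) : Summable fun h : ℤ × ℤ × ℤ => ‖zt a b c k (q, h)‖ := by
  rw [← tsum_enorm_ne_top_iff_summable_norm]
  simp only [enorm_zt, amp]
  rw [tsum_triple_mul (fun h => ‖a (k - q.1) h‖ₑ) (fun h => ‖b (k - q.1 - q.2) h‖ₑ)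
    (fun h => ‖c (k - q.2) h‖ₑ)]
  refine ENNReal.mul_ne_top (ENNReal.mul_ne_top ?_ ?_) ?_ <;>
    rw [tsum_enorm_ne_top_iff_summable_norm]
  exacts [ha _, hb _, hc _]

theorem hasSum_mul_triple {u v w : ℤ → ℂ} (hu : Summable fun h => ‖u h‖)
    (hv : Summable fun h => ‖v h‖) (hw : Summable fun h => ‖w h‖) :
    HasSum (fun x : ℤ × ℤ × ℤ => u x.1 * (v x.2.1 * w x.2.2))
      ((∑' h, u h) * ((∑' h, v h) * ∑' h, w h)) := by
  have h1 : Summable fun x : ℤ × ℤ => v x.1 * w x.2 := summable_mul_of_summable_norm hv hw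
  have h2 : HasSum (fun x : ℤ × ℤ => v x.1 * w x.2) ((∑' h, v h) * ∑' h, w h) :=
    hv.of_norm.hasSum.mul hw.of_norm.hasSum h1
  have h3 := h1.norm
  generalize hg : (fun x : ℤ × ℤ => v x.1 * w x.2) = g at h2
  have hg' : ∀ x : ℤ × ℤ, v x.1 * w x.2 = g x := fun x => by rw [← hg]
  simp only [hg'] at h3 ⊢
  exact hu.of_norm.hasSum.mul h2 (summable_mul_of_summable_norm hu h3)

theorem hasSum_trm {a b c : ℤ → ℤ → ℂ} (ha : ∀ k, Summable fun h => ‖a k h‖)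
    (hb : ∀ k, Summable fun h => ‖b k h‖) (hc : ∀ k, Summable fun h => ‖c k h‖)
    (ψ : ℤ → ℤ × ℤ → ℝ → ℂ) (k : ℤ) (q : ℤ × ℤ) (τ : ℝ) :
    HasSum (fun h : ℤ × ℤ × ℤ => zt a b c k (q, h) * (ψ k q τ * ex (freq (q, h)) τ))
      (trm ψ (ev a) (ev b) (ev c) k q τ) := by
  have hB : Summable fun h => ‖(starRingEnd ℂ) (b (k - q.1 - q.2) h * ex h τ)‖ := by
    simpa [norm_ex] using hb (k - q.1 - q.2)
  have h1 := hasSum_mul_triple (summable_mul_ex (ha (k - q.1)) τ) hB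
    (summable_mul_ex (hc (k - q.2)) τ)
  have e1 : ∑' h, (starRingEnd ℂ) (b (k - q.1 - q.2) h * ex h τ) =
      (starRingEnd ℂ) (ev b (k - q.1 - q.2) τ) := (Complex.conj_tsum _).symm
  rw [e1] at h1
  have h2 := h1.mul_left (ψ k q τ * ex (-(4 * (q.1 * q.2))) τ)
  have e2 : trm ψ (ev a) (ev b) (ev c) k q τ = ψ k q τ * ex (-(4 * (q.1 * q.2))) τ *
      ((∑' h, a (k - q.1) h * ex h τ) * ((starRingEnd ℂ) (ev b (k - q.1 - q.2) τ) *
        ∑' h, c (k - q.2) h * ex h τ)) := by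
    simp only [trm, ev]; ring
  rw [e2]
  refine h2.congr_fun fun h => ?_
  have e : freq (q, h) = h.1 + -h.2.1 + h.2.2 + -(4 * (q.1 * q.2)) := by
    simp only [freq]; ring
  simp only [zt, e, ex_add, ex_neg, map_mul]
  ring

theorem hasSum_integral_trm {a b c : ℤ → ℤ → ℂ} (ha : ∀ k, Summable fun h => ‖a k h‖)
    (hb : ∀ k, Summable fun h => ‖b k h‖) (hc : ∀ k, Summable fun h => ‖c k h‖)
    {ψ : ℤ → ℤ × ℤ → ℝ → ℂ} {k : ℤ} {q : ℤ × ℤ} {t t' : ℝ}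
    (hψ : IntervalIntegrable (ψ k q) volume t t') :
    HasSum (fun h : ℤ × ℤ × ℤ => zt a b c k (q, h) * ∫ τ in t..t', ψ k q τ * ex (freq (q, h)) τ)
      (∫ τ in t..t', trm ψ (ev a) (ev b) (ev c) k q τ) := by
  have hs := summable_zt ha hb hc k q
  simp only [← intervalIntegral.integral_const_mul]
  refine intervalIntegral.hasSum_integral_of_dominated_convergence
    (fun h τ => ‖zt a b c k (q, h)‖ * ‖ψ k q τ‖) (fun h => ?_) (fun h => ?_) ?_ ?_ ?_
  · exact ((hψ.mul_continuousOn (continuous_ex _).continuousOn).const_mul _).aestronglyMeasurable_restrict_uIoc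
  · exact ae_of_all _ fun τ _ => by rw [norm_mul, norm_mul, norm_ex, mul_one]
  · exact ae_of_all _ fun τ _ => hs.mul_right _
  · simp only [tsum_mul_right]
    exact hψ.norm.const_mul _
  · exact ae_of_all _ fun τ _ => hasSum_trm ha hb hc ψ k q τ

/-- The size of the modes of the trilinear integrand of index `k`. -/
def lev (ε p : ℝ) (Q : Set (ℤ × ℤ)) (a b c : ℤ → ℤ → ℂ) (k : ℤ) : ℝ≥0∞ :=
  lpN p fun m => wt (-ε) m *
    levelSum (fun i : Q × (ℤ × ℤ × ℤ) => zt a b c k (i.1, i.2)) (fun i => freq (i.1, i.2)) m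

theorem lev_le_freqSum {ε p : ℝ} (hp : 0 < p) {Q : Set (ℤ × ℤ)} (hQ : Q ⊆ pairs)
    (a b c : ℤ → ℤ → ℂ) (k : ℤ) :
    lev ε p Q a b c k ≤ lpN p fun m => wt (-ε) m *
      freqSum (fun k h => ‖a k h‖ₑ) (fun k h => ‖b k h‖ₑ) (fun k h => ‖c k h‖ₑ) k m := by
  refine lpN_mono hp fun m => ?_
  gcongr
  unfold levelSum freqSum
  have hinj : Function.Injective fun i : Q × (ℤ × ℤ × ℤ) => (((i.1 : ℤ × ℤ), i.2) : Idx) := by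
    rintro ⟨⟨x, hx⟩, h⟩ ⟨⟨x', hx'⟩, h'⟩ heq
    simp only [Prod.mk.injEq] at heq
    simp [heq.1, heq.2]
  refine le_trans (le_of_eq (tsum_congr fun i => ?_)) (ENNReal.tsum_comp_le_tsum_of_injective hinj _)
  simp only [enorm_zt, hQ i.1.2, true_and]

theorem lpN_lev_le {s p q ε : ℝ} (H : Adm s p q ε) :
    ∃ C : ℝ≥0∞, C ≠ ⊤ ∧ ∀ (Q : Set (ℤ × ℤ)), Q ⊆ pairs → ∀ a b c : ℤ → ℤ → ℂ,
      lpN p (lev ε p Q a b c) ≤ C * (nE s p a * nE s p b * nE s p c) := by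
  obtain ⟨C, hC, hCF⟩ := freqSum_le H
  refine ⟨C, hC, fun Q hQ a b c => le_trans (lpN_mono H.p_pos fun k => lev_le_freqSum H.p_pos hQ a b c k) ?_⟩
  exact hCF _ _ _

theorem hasSum_fiberwise_tsum {α β : Type*} {G : α × β → ℂ} {g : α → ℂ} (hG : Summable G)
    (h : ∀ a, HasSum (fun b => G (a, b)) (g a)) : HasSum g (∑' i, G i) :=
  hG.hasSum.prod_fiberwise h

/-- Time integration of a trilinear expression on a window, for one index `k`. -/
theorem exists_coeff_trm {s p q ε : ℝ} (H : Adm s p q ε) :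
    ∃ C : ℝ≥0∞, C ≠ ⊤ ∧ ∀ (ν : ℕ) (Q : Set (ℤ × ℤ)) (ψ : ℤ → ℤ × ℤ → ℝ → ℂ) (B : ℝ) (k : ℤ),
      (∀ q ∈ Q, OscWeight ε ν B (ψ k q)) → ∀ a b c : ℤ → ℤ → ℂ,
      (∀ k, sN s p (a k) ≠ ⊤) → (∀ k, sN s p (b k) ≠ ⊤) → (∀ k, sN s p (c k) ≠ ⊤) →
      lev ε p Q a b c k ≠ ⊤ →
      ∃ e : ℤ → ℂ, sN s p e ≤ C * ENNReal.ofReal B * lev ε p Q a b c k ∧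
        ∀ t ∈ window ν, HasSum
          (fun q : Q => ∫ τ in t..winR ν, trm ψ (ev a) (ev b) (ev c) k q τ) (∑' h, e h * ex h t) := by
  obtain ⟨C, hC, hCF⟩ := exists_coeff_sum H
  refine ⟨C, hC, fun ν Q ψ B k hψ a b c ha hb hc hlev => ?_⟩
  set z : Q × (ℤ × ℤ × ℤ) → ℂ := fun i => zt a b c k (i.1, i.2) with hz
  set n : Q × (ℤ × ℤ × ℤ) → ℤ := fun i => freq (i.1, i.2) with hn
  set φ : Q × (ℤ × ℤ × ℤ) → ℝ → ℂ := fun i => ψ k i.1 with hφ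
  obtain ⟨e, he1, -, he2⟩ := hCF ν (Q × (ℤ × ℤ × ℤ)) z n φ B (fun i => hψ _ i.1.2) hlev
  refine ⟨e, he1, fun t ht => ?_⟩
  obtain ⟨h1, h2⟩ := he2 t ht
  have ha' := fun k => summable_norm_of_sN H (ha k)
  have hb' := fun k => summable_norm_of_sN H (hb k)
  have hc' := fun k => summable_norm_of_sN H (hc k)
  have h3 : ∀ q : Q, HasSum (fun h : ℤ × ℤ × ℤ => zt a b c k (q, h) *
      ∫ τ in t..winR ν, ψ k q τ * ex (freq (q, h)) τ)
      (∫ τ in t..winR ν, trm ψ (ev a) (ev b) (ev c) k q τ) := fun q => by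
    exact hasSum_integral_trm ha' hb' hc' ((hψ q q.2).int _ _)
  rw [← h2]
  refine hasSum_fiberwise_tsum (G := fun i => z i * ∫ τ in t..winR ν, φ i τ * ex (n i) τ) h1 ?_
  intro q
  simp only [hz, hn, hφ]
  exact h3 q

/-- Absolute summability of the trilinear integrals, for one index `k`. -/
theorem tsum_trm_le {s p q ε : ℝ} (H : Adm s p q ε) :
    ∃ C : ℝ≥0∞, C ≠ ⊤ ∧ ∀ (Q : Set (ℤ × ℤ)) (ψ : ℤ → ℤ × ℤ → ℝ → ℂ) (B : ℝ) (k : ℤ) (t t' : ℝ),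
      0 ≤ B → (∀ q ∈ Q, IntervalIntegrable (ψ k q) volume t t') → ∀ a b c : ℤ → ℤ → ℂ,
      (∀ k, sN s p (a k) ≠ ⊤) → (∀ k, sN s p (b k) ≠ ⊤) → (∀ k, sN s p (c k) ≠ ⊤) →
      (∀ q ∈ Q, ∀ h, zt a b c k (q, h) = 0 ∨
        ‖∫ τ in t..t', ψ k q τ * ex (freq (q, h)) τ‖ ≤ B * w (freq (q, h)) ^ (-1 + ε)) →
      ∑' q : Q, ‖∫ τ in t..t', trm ψ (ev a) (ev b) (ev c) k q τ‖ₑ ≤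
        C * ENNReal.ofReal B * lev ε p Q a b c k := by
  obtain ⟨C, hC, hCF⟩ := tsum_osc_le H
  refine ⟨C, hC, fun Q ψ B k t t' hB hψ a b c ha hb hc hosc => ?_⟩
  classical
  set z : Q × (ℤ × ℤ × ℤ) → ℂ := fun i => zt a b c k (i.1, i.2) with hz
  set n : Q × (ℤ × ℤ × ℤ) → ℤ := fun i => freq (i.1, i.2) with hn
  -- The oscillatory bound is available only for modes of non-zero amplitude, so the remaining
  -- integrals are replaced by 0.
  set v : Q × (ℤ × ℤ × ℤ) → ℂ := fun i => if z i = 0 then 0 else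
    ∫ τ in t..t', ψ k i.1 τ * ex (n i) τ with hv
  have h1 := hCF (Q × (ℤ × ℤ × ℤ)) z n v B hB (fun i => by
    have hw := w_pos (n i)
    by_cases h0 : z i = 0
    · rw [hv]; simp only [h0, if_true, norm_zero]; positivity
    · rw [hv]; simp only [h0, if_false]
      exact (hosc _ i.1.2 i.2).resolve_left h0)
  refine le_trans ?_ h1
  rw [ENNReal.tsum_prod' (f := fun i => ‖z i * v i‖ₑ)]
  refine ENNReal.tsum_le_tsum fun q => ?_
  have h2 := (hasSum_integral_trm (fun k => summable_norm_of_sN H (ha k))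
    (fun k => summable_norm_of_sN H (hb k)) (fun k => summable_norm_of_sN H (hc k))
    (hψ q q.2)).tsum_eq
  rw [← h2]
  refine enorm_tsum_le_tsum_enorm.trans (le_of_eq (tsum_congr fun h => ?_))
  by_cases h0 : z (q, h) = 0
  · have h3 : zt a b c k (q, h) = 0 := h0
    simp only [h0, h3, zero_mul]
  · have h3 : ¬ zt a b c k (q, h) = 0 := h0
    simp only [hv, hz, hn, h3, if_false]

/-! ### The weight `τ⁻¹ e^{iλ log 4τ}` -/

/-- The function `τ⁻¹ e^{iλ log 4τ}`. -/
def phi (l : ℝ) (τ : ℝ) : ℂ :=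
  1 / (τ : ℂ) * Complex.exp (Complex.I * ((l * Real.log (4 * τ) : ℝ) : ℂ))

theorem norm_exp_I_ofReal (x : ℝ) : ‖Complex.exp (Complex.I * (x : ℂ))‖ = 1 := by
  rw [mul_comm, Complex.norm_exp_ofReal_mul_I]

theorem norm_phi (l : ℝ) {τ : ℝ} (hτ : 0 < τ) : ‖phi l τ‖ = 1 / τ := by
  rw [phi, norm_mul, norm_exp_I_ofReal, mul_one, norm_div, norm_one, Complex.norm_real,
    Real.norm_of_nonneg hτ.le]

theorem hasDerivAt_phi (l : ℝ) {τ : ℝ} (hτ : 0 < τ) :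
    HasDerivAt (phi l) ((1 / (τ : ℂ)) * ((-1 + Complex.I * l) * phi l τ)) τ := by
  have hτ' : (τ : ℂ) ≠ 0 := by exact_mod_cast hτ.ne'
  have h1 : HasDerivAt (fun τ : ℝ => 1 / (τ : ℂ)) (-1 / (τ : ℂ) ^ 2) τ := by
    have := (hasDerivAt_id τ).ofReal_comp.inv hτ'
    simp only [one_div]
    exact this.congr_deriv (by simp)
  have h2 : HasDerivAt (fun τ : ℝ => l * Real.log (4 * τ)) (l * (4 / (4 * τ))) τ := by
    have := ((hasDerivAt_id τ).const_mul 4).log (by simpa using hτ.ne')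
    simpa using this.const_mul l
  have h3 := (h2.ofReal_comp.const_mul Complex.I).cexp
  have h4 := h1.mul h3
  refine h4.congr_deriv ?_
  simp only [phi]
  push_cast
  field_simp

theorem continuousAt_phi (l : ℝ) {τ : ℝ} (hτ : 0 < τ) : ContinuousAt (phi l) τ :=
  (hasDerivAt_phi l hτ).continuousAt

theorem norm_ex_primitive (h : ℤ) (t : ℝ) :
    ‖(Complex.I * ((h : ℂ) / 2))⁻¹ * ex h t‖ = 2 / |(h : ℝ)| := by
  rw [norm_mul, norm_ex, mul_one, norm_inv, norm_mul, Complex.norm_I, one_mul, norm_div,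
    Complex.norm_intCast, Complex.norm_ofNat, inv_div]

theorem norm_integral_phi_le_triv {l u v t t' : ℝ} (hu : 0 < u) (ht : t ∈ Icc u v)
    (ht' : t' ∈ Icc u v) (h : ℤ) : ‖∫ τ in t..t', phi l τ * ex h τ‖ ≤ (v - u) / u := by
  have h1 : ∀ τ ∈ uIoc t t', ‖phi l τ * ex h τ‖ ≤ 1 / u := by
    intro τ hτ
    have : u ≤ τ := (le_min ht.1 ht'.1).trans hτ.1.le
    rw [norm_mul, norm_ex, mul_one, norm_phi l (by linarith)]
    exact one_div_le_one_div_of_le hu this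
  refine (intervalIntegral.norm_integral_le_of_norm_le_const h1).trans ?_
  have : |t' - t| ≤ v - u := abs_sub_le_iff.2 ⟨by linarith [ht.1, ht'.2], by linarith [ht.2, ht'.1]⟩
  calc 1 / u * |t' - t| ≤ 1 / u * (v - u) := by gcongr
    _ = (v - u) / u := by ring

/-- The difference of the weight at the end points controls the oscillatory integrals. -/
theorem norm_integral_phi_parts {l u v t t' : ℝ} (hl : |l| ≤ 1) (hu : 0 < u) (ht : t ∈ Icc u v)
    (ht' : t' ∈ Icc u v) {h : ℤ} (hh : h ≠ 0) :
    ‖∫ τ in t..t', phi l τ * ex h τ‖ ≤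
      ‖phi l t' * ((Complex.I * ((h : ℂ) / 2))⁻¹ * ex h t') -
        phi l t * ((Complex.I * ((h : ℂ) / 2))⁻¹ * ex h t)‖ +
      2 / |(h : ℝ)| * (2 * (v - u) / u ^ 2) := by
  have hI : Complex.I * ((h : ℂ) / 2) ≠ 0 := by simp [hh]
  have hpos : ∀ τ ∈ uIcc t t', u ≤ τ := fun τ hτ => (le_min ht.1 ht'.1).trans hτ.1
  have hd2 : ∀ τ ∈ uIcc t t',
      HasDerivAt (fun τ => (Complex.I * ((h : ℂ) / 2))⁻¹ * ex h τ) (ex h τ) τ := by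
    intro τ _
    have := (hasDerivAt_ex h τ).const_mul (Complex.I * ((h : ℂ) / 2))⁻¹
    rwa [← mul_assoc, inv_mul_cancel₀ hI, one_mul] at this
  have hd1 : ∀ τ ∈ uIcc t t', HasDerivAt (phi l) ((1 / (τ : ℂ)) * ((-1 + Complex.I * l) * phi l τ)) τ :=
    fun τ hτ => hasDerivAt_phi l (hu.trans_le (hpos τ hτ))
  have hc : ContinuousOn (fun τ : ℝ => (1 / (τ : ℂ)) * ((-1 + Complex.I * l) * phi l τ)) (uIcc t t') := by
    intro τ hτ
    have hτ0 := hu.trans_le (hpos τ hτ)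
    refine ContinuousAt.continuousWithinAt ?_
    refine ContinuousAt.mul ?_ (continuousAt_const.mul (continuousAt_phi l hτ0))
    exact continuousAt_const.div Complex.continuous_ofReal.continuousAt (by exact_mod_cast hτ0.ne')
  rw [intervalIntegral.integral_mul_deriv_eq_deriv_mul hd1 hd2 hc.intervalIntegrable
    ((continuous_ex h).intervalIntegrable _ _)]
  refine (norm_sub_le _ _).trans (add_le_add le_rfl ?_)
  have h1 : ∀ τ ∈ uIoc t t', ‖(1 / (τ : ℂ)) * ((-1 + Complex.I * l) * phi l τ) *
      ((Complex.I * ((h : ℂ) / 2))⁻¹ * ex h τ)‖ ≤ 1 / u * (2 * (1 / u)) * (2 / |(h : ℝ)|) := by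
    intro τ hτ
    have hτu := hpos τ (uIoc_subset_uIcc hτ)
    have hτ0 := hu.trans_le hτu
    rw [norm_mul, norm_ex_primitive, norm_mul, norm_mul, norm_phi l hτ0, norm_div, norm_one,
      Complex.norm_real, Real.norm_of_nonneg hτ0.le]
    have h2 : ‖-1 + Complex.I * (l : ℂ)‖ ≤ 2 := by
      refine (norm_add_le _ _).trans ?_
      rw [norm_neg, norm_one, norm_mul, Complex.norm_I, one_mul, Complex.norm_real, Real.norm_eq_abs]
      linarith
    have h3 : 1 / τ ≤ 1 / u := one_div_le_one_div_of_le hu hτu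
    gcongr
  refine (intervalIntegral.norm_integral_le_of_norm_le_const h1).trans ?_
  have : |t' - t| ≤ v - u := abs_sub_le_iff.2 ⟨by linarith [ht.1, ht'.2], by linarith [ht.2, ht'.1]⟩
  calc 1 / u * (2 * (1 / u)) * (2 / |(h : ℝ)|) * |t' - t|
      ≤ 1 / u * (2 * (1 / u)) * (2 / |(h : ℝ)|) * (v - u) := by gcongr
    _ = _ := by field_simp

theorem norm_integral_phi_le_osc {l u v t t' : ℝ} (hl : |l| ≤ 1) (hu : 0 < u) (ht : t ∈ Icc u v)
    (ht' : t' ∈ Icc u v) {h : ℤ} (hh : h ≠ 0) :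
    ‖∫ τ in t..t', phi l τ * ex h τ‖ ≤ 2 / |(h : ℝ)| * (2 / u + 2 * (v - u) / u ^ 2) := by
  refine (norm_integral_phi_parts hl hu ht ht' hh).trans ?_
  rw [mul_add]
  refine add_le_add ((norm_sub_le _ _).trans ?_) le_rfl
  rw [norm_mul (phi l t'), norm_mul (phi l t), norm_ex_primitive, norm_ex_primitive,
    norm_phi l (hu.trans_le ht.1), norm_phi l (hu.trans_le ht'.1)]
  have h1 : 1 / t ≤ 1 / u := one_div_le_one_div_of_le hu ht.1
  have h2 : 1 / t' ≤ 1 / u := one_div_le_one_div_of_le hu ht'.1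
  calc 1 / t' * (2 / |(h : ℝ)|) + 1 / t * (2 / |(h : ℝ)|)
      ≤ 1 / u * (2 / |(h : ℝ)|) + 1 / u * (2 / |(h : ℝ)|) := by gcongr
    _ = _ := by ring

/-- The bound for the oscillatory integrals of `phi` on `[u, v]`. -/
def oscB (ε u v : ℝ) : ℝ :=
  ((v - u) / u) ^ ε * (6 / u + 6 * (v - u) / u ^ 2 + (v - u) / u) ^ (1 - ε)

theorem oscB_nonneg {ε u v : ℝ} (hu : 0 < u) (huv : u ≤ v) : 0 ≤ oscB ε u v := by
  have : 0 ≤ v - u := by linarith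
  unfold oscB; positivity

/-- Interpolation I = I^ε · I^{1-ε} between the bound by the length and the bound from integration
by parts. The factor ((v-u)/u)^ε makes the constant small on short intervals, at the price of the
exponent -1 + ε. The summand (v-u)/u in the second factor covers h = 0, where integration by parts
is impossible. -/
theorem norm_integral_phi_le {ε l u v t t' : ℝ} (hε : 0 < ε) (hε1 : ε < 1) (hl : |l| ≤ 1) (hu : 0 < u)
    (ht : t ∈ Icc u v) (ht' : t' ∈ Icc u v) (h : ℤ) :
    ‖∫ τ in t..t', phi l τ * ex h τ‖ ≤ oscB ε u v * w h ^ (-1 + ε) := by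
  have huv : u ≤ v := ht.1.trans ht.2
  set X := (v - u) / u with hX
  set Y := 6 / u + 6 * (v - u) / u ^ 2 with hY
  have hX0 : 0 ≤ X := div_nonneg (by linarith) hu.le
  have hY0 : 0 ≤ Y := by
    have : 0 ≤ v - u := by linarith
    positivity
  have hB : oscB ε u v = X ^ ε * (Y + X) ^ (1 - ε) := rfl
  have hw := w_pos h
  have h1 := norm_integral_phi_le_triv (l := l) hu ht ht' h
  set I := ‖∫ τ in t..t', phi l τ * ex h τ‖ with hI
  have hI0 : 0 ≤ I := norm_nonneg _
  have h2 : I ≤ (Y + X) / w h := by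
    rcases eq_or_ne h 0 with rfl | hh
    · rw [w_zero, div_one]; linarith
    · have h3 := norm_integral_phi_le_osc hl hu ht ht' hh
      have h4 : 0 < |(h : ℝ)| := by positivity
      have h5 : 2 / |(h : ℝ)| ≤ 3 / w h := by
        rw [div_le_div_iff₀ h4 hw]; linarith [w_le_abs hh]
      have h6 : 0 ≤ v - u := by linarith
      calc I ≤ 2 / |(h : ℝ)| * (2 / u + 2 * (v - u) / u ^ 2) := h3
        _ ≤ 3 / w h * (2 / u + 2 * (v - u) / u ^ 2) := by gcongr
        _ = Y / w h := by rw [hY]; field_simp; ring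
        _ ≤ (Y + X) / w h := by gcongr; linarith
  calc I = I ^ ε * I ^ (1 - ε) := by
        rcases eq_or_lt_of_le hI0 with h0 | h0
        · rw [← h0, Real.zero_rpow hε.ne', zero_mul]
        · rw [← Real.rpow_add h0]; simp
    _ ≤ X ^ ε * ((Y + X) / w h) ^ (1 - ε) := by
        have : 0 ≤ 1 - ε := by linarith
        gcongr
    _ = _ := by
        rw [hB, Real.div_rpow (by linarith) hw.le, show (-1 + ε) = -(1 - ε) by ring,
          Real.rpow_neg hw.le]
        ring

/-! ### Cut-off of the weight to a subinterval of a window. -/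

/-- Restriction of a function to `[u, v)`. -/
def cut (u v : ℝ) (f : ℝ → ℂ) : ℝ → ℂ := (Ico u v).indicator f

theorem cut_mul (u v : ℝ) (f g : ℝ → ℂ) (t : ℝ) : cut u v f t * g t = cut u v (fun t => f t * g t) t := by
  unfold cut
  by_cases h : t ∈ Ico u v
  · rw [indicator_of_mem h, indicator_of_mem h]
  · rw [indicator_of_notMem h, indicator_of_notMem h, zero_mul]

/-- The nearest point of `[u, v]`. -/
def clamp (u v t : ℝ) : ℝ := max u (min v t)

theorem clamp_mem {u v : ℝ} (huv : u ≤ v) (t : ℝ) : clamp u v t ∈ Icc u v :=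
  ⟨le_max_left _ _, max_le huv (min_le_left _ _)⟩

theorem clamp_of_mem {u v t : ℝ} (ht : t ∈ Icc u v) : clamp u v t = t := by
  rw [clamp, min_eq_right ht.2, max_eq_right ht.1]

theorem clamp_of_ge {u v t : ℝ} (huv : u ≤ v) (ht : v ≤ t) : clamp u v t = v := by
  rw [clamp, min_eq_left ht, max_eq_right huv]

theorem clamp_of_le {u v t : ℝ} (huv : u ≤ v) (ht : t ≤ u) : clamp u v t = u := by
  rw [clamp, min_eq_right (ht.trans huv), max_eq_left ht]

/-- Clamping the end points replaces the cut-off. In this way functions defined on [u, v] only give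
primitives on the whole window. -/
theorem integral_cut {u v : ℝ} (huv : u ≤ v) (f : ℝ → ℂ) (t t' : ℝ) :
    ∫ τ in t..t', cut u v f τ = ∫ τ in clamp u v t..clamp u v t', f τ := by
  have key : ∀ t t' : ℝ, t ≤ t' → ∫ τ in t..t', cut u v f τ = ∫ τ in clamp u v t..clamp u v t', f τ := by
    intro t t' htt
    have hcl : clamp u v t ≤ clamp u v t' := max_le_max le_rfl (min_le_min le_rfl htt)
    rw [intervalIntegral.integral_of_le htt, intervalIntegral.integral_of_le hcl, cut,
      setIntegral_indicator measurableSet_Ico]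
    have h1 : (Ioc t t' ∩ Ico u v : Set ℝ) =ᵐ[volume] (Ioc t t' ∩ Ioc u v : Set ℝ) :=
      (ae_eq_refl _).inter Ico_ae_eq_Ioc
    rw [setIntegral_congr_set h1, Ioc_inter_Ioc]
    rcases le_or_gt (t ⊔ u) (t' ⊓ v) with h | h
    · have e1 : clamp u v t = t ⊔ u := by
        have : t ≤ v := (le_sup_left.trans h).trans inf_le_right
        rw [clamp, min_eq_right this, max_comm]
      have e2 : clamp u v t' = t' ⊓ v := by
        have : u ≤ t' ⊓ v := le_sup_right.trans h
        rw [clamp, min_comm, max_eq_right this]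
      rw [e1, e2]
    · have e : clamp u v t = clamp u v t' := by
        rcases le_or_gt v t with h1 | h1
        · rw [clamp_of_ge huv h1, clamp_of_ge huv (h1.trans htt)]
        · rcases le_or_gt t' u with h2 | h2
          · rw [clamp_of_le huv h2, clamp_of_le huv (htt.trans h2)]
          · exfalso
            rcases lt_sup_iff.1 h with h3 | h3 <;> rcases inf_lt_iff.1 h3 with h4 | h4 <;> linarith
      rw [e, Ioc_self, Ioc_eq_empty (not_lt.2 h.le)]
  rcases le_total t t' with h | h
  · exact key t t' h
  · rw [intervalIntegral.integral_symm, intervalIntegral.integral_symm (clamp u v t'), key t' t h]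

theorem oscWeight_cut {ε l u v : ℝ} {ν : ℕ} (hε : 0 < ε) (hε1 : ε < 1) (hl : |l| ≤ 1) (hu : 0 < u)
    (huv : u ≤ v) (hLu : winL ν ≤ u) (hvR : v ≤ winR ν) :
    OscWeight ε ν (oscB ε u v) (cut u v (phi l)) where
  rc x := by
    by_cases hx : x ∈ Ico u v
    · have hev : cut u v (phi l) =ᶠ[𝓝[>] x] phi l := by
        filter_upwards [Ioo_mem_nhdsGT hx.2] with y hy
        exact indicator_of_mem (show y ∈ Ico u v from ⟨hx.1.trans hy.1.le, hy.2⟩) _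
      exact ((continuousAt_phi l (hu.trans_le hx.1)).continuousWithinAt).congr_of_eventuallyEq hev
        (indicator_of_mem hx _)
    · have hev : cut u v (phi l) =ᶠ[𝓝[>] x] fun _ => 0 := by
        rcases lt_or_ge x u with h | h
        · filter_upwards [Ioo_mem_nhdsGT h] with y hy
          exact indicator_of_notMem (fun h' => absurd h'.1 (not_le.2 hy.2)) _
        · have hxa : v ≤ x := not_lt.1 fun h' => hx ⟨h, h'⟩
          filter_upwards [self_mem_nhdsWithin] with y hy
          exact indicator_of_notMem (fun h' => absurd (h'.2.trans_le hxa) (not_lt.2 (le_of_lt hy))) _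
      exact (continuousWithinAt_const).congr_of_eventuallyEq hev (indicator_of_notMem hx _)
  int a b := by
    have hc : ContinuousOn (phi l) (Icc u v) := fun τ hτ =>
      (continuousAt_phi l (hu.trans_le hτ.1)).continuousWithinAt
    have hi : Integrable (cut u v (phi l)) := by
      rw [cut, integrable_indicator_iff measurableSet_Ico]
      exact (hc.integrableOn_Icc).mono_set Ico_subset_Icc_self
    exact hi.intervalIntegrable
  zero x hx := indicator_of_notMem (fun h => hx ⟨hLu.trans h.1, h.2.trans_le hvR⟩) _
  osc h t _ t' _ := by
    simp only [cut_mul]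
    rw [integral_cut huv]
    exact norm_integral_phi_le hε hε1 hl hu (clamp_mem huv t) (clamp_mem huv t') h

/-! ### Families of functions represented by summable Fourier series -/

/-- The coefficients of a family of constants. -/
def cst (c : ℤ → ℂ) : ℤ → ℤ → ℂ := fun k h => if h = 0 then c k else 0

theorem ev_cst (c : ℤ → ℂ) (k : ℤ) (t : ℝ) : ev (cst c) k t = c k := by
  rw [ev, tsum_eq_single 0 (fun h hh => by simp [cst, hh])]
  simp [cst, ex_zero]

theorem sN_cst {s p : ℝ} (hp : 0 < p) (c : ℤ → ℂ) (k : ℤ) : sN s p (cst c k) = ‖c k‖ₑ := by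
  rw [sN, ← lpN_single hp (0 : ℤ) ‖c k‖ₑ]
  congr 1
  funext h
  by_cases hh : h = 0
  · simp [cst, hh, wt_at_zero]
  · simp [cst, hh]

theorem nE_cst {s p : ℝ} (hp : 0 < p) (c : ℤ → ℂ) :
    nE s p (cst c) = lpN p fun k => ‖c k‖ₑ := by
  simp only [nE, sN_cst hp]

theorem sN_add_le {s p : ℝ} (hp : 1 ≤ p) (a b : ℤ → ℂ) :
    sN s p (fun h => a h + b h) ≤ sN s p a + sN s p b := by
  refine le_trans (lpN_mono (by linarith) fun h => ?_) (lpN_add_le hp _ _)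
  rw [← mul_add]
  gcongr
  exact enorm_add_le _ _

theorem sN_const_mul {s p : ℝ} (hp : 0 < p) (z : ℂ) (a : ℤ → ℂ) :
    sN s p (fun h => z * a h) = ‖z‖ₑ * sN s p a := by
  rw [sN, sN, ← lpN_const_mul hp]
  congr 1
  funext h
  rw [enorm_mul]; ring

theorem nE_add_le {s p : ℝ} (hp : 1 ≤ p) (a b : ℤ → ℤ → ℂ) :
    nE s p (fun k h => a k h + b k h) ≤ nE s p a + nE s p b :=
  (lpN_mono (by linarith) fun k => sN_add_le hp (a k) (b k)).trans (lpN_add_le hp _ _)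

theorem nE_const_mul {s p : ℝ} (hp : 0 < p) (z : ℂ) (a : ℤ → ℤ → ℂ) :
    nE s p (fun k h => z * a k h) = ‖z‖ₑ * nE s p a := by
  simp only [nE, sN_const_mul hp, lpN_const_mul hp]

theorem sN_ne_top {s p : ℝ} (hp : 0 < p) {a : ℤ → ℤ → ℂ} (ha : nE s p a ≠ ⊤) (k : ℤ) :
    sN s p (a k) ≠ ⊤ := ne_top_of_le_ne_top ha (sN_le_nE hp a k)

theorem summable_norm_of_nE {s p q ε : ℝ} (H : Adm s p q ε) {a : ℤ → ℤ → ℂ} (ha : nE s p a ≠ ⊤)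
    (k : ℤ) : Summable fun h => ‖a k h‖ := summable_norm_of_sN H (sN_ne_top H.p_pos ha k)

theorem ev_add {a b : ℤ → ℤ → ℂ} {k : ℤ} (ha : Summable fun h => ‖a k h‖)
    (hb : Summable fun h => ‖b k h‖) (t : ℝ) :
    ev (fun k h => a k h + b k h) k t = ev a k t + ev b k t := by
  unfold ev
  rw [← (summable_mul_ex ha t).of_norm.tsum_add (summable_mul_ex hb t).of_norm]
  exact tsum_congr fun h => add_mul _ _ _

theorem ev_const_mul (z : ℂ) (a : ℤ → ℤ → ℂ) (k : ℤ) (t : ℝ) :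
    ev (fun k h => z * a k h) k t = z * ev a k t := by
  unfold ev
  rw [← tsum_mul_left]
  exact tsum_congr fun h => mul_assoc _ _ _

/-- The family `f` agrees on `S` with functions whose coefficients have norm at most `N`. -/
def RepOn (s p : ℝ) (f : ℤ → ℝ → ℂ) (S : Set ℝ) (N : ℝ≥0∞) : Prop :=
  ∃ a : ℤ → ℤ → ℂ, nE s p a ≤ N ∧ ∀ k, ∀ t ∈ S, f k t = ev a k t

namespace RepOn

variable {s p q ε : ℝ} {f g : ℤ → ℝ → ℂ} {S S' : Set ℝ} {N N' : ℝ≥0∞}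

theorem mono (h : RepOn s p f S N) (hS : S' ⊆ S) (hN : N ≤ N') : RepOn s p f S' N' := by
  obtain ⟨a, ha, hf⟩ := h
  exact ⟨a, ha.trans hN, fun k t ht => hf k t (hS ht)⟩

theorem congr (h : RepOn s p f S N) (hfg : ∀ k, ∀ t ∈ S, g k t = f k t) : RepOn s p g S N := by
  obtain ⟨a, ha, hf⟩ := h
  exact ⟨a, ha, fun k t ht => (hfg k t ht).trans (hf k t ht)⟩

theorem const (H : Adm s p q ε) (c : ℤ → ℂ) (S : Set ℝ) :
    RepOn s p (fun k _ => c k) S (lpN p fun k => ‖c k‖ₑ) :=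
  ⟨cst c, (nE_cst H.p_pos c).le, fun k t _ => (ev_cst c k t).symm⟩

theorem zero (H : Adm s p q ε) (S : Set ℝ) : RepOn s p (fun _ _ => 0) S 0 := by
  have := const H (fun _ => 0) S
  simpa [lpN_zero H.p_pos] using this

theorem add (H : Adm s p q ε) (hf : RepOn s p f S N) (hg : RepOn s p g S N') (hN : N ≠ ⊤)
    (hN' : N' ≠ ⊤) : RepOn s p (fun k t => f k t + g k t) S (N + N') := by
  obtain ⟨a, ha, hf⟩ := hf
  obtain ⟨b, hb, hg⟩ := hg
  refine ⟨_, (nE_add_le H.one_le_p a b).trans (add_le_add ha hb), fun k t ht => ?_⟩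
  beta_reduce
  rw [ev_add (summable_norm_of_nE H (ne_top_of_le_ne_top hN ha) k)
    (summable_norm_of_nE H (ne_top_of_le_ne_top hN' hb) k), hf k t ht, hg k t ht]

theorem const_mul (H : Adm s p q ε) (z : ℂ) (hf : RepOn s p f S N) :
    RepOn s p (fun k t => z * f k t) S (‖z‖ₑ * N) := by
  obtain ⟨a, ha, hf⟩ := hf
  refine ⟨fun k h => z * a k h, ?_, fun k t ht => ?_⟩
  · rw [nE_const_mul H.p_pos]; gcongr
  · beta_reduce
    rw [ev_const_mul, hf k t ht]

theorem neg (H : Adm s p q ε) (hf : RepOn s p f S N) : RepOn s p (fun k t => -f k t) S N := by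
  simpa using hf.const_mul H (-1)

theorem sub (H : Adm s p q ε) (hf : RepOn s p f S N) (hg : RepOn s p g S N') (hN : N ≠ ⊤)
    (hN' : N' ≠ ⊤) : RepOn s p (fun k t => f k t - g k t) S (N + N') := by
  simpa only [sub_eq_add_neg] using hf.add H (hg.neg H) hN hN'

theorem continuousOn (H : Adm s p q ε) (hf : RepOn s p f S N) (hN : N ≠ ⊤) (k : ℤ) :
    ContinuousOn (f k) S := by
  obtain ⟨a, ha, hf⟩ := hf
  exact (continuous_ev (summable_norm_of_nE H (ne_top_of_le_ne_top hN ha) k)).continuousOn.congr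
    (hf k)

end RepOn

/-- Pointwise bounds for represented families. -/
theorem RepOn.exists_lpN_le {s p q ε : ℝ} (H : Adm s p q ε) :
    ∃ C : ℝ≥0∞, C ≠ ⊤ ∧ 1 ≤ C ∧ ∀ {f : ℤ → ℝ → ℂ} {S : Set ℝ} {N : ℝ≥0∞}, RepOn s p f S N →
      ∀ t ∈ S, (lpN p fun k => ‖f k t‖ₑ) ≤ C * N := by
  obtain ⟨C, hC, hCa⟩ := enorm_ev_le H
  refine ⟨C + 1, by simp [hC], le_add_self, fun {f S N} hf t ht => ?_⟩
  obtain ⟨a, ha, hf⟩ := hf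
  calc (lpN p fun k => ‖f k t‖ₑ) ≤ lpN p fun k => C * sN s p (a k) :=
        lpN_mono H.p_pos fun k => by rw [hf k t ht]; exact hCa a k t
    _ = C * nE s p a := lpN_const_mul H.p_pos _ _
    _ ≤ (C + 1) * N := by gcongr; exact le_self_add

theorem enorm_le_lpN {p : ℝ} (hp : 0 < p) (c : ℤ → ℂ) (k : ℤ) :
    ‖c k‖ₑ ≤ lpN p fun k => ‖c k‖ₑ := le_lpN hp (fun k => ‖c k‖ₑ) k

theorem tsum_comm_of_uncurry {β γ : Type*} {F : β → γ → ℂ} (h : Summable (Function.uncurry F)) :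
    ∑' b, ∑' c, F b c = ∑' c, ∑' b, F b c := h.tsum_comm.symm

/-- Series of represented families. -/
theorem RepOn.tsum {s p q ε : ℝ} (H : Adm s p q ε) {f : ℕ → ℤ → ℝ → ℂ} {S : Set ℝ} {N : ℕ → ℝ≥0∞}
    (hf : ∀ n, RepOn s p (f n) S (N n)) (hN : ∑' n, N n ≠ ⊤) :
    RepOn s p (fun k t => ∑' n, f n k t) S (∑' n, N n) := by
  choose a ha hfa using hf
  obtain ⟨C, hC, hCa⟩ := tsum_enorm_le H
  have hNn : ∀ n, N n ≠ ⊤ := fun n => ne_top_of_le_ne_top hN (ENNReal.le_tsum n)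
  have hfin : ∀ k, ∑' n, ∑' h, ‖a n k h‖ₑ ≠ ⊤ := fun k => by
    refine ne_top_of_le_ne_top (ENNReal.mul_ne_top hC hN) ?_
    rw [← ENNReal.tsum_mul_left]
    refine ENNReal.tsum_le_tsum fun n => (hCa _).trans ?_
    gcongr
    exact (sN_le_nE H.p_pos _ k).trans (ha n)
  have hsum : ∀ k, Summable fun i : ℕ × ℤ => ‖a i.1 k i.2‖ := fun k => by
    rw [← tsum_enorm_ne_top_iff_summable_norm, ENNReal.tsum_prod' (f := fun i : ℕ × ℤ => ‖a i.1 k i.2‖ₑ)]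
    exact hfin k
  refine ⟨fun k h => ∑' n, a n k h, ?_, fun k t ht => ?_⟩
  · calc nE s p (fun k h => ∑' n, a n k h)
        ≤ lpN p fun k => ∑' n, sN s p (a n k) := by
          refine lpN_mono H.p_pos fun k => ?_
          refine le_trans (lpN_mono H.p_pos fun h => ?_) (lpN_tsum_le H.one_le_p _)
          rw [ENNReal.tsum_mul_left]
          gcongr
          exact enorm_tsum_le_tsum_enorm
      _ ≤ ∑' n, nE s p (a n) := lpN_tsum_le H.one_le_p _
      _ ≤ _ := ENNReal.tsum_le_tsum ha
  · have h1 : Summable (Function.uncurry fun n h => a n k h * ex h t) := by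
      refine Summable.of_norm ?_
      simpa only [Function.uncurry_def, norm_mul, norm_ex, mul_one] using hsum k
    simp only [hfa _ k t ht, ev]
    rw [tsum_comm_of_uncurry h1]
    exact tsum_congr fun h => tsum_mul_right

/-! ### Trilinear Duhamel terms -/

/-- The index set of the non-resonant triples. -/
def nrS : Set (ℤ × ℤ) := {q | q.1 ≠ 0 ∧ q.2 ≠ 0}

theorem nrS_subset_pairs : nrS ⊆ pairs := fun _ hq => Or.inl hq

theorem zero_subset_pairs : ({(0, 0)} : Set (ℤ × ℤ)) ⊆ pairs := by
  rintro _ rfl; exact Or.inr ⟨rfl, rfl⟩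

/-- The phase shift parametrized by `(x, y) = (k - j₁, k - j₃)`. -/
def shift (α : ℤ → ℂ) (k : ℤ) (q : ℤ × ℤ) : ℝ :=
  phaseShift α k (k - q.1, k - q.1 - q.2, k - q.2) / (8 * Real.pi)

/-- The weights in the integral system. -/
def wgt (α : ℤ → ℂ) (k : ℤ) (q : ℤ × ℤ) : ℝ → ℂ := phi (shift α k q)

/-- A sup bound on α keeps the exponents λ in [-1, 1], so all oscillatory bounds are uniform in α, k
and the triple. -/
theorem abs_shift_le {α : ℤ → ℂ} (hα : ∀ k, ‖α k‖ ≤ 1) (k : ℤ) (q : ℤ × ℤ) : |shift α k q| ≤ 1 := by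
  have h2 : ∀ j, ‖α j‖ ^ 2 ≤ 1 := fun j => by
    have := hα j; have := norm_nonneg (α j); nlinarith
  have h3 : ∀ j, 0 ≤ ‖α j‖ ^ 2 := fun j => by positivity
  have hpi := Real.pi_gt_three
  rw [shift, abs_div, abs_of_pos (by positivity : 0 < 8 * Real.pi), div_le_one (by positivity)]
  unfold phaseShift
  rw [abs_le]
  constructor <;>
    linarith [h2 k, h3 k, h2 (k - q.1), h3 (k - q.1), h2 (k - q.1 - q.2), h3 (k - q.1 - q.2),
      h2 (k - q.2), h3 (k - q.2)]

/-- At (0, 0) the weight is plain 1/τ; the resonant term can therefore be handled as the trilinear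
term with this index. -/
theorem shift_zero (α : ℤ → ℂ) (k : ℤ) : shift α k (0, 0) = 0 := by
  simp [shift, phaseShift]

theorem continuousOn_wgt (α : ℤ → ℂ) (k : ℤ) (q : ℤ × ℤ) {S : Set ℝ} (hS : ∀ t ∈ S, 0 < t) :
    ContinuousOn (wgt α k q) S := fun t ht => (continuousAt_phi _ (hS t ht)).continuousWithinAt

theorem continuousOn_trm {ψ : ℤ → ℤ × ℤ → ℝ → ℂ} {f g h : ℤ → ℝ → ℂ} {k : ℤ} {q : ℤ × ℤ} {S : Set ℝ}
    (hψ : ContinuousOn (ψ k q) S) (hf : ∀ k, ContinuousOn (f k) S) (hg : ∀ k, ContinuousOn (g k) S)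
    (hh : ∀ k, ContinuousOn (h k) S) : ContinuousOn (trm ψ f g h k q) S :=
  (hψ.mul (continuous_ex _).continuousOn).mul
    (((hf _).mul (Complex.continuous_conj.comp_continuousOn (hg _))).mul (hh _))

theorem trm_congr {ψ : ℤ → ℤ × ℤ → ℝ → ℂ} {f g h f' g' h' : ℤ → ℝ → ℂ} {τ : ℝ}
    (hf : ∀ k, f k τ = f' k τ) (hg : ∀ k, g k τ = g' k τ) (hh : ∀ k, h k τ = h' k τ) (k : ℤ)
    (q : ℤ × ℤ) : trm ψ f g h k q τ = trm ψ f' g' h' k q τ := by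
  simp only [trm, hf, hg, hh]

/-- Local trilinear estimate. -/
theorem RepOn.exists_trilinear {s p q ε : ℝ} (H : Adm s p q ε) :
    ∃ C : ℝ≥0∞, C ≠ ⊤ ∧ ∀ {ν : ℕ} {u v : ℝ} {α : ℤ → ℂ} {f g h : ℤ → ℝ → ℂ} {X Y Z : ℝ≥0∞}
      {Q : Set (ℤ × ℤ)}, Q ⊆ pairs → 0 < u → u ≤ v → winL ν ≤ u → v ≤ winR ν → (∀ k, ‖α k‖ ≤ 1) →
      RepOn s p f (Icc u v) X → RepOn s p g (Icc u v) Y → RepOn s p h (Icc u v) Z →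
      X ≠ ⊤ → Y ≠ ⊤ → Z ≠ ⊤ →
      (∀ k, ∀ t ∈ Icc u v, Summable fun q : Q => ∫ τ in t..v, trm (wgt α) f g h k q τ) ∧
      RepOn s p (fun k t => ∑' q : Q, ∫ τ in clamp u v t..v, trm (wgt α) f g h k q τ) (window ν)
        (C * ENNReal.ofReal (oscB ε u v) * (X * Y * Z)) := by
  obtain ⟨C₁, hC₁, hF⟩ := exists_coeff_trm H
  obtain ⟨C₂, hC₂, hL⟩ := lpN_lev_le H
  refine ⟨C₁ * C₂, ENNReal.mul_ne_top hC₁ hC₂, ?_⟩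
  intro ν u v α f g h X Y Z Q hQ hu huv hLu hvR hα ⟨a, ha, hfa⟩ ⟨b, hb, hgb⟩ ⟨c, hc, hhc⟩ hX hY hZ
  have hε1 : ε < 1 := by linarith [H.s_lt, H.pos, H.s_pos]
  have hfin : ∀ k, lev ε p Q a b c k ≠ ⊤ := fun k => by
    refine ne_top_of_le_ne_top ?_ ((le_lpN H.p_pos _ k).trans (hL Q hQ a b c))
    exact ENNReal.mul_ne_top hC₂ (ENNReal.mul_ne_top (ENNReal.mul_ne_top
      (ne_top_of_le_ne_top hX ha) (ne_top_of_le_ne_top hY hb)) (ne_top_of_le_ne_top hZ hc))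
  -- The weights are cut to [u, v), so the integrals are constant in t outside [u, v] and are
  -- represented on the whole window.
  have hex := fun k => hF ν Q (fun k q => cut u v (wgt α k q)) (oscB ε u v) k
    (fun q _ => oscWeight_cut H.pos hε1 (abs_shift_le hα k q) hu huv hLu hvR) a b c
    (sN_ne_top H.p_pos (ne_top_of_le_ne_top hX ha)) (sN_ne_top H.p_pos (ne_top_of_le_ne_top hY hb))
    (sN_ne_top H.p_pos (ne_top_of_le_ne_top hZ hc)) (hfin k)
  choose e he hsum using hex
  have hint : ∀ k t (q : Q), ∫ τ in t..winR ν, trm (fun k q => cut u v (wgt α k q)) (ev a) (ev b)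
      (ev c) k q τ = ∫ τ in clamp u v t..v, trm (wgt α) f g h k q τ := by
    intro k t q
    have h1 : ∀ τ, trm (fun k q => cut u v (wgt α k q)) (ev a) (ev b) (ev c) k q τ =
        cut u v (trm (wgt α) (ev a) (ev b) (ev c) k q) τ := fun τ => by
      by_cases hτ : τ ∈ Ico u v <;> simp [trm, cut, hτ]
    simp only [h1]
    rw [integral_cut huv, clamp_of_ge huv hvR]
    refine intervalIntegral.integral_congr fun τ hτ => ?_
    have hcl := clamp_mem huv t
    rw [uIcc_of_le hcl.2] at hτ
    have hτ' : τ ∈ Icc u v := ⟨hcl.1.trans hτ.1, hτ.2⟩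
    exact (trm_congr (fun k => hfa k τ hτ') (fun k => hgb k τ hτ') (fun k => hhc k τ hτ') _ _).symm
  simp only [hint] at hsum
  refine ⟨fun k t ht => ?_, ⟨e, ?_, fun k t ht => (hsum k t ht).tsum_eq⟩⟩
  · have := (hsum k t ⟨hLu.trans ht.1, ht.2.trans hvR⟩).summable
    simpa only [clamp_of_mem ht] using this
  · calc nE s p e ≤ lpN p fun k => C₁ * ENNReal.ofReal (oscB ε u v) * lev ε p Q a b c k :=
          lpN_mono H.p_pos he
      _ = C₁ * ENNReal.ofReal (oscB ε u v) * lpN p (lev ε p Q a b c) := lpN_const_mul H.p_pos _ _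
      _ ≤ C₁ * ENNReal.ofReal (oscB ε u v) * (C₂ * (X * Y * Z)) := by
          gcongr
          exact (hL Q hQ a b c).trans (by gcongr)
      _ = _ := by ring

/-! ### The Duhamel term -/

/-- The sum of the integrals of the non-resonant terms over `[t, v]`. -/
def nrT (α : ℤ → ℂ) (f g h : ℤ → ℝ → ℂ) (k : ℤ) (t v : ℝ) : ℂ :=
  ∑' q : nrS, ∫ τ in t..v, trm (wgt α) f g h k q τ

/-- The resonant part of the integrand. -/
def slf (α : ℤ → ℂ) (A : ℤ → ℝ → ℂ) (k : ℤ) (τ : ℝ) : ℂ :=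
  -- Writing |A|²A - |α|²A as a difference of trilinear terms puts the resonant part under the same
  -- estimates.
  trm (wgt α) A A A k (0, 0) τ - trm (wgt α) (fun k _ => α k) (fun k _ => α k) A k (0, 0) τ

/-- The Duhamel term over `[t, v]`. -/
def duh (α : ℤ → ℂ) (A : ℤ → ℝ → ℂ) (k : ℤ) (t v : ℝ) : ℂ :=
  nrT α A A A k t v - ∫ τ in t..v, slf α A k τ

theorem trm_diff (ψ : ℤ → ℤ × ℤ → ℝ → ℂ) (A A' : ℤ → ℝ → ℂ) (k : ℤ) (q : ℤ × ℤ) (τ : ℝ) :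
    trm ψ A A A k q τ - trm ψ A' A' A' k q τ =
      trm ψ (fun k t => A k t - A' k t) A A k q τ + trm ψ A' (fun k t => A k t - A' k t) A k q τ +
        trm ψ A' A' (fun k t => A k t - A' k t) k q τ := by
  simp only [trm, map_sub]
  ring

theorem intervalIntegrable_trm (α : ℤ → ℂ) {f g h : ℤ → ℝ → ℂ} {t t' : ℝ} (ht : 0 < t) (ht' : 0 < t')
    (hf : ∀ k, ContinuousOn (f k) (uIcc t t')) (hg : ∀ k, ContinuousOn (g k) (uIcc t t'))
    (hh : ∀ k, ContinuousOn (h k) (uIcc t t')) (k : ℤ) (q : ℤ × ℤ) :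
    IntervalIntegrable (trm (wgt α) f g h k q) volume t t' :=
  (continuousOn_trm (continuousOn_wgt α k q fun _ hx => (lt_min ht ht').trans_le hx.1)
    hf hg hh).intervalIntegrable

theorem integral_trm_diff (α : ℤ → ℂ) {A A' : ℤ → ℝ → ℂ} {t t' : ℝ} (ht : 0 < t) (ht' : 0 < t')
    (hA : ∀ k, ContinuousOn (A k) (uIcc t t')) (hA' : ∀ k, ContinuousOn (A' k) (uIcc t t'))
    (k : ℤ) (q : ℤ × ℤ) :
    (∫ τ in t..t', trm (wgt α) A A A k q τ) - ∫ τ in t..t', trm (wgt α) A' A' A' k q τ =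
      (∫ τ in t..t', trm (wgt α) (fun k t => A k t - A' k t) A A k q τ) +
      (∫ τ in t..t', trm (wgt α) A' (fun k t => A k t - A' k t) A k q τ) +
        ∫ τ in t..t', trm (wgt α) A' A' (fun k t => A k t - A' k t) k q τ := by
  have hD : ∀ k, ContinuousOn (fun t => A k t - A' k t) (uIcc t t') := fun k => (hA k).sub (hA' k)
  have i1 := intervalIntegrable_trm α ht ht' hD hA hA k q
  have i2 := intervalIntegrable_trm α ht ht' hA' hD hA k q
  have i3 := intervalIntegrable_trm α ht ht' hA' hA' hD k q
  rw [← intervalIntegral.integral_sub (intervalIntegrable_trm α ht ht' hA hA hA k q)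
    (intervalIntegrable_trm α ht ht' hA' hA' hA' k q), ← intervalIntegral.integral_add i1 i2,
    ← intervalIntegral.integral_add (i1.add i2) i3]
  simp only [trm_diff]

theorem slf_diff (α : ℤ → ℂ) (A A' : ℤ → ℝ → ℂ) (k : ℤ) (τ : ℝ) :
    slf α A k τ - slf α A' k τ =
      trm (wgt α) (fun k t => A k t - A' k t) A A k (0, 0) τ +
      trm (wgt α) A' (fun k t => A k t - A' k t) A k (0, 0) τ +
      trm (wgt α) A' A' (fun k t => A k t - A' k t) k (0, 0) τ -
      trm (wgt α) (fun k _ => α k) (fun k _ => α k) (fun k t => A k t - A' k t) k (0, 0) τ := by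
  simp only [slf, trm, map_sub]
  ring

theorem continuousOn_slf (α : ℤ → ℂ) {A : ℤ → ℝ → ℂ} {S : Set ℝ} (hS : ∀ t ∈ S, 0 < t)
    (hA : ∀ k, ContinuousOn (A k) S) (k : ℤ) : ContinuousOn (slf α A k) S :=
  (continuousOn_trm (continuousOn_wgt α k _ hS) hA hA hA).sub
    (continuousOn_trm (continuousOn_wgt α k _ hS) (fun _ => continuousOn_const)
      (fun _ => continuousOn_const) hA)

theorem intervalIntegrable_slf (α : ℤ → ℂ) {A : ℤ → ℝ → ℂ} {t t' : ℝ} (ht : 0 < t) (ht' : 0 < t')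
    (hA : ∀ k, ContinuousOn (A k) (uIcc t t')) (k : ℤ) :
    IntervalIntegrable (slf α A k) volume t t' :=
  (continuousOn_slf α (fun _ hx => (lt_min ht ht').trans_le hx.1) hA k).intervalIntegrable

theorem integral_slf_diff (α : ℤ → ℂ) {A A' : ℤ → ℝ → ℂ} {t t' : ℝ} (ht : 0 < t) (ht' : 0 < t')
    (hA : ∀ k, ContinuousOn (A k) (uIcc t t')) (hA' : ∀ k, ContinuousOn (A' k) (uIcc t t')) (k : ℤ) :
    (∫ τ in t..t', slf α A k τ) - ∫ τ in t..t', slf α A' k τ =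
      (∫ τ in t..t', trm (wgt α) (fun k t => A k t - A' k t) A A k (0, 0) τ) +
      (∫ τ in t..t', trm (wgt α) A' (fun k t => A k t - A' k t) A k (0, 0) τ) +
      (∫ τ in t..t', trm (wgt α) A' A' (fun k t => A k t - A' k t) k (0, 0) τ) -
      ∫ τ in t..t', trm (wgt α) (fun k _ => α k) (fun k _ => α k) (fun k t => A k t - A' k t)
        k (0, 0) τ := by
  have hD : ∀ k, ContinuousOn (fun t => A k t - A' k t) (uIcc t t') := fun k => (hA k).sub (hA' k)
  have hα : ∀ k, ContinuousOn (fun _ : ℝ => α k) (uIcc t t') := fun k => continuousOn_const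
  have i1 := intervalIntegrable_trm α ht ht' hD hA hA k (0, 0)
  have i2 := intervalIntegrable_trm α ht ht' hA' hD hA k (0, 0)
  have i3 := intervalIntegrable_trm α ht ht' hA' hA' hD k (0, 0)
  have i4 := intervalIntegrable_trm α ht ht' hα hα hD k (0, 0)
  rw [← intervalIntegral.integral_sub (intervalIntegrable_slf α ht ht' hA k)
    (intervalIntegrable_slf α ht ht' hA' k), ← intervalIntegral.integral_add i1 i2,
    ← intervalIntegral.integral_add (i1.add i2) i3,
    ← intervalIntegral.integral_sub ((i1.add i2).add i3) i4]
  simp only [slf_diff]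

/-- Difference of two Duhamel terms in terms of their trilinear parts. -/
theorem duh_sub_duh {α : ℤ → ℂ} {A A' : ℤ → ℝ → ℂ} {t t' : ℝ} (ht : 0 < t) (ht' : 0 < t')
    (hA : ∀ k, ContinuousOn (A k) (uIcc t t')) (hA' : ∀ k, ContinuousOn (A' k) (uIcc t t')) (k : ℤ)
    (s1 : Summable fun q : nrS => ∫ τ in t..t', trm (wgt α) (fun k t => A k t - A' k t) A A k q τ)
    (s2 : Summable fun q : nrS => ∫ τ in t..t', trm (wgt α) A' (fun k t => A k t - A' k t) A k q τ)
    (s3 : Summable fun q : nrS => ∫ τ in t..t', trm (wgt α) A' A' (fun k t => A k t - A' k t) k q τ)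
    (s4 : Summable fun q : nrS => ∫ τ in t..t', trm (wgt α) A A A k q τ)
    (s5 : Summable fun q : nrS => ∫ τ in t..t', trm (wgt α) A' A' A' k q τ) :
    duh α A k t t' - duh α A' k t t' =
      nrT α (fun k t => A k t - A' k t) A A k t t' + nrT α A' (fun k t => A k t - A' k t) A k t t' +
      nrT α A' A' (fun k t => A k t - A' k t) k t t' -
      ((∫ τ in t..t', trm (wgt α) (fun k t => A k t - A' k t) A A k (0, 0) τ) +
      (∫ τ in t..t', trm (wgt α) A' (fun k t => A k t - A' k t) A k (0, 0) τ) +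
      (∫ τ in t..t', trm (wgt α) A' A' (fun k t => A k t - A' k t) k (0, 0) τ) -
      ∫ τ in t..t', trm (wgt α) (fun k _ => α k) (fun k _ => α k) (fun k t => A k t - A' k t)
        k (0, 0) τ) := by
  have h1 : nrT α A A A k t t' - nrT α A' A' A' k t t' =
      nrT α (fun k t => A k t - A' k t) A A k t t' + nrT α A' (fun k t => A k t - A' k t) A k t t' +
      nrT α A' A' (fun k t => A k t - A' k t) k t t' := by
    unfold nrT
    rw [← s4.tsum_sub s5, ← s1.tsum_add s2, ← (s1.add s2).tsum_add s3]
    exact tsum_congr fun q => integral_trm_diff α ht ht' hA hA' k q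
  rw [← h1, ← integral_slf_diff α ht ht' hA hA' k]
  unfold duh
  ring

/-- Local Lipschitz estimate for the Duhamel term. -/
theorem RepOn.exists_duh_sub {s p q ε : ℝ} (H : Adm s p q ε) :
    ∃ C : ℝ≥0∞, C ≠ ⊤ ∧ ∀ {ν : ℕ} {u v : ℝ} {α : ℤ → ℂ} {A A' : ℤ → ℝ → ℂ} {M N : ℝ≥0∞},
      0 < u → u ≤ v → winL ν ≤ u → v ≤ winR ν → (∀ k, ‖α k‖ ≤ 1) →
      (lpN p fun k => ‖α k‖ₑ) ≤ M → RepOn s p A (Icc u v) M → RepOn s p A' (Icc u v) M →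
      RepOn s p (fun k t => A k t - A' k t) (Icc u v) N → M ≠ ⊤ → N ≠ ⊤ →
      RepOn s p (fun k t => duh α A k (clamp u v t) v - duh α A' k (clamp u v t) v) (window ν)
        (C * ENNReal.ofReal (oscB ε u v) * (M ^ 2 * N)) := by
  obtain ⟨C, hC, hT⟩ := RepOn.exists_trilinear H
  -- Seven trilinear terms: three non-resonant ones and four at (0, 0), the last of them with two
  -- factors α.
  refine ⟨7 * C, ENNReal.mul_ne_top (by simp) hC, ?_⟩
  intro ν u v α A A' M N hu huv hLu hvR hα hαM hA hA' hD hM hN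
  have hαR : RepOn s p (fun k _ => α k) (Icc u v) M := (RepOn.const H α _).mono le_rfl hαM
  have hfin : C * ENNReal.ofReal (oscB ε u v) * (M ^ 2 * N) ≠ ⊤ :=
    ENNReal.mul_ne_top (ENNReal.mul_ne_top hC ENNReal.ofReal_ne_top)
      (ENNReal.mul_ne_top (ENNReal.pow_ne_top hM) hN)
  have e1 : N * M * M = M ^ 2 * N := by ring
  have e2 : M * N * M = M ^ 2 * N := by ring
  have e3 : M * M * N = M ^ 2 * N := by ring
  have hS : ∀ (f g h : ℤ → ℝ → ℂ) k t, ∑' q : ({(0, 0)} : Set (ℤ × ℤ)),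
      ∫ τ in clamp u v t..v, trm (wgt α) f g h k q τ =
      ∫ τ in clamp u v t..v, trm (wgt α) f g h k (0, 0) τ := fun f g h k t =>
    tsum_singleton (0, 0) fun q : ℤ × ℤ => ∫ τ in clamp u v t..v, trm (wgt α) f g h k q τ
  have T := @hT ν u v α
  obtain ⟨s1, r1⟩ := T nrS_subset_pairs hu huv hLu hvR hα hD hA hA hN hM hM
  obtain ⟨s2, r2⟩ := T nrS_subset_pairs hu huv hLu hvR hα hA' hD hA hM hN hM
  obtain ⟨s3, r3⟩ := T nrS_subset_pairs hu huv hLu hvR hα hA' hA' hD hM hM hN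
  obtain ⟨s4, -⟩ := T nrS_subset_pairs hu huv hLu hvR hα hA hA hA hM hM hM
  obtain ⟨s5, -⟩ := T nrS_subset_pairs hu huv hLu hvR hα hA' hA' hA' hM hM hM
  obtain ⟨-, d1⟩ := T zero_subset_pairs hu huv hLu hvR hα hD hA hA hN hM hM
  obtain ⟨-, d2⟩ := T zero_subset_pairs hu huv hLu hvR hα hA' hD hA hM hN hM
  obtain ⟨-, d3⟩ := T zero_subset_pairs hu huv hLu hvR hα hA' hA' hD hM hM hN
  obtain ⟨-, d4⟩ := T zero_subset_pairs hu huv hLu hvR hα hαR hαR hD hM hM hN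
  rw [e1] at r1 d1
  rw [e2] at r2 d2
  rw [e3] at r3 d3 d4
  have htot := ((r1.add H r2 hfin hfin).add H r3 (by finiteness) hfin).sub H
    (((d1.add H d2 hfin hfin).add H d3 (by finiteness) hfin).sub H d4 (by finiteness) hfin)
    (by finiteness) (by finiteness)
  refine (htot.congr fun k t _ => ?_).mono le_rfl (le_of_eq (by ring))
  have hcl := clamp_mem huv t
  have hsub : uIcc (clamp u v t) v ⊆ Icc u v := by
    rw [uIcc_of_le hcl.2]; exact Icc_subset_Icc hcl.1 le_rfl
  rw [duh_sub_duh (hu.trans_le hcl.1) (hu.trans_le huv)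
    (fun k => (hA.continuousOn H hM k).mono hsub) (fun k => (hA'.continuousOn H hM k).mono hsub) k
    (s1 k _ hcl) (s2 k _ hcl) (s3 k _ hcl) (s4 k _ hcl) (s5 k _ hcl)]
  simp only [nrT, hS]

theorem Adm.eps_lt_one {s p q ε : ℝ} (H : Adm s p q ε) : ε < 1 := by
  linarith [H.s_lt, H.pos, H.s_pos]

/-- The non-resonant sum over a subinterval of a window converges. -/
theorem RepOn.summable_trm {s p q ε : ℝ} (H : Adm s p q ε) {ν : ℕ} {t t' : ℝ} {α : ℤ → ℂ}
    {A : ℤ → ℝ → ℂ} {M : ℝ≥0∞} (hu : 0 < t) (huv : t ≤ t') (hLu : winL ν ≤ t)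
    (hvR : t' ≤ winR ν) (hα : ∀ k, ‖α k‖ ≤ 1) (hA : RepOn s p A (Icc t t') M) (hM : M ≠ ⊤) (k : ℤ) :
    Summable fun q : nrS => ∫ τ in t..t', trm (wgt α) A A A k q τ := by
  obtain ⟨C, hC, hT⟩ := RepOn.exists_trilinear H
  exact (hT nrS_subset_pairs hu huv hLu hvR hα hA hA hA hM hM hM).1 k t ⟨le_rfl, huv⟩

theorem duh_zero (α : ℤ → ℂ) (k : ℤ) (t v : ℝ) : duh α (fun _ _ => 0) k t v = 0 := by
  simp [duh, nrT, slf, trm]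

theorem duh_self (α : ℤ → ℂ) (A : ℤ → ℝ → ℂ) (k : ℤ) (t : ℝ) : duh α A k t t = 0 := by
  simp [duh, nrT]

/-- Local bound for the Duhamel term. -/
theorem RepOn.exists_duh {s p q ε : ℝ} (H : Adm s p q ε) :
    ∃ C : ℝ≥0∞, C ≠ ⊤ ∧ ∀ {ν : ℕ} {u v : ℝ} {α : ℤ → ℂ} {A : ℤ → ℝ → ℂ} {M N : ℝ≥0∞},
      0 < u → u ≤ v → winL ν ≤ u → v ≤ winR ν → (∀ k, ‖α k‖ ≤ 1) →
      (lpN p fun k => ‖α k‖ₑ) ≤ M → RepOn s p A (Icc u v) N → N ≤ M → M ≠ ⊤ →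
      RepOn s p (fun k t => duh α A k (clamp u v t) v) (window ν)
        (C * ENNReal.ofReal (oscB ε u v) * (M ^ 2 * N)) := by
  obtain ⟨C, hC, hT⟩ := RepOn.exists_duh_sub H
  refine ⟨C, hC, fun {ν u v α A M N} hu huv hLu hvR hα hαM hA hNM hM => ?_⟩
  have h0 : RepOn s p (fun _ _ => 0) (Icc u v) M := (RepOn.zero H _).mono le_rfl (zero_le)
  have := hT hu huv hLu hvR hα hαM (hA.mono le_rfl hNM) h0 (by simpa using hA) hM
    (ne_top_of_le_ne_top hM hNM)
  simpa only [duh_zero, sub_zero] using this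

/-- The Duhamel term is additive in the interval of integration. -/
theorem duh_add {α : ℤ → ℂ} {A : ℤ → ℝ → ℂ} {k : ℤ} {t t' t'' : ℝ}
    (i1 : ∀ q : nrS, IntervalIntegrable (trm (wgt α) A A A k q) volume t t')
    (i2 : ∀ q : nrS, IntervalIntegrable (trm (wgt α) A A A k q) volume t' t'')
    (j1 : IntervalIntegrable (slf α A k) volume t t')
    (j2 : IntervalIntegrable (slf α A k) volume t' t'')
    (s1 : Summable fun q : nrS => ∫ τ in t..t', trm (wgt α) A A A k q τ)
    (s2 : Summable fun q : nrS => ∫ τ in t'..t'', trm (wgt α) A A A k q τ) :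
    (Summable fun q : nrS => ∫ τ in t..t'', trm (wgt α) A A A k q τ) ∧
    duh α A k t t'' = duh α A k t t' + duh α A k t' t'' := by
  have h1 : ∀ q : nrS, (∫ τ in t..t', trm (wgt α) A A A k q τ) +
      ∫ τ in t'..t'', trm (wgt α) A A A k q τ = ∫ τ in t..t'', trm (wgt α) A A A k q τ := fun q =>
    intervalIntegral.integral_add_adjacent_intervals (i1 q) (i2 q)
  refine ⟨by simpa only [h1] using s1.add s2, ?_⟩
  unfold duh nrT
  rw [← intervalIntegral.integral_add_adjacent_intervals j1 j2, ← tsum_congr h1, s1.tsum_add s2]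
  ring

/-! ### The integrated system on compact intervals. -/

/-- Solutions of the integrated system on `(T, ∞)`. -/
structure IncSol (c : ℂ) (α : ℤ → ℂ) (T : ℝ) (A : ℤ → ℝ → ℂ) : Prop where
  cont : ∀ k, ContinuousOn (A k) (Ioi T)
  summ : ∀ k t t', T < t → t ≤ t' → Summable fun q : nrS => ∫ τ in t..t', trm (wgt α) A A A k q τ
  inc : ∀ k t t', T < t → t ≤ t' → A k t = A k t' + c * duh α A k t t'

/-- A function which solves the integrated system on two adjacent intervals is represented on the
union. -/
theorem RepOn.glue {s p q ε : ℝ} (H : Adm s p q ε) {ν : ℕ} {u y v : ℝ} {α : ℤ → ℂ} {c : ℂ}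
    {A : ℤ → ℝ → ℂ} {M : ℝ≥0∞} (hu : 0 < u) (huy : u ≤ y) (hyv : y ≤ v) (hLu : winL ν ≤ u)
    (hvR : v ≤ winR ν) (hα : ∀ k, ‖α k‖ ≤ 1) (hαp : (lpN p fun k => ‖α k‖ₑ) ≠ ⊤)
    (h1 : RepOn s p A (Icc u y) M) (h2 : RepOn s p A (Icc y v) M) (hM : M ≠ ⊤)
    (e1 : ∀ k, ∀ t ∈ Icc u y, A k t = A k y + c * duh α A k t y)
    (e2 : ∀ k, ∀ t ∈ Icc y v, A k t = A k v + c * duh α A k t v) :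
    ∃ N : ℝ≥0∞, N ≠ ⊤ ∧ RepOn s p A (Icc u v) N := by
  obtain ⟨C, hC, hd⟩ := RepOn.exists_duh H
  obtain ⟨C', hC', -, hpt⟩ := RepOn.exists_lpN_le H
  set M' := M + lpN p fun k => ‖α k‖ₑ with hM'
  have hM't : M' ≠ ⊤ := ENNReal.add_ne_top.2 ⟨hM, hαp⟩
  have d1 := hd hu huy hLu (hyv.trans hvR) hα le_add_self h1 le_self_add hM't
  have d2 := hd (hu.trans_le huy) hyv (hLu.trans huy) hvR hα le_add_self h2 le_self_add hM't
  have hv : (lpN p fun k => ‖A k v‖ₑ) ≠ ⊤ :=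
    ne_top_of_le_ne_top (ENNReal.mul_ne_top hC' hM) (hpt h2 v ⟨hyv, le_rfl⟩)
  have n1 : ‖c‖ₑ * (C * ENNReal.ofReal (oscB ε u y) * (M' ^ 2 * M)) ≠ ⊤ := by finiteness
  have n2 : ‖c‖ₑ * (C * ENNReal.ofReal (oscB ε y v) * (M' ^ 2 * M)) ≠ ⊤ := by finiteness
  -- Two representations cannot simply be put side by side, but the equation can: A is its value at
  -- v plus the Duhamel terms over both intervals, and the clamps switch off the part of each that
  -- lies to the left of t.
  have htot := (((RepOn.const H (fun k => A k v) (window ν)).add H (d2.const_mul H c) hv n2).add H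
    (d1.const_mul H c) (ENNReal.add_ne_top.2 ⟨hv, n2⟩) n1)
  refine ⟨_, ENNReal.add_ne_top.2 ⟨ENNReal.add_ne_top.2 ⟨hv, n2⟩, n1⟩,
    (htot.mono (Icc_subset_Icc hLu hvR) le_rfl).congr fun k t ht => ?_⟩
  rcases le_total t y with h | h
  · rw [clamp_of_le hyv h, clamp_of_mem ⟨ht.1, h⟩, ← e2 k y ⟨le_rfl, hyv⟩, ← e1 k t ⟨ht.1, h⟩]
  · rw [clamp_of_ge huy h, clamp_of_mem ⟨h, ht.2⟩, duh_self, mul_zero, add_zero, ← e2 k t ⟨h, ht.2⟩]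

/-! ### The integral system -/

/-- Parametrization of the non-resonant triples. -/
def nonResEquiv (k : ℤ) : nonRes k ≃ nrS where
  toFun j := ⟨(k - j.1.1, k - j.1.2.2), by
    obtain ⟨⟨j1, j2, j3⟩, h1, h2⟩ := j
    -- The factorization 2(k - j₁)(k - j₃): being non-resonant means that neither difference
    -- vanishes.
    have h3 : resonance k (j1, j2, j3) = 2 * ((k - j1) * (k - j3)) := by
      simp only at h1
      simp only [resonance]
      have : j2 = j1 + j3 - k := by linarith
      rw [this]; ring
    rw [h3] at h2
    exact ⟨fun h => h2 (by simp only at h; rw [h]; ring), fun h => h2 (by simp only at h; rw [h]; ring)⟩⟩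
  invFun q := ⟨(k - q.1.1, k - q.1.1 - q.1.2, k - q.1.2), by
    obtain ⟨⟨x, y⟩, hx, hy⟩ := q
    refine ⟨by simp only; ring, ?_⟩
    have h3 : resonance k (k - x, k - x - y, k - y) = 2 * (x * y) := by
      simp only [resonance]; ring
    simp only [h3]
    exact mul_ne_zero two_ne_zero (mul_ne_zero hx hy)⟩
  left_inv j := by
    obtain ⟨⟨j1, j2, j3⟩, h1, h2⟩ := j
    simp only at h1
    refine Subtype.ext (Prod.ext ?_ (Prod.ext ?_ ?_)) <;> simp only <;> linarith
  right_inv q := by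
    obtain ⟨⟨x, y⟩, hx, hy⟩ := q
    simp

/-- The factor e^{-2ixyτ} is the mode of index -4xy because indices count half-integers. -/
theorem cubicTerm_eq_trm (α : ℤ → ℂ) (R : ℤ → ℝ → ℂ) (k : ℤ) (q : nrS) (τ : ℝ) :
    cubicTerm α R k ((nonResEquiv k).symm q) τ =
      trm (wgt α) (fun k t => R k t + α k) (fun k t => R k t + α k) (fun k t => R k t + α k) k q τ := by
  obtain ⟨⟨x, y⟩, hx, hy⟩ := q
  have h3 : resonance k (k - x, k - x - y, k - y) = 2 * (x * y) := by
    simp only [resonance]; ring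
  simp only [cubicTerm, nonResEquiv, Equiv.coe_fn_symm_mk, trm, wgt, phi, shift, h3]
  have h4 : Complex.exp (-(Complex.I * ((2 * (x * y) : ℤ) : ℂ) * τ)) = ex (-(4 * (x * y))) τ := by
    unfold ex
    congr 1
    push_cast
    ring
  rw [h4]
  ring

theorem selfTerm_eq_slf (α : ℤ → ℂ) (R : ℤ → ℝ → ℂ) (k : ℤ) (τ : ℝ) :
    selfTerm α R k τ = slf α (fun k t => R k t + α k) k τ := by
  simp only [selfTerm, slf, trm, wgt, phi, shift_zero, zero_mul, mul_zero, neg_zero, ex_zero,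
    Complex.ofReal_zero, Complex.exp_zero, mul_one, sub_zero]
  push_cast
  rw [← Complex.conj_mul', ← Complex.conj_mul']
  ring

/-- The constant in front of the integrals. -/
def sgnC (σ : ℝ) : ℂ := (σ : ℂ) * (Complex.I / (8 * (Real.pi : ℂ)))

theorem isSolution_iff {σ T : ℝ} {α : ℤ → ℂ} {R : ℤ → ℝ → ℂ} :
    IsSolution σ α T R ↔ ∀ k : ℤ, ∀ t : ℝ, T < t → ∃ (J : nrS → ℂ) (S D : ℂ),
      (∀ q : nrS, HasImproperIntegral (trm (wgt α) (fun k t => R k t + α k)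
        (fun k t => R k t + α k) (fun k t => R k t + α k) k q) t (J q)) ∧ HasSum J S ∧
      HasImproperIntegral (slf α (fun k t => R k t + α k) k) t D ∧ R k t = sgnC σ * (S - D) := by
  unfold IsSolution
  refine forall_congr' fun k => forall_congr' fun t => imp_congr_right fun _ => ?_
  have e1 : ∀ q : nrS, cubicTerm α R k ((nonResEquiv k).symm q) = trm (wgt α) (fun k t => R k t + α k)
      (fun k t => R k t + α k) (fun k t => R k t + α k) k q := fun q => funext fun τ =>
    cubicTerm_eq_trm α R k q τ
  have e2 : selfTerm α R k = slf α (fun k t => R k t + α k) k := funext fun τ => selfTerm_eq_slf α R k τ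
  rw [e2]
  constructor
  · rintro ⟨J, S, D, h1, h2, h3, h4⟩
    refine ⟨J ∘ (nonResEquiv k).symm, S, D, fun q => ?_, (nonResEquiv k).symm.hasSum_iff.2 h2, h3, h4⟩
    rw [← e1]
    exact h1 _
  · rintro ⟨J, S, D, h1, h2, h3, h4⟩
    refine ⟨J ∘ nonResEquiv k, S, D, fun j => ?_, (nonResEquiv k).hasSum_iff.2 h2, h3, h4⟩
    have := h1 (nonResEquiv k j)
    rwa [← e1, Equiv.symm_apply_apply] at this

theorem HasImproperIntegral.sub {f : ℝ → ℂ} {t t' : ℝ} {J J' : ℂ} (h : HasImproperIntegral f t J)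
    (h' : HasImproperIntegral f t' J') (htt : t ≤ t') : ∫ τ in t..t', f τ = J - J' := by
  have h1 := h.2.sub h'.2
  refine tendsto_nhds_unique (tendsto_const_nhds.congr' ?_) h1
  filter_upwards [eventually_ge_atTop t'] with b hb
  rw [← intervalIntegral.integral_add_adjacent_intervals (h.1 t' htt) (h'.1 b hb)]
  ring

/-- Solutions of the integral system solve the integrated system. -/
theorem IsSolution.inc {σ T : ℝ} {α : ℤ → ℂ} {R : ℤ → ℝ → ℂ} (h : IsSolution σ α T R) (k : ℤ)
    {t t' : ℝ} (ht : T < t) (htt : t ≤ t') :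
    (Summable fun q : nrS => ∫ τ in t..t', trm (wgt α) (fun k t => R k t + α k)
        (fun k t => R k t + α k) (fun k t => R k t + α k) k q τ) ∧
    R k t + α k = R k t' + α k + sgnC σ * duh α (fun k t => R k t + α k) k t t' := by
  rw [isSolution_iff] at h
  obtain ⟨J, S, D, h1, h2, h3, h4⟩ := h k t ht
  obtain ⟨J', S', D', h1', h2', h3', h4'⟩ := h k t' (ht.trans_le htt)
  have e1 : ∀ q : nrS, ∫ τ in t..t', trm (wgt α) (fun k t => R k t + α k)
      (fun k t => R k t + α k) (fun k t => R k t + α k) k q τ = J q - J' q := fun q =>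
    (h1 q).sub (h1' q) htt
  have e2 := h3.sub h3' htt
  have h5 := h2.sub h2'
  refine ⟨by simpa only [e1] using h5.summable, ?_⟩
  rw [duh, nrT, tsum_congr e1, h5.tsum_eq, e2, h4, h4']
  ring

/-! ### Fourier inversion for integrable functions with summable coefficients -/

theorem integral_ex_ext (ν : ℕ) (m : ℤ) :
    ∫ x in extLeft ν..extRight ν, ex m x = if m = 0 then (4 * Real.pi : ℂ) else 0 := by
  split_ifs with h
  · subst h
    have : ∀ x, ex 0 x = 1 := fun x => ex_zero x
    simp only [this, intervalIntegral.integral_const, ext_length]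
    simp
  · have hI : Complex.I * ((m : ℂ) / 2) ≠ 0 := by simp [h]
    have hd : ∀ x ∈ uIcc (extLeft ν) (extRight ν),
        HasDerivAt (fun τ => (Complex.I * ((m : ℂ) / 2))⁻¹ * ex m τ) (ex m x) x := by
      intro x _
      have := (hasDerivAt_ex m x).const_mul (Complex.I * ((m : ℂ) / 2))⁻¹
      rwa [← mul_assoc, inv_mul_cancel₀ hI, one_mul] at this
    rw [intervalIntegral.integral_eq_sub_of_hasDerivAt hd ((continuous_ex m).intervalIntegrable _ _),
      ← fourier_eq_ex ν, ← fourier_eq_ex ν]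
    have : ((extRight ν : ℝ) : AddCircle (extRight ν - extLeft ν)) = (extLeft ν : ℝ) := by
      have := AddCircle.coe_add_period (extRight ν - extLeft ν) (extLeft ν)
      rwa [add_sub_cancel] at this
    rw [this, sub_self]

theorem fourierCoeffOn_tsum (ν : ℕ) {a : ℤ → ℂ} (ha : Summable fun h => ‖a h‖) (n : ℤ) :
    fourierCoeffOn (extLeft_lt_extRight ν) (fun t => ∑' h, a h * ex h t) n = a n := by
  rw [fourierCoeffOn_eq]
  have h1 : HasSum (fun h => ∫ x in extLeft ν..extRight ν, ex (-n) x * (a h * ex h x))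
      (∫ x in extLeft ν..extRight ν, ex (-n) x * ∑' h, a h * ex h x) := by
    refine intervalIntegral.hasSum_integral_of_dominated_convergence (fun h _ => ‖a h‖)
      (fun h => ?_) (fun h => ?_) ?_ ?_ ?_
    · exact ((continuous_ex _).mul (continuous_const.mul (continuous_ex h))).aestronglyMeasurable
    · exact ae_of_all _ fun x _ => by simp [norm_ex]
    · exact ae_of_all _ fun x _ => ha
    · exact intervalIntegrable_const
    · exact ae_of_all _ fun x _ => (summable_mul_ex ha x).of_norm.hasSum.mul_left _
  have h2 : ∀ h, ∫ x in extLeft ν..extRight ν, ex (-n) x * (a h * ex h x) =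
      if h = n then a n * (4 * Real.pi : ℂ) else 0 := by
    intro h
    have : ∀ x, ex (-n) x * (a h * ex h x) = a h * ex (h - n) x := fun x => by
      rw [sub_eq_add_neg, ex_add]; ring
    simp only [this, intervalIntegral.integral_const_mul, integral_ex_ext, sub_eq_zero]
    split_ifs with hh
    · rw [hh]
    · rw [mul_zero]
  simp only [h2] at h1
  rw [h1.unique (hasSum_ite_eq n (a n * (4 * Real.pi : ℂ)))]
  have : (Real.pi : ℂ) ≠ 0 := by exact_mod_cast Real.pi_ne_zero
  rw [Complex.real_smul]
  push_cast
  field_simp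

/-- The functional φ ↦ ∫ φ f is continuous for the sup norm and kills the exponentials, whose span
is dense. -/
theorem integral_mul_eq_zero_of_fourier (ν : ℕ) {f : ℝ → ℂ}
    (hf : IntervalIntegrable f volume (extLeft ν) (extRight ν))
    (h0 : ∀ n, ∫ x in extLeft ν..extRight ν, ex n x * f x = 0)
    (φ : C(AddCircle (extRight ν - extLeft ν), ℂ)) :
    ∫ x in extLeft ν..extRight ν, φ x * f x = 0 := by
  have hT := Fact.mk (by linarith [extLeft_lt_extRight ν] : 0 < extRight ν - extLeft ν)
  have hcont : ∀ φ : C(AddCircle (extRight ν - extLeft ν), ℂ),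
      Continuous fun x : ℝ => φ (x : AddCircle (extRight ν - extLeft ν)) := fun φ =>
    φ.continuous.comp (AddCircle.continuous_mk' _)
  have hi : ∀ φ : C(AddCircle (extRight ν - extLeft ν), ℂ),
      IntervalIntegrable (fun x : ℝ => φ x * f x) volume (extLeft ν) (extRight ν) := fun φ =>
    hf.continuousOn_mul (hcont φ).continuousOn
  let L₀ : C(AddCircle (extRight ν - extLeft ν), ℂ) →ₗ[ℂ] ℂ :=
    { toFun := fun φ => ∫ x in extLeft ν..extRight ν, φ x * f x
      map_add' := fun φ ψ => by
        rw [← intervalIntegral.integral_add (hi φ) (hi ψ)]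
        simp only [ContinuousMap.add_apply, add_mul]
      map_smul' := fun c φ => by
        simp only [ContinuousMap.smul_apply, smul_eq_mul, mul_assoc,
          intervalIntegral.integral_const_mul, RingHom.id_apply] }
  let L := L₀.mkContinuous (∫ x in extLeft ν..extRight ν, ‖f x‖) (fun φ => by
    change ‖∫ x in extLeft ν..extRight ν, φ x * f x‖ ≤ _
    refine (intervalIntegral.norm_integral_le_integral_norm (extLeft_lt_extRight ν).le).trans ?_
    rw [mul_comm, ← intervalIntegral.integral_const_mul]
    refine intervalIntegral.integral_mono_on (extLeft_lt_extRight ν).le (hi φ).norm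
      (hf.norm.const_mul _) fun x _ => ?_
    rw [norm_mul]
    gcongr
    exact φ.norm_coe_le_norm _)
  have hker : (Submodule.span ℂ (range (@fourier (extRight ν - extLeft ν)))).topologicalClosure ≤
      LinearMap.ker L.toLinearMap := by
    refine Submodule.topologicalClosure_minimal _ (Submodule.span_le.2 ?_) L.isClosed_ker
    rintro _ ⟨n, rfl⟩
    change ∫ x in extLeft ν..extRight ν, fourier n (x : AddCircle (extRight ν - extLeft ν)) * f x = 0
    simp only [fourier_eq_ex]
    exact h0 n
  rw [span_fourier_closure_eq_top] at hker
  exact hker (Submodule.mem_top (x := φ))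

/-- Smooth test functions supported in the open interval vanish at its ends, so they periodize to
continuous functions. -/
theorem ae_eq_zero_of_fourier (ν : ℕ) {f : ℝ → ℂ}
    (hf : IntegrableOn f (Icc (extLeft ν) (extRight ν)))
    (h0 : ∀ n, ∫ x in extLeft ν..extRight ν, ex n x * f x = 0) :
    ∀ᵐ x, x ∈ Ioo (extLeft ν) (extRight ν) → f x = 0 := by
  have hlt := extLeft_lt_extRight ν
  have hT := Fact.mk (by linarith : 0 < extRight ν - extLeft ν)
  refine IsOpen.ae_eq_zero_of_integral_contDiff_smul_eq_zero isOpen_Ioo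
    (hf.mono_set Ioo_subset_Icc_self).locallyIntegrableOn fun g hg _ hsupp => ?_
  have hz : ∀ x, x ∉ Ioo (extLeft ν) (extRight ν) → g x = 0 := fun x hx =>
    image_eq_zero_of_notMem_tsupport fun h => hx (hsupp h)
  have hc : Continuous (AddCircle.liftIoc (extRight ν - extLeft ν) (extLeft ν) fun x => (g x : ℂ)) := by
    refine AddCircle.liftIoc_continuous ?_
      ((Complex.continuous_ofReal.comp hg.continuous).continuousOn)
    rw [add_sub_cancel, hz _ (by simp), hz _ (by simp)]
  have h1 := integral_mul_eq_zero_of_fourier ν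
    ((intervalIntegrable_iff_integrableOn_Icc_of_le hlt.le).2 hf) h0 ⟨_, hc⟩
  rw [intervalIntegral.integral_of_le hlt.le] at h1
  rw [← h1, ← integral_indicator measurableSet_Ioc]
  refine integral_congr_ae (ae_of_all _ fun x => ?_)
  by_cases hx : x ∈ Ioc (extLeft ν) (extRight ν)
  · simp only [indicator_of_mem hx, ContinuousMap.coe_mk]
    rw [AddCircle.liftIoc_coe_apply (by rwa [add_sub_cancel])]
    exact Complex.real_smul.symm
  · simp only [indicator_of_notMem hx]
    rw [hz x fun h => hx ⟨h.1, h.2.le⟩, zero_smul]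

/-- The difference of the function and its Fourier series is integrable with vanishing coefficients.
No square integrability is available: the norm of the window allows any integrable extension. -/
theorem ae_eq_tsum_fourierCoeffOn (ν : ℕ) {g : ℝ → ℂ}
    (hg : IntegrableOn g (Icc (extLeft ν) (extRight ν)))
    (hs : Summable fun h => ‖fourierCoeffOn (extLeft_lt_extRight ν) g h‖) :
    ∀ᵐ x, x ∈ Ioo (extLeft ν) (extRight ν) →
      g x = ∑' h, fourierCoeffOn (extLeft_lt_extRight ν) g h * ex h x := by
  have hlt := extLeft_lt_extRight ν
  set a := fourierCoeffOn (extLeft_lt_extRight ν) g with ha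
  have hGc : Continuous fun t => ∑' h, a h * ex h t :=
    continuous_ev (a := fun _ => a) (k := 0) hs
  have hG : IntegrableOn (fun t => ∑' h, a h * ex h t) (Icc (extLeft ν) (extRight ν)) :=
    hGc.continuousOn.integrableOn_Icc
  have h1 := ae_eq_zero_of_fourier ν (hg.sub hG) (fun n => by
    have e1 := fourierCoeffOn_eq ν g (-n)
    have e2 := fourierCoeffOn_eq ν (fun t => ∑' h, a h * ex h t) (-n)
    rw [fourierCoeffOn_tsum ν hs] at e2
    have e3 := e1.symm.trans e2
    rw [neg_neg] at e3
    have hpi : (1 / (4 * Real.pi) : ℝ) ≠ 0 := by have := Real.pi_pos; positivity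
    have e4 := smul_right_injective ℂ hpi e3
    have i1 : IntervalIntegrable g volume (extLeft ν) (extRight ν) :=
      (intervalIntegrable_iff_integrableOn_Icc_of_le hlt.le).2 hg
    simp only [Pi.sub_apply, mul_sub]
    rw [intervalIntegral.integral_sub (i1.continuousOn_mul (continuous_ex n).continuousOn)
      ((show Continuous fun x => ex n x * ∑' h, a h * ex h x from
        (continuous_ex n).mul hGc).intervalIntegrable _ _), sub_eq_zero]
    exact e4)
  filter_upwards [h1] with x hx hx'
  exact sub_eq_zero.1 (hx hx')

theorem extNorm_eq_sN (s p : ℝ) (ν : ℕ) (g : ℝ → ℂ) :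
    extNorm s p ν g = sN s p (fourierCoeffOn (extLeft_lt_extRight ν) g) := rfl

theorem window_subset_Ioo (ν : ℕ) : window ν ⊆ Ioo (extLeft ν) (extRight ν) := fun x hx => by
  rw [window_eq] at hx
  rw [extLeft_eq, extRight_eq]
  have := Real.pi_pos
  exact ⟨by linarith [hx.1], by linarith [hx.2]⟩

/-! ### The spaces `X^s_p(T)` and representations on windows -/

theorem enorm_nat_add_one (ν : ℕ) : ‖((ν : ℂ) + 1)‖ₑ = (ν : ℝ≥0∞) + 1 := by
  have : ((ν : ℂ) + 1) = ((ν + 1 : ℕ) : ℂ) := by push_cast; rfl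
  rw [this, ← ofReal_norm, Complex.norm_natCast, ENNReal.ofReal_natCast]
  push_cast; rfl

/-- The infimum defining the window norm need not be attained. This supplies strictly positive
errors, one for each k, with which near-optimal extensions are chosen simultaneously. -/
theorem exists_lpN_le_one (p : ℝ) (hp : 1 ≤ p) :
    ∃ f : ℤ → ℝ≥0∞, (∀ k, 0 < f k) ∧ lpN p f ≤ 1 := by
  obtain ⟨f, hf, hs⟩ := ENNReal.exists_pos_sum_of_countable' (ε := 1) one_ne_zero ℤ
  refine ⟨f, hf, ?_⟩
  rw [lpN_le_iff (by linarith), ENNReal.one_rpow]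
  refine le_trans (ENNReal.tsum_le_tsum fun k => ?_) hs.le
  have h1 : f k ≤ 1 := (ENNReal.le_tsum k).trans hs.le
  calc f k ^ p ≤ f k ^ (1 : ℝ) := ENNReal.rpow_le_rpow_of_exponent_ge h1 hp
    _ = f k := ENNReal.rpow_one _

theorem windowNorm_exists {s p : ℝ} {ν : ℕ} {f : ℝ → ℂ} {c : ℝ≥0∞} (h : windowNorm s p ν f ≠ ⊤)
    (hc : 0 < c) : ∃ g : ℝ → ℂ, IntegrableOn g (Icc (extLeft ν) (extRight ν)) ∧
      g =ᵐ[volume.restrict (window ν)] f ∧ extNorm s p ν g ≤ windowNorm s p ν f + c := by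
  have h1 : windowNorm s p ν f < windowNorm s p ν f + c := ENNReal.lt_add_right h hc.ne'
  conv_lhs at h1 => unfold windowNorm
  simp only [iInf_lt_iff] at h1
  obtain ⟨g, hg1, hg2, hg3⟩ := h1
  exact ⟨g, hg1, hg2, hg3.le⟩

/-- Elements of `X^s_p(T)` are represented almost everywhere on each window. -/
theorem MemX.exists_ae {s p q ε T : ℝ} (H : Adm s p q ε) {R : ℤ → ℝ → ℂ} (h : MemX s p T R) :
    ∃ N : ℝ≥0∞, N ≠ ⊤ ∧ ∀ ν : ℕ, ∃ a : ℤ → ℤ → ℂ, nE s p a ≤ N / ((ν : ℝ≥0∞) + 1) ∧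
      ∀ k, ∀ᵐ t, t ∈ window ν → T < t → R k t = ev a k t := by
  have h' : xNormOn s p T R < ⊤ := h
  unfold xNormOn at h'
  simp only [iInf_lt_iff] at h'
  obtain ⟨Q, hQ, hx⟩ := h'
  refine ⟨xNorm s p Q + 1, by finiteness, fun ν => ?_⟩
  obtain ⟨δ, hδ, hδ1⟩ := exists_lpN_le_one p H.one_le_p
  have hle : lpN p (fun k => windowNorm s p ν (fun t => ((ν : ℂ) + 1) * Q k t)) ≤ xNorm s p Q :=
    le_iSup (fun ν : ℕ => lpN p (fun k => windowNorm s p ν (fun t => ((ν : ℂ) + 1) * Q k t))) ν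
  have hfin : ∀ k, windowNorm s p ν (fun t => ((ν : ℂ) + 1) * Q k t) ≠ ⊤ := fun k =>
    ne_top_of_le_ne_top hx.ne ((le_lpN H.p_pos
      (fun k => windowNorm s p ν (fun t => ((ν : ℂ) + 1) * Q k t)) k).trans hle)
  choose g hgi hge hgn using fun k => windowNorm_exists (hfin k) (hδ k)
  set b : ℤ → ℤ → ℂ := fun k => fourierCoeffOn (extLeft_lt_extRight ν) (g k) with hb
  have hbN : nE s p b ≤ xNorm s p Q + 1 := by
    calc nE s p b ≤ lpN p fun k => windowNorm s p ν (fun t => ((ν : ℂ) + 1) * Q k t) + δ k :=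
          lpN_mono H.p_pos hgn
      _ ≤ _ := (lpN_add_le H.one_le_p _ _).trans (add_le_add hle hδ1)
  have hν : ((ν : ℂ) + 1) ≠ 0 := by exact_mod_cast Nat.succ_ne_zero ν
  refine ⟨fun k h => ((ν : ℂ) + 1)⁻¹ * b k h, ?_, fun k => ?_⟩
  · rw [nE_const_mul H.p_pos, enorm_inv hν, enorm_nat_add_one, mul_comm, ← div_eq_mul_inv]
    gcongr
  · have h1 := ae_eq_tsum_fourierCoeffOn ν (hgi k)
      (summable_norm_of_nE H (ne_top_of_le_ne_top (by finiteness) hbN) k)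
    have h2 := (ae_restrict_iff' (measurableSet_Icc (a := Real.pi * ν) (b := Real.pi * (ν + 2)))).1
      (hge k)
    filter_upwards [h1, h2] with t ht1 ht2 htw htT
    rw [ev_const_mul, ev, ← hQ k htT]
    rw [← ht1 (window_subset_Ioo ν htw), ht2 htw, inv_mul_cancel_left₀ hν]

/-- Represented families belong to `X^s_p`. -/
theorem xNorm_le_of_repOn {s p q ε : ℝ} (H : Adm s p q ε) {Q : ℤ → ℝ → ℂ} {N : ℝ≥0∞} (hN : N ≠ ⊤)
    (h : ∀ ν : ℕ, RepOn s p Q (window ν) (N / ((ν : ℝ≥0∞) + 1))) : xNorm s p Q ≤ N := by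
  refine iSup_le fun ν => ?_
  obtain ⟨a, ha, hQ⟩ := h ν
  have hν0 : ((ν : ℝ≥0∞) + 1) ≠ 0 := by simp
  have hνt : ((ν : ℝ≥0∞) + 1) ≠ ⊤ := by finiteness
  have hat : nE s p a ≠ ⊤ := ne_top_of_le_ne_top (ENNReal.div_ne_top hN hν0) ha
  change lpN p (fun k => windowNorm s p ν (fun t => ((ν : ℂ) + 1) * Q k t)) ≤ N
  have h1 : ∀ k, windowNorm s p ν (fun t => ((ν : ℂ) + 1) * Q k t) ≤
      ((ν : ℝ≥0∞) + 1) * sN s p (a k) := fun k => by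
    have hs : Summable fun h => ‖((ν : ℂ) + 1) * a k h‖ := by
      simp only [norm_mul]
      exact (summable_norm_of_nE H hat k).mul_left _
    have hc : Continuous fun t => ∑' h, ((ν : ℂ) + 1) * a k h * ex h t :=
      continuous_ev (a := fun k h => ((ν : ℂ) + 1) * a k h) (k := k) hs
    have h2 : windowNorm s p ν (fun t => ((ν : ℂ) + 1) * Q k t) ≤
        extNorm s p ν (fun t => ∑' h, ((ν : ℂ) + 1) * a k h * ex h t) := by
      refine iInf_le_of_le _ (iInf_le_of_le hc.continuousOn.integrableOn_Icc
        (iInf_le_of_le ?_ le_rfl))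
      refine (ae_restrict_iff' measurableSet_Icc).2 (ae_of_all _ fun t ht => ?_)
      beta_reduce
      rw [hQ k t ht]
      exact ev_const_mul _ a k t
    refine h2.trans (le_of_eq ?_)
    rw [extNorm_eq_sN, ← enorm_nat_add_one, ← sN_const_mul H.p_pos]
    congr 1
    funext n
    exact fourierCoeffOn_tsum ν hs n
  calc lpN p (fun k => windowNorm s p ν (fun t => ((ν : ℂ) + 1) * Q k t))
      ≤ lpN p fun k => ((ν : ℝ≥0∞) + 1) * sN s p (a k) := lpN_mono H.p_pos h1
    _ = ((ν : ℝ≥0∞) + 1) * nE s p a := lpN_const_mul H.p_pos _ _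
    _ ≤ ((ν : ℝ≥0∞) + 1) * (N / ((ν : ℝ≥0∞) + 1)) := by gcongr
    _ = N := ENNReal.mul_div_cancel hν0 hνt

/-- The family `R` is represented on the parts of the windows in `(T, ∞)`, with decay. -/
def Good (s p T : ℝ) (R : ℤ → ℝ → ℂ) : Prop :=
  ∃ N : ℝ≥0∞, N ≠ ⊤ ∧ ∀ ν : ℕ, RepOn s p R (window ν ∩ Ioi T) (N / ((ν : ℝ≥0∞) + 1))

theorem Good.mono {s p T T' : ℝ} {R : ℤ → ℝ → ℂ} (h : Good s p T R) (hT : T ≤ T') :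
    Good s p T' R := by
  obtain ⟨N, hN, h⟩ := h
  exact ⟨N, hN, fun ν => (h ν).mono (inter_subset_inter_right _ (Ioi_subset_Ioi hT)) le_rfl⟩

/-- Finitely many windows do not matter. -/
theorem exists_repOn_of_eventually {s p : ℝ} {f : ℤ → ℝ → ℂ} {F : ℕ → Set ℝ} (n : ℕ) {N : ℝ≥0∞}
    (hN : N ≠ ⊤) (h1 : ∀ ν, ∃ M : ℝ≥0∞, M ≠ ⊤ ∧ RepOn s p f (F ν) M)
    (h2 : ∀ ν, n ≤ ν → RepOn s p f (F ν) (N / ((ν : ℝ≥0∞) + 1))) :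
    ∃ N' : ℝ≥0∞, N' ≠ ⊤ ∧ ∀ ν, RepOn s p f (F ν) (N' / ((ν : ℝ≥0∞) + 1)) := by
  choose M hM hR using h1
  refine ⟨N + ∑ ν ∈ Finset.range n, M ν * ((ν : ℝ≥0∞) + 1), ?_, fun ν => ?_⟩
  · refine ENNReal.add_ne_top.2 ⟨hN, ?_⟩
    refine ENNReal.sum_ne_top.2 fun ν _ => ?_
    have := hM ν
    finiteness
  · rcases lt_or_ge ν n with h | h
    · refine (hR ν).mono Subset.rfl ?_
      rw [ENNReal.le_div_iff_mul_le (by simp) (by left; finiteness)]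
      exact (Finset.single_le_sum (f := fun ν : ℕ => M ν * ((ν : ℝ≥0∞) + 1)) (fun _ _ => zero_le)
        (Finset.mem_range.2 h)).trans le_add_self
    · refine (h2 ν h).mono Subset.rfl ?_
      gcongr
      exact le_self_add

/-- Consecutive windows overlap in half their length, so every positive time is interior to one of
them; the index ⌈t/π⌉ - 1 works. -/
theorem exists_window_mem {t : ℝ} (ht : 0 < t) : ∃ ν : ℕ, winL ν < t ∧ t < winR ν := by
  have hpi := Real.pi_pos
  have h1 : 0 < ⌈t / Real.pi⌉₊ := Nat.ceil_pos.2 (by positivity)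
  obtain ⟨n, hn⟩ := Nat.exists_eq_succ_of_ne_zero h1.ne'
  have h2 := Nat.ceil_lt_add_one (a := t / Real.pi) (by positivity)
  have h3 := Nat.le_ceil (t / Real.pi)
  rw [hn] at h2 h3
  push_cast at h2 h3
  rw [div_le_iff₀ hpi] at h3
  have h4 : (n : ℝ) < t / Real.pi := by linarith
  rw [lt_div_iff₀ hpi] at h4
  refine ⟨n, ?_, ?_⟩
  · unfold winL; linarith
  · unfold winR; nlinarith

theorem Good.continuousOn {s p q ε T : ℝ} (H : Adm s p q ε) (hT : 0 ≤ T) {R : ℤ → ℝ → ℂ}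
    (h : Good s p T R) (k : ℤ) : ContinuousOn (R k) (Ioi T) := by
  obtain ⟨N, hN, h⟩ := h
  intro t ht
  obtain ⟨ν, h1, h2⟩ := exists_window_mem (hT.trans_lt ht)
  have hc := (h ν).continuousOn H (ENNReal.div_ne_top hN (by simp)) k
  refine ContinuousAt.continuousWithinAt (hc.continuousAt (inter_mem ?_ (Ioi_mem_nhds ht)))
  exact Icc_mem_nhds h1 h2

/-- Integrals see functions only almost everywhere, and this is all that membership in X^s_p(T)
determines. -/
theorem duh_congr_ae {α : ℤ → ℂ} {A A' : ℤ → ℝ → ℂ} {t v : ℝ}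
    (h : ∀ j, ∀ᵐ τ, τ ∈ uIoc t v → A j τ = A' j τ) (k : ℤ) : duh α A k t v = duh α A' k t v := by
  have h' : ∀ᵐ τ, τ ∈ uIoc t v → ∀ j, A j τ = A' j τ := by
    filter_upwards [ae_all_iff.2 h] with τ hτ hm j using hτ j hm
  have h1 : ∀ q : ℤ × ℤ, ∫ τ in t..v, trm (wgt α) A A A k q τ =
      ∫ τ in t..v, trm (wgt α) A' A' A' k q τ := fun q => by
    refine intervalIntegral.integral_congr_ae ?_
    filter_upwards [h'] with τ hτ hm
    exact trm_congr (hτ hm) (hτ hm) (hτ hm) _ _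
  have h2 : ∫ τ in t..v, slf α A k τ = ∫ τ in t..v, slf α A' k τ := by
    refine intervalIntegral.integral_congr_ae ?_
    filter_upwards [h'] with τ hτ hm
    simp only [slf]
    rw [trm_congr (hτ hm) (hτ hm) (hτ hm), trm_congr (fun _ => rfl) (fun _ => rfl) (hτ hm)]
  unfold duh nrT
  rw [h2, tsum_congr fun q : nrS => h1 q]

theorem duh_congr {α : ℤ → ℂ} {A A' : ℤ → ℝ → ℂ} {t v : ℝ}
    (h : ∀ j, ∀ τ ∈ uIcc t v, A j τ = A' j τ) (k : ℤ) : duh α A k t v = duh α A' k t v :=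
  duh_congr_ae (fun j => ae_of_all _ fun τ hτ => h j τ (uIoc_subset_uIcc hτ)) k

/-- Solutions in `X^s_p(T)` are represented everywhere on the windows. -/
theorem IsSolution.good {s p q ε σ T : ℝ} (H : Adm s p q ε) (hT : 0 ≤ T) {α : ℤ → ℂ}
    (hα : ∀ k, ‖α k‖ ≤ 1) (hαp : (lpN p fun k => ‖α k‖ₑ) ≠ ⊤) {R : ℤ → ℝ → ℂ}
    (h : IsSolution σ α T R) (hX : MemX s p T R) : Good s p T R := by
  obtain ⟨N, hN, hrep⟩ := hX.exists_ae H
  obtain ⟨C, hC, hduh⟩ := RepOn.exists_duh H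
  refine ⟨N, hN, fun ν => ?_⟩
  obtain ⟨a, ha, hae⟩ := hrep ν
  refine ⟨a, ha, fun k t ht => ?_⟩
  obtain ⟨⟨htL, htR⟩, htT⟩ := ht
  have htT' : T < t := htT
  have htL' : winL ν ≤ t := htL
  have htR' : t ≤ winR ν := htR
  have hLR : winL ν < winR ν := by rw [winR_eq]; linarith [Real.pi_pos]
  -- The interval [u, winR ν] contains t, stays in (T, ∞), and is non-degenerate even if t is the
  -- right end of the window.
  obtain ⟨u, hu0, huT, huL, hut, huR⟩ : ∃ u, 0 < u ∧ T < u ∧ winL ν ≤ u ∧ u ≤ t ∧ u < winR ν := by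
    refine ⟨max (winL ν) ((T + t) / 2), ?_, ?_, le_max_left _ _, max_le htL' (by linarith),
      max_lt hLR (by linarith)⟩
    · exact lt_of_lt_of_le (by linarith) (le_max_right _ _)
    · exact lt_of_lt_of_le (by linarith) (le_max_right _ _)
  have hat : N / ((ν : ℝ≥0∞) + 1) ≠ ⊤ := ENNReal.div_ne_top hN (by simp)
  have hA : RepOn s p (fun k t => ev a k t + α k) (Icc u (winR ν))
      (N / ((ν : ℝ≥0∞) + 1) + lpN p fun k => ‖α k‖ₑ) :=
    RepOn.add H (f := ev a) (g := fun k _ => α k) ⟨a, ha, fun _ _ _ => rfl⟩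
      (RepOn.const H α _) hat hαp
  have hnt := ENNReal.add_ne_top.2 ⟨hat, hαp⟩
  have hd := hduh hu0 huR.le huL le_rfl hα le_add_self hA le_rfl hnt
  have hcd := hd.continuousOn H (by finiteness) k
  have hsub : Icc u (winR ν) ⊆ window ν := Icc_subset_Icc huL le_rfl
  -- The equation expresses R through the Duhamel term of its almost everywhere representative.
  -- Hence R is continuous, and the almost everywhere equality holds everywhere.
  have hR : ∀ t' ∈ Icc u (winR ν), R k t' = R k (winR ν) + sgnC σ *
      duh α (fun k t => ev a k t + α k) k (clamp u (winR ν) t') (winR ν) := by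
    intro t' ht'
    have h1 := (h.inc k (huT.trans_le ht'.1) ht'.2).2
    rw [clamp_of_mem ht']
    rw [duh_congr_ae (A' := fun k t => ev a k t + α k) (fun j => ?_) k] at h1
    · linear_combination h1
    · filter_upwards [hae j] with τ hτ hτm
      have h2 : τ ∈ uIcc t' (winR ν) := uIoc_subset_uIcc hτm
      rw [uIcc_of_le ht'.2] at h2
      rw [hτ (hsub ⟨ht'.1.trans h2.1, h2.2⟩) (huT.trans_le (ht'.1.trans h2.1))]
  have hcR : ContinuousOn (R k) (Icc u (winR ν)) :=
    (continuousOn_const.add (continuousOn_const.mul (hcd.mono hsub))).congr hR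
  have hce : ContinuousOn (ev a k) (Icc u (winR ν)) :=
    (continuous_ev (summable_norm_of_nE H (ne_top_of_le_ne_top hat ha) k)).continuousOn
  refine Measure.eqOn_Icc_of_ae_eq volume huR.ne ?_ hcR hce ⟨hut, htR'⟩
  refine (ae_restrict_iff' measurableSet_Icc).2 ?_
  filter_upwards [hae k] with τ hτ hτm
  exact hτ (hsub hτm) (huT.trans_le hτm.1)

theorem IsSolution.incSol {s p q ε σ T : ℝ} (H : Adm s p q ε) (hT : 0 ≤ T) {α : ℤ → ℂ}
    {R : ℤ → ℝ → ℂ} (h : IsSolution σ α T R) (hG : Good s p T R) :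
    IncSol (sgnC σ) α T (fun k t => R k t + α k) where
  cont k := (hG.continuousOn H hT k).add continuousOn_const
  summ k _ _ ht htt := (h.inc k ht htt).1
  inc k _ _ ht htt := (h.inc k ht htt).2

/-- Represented solutions on `(T₁, ∞)` belong to `X^s_p(T)` for `T > T₁`. -/
theorem Good.memX {s p q ε T₁ T : ℝ} (H : Adm s p q ε) (hT₁ : 0 ≤ T₁) (hT : T₁ < T) {α : ℤ → ℂ}
    (hα : ∀ k, ‖α k‖ ≤ 1) (hαp : (lpN p fun k => ‖α k‖ₑ) ≠ ⊤) {c : ℂ} {R : ℤ → ℝ → ℂ}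
    (hG : Good s p T₁ R) (hI : IncSol c α T₁ (fun k t => R k t + α k)) : MemX s p T R := by
  obtain ⟨N, hN, hG⟩ := hG
  obtain ⟨C, hC, hduh⟩ := RepOn.exists_duh H
  obtain ⟨C', hC', -, hpt⟩ := RepOn.exists_lpN_le H
  have hT0 : 0 < T := hT₁.trans_lt hT
  have hNν : ∀ ν : ℕ, N / ((ν : ℝ≥0∞) + 1) ≠ ⊤ := fun ν => ENNReal.div_ne_top hN (by simp)
  have hlp : ∀ t, T₁ < t → (lpN p fun k => ‖R k t‖ₑ) ≠ ⊤ := fun t ht => by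
    obtain ⟨ν, h1, h2⟩ := exists_window_mem (hT₁.trans_lt ht)
    exact ne_top_of_le_ne_top (ENNReal.mul_ne_top hC' (hNν ν)) (hpt (hG ν) t ⟨⟨h1.le, h2.le⟩, ht⟩)
  -- The extension is frozen at the value R(T) to the left of T. It is constant on windows before T
  -- and unchanged on windows after T; on a window that contains T in its interior it is a value
  -- plus a clamped Duhamel term.
  have hQ : ∃ N' : ℝ≥0∞, N' ≠ ⊤ ∧ ∀ ν : ℕ, RepOn s p (fun k t => R k (max t T)) (window ν)
      (N' / ((ν : ℝ≥0∞) + 1)) := by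
    have key : ∀ ν : ℕ, T ≤ winL ν → RepOn s p (fun k t => R k (max t T)) (window ν)
      (N / ((ν : ℝ≥0∞) + 1)) := fun ν hν => by
      refine ((hG ν).mono (S' := window ν) ?_ le_rfl).congr fun k t ht => ?_
      · exact fun t ht => ⟨ht, hT.trans_le (hν.trans ht.1)⟩
      · rw [max_eq_left (hν.trans ht.1)]
    refine exists_repOn_of_eventually ⌈T⌉₊ hN (fun ν => ?_) fun ν hν => key ν ?_
    · rcases le_or_gt T (winL ν) with h1 | h1
      · exact ⟨_, hNν ν, key ν h1⟩
      rcases le_or_gt (winR ν) T with h2 | h2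
      · exact ⟨_, hlp T hT, (RepOn.const H (fun k => R k T) _).congr fun k t ht => by
          rw [max_eq_right (ht.2.trans h2)]⟩
      have hA : RepOn s p (fun k t => R k t + α k) (Icc T (winR ν))
          (N / ((ν : ℝ≥0∞) + 1) + lpN p fun k => ‖α k‖ₑ) :=
        ((hG ν).mono (fun t ht => ⟨⟨h1.le.trans ht.1, ht.2⟩, hT.trans_le ht.1⟩) le_rfl).add H
          (RepOn.const H α _) (hNν ν) hαp
      have hnt := ENNReal.add_ne_top.2 ⟨hNν ν, hαp⟩
      have hd := hduh hT0 h2.le h1.le le_rfl hα le_add_self hA le_rfl hnt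
      have hw := hlp (winR ν) (hT.trans h2)
      refine ⟨_, ?_, ((RepOn.const H (fun k => R k (winR ν)) _).add H (hd.const_mul H c) hw
        (by finiteness)).congr fun k t ht => ?_⟩
      · finiteness
      · have hcl : clamp T (winR ν) t = max t T := by
          rw [clamp, min_eq_right (show t ≤ winR ν from ht.2), max_comm]
        have := hI.inc k (max t T) (winR ν) (hT.trans_le (le_max_right _ _)) (max_le ht.2 h2.le)
        rw [hcl]
        linear_combination this
    · have h1 : T ≤ ν := (Nat.le_ceil T).trans (by exact_mod_cast hν)
      have : (ν : ℝ) ≤ winL ν := by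
        unfold winL
        have := Real.pi_gt_three
        nlinarith [(Nat.cast_nonneg ν : (0 : ℝ) ≤ ν)]
      linarith
  obtain ⟨N', hN', hrep⟩ := hQ
  refine lt_of_le_of_lt ?_ (lt_top_iff_ne_top.2 hN')
  refine iInf_le_of_le (fun k t => R k (max t T)) (iInf_le_of_le (fun k t ht => ?_)
    (xNorm_le_of_repOn H hN' hrep))
  exact congrArg (R k) (max_eq_left (le_of_lt ht))

/-! ### Contractions for gauges -/

/-- A complete system of bounds for families of functions on `S`. -/
structure Gauge (S : Set ℝ) (P : ℝ≥0∞ → (ℤ → ℝ → ℂ) → Prop) : Prop where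
  mono : ∀ {N N' f}, P N f → N ≤ N' → P N' f
  congr : ∀ {N f g}, P N f → (∀ k, ∀ t ∈ S, g k t = f k t) → P N g
  zero : P 0 fun _ _ => 0
  add : ∀ {N N' f g}, P N f → P N' g → N ≠ ⊤ → N' ≠ ⊤ → P (N + N') fun k t => f k t + g k t
  tsum : ∀ {N : ℕ → ℝ≥0∞} {f : ℕ → ℤ → ℝ → ℂ}, (∀ n, P (N n) (f n)) → ∑' n, N n ≠ ⊤ →
    P (∑' n, N n) fun k t => ∑' n, f n k t
  pt : ∃ C : ℝ≥0∞, C ≠ ⊤ ∧ ∀ {N f}, P N f → ∀ k, ∀ t ∈ S, ‖f k t‖ₑ ≤ C * N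

theorem tendsto_div_two_pow {X : ℝ≥0∞} (hX : X ≠ ⊤) :
    Tendsto (fun n : ℕ => X / 2 ^ n) atTop (𝓝 0) := by
  have h := ENNReal.tendsto_pow_atTop_nhds_zero_of_lt_one (r := 2⁻¹) (by norm_num)
  have := ENNReal.Tendsto.const_mul h (Or.inr hX)
  simpa [div_eq_mul_inv, ENNReal.inv_pow] using this

theorem eq_zero_of_le_div_two_pow {z : ℂ} {X : ℝ≥0∞} (hX : X ≠ ⊤) (h : ∀ n : ℕ, ‖z‖ₑ ≤ X / 2 ^ n) :
    z = 0 := by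
  have := ge_of_tendsto' (tendsto_div_two_pow hX) h
  simpa using this

theorem div_two_pow_succ (X : ℝ≥0∞) (n : ℕ) : X / 2 ^ (n + 1) = X / 2 ^ n / 2 := by
  rw [pow_succ, ENNReal.div_eq_inv_mul, ENNReal.div_eq_inv_mul, ENNReal.div_eq_inv_mul,
    ENNReal.mul_inv (by simp) (by simp)]
  ring

/-- A bound that may be halved again and again forces the pointwise values to vanish. -/
theorem Gauge.eq_zero {S : Set ℝ} {P : ℝ≥0∞ → (ℤ → ℝ → ℂ) → Prop} (hP : Gauge S P)
    {d : ℤ → ℝ → ℂ} {X : ℝ≥0∞} (hX : X ≠ ⊤) (h0 : P X d) (h : ∀ N, N ≤ X → P N d → P (N / 2) d) :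
    ∀ k, ∀ t ∈ S, d k t = 0 := by
  obtain ⟨C, hC, hpt⟩ := hP.pt
  have h1 : ∀ n : ℕ, P (X / 2 ^ n) d := by
    intro n
    induction n with
    | zero => simpa using h0
    | succ n ih =>
      rw [div_two_pow_succ]
      exact h _ (ENNReal.div_le_of_le_mul (le_mul_of_one_le_right' (one_le_pow₀ (by norm_num)))) ih
  intro k t ht
  refine eq_zero_of_le_div_two_pow (X := C * X) (by finiteness) fun n => ?_
  rw [mul_div_assoc]
  exact hpt (h1 n) k t ht

theorem tsum_div_two_pow (X : ℝ≥0∞) : ∑' n : ℕ, X / 2 ^ (n + 1) = X := by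
  have h := ENNReal.tsum_geometric_add_one (2⁻¹ : ℝ≥0∞)
  simp only [div_eq_mul_inv, ENNReal.tsum_mul_left, ENNReal.inv_pow]
  rw [h, ENNReal.one_sub_inv_two, inv_inv, ENNReal.inv_mul_cancel (by simp) (by simp), mul_one]

theorem tsum_div_two_pow_add (X : ℝ≥0∞) (m : ℕ) :
    ∑' n : ℕ, X / 2 ^ (n + m + 1) = X / 2 ^ m := by
  rw [← tsum_div_two_pow (X / 2 ^ m)]
  refine tsum_congr fun n => ?_
  rw [show n + m + 1 = m + (n + 1) by ring, pow_add, div_eq_mul_inv, div_eq_mul_inv, div_eq_mul_inv,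
    ENNReal.mul_inv (by simp) (by simp), mul_assoc]

/-- Fixed points of contractions. -/
theorem Gauge.exists_fixedPoint {S : Set ℝ} {P : ℝ≥0∞ → (ℤ → ℝ → ℂ) → Prop} (hP : Gauge S P)
    {Φ : (ℤ → ℝ → ℂ) → ℤ → ℝ → ℂ} {X : ℝ≥0∞} (hX : X ≠ ⊤)
    (h0 : P (X / 2) (Φ fun _ _ => 0))
    (hΦ : ∀ r r' N, P X r → P X r' → N ≤ X → P N (fun k t => r k t - r' k t) →
      P (N / 2) fun k t => Φ r k t - Φ r' k t) :
    ∃ r, P X r ∧ ∀ k, ∀ t ∈ S, r k t = Φ r k t := by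
  obtain ⟨C, hC, hpt⟩ := hP.pt
  -- Picard iteration. A gauge is only a predicate, so the limit is built as the series of the
  -- increments, the n-th being bounded by X/2^{n+1}.
  set r : ℕ → ℤ → ℝ → ℂ := fun n => n.rec (fun _ _ => 0) fun _ r => Φ r with hr
  have hr0 : r 0 = fun _ _ => 0 := rfl
  have hrs : ∀ n, r (n + 1) = Φ (r n) := fun n => rfl
  set d : ℕ → ℤ → ℝ → ℂ := fun n k t => r (n + 1) k t - r n k t with hd
  have hle : ∀ n : ℕ, X / 2 ^ n ≤ X := fun n =>
    ENNReal.div_le_of_le_mul (le_mul_of_one_le_right' (one_le_pow₀ (by norm_num)))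
  have hsumle : ∀ n : ℕ, ∑ m ∈ Finset.range n, X / 2 ^ (m + 1) ≤ X := fun n =>
    (ENNReal.sum_le_tsum _).trans (tsum_div_two_pow X).le
  have key : ∀ n : ℕ, P (∑ m ∈ Finset.range n, X / 2 ^ (m + 1)) (r n) ∧ P (X / 2 ^ (n + 1)) (d n) := by
    intro n
    induction n with
    | zero =>
      refine ⟨by simpa [hr0] using hP.zero, ?_⟩
      simp only [hd, hrs, hr0, sub_zero]
      simpa using h0
    | succ n ih =>
      have h1 : P (∑ m ∈ Finset.range (n + 1), X / 2 ^ (m + 1)) (r (n + 1)) := by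
        rw [Finset.sum_range_succ]
        refine hP.congr (hP.add ih.1 ih.2 (ne_top_of_le_ne_top hX (hsumle n))
          (ne_top_of_le_ne_top hX (hle _))) fun k t _ => ?_
        simp only [hd]; ring
      refine ⟨h1, ?_⟩
      rw [div_two_pow_succ]
      exact hΦ _ _ _ (hP.mono h1 (hsumle _)) (hP.mono ih.1 (hsumle _)) (hle _) ih.2
  have hts : ∑' n : ℕ, X / 2 ^ (n + 1) ≠ ⊤ := by rwa [tsum_div_two_pow]
  have hsum : ∀ k, ∀ t ∈ S, Summable fun n => d n k t := fun k t ht => by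
    refine Summable.of_norm ?_
    rw [← tsum_enorm_ne_top_iff_summable_norm]
    refine ne_top_of_le_ne_top (ENNReal.mul_ne_top hC hts) ?_
    rw [← ENNReal.tsum_mul_left]
    exact ENNReal.tsum_le_tsum fun n => hpt (key n).2 k t ht
  set R : ℤ → ℝ → ℂ := fun k t => ∑' n, d n k t with hR
  have hPR : P X R := by
    have := hP.tsum (fun n => (key n).2) hts
    rwa [tsum_div_two_pow] at this
  -- The tail of the geometric series bounds the distance to the n-th iterate; one more application
  -- of the contraction yields the fixed-point equation in the limit.
  have hdiff : ∀ n : ℕ, P (X / 2 ^ n) fun k t => R k t - r n k t := fun n => by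
    have h1 : ∑' m : ℕ, X / 2 ^ (m + n + 1) ≠ ⊤ := by
      rw [tsum_div_two_pow_add]; exact ne_top_of_le_ne_top hX (hle n)
    have h2 := hP.tsum (f := fun m => d (m + n)) (fun m => (key (m + n)).2) h1
    rw [tsum_div_two_pow_add] at h2
    refine hP.congr h2 fun k t ht => ?_
    have h3 : ∑ m ∈ Finset.range n, d m k t = r n k t := by
      simp only [hd]
      rw [Finset.sum_range_sub (fun m => r m k t), hr0, sub_zero]
    simp only [hR]
    rw [← h3, ← (hsum k t ht).sum_add_tsum_nat_add n]
    ring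
  refine ⟨R, hPR, fun k t ht => ?_⟩
  rw [← sub_eq_zero]
  refine eq_zero_of_le_div_two_pow (X := C * X) (by finiteness) fun n => ?_
  have h1 := hΦ R (r n) _ hPR (hP.mono (key n).1 (hsumle n)) (hle n) (hdiff n)
  rw [← div_two_pow_succ, ← hrs] at h1
  have h2 := hpt h1 k t ht
  have h3 := hpt (hdiff (n + 1)) k t ht
  calc ‖R k t - Φ R k t‖ₑ = ‖(R k t - r (n + 1) k t) - (Φ R k t - r (n + 1) k t)‖ₑ := by
        congr 1; ring
    _ ≤ C * (X / 2 ^ (n + 1)) + C * (X / 2 ^ (n + 1)) := (enorm_sub_le).trans (add_le_add h3 h2)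
    _ = C * X / 2 ^ n := by
        rw [← mul_add, div_two_pow_succ, ENNReal.add_halves, mul_div_assoc]

theorem RepOn.gauge {s p q ε : ℝ} (H : Adm s p q ε) (S : Set ℝ) :
    Gauge S fun N f => RepOn s p f S N where
  mono h hN := h.mono Subset.rfl hN
  congr h hfg := h.congr hfg
  zero := RepOn.zero H S
  add hf hg hN hN' := hf.add H hg hN hN'
  tsum hf hN := RepOn.tsum H hf hN
  pt := by
    obtain ⟨C, hC, -, h⟩ := RepOn.exists_lpN_le H
    exact ⟨C, hC, fun {N f} hf k t ht => (enorm_le_lpN H.p_pos (fun k => f k t) k).trans (h hf t ht)⟩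

/-! ### Local solutions -/

/-- Truncation in k does not increase the norm, so the local theory holds for the finite systems on
which the energy identity is exact. -/
theorem RepOn.proj {s p q ε : ℝ} (H : Adm s p q ε) {f : ℤ → ℝ → ℂ} {S : Set ℝ} {N : ℝ≥0∞}
    (h : RepOn s p f S N) (K : Set ℤ) : RepOn s p (fun k t => K.indicator (fun k => f k t) k) S N := by
  obtain ⟨a, ha, hf⟩ := h
  classical
  refine ⟨fun k h => if k ∈ K then a k h else 0, le_trans (lpN_mono H.p_pos fun k => ?_) ha,
    fun k t ht => ?_⟩
  · by_cases hk : k ∈ K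
    · simp [hk]
    · simp [hk, sN, lpN_zero H.p_pos]
  · by_cases hk : k ∈ K
    · simp [hk, ev, hf k t ht]
    · simp [hk, ev]

theorem lpN_indicator_le {p : ℝ} (hp : 0 < p) (c : ℤ → ℂ) (K : Set ℤ) :
    (lpN p fun k => ‖K.indicator c k‖ₑ) ≤ lpN p fun k => ‖c k‖ₑ :=
  lpN_mono hp fun k => by
    by_cases hk : k ∈ K <;> simp [hk]

/-- Local existence for the projected system. -/
theorem exists_local {s p q ε : ℝ} (H : Adm s p q ε) :
    ∃ C : ℝ≥0∞, C ≠ ⊤ ∧ ∀ {ν : ℕ} {u v : ℝ} {α A₀ : ℤ → ℂ} {M : ℝ≥0∞} {c : ℂ} (K : Set ℤ),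
      0 < u → u ≤ v → winL ν ≤ u → v ≤ winR ν → ‖c‖ₑ ≤ 1 → (∀ k, ‖α k‖ ≤ 1) →
      (lpN p fun k => ‖α k‖ₑ) ≤ M → (lpN p fun k => ‖A₀ k‖ₑ) ≤ M → M ≠ ⊤ →
      C * ENNReal.ofReal (oscB ε u v) * M ^ 2 ≤ 1 →
      ∃ A, RepOn s p A (Icc u v) (2 * lpN p fun k => ‖A₀ k‖ₑ) ∧
        ∀ k, ∀ t ∈ Icc u v, A k t = K.indicator (fun k => A₀ k + c * duh α A k t v) k := by
  obtain ⟨C, hC, hd⟩ := RepOn.exists_duh_sub H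
  obtain ⟨C', hC', hd'⟩ := RepOn.exists_duh H
  -- 8 = 2² · 2: the functions have norm at most 2M, and the output has to be halved.
  refine ⟨8 * (C + C'), by finiteness, ?_⟩
  intro ν u v α A₀ M c K hu huv hLu hvR hc hα hαM hAM hM hsmall
  set X := lpN p fun k => ‖A₀ k‖ₑ with hX
  have hXt : X ≠ ⊤ := ne_top_of_le_ne_top hM hAM
  set A₁ : ℤ → ℂ := K.indicator A₀ with hA₁
  have hA₁X : (lpN p fun k => ‖A₁ k‖ₑ) ≤ X := lpN_indicator_le H.p_pos A₀ K
  have hsub : Icc u v ⊆ window ν := Icc_subset_Icc hLu hvR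
  -- The unknown is r = A - A₁, with A₁ the projected data, so that the iteration starts from 0.
  set Φ : (ℤ → ℝ → ℂ) → ℤ → ℝ → ℂ := fun r k t =>
    K.indicator (fun k => c * duh α (fun k t => A₁ k + r k t) k (clamp u v t) v) k with hΦ
  have hrep : ∀ r N, RepOn s p r (Icc u v) N → N ≤ X →
      RepOn s p (fun k t => A₁ k + r k t) (Icc u v) (X + N) := fun r N hr hN =>
    ((RepOn.const H A₁ _).mono Subset.rfl hA₁X).add H hr hXt (ne_top_of_le_ne_top hXt hN)
  have h2M : X + X ≤ 2 * M := by rw [two_mul]; gcongr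
  have hM2 : M ≤ 2 * M := by rw [two_mul]; exact le_self_add
  have h2Mt : 2 * M ≠ ⊤ := by finiteness
  have hfix := (RepOn.gauge H (Icc u v)).exists_fixedPoint (Φ := Φ) hXt ?_ ?_
  · obtain ⟨r, hr, hfix⟩ := hfix
    refine ⟨fun k t => A₁ k + r k t, ?_, fun k t ht => ?_⟩
    · rw [two_mul]; exact hrep r X hr le_rfl
    · beta_reduce
      rw [hfix k t ht]
      by_cases hk : k ∈ K
      · simp only [hΦ, hA₁, indicator_of_mem hk, clamp_of_mem ht]
      · simp only [hΦ, hA₁, indicator_of_notMem hk, add_zero]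
  · have h0 := hrep (fun _ _ => 0) 0 ((RepOn.zero H _)) zero_le
    rw [add_zero] at h0
    have h1 := hd' hu huv hLu hvR hα (hαM.trans hM2) h0 (hAM.trans hM2) h2Mt
    refine (((h1.const_mul H c).proj H K).mono hsub ?_).congr fun k t _ => rfl
    rw [ENNReal.le_div_iff_mul_le (by simp) (by simp)]
    calc ‖c‖ₑ * (C' * ENNReal.ofReal (oscB ε u v) * ((2 * M) ^ 2 * X)) * 2
        ≤ 1 * ((C + C') * ENNReal.ofReal (oscB ε u v) * ((2 * M) ^ 2 * X)) * 2 := by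
          gcongr; exact le_add_self
      _ = 8 * (C + C') * ENNReal.ofReal (oscB ε u v) * M ^ 2 * X := by ring
      _ ≤ 1 * X := by gcongr
      _ = X := one_mul X
  · intro r r' N hr hr' hN hrr
    have h1 := hd hu huv hLu hvR hα (hαM.trans hM2) ((hrep r X hr le_rfl).mono Subset.rfl h2M)
      ((hrep r' X hr' le_rfl).mono Subset.rfl h2M)
      (hrr.congr fun k t _ => by ring) h2Mt (ne_top_of_le_ne_top hXt hN)
    refine (((h1.const_mul H c).proj H K).mono hsub ?_).congr fun k t _ => ?_
    · rw [ENNReal.le_div_iff_mul_le (by simp) (by simp)]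
      calc ‖c‖ₑ * (C * ENNReal.ofReal (oscB ε u v) * ((2 * M) ^ 2 * N)) * 2
          ≤ 1 * ((C + C') * ENNReal.ofReal (oscB ε u v) * ((2 * M) ^ 2 * N)) * 2 := by
            gcongr; exact le_self_add
        _ = 8 * (C + C') * ENNReal.ofReal (oscB ε u v) * M ^ 2 * N := by ring
        _ ≤ 1 * N := by gcongr
        _ = N := one_mul N
    · by_cases hk : k ∈ K
      · simp only [hΦ, indicator_of_mem hk]; ring
      · simp only [hΦ, indicator_of_notMem hk, sub_zero]

/-- Local uniqueness. -/
theorem local_unique {s p q ε : ℝ} (H : Adm s p q ε) :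
    ∃ C : ℝ≥0∞, C ≠ ⊤ ∧ ∀ {ν : ℕ} {u v : ℝ} {α : ℤ → ℂ} {M : ℝ≥0∞} {c : ℂ} {A A' : ℤ → ℝ → ℂ},
      0 < u → u ≤ v → winL ν ≤ u → v ≤ winR ν → ‖c‖ₑ ≤ 1 → (∀ k, ‖α k‖ ≤ 1) →
      (lpN p fun k => ‖α k‖ₑ) ≤ M → M ≠ ⊤ → RepOn s p A (Icc u v) M → RepOn s p A' (Icc u v) M →
      C * ENNReal.ofReal (oscB ε u v) * M ^ 2 ≤ 1 →
      (∀ k, ∀ t ∈ Icc u v, A k t - A' k t = c * (duh α A k t v - duh α A' k t v)) →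
      ∀ k, ∀ t ∈ Icc u v, A k t = A' k t := by
  obtain ⟨C, hC, hd⟩ := RepOn.exists_duh_sub H
  refine ⟨2 * C, by finiteness, ?_⟩
  intro ν u v α M c A A' hu huv hLu hvR hc hα hαM hM hA hA' hsmall heq k t ht
  have hsub : Icc u v ⊆ window ν := Icc_subset_Icc hLu hvR
  have h0 := hA.sub H hA' hM hM
  have hMM : M + M ≠ ⊤ := by finiteness
  refine sub_eq_zero.1 ((RepOn.gauge H (Icc u v)).eq_zero hMM h0 (fun N hN hNd => ?_) k t ht)
  have h1 := hd hu huv hLu hvR hα hαM hA hA' hNd hM (ne_top_of_le_ne_top hMM hN)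
  refine ((h1.const_mul H c).mono hsub ?_).congr fun k t ht => ?_
  · rw [ENNReal.le_div_iff_mul_le (by simp) (by simp)]
    calc ‖c‖ₑ * (C * ENNReal.ofReal (oscB ε u v) * (M ^ 2 * N)) * 2
        ≤ 1 * (C * ENNReal.ofReal (oscB ε u v) * (M ^ 2 * N)) * 2 := by gcongr
      _ = 2 * C * ENNReal.ofReal (oscB ε u v) * M ^ 2 * N := by ring
      _ ≤ 1 * N := by gcongr
      _ = N := one_mul N
  · rw [heq k t ht, clamp_of_mem ht]

/-- The local smallness condition holds on short intervals. -/
theorem exists_short {ε τ₀ : ℝ} (hε : 0 < ε) (hε1 : ε < 1) (hτ : 0 < τ₀) {X : ℝ≥0∞} (hX : X ≠ ⊤) :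
    ∃ η : ℝ, 0 < η ∧ η ≤ 1 ∧ ∀ u v, τ₀ ≤ u → u ≤ v → v ≤ u + η →
      X * ENNReal.ofReal (oscB ε u v) ≤ 1 := by
  set K := (6 / τ₀ + 6 / τ₀ ^ 2 + 1 / τ₀) ^ (1 - ε) with hK
  have hK0 : 0 < K := Real.rpow_pos_of_pos (by positivity) _
  -- The target is `oscB` ≤ κ with X · κ ≤ 1. The second factor of `oscB` is at most K, hence the
  -- first must be at most κ/K, which fixes η.
  set κ := 1 / (X.toReal + 1) with hκ
  have hX0 : 0 ≤ X.toReal := ENNReal.toReal_nonneg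
  have hκ0 : 0 < κ := by positivity
  set η := min 1 (τ₀ * (κ / K) ^ (1 / ε)) with hη
  have hη0 : 0 < η := by positivity
  refine ⟨η, hη0, min_le_left _ _, fun u v hu huv hv => ?_⟩
  have hu0 : 0 < u := hτ.trans_le hu
  have hvu : v - u ≤ η := by linarith
  have hvu0 : 0 ≤ v - u := by linarith
  have hη1 : η ≤ 1 := min_le_left _ _
  have h1 : (v - u) / u ≤ (κ / K) ^ (1 / ε) := by
    rw [div_le_iff₀ hu0]
    calc v - u ≤ τ₀ * (κ / K) ^ (1 / ε) := hvu.trans (min_le_right _ _)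
      _ ≤ u * (κ / K) ^ (1 / ε) := by gcongr
      _ = _ := mul_comm _ _
  have h2 : oscB ε u v ≤ κ / K * K := by
    unfold oscB
    have hε2 : 0 ≤ 1 - ε := by linarith
    have e1 : ((v - u) / u) ^ ε ≤ κ / K := by
      calc ((v - u) / u) ^ ε ≤ ((κ / K) ^ (1 / ε)) ^ ε := by gcongr
        _ = κ / K := by rw [← Real.rpow_mul (by positivity), one_div_mul_cancel hε.ne', Real.rpow_one]
    have e2 : (6 / u + 6 * (v - u) / u ^ 2 + (v - u) / u) ^ (1 - ε) ≤ K := by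
      rw [hK]
      have : 6 * (v - u) ≤ 6 := by linarith
      have : v - u ≤ 1 := by linarith
      gcongr
    exact mul_le_mul e1 e2 (by positivity) (by positivity)
  rw [div_mul_cancel₀ _ hK0.ne'] at h2
  calc X * ENNReal.ofReal (oscB ε u v) ≤ ENNReal.ofReal X.toReal * ENNReal.ofReal κ := by
        rw [ENNReal.ofReal_toReal hX]; gcongr
    _ = ENNReal.ofReal (X.toReal * κ) := (ENNReal.ofReal_mul hX0).symm
    _ ≤ 1 := by
        rw [ENNReal.ofReal_le_one, hκ, mul_one_div, div_le_one (by positivity)]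
        linarith

/-- For the index ⌊u/π⌋ the window extends beyond u by more than π > 1. -/
theorem exists_window_of_short {u v : ℝ} (hu : 0 < u) (hv : v ≤ u + 1) :
    ∃ ν : ℕ, winL ν ≤ u ∧ v ≤ winR ν := by
  have hpi := Real.pi_gt_three
  refine ⟨⌊u / Real.pi⌋₊, ?_, ?_⟩
  · have := Nat.floor_le (a := u / Real.pi) (by positivity)
    rw [le_div_iff₀ (by positivity)] at this
    unfold winL; linarith
  · have := Nat.lt_floor_add_one (u / Real.pi)
    rw [div_lt_iff₀ (by positivity)] at this
    unfold winR; linarith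

/-! ### Backward uniqueness and continuation -/

theorem Good.repOn_Icc {s p q ε T : ℝ} (H : Adm s p q ε) {R : ℤ → ℝ → ℂ} {α : ℤ → ℂ}
    (hαp : (lpN p fun k => ‖α k‖ₑ) ≠ ⊤) (h : Good s p T (fun k t => R k t - α k)) :
    ∃ M : ℝ≥0∞, M ≠ ⊤ ∧ ∀ {u v : ℝ} {ν : ℕ}, T < u → winL ν ≤ u → v ≤ winR ν →
      RepOn s p R (Icc u v) M := by
  obtain ⟨N, hN, h⟩ := h
  refine ⟨N + lpN p fun k => ‖α k‖ₑ, by finiteness, fun {u v ν} hu hL hR => ?_⟩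
  have h1 := (h ν).mono (S' := Icc u v) (N' := N)
    (fun t ht => ⟨⟨hL.trans ht.1, ht.2.trans hR⟩, hu.trans_le ht.1⟩)
    (ENNReal.div_le_of_le_mul (le_mul_of_one_le_right' le_add_self))
  exact (h1.add H (RepOn.const H α _) hN hαp).congr fun k t _ => (sub_add_cancel _ _).symm

/-- A single step length η serves all of [t, ∞), as it depends only on a lower bound for the times
and on uniform bounds for both solutions. Local uniqueness is then iterated to the left from t₁. -/
theorem backward_unique {s p q ε T t₁ : ℝ} (H : Adm s p q ε) (hT : 0 ≤ T) {α : ℤ → ℂ} {c : ℂ}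
    (hα : ∀ k, ‖α k‖ ≤ 1) (hαp : (lpN p fun k => ‖α k‖ₑ) ≠ ⊤) (hc : ‖c‖ₑ ≤ 1) {A A' : ℤ → ℝ → ℂ}
    (hI : IncSol c α T A) (hI' : IncSol c α T A') (hG : Good s p T (fun k t => A k t - α k))
    (hG' : Good s p T (fun k t => A' k t - α k)) (h1 : ∀ k t, t₁ ≤ t → A k t = A' k t) :
    ∀ k t, T < t → A k t = A' k t := by
  intro k t ht
  obtain ⟨C, hC, hun⟩ := local_unique H
  obtain ⟨M₁, hM₁, hrep⟩ := hG.repOn_Icc H hαp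
  obtain ⟨M₂, hM₂, hrep'⟩ := hG'.repOn_Icc H hαp
  set M := M₁ + M₂ + lpN p fun k => ‖α k‖ₑ with hM
  have hMt : M ≠ ⊤ := by finiteness
  obtain ⟨η, hη, hη1, hsh⟩ := exists_short H.pos H.eps_lt_one (hT.trans_lt ht) (X := C * M ^ 2)
    (by finiteness)
  have key : ∀ n : ℕ, ∀ x, t ≤ x → t₁ - n * η ≤ x → ∀ k, A k x = A' k x := by
    intro n
    induction n with
    | zero => intro x _ hx k; exact h1 k x (by simpa using hx)
    | succ n ih =>
      intro x htx hx k
      push_cast at hx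
      have hx0 : 0 < x := (hT.trans_lt ht).trans_le htx
      have hTx : T < x := ht.trans_le htx
      have hxv : x ≤ x + η := by linarith
      obtain ⟨ν, hL, hR⟩ := exists_window_of_short (v := x + η) hx0 (by linarith)
      refine hun hx0 hxv hL hR hc hα le_add_self hMt ((hrep hTx hL hR).mono Subset.rfl ?_)
        ((hrep' hTx hL hR).mono Subset.rfl ?_) ?_ (fun k y hy => ?_) k x ⟨le_rfl, hxv⟩
      · exact le_add_right le_self_add
      · exact le_add_right le_add_self
      · rw [mul_right_comm]; exact hsh x (x + η) htx hxv le_rfl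
      · have e1 := hI.inc k y (x + η) (hTx.trans_le hy.1) hy.2
        have e2 := hI'.inc k y (x + η) (hTx.trans_le hy.1) hy.2
        have e3 := ih (x + η) (by linarith) (by linarith) k
        rw [e1, e2, e3]; ring
  obtain ⟨n, hn⟩ := exists_nat_gt ((t₁ - t) / η)
  rw [div_lt_iff₀ hη] at hn
  exact key n t le_rfl (by linarith) k

theorem duh_add_of_continuousOn {α : ℤ → ℂ} {A : ℤ → ℝ → ℂ} {t t' t'' : ℝ} (ht : 0 < t)
    (htt : t ≤ t') (htt' : t' ≤ t'') (hA : ∀ k, ContinuousOn (A k) (Icc t t'')) {k : ℤ}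
    (s1 : Summable fun q : nrS => ∫ τ in t..t', trm (wgt α) A A A k q τ)
    (s2 : Summable fun q : nrS => ∫ τ in t'..t'', trm (wgt α) A A A k q τ) :
    (Summable fun q : nrS => ∫ τ in t..t'', trm (wgt α) A A A k q τ) ∧
    duh α A k t t'' = duh α A k t t' + duh α A k t' t'' := by
  have c1 : ∀ k, ContinuousOn (A k) (uIcc t t') := fun k => (hA k).mono (by
    rw [uIcc_of_le htt]; exact Icc_subset_Icc le_rfl htt')
  have c2 : ∀ k, ContinuousOn (A k) (uIcc t' t'') := fun k => (hA k).mono (by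
    rw [uIcc_of_le htt']; exact Icc_subset_Icc htt le_rfl)
  have ht' := ht.trans_le htt
  have ht'' := ht'.trans_le htt'
  exact duh_add (fun q => intervalIntegrable_trm α ht ht' c1 c1 c1 k q)
    (fun q => intervalIntegrable_trm α ht' ht'' c2 c2 c2 k q)
    (intervalIntegrable_slf α ht ht' c1 k) (intervalIntegrable_slf α ht' ht'' c2 k) s1 s2

/-- Gluing a local solution to the left of a solution. -/
theorem IncSol.glue {s p q ε T u t₀ : ℝ} (H : Adm s p q ε) {ν₀ : ℕ} (hu : 0 < u)
    (hut : u ≤ t₀) (hTt : T < t₀) (hL : winL ν₀ ≤ u) (hR : t₀ ≤ winR ν₀) {α : ℤ → ℂ} {c : ℂ}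
    (hα : ∀ k, ‖α k‖ ≤ 1) (hαp : (lpN p fun k => ‖α k‖ₑ) ≠ ⊤) {A B : ℤ → ℝ → ℂ}
    (hI : IncSol c α T A) (hG : Good s p T (fun k t => A k t - α k)) {M : ℝ≥0∞} (hM : M ≠ ⊤)
    (hB : RepOn s p B (Icc u t₀) M)
    (hBA : ∀ k, ∀ t ∈ Icc u t₀, B k t = A k t₀ + c * duh α B k t t₀) :
    ∃ A' : ℤ → ℝ → ℂ, IncSol c α u A' ∧ Good s p u (fun k t => A' k t - α k) ∧
      (∀ k t, t₀ ≤ t → A' k t = A k t) ∧ (∀ k, ∀ t ∈ Icc u t₀, A' k t = B k t) := by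
  have hB0 : ∀ k, B k t₀ = A k t₀ := fun k => by
    rw [hBA k t₀ ⟨hut, le_rfl⟩, duh_self, mul_zero, add_zero]
  set A' : ℤ → ℝ → ℂ := fun k t => if t ≤ t₀ then B k t else A k t with hA'
  have hAB : ∀ k t, t ≤ t₀ → A' k t = B k t := fun k t h => if_pos h
  have hAA : ∀ k t, t₀ ≤ t → A' k t = A k t := fun k t h => by
    rcases eq_or_lt_of_le h with rfl | h
    · rw [hAB _ _ le_rfl, hB0]
    · exact if_neg (not_le.2 h)
  have hdB : ∀ k t t', t ≤ t' → t' ≤ t₀ → duh α A' k t t' = duh α B k t t' := fun k t t' h1 h2 =>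
    duh_congr (fun j τ hτ => hAB j τ (by rw [uIcc_of_le h1] at hτ; exact hτ.2.trans h2)) k
  have hdA : ∀ k t t', t₀ ≤ t → t ≤ t' → duh α A' k t t' = duh α A k t t' := fun k t t' h1 h2 =>
    duh_congr (fun j τ hτ => hAA j τ (by rw [uIcc_of_le h2] at hτ; exact h1.trans hτ.1)) k
  have hrepB : RepOn s p A' (Icc u t₀) M := hB.congr fun k t ht => hAB k t ht.2
  have hleft : ∀ k, ∀ t ∈ Icc u t₀, A' k t = A' k t₀ + c * duh α A' k t t₀ := fun k t ht => by
    rw [hAB k t ht.2, hAB k t₀ le_rfl, hdB k t t₀ ht.2 le_rfl, hB0]; exact hBA k t ht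
  obtain ⟨M₁, hM₁, hrepA⟩ := hG.repOn_Icc H hαp
  obtain ⟨N, hN, hGN⟩ := hG
  have hgood : Good s p u (fun k t => A' k t - α k) := by
    refine exists_repOn_of_eventually ⌈t₀⌉₊ hN (fun ν => ?_) fun ν hν => ?_
    -- Windows on one side of t₀, or entirely before u, are immediate. The finitely many windows
    -- that straddle t₀ need `RepOn.glue`.
    · have key : ∃ M' : ℝ≥0∞, M' ≠ ⊤ ∧ RepOn s p A' (window ν ∩ Ioi u) M' := by
        rcases le_or_gt t₀ (winL ν) with h1 | h1
        · refine ⟨M₁, hM₁, ((hrepA (hTt.trans_le h1) le_rfl le_rfl).mono (fun t ht => ht.1)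
            le_rfl).congr fun k t ht => hAA k t (h1.trans ht.1.1)⟩
        rcases le_or_gt (winR ν) u with h2 | h2
        · refine ⟨0, by simp, (RepOn.zero H _).congr fun k t ht => ?_⟩
          exact absurd (ht.1.2 : t ≤ winR ν) (not_le.2 (h2.trans_lt ht.2))
        rcases le_or_gt (winR ν) t₀ with h3 | h3
        · exact ⟨M, hM, hrepB.mono (fun t ht => ⟨le_of_lt ht.2, le_trans ht.1.2 h3⟩) le_rfl⟩
        have hx0 : 0 < max u (winL ν) := lt_max_of_lt_left hu
        have hxt : max u (winL ν) ≤ t₀ := max_le hut h1.le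
        have g1 := hrepB.mono (S' := Icc (max u (winL ν)) t₀)
          (Icc_subset_Icc (le_max_left _ _) le_rfl) (le_self_add (b := M₁))
        have g2 : RepOn s p A' (Icc t₀ (winR ν)) (M + M₁) :=
          ((hrepA hTt h1.le le_rfl).mono Subset.rfl le_add_self).congr fun k t ht => hAA k t ht.1
        obtain ⟨M', hM', hr⟩ := RepOn.glue H hx0 hxt h3.le (le_max_right _ _) le_rfl hα hαp g1 g2
          (by finiteness) (c := c) (fun k t ht => hleft k t ⟨(le_max_left _ _).trans ht.1, ht.2⟩)
          (fun k t ht => by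
            rw [hAA k t ht.1, hAA k _ h3.le, hdA k t _ ht.1 ht.2]
            exact hI.inc k t _ (hTt.trans_le ht.1) ht.2)
        exact ⟨M', hM', hr.mono (fun t ht => ⟨max_le (le_of_lt ht.2) ht.1.1, ht.1.2⟩) le_rfl⟩
      obtain ⟨M', hM', hr⟩ := key
      exact ⟨_, ENNReal.add_ne_top.2 ⟨hM', hαp⟩, hr.sub H (RepOn.const H α _) hM' hαp⟩
    · have h1 : t₀ ≤ winL ν := by
        have h1 : t₀ ≤ ν := (Nat.le_ceil t₀).trans (by exact_mod_cast hν)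
        have : (ν : ℝ) ≤ winL ν := by
          unfold winL
          have := Real.pi_gt_three
          nlinarith [(Nat.cast_nonneg ν : (0 : ℝ) ≤ ν)]
        linarith
      refine ((hGN ν).mono (S' := window ν ∩ Ioi u) (fun t ht => ?_) le_rfl).congr fun k t ht => ?_
      · exact ⟨ht.1, hTt.trans_le (h1.trans ht.1.1)⟩
      · rw [hAA k t (h1.trans ht.1.1)]
  have hcont : ∀ k, ContinuousOn (A' k) (Ioi u) := fun k => by
    have := (hgood.continuousOn H hu.le k).add (continuousOn_const (c := α k))
    exact this.congr fun t _ => by simp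
  have hsB : ∀ k t t', u ≤ t → t ≤ t' → t' ≤ t₀ →
      Summable fun q : nrS => ∫ τ in t..t', trm (wgt α) A' A' A' k q τ := fun k t t' h1 h2 h3 =>
    RepOn.summable_trm H (hu.trans_le h1) h2 (hL.trans h1) (h3.trans hR) hα
      (hrepB.mono (Icc_subset_Icc h1 h3) le_rfl) hM k
  have hsA : ∀ k t t', t₀ ≤ t → t ≤ t' →
      Summable fun q : nrS => ∫ τ in t..t', trm (wgt α) A' A' A' k q τ := fun k t t' h1 h2 => by
    have e : ∀ q : nrS, ∫ τ in t..t', trm (wgt α) A' A' A' k q τ =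
        ∫ τ in t..t', trm (wgt α) A A A k q τ := fun q =>
      intervalIntegral.integral_congr fun τ hτ => by
        rw [uIcc_of_le h2] at hτ
        have := fun k => hAA k τ (h1.trans hτ.1)
        exact trm_congr this this this _ _
    simp only [e]
    exact hI.summ k t t' (hTt.trans_le h1) h2
  have hcc : ∀ t t', u < t → ∀ k, ContinuousOn (A' k) (Icc t t') := fun t t' ht k =>
    (hcont k).mono fun x hx => ht.trans_le hx.1
  refine ⟨A', ⟨hcont, fun k t t' ht htt => ?_, fun k t t' ht htt => ?_⟩, hgood, hAA,
    fun k t ht => hAB k t ht.2⟩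
  · rcases le_total t' t₀ with h1 | h1
    · exact hsB k t t' ht.le htt h1
    rcases le_total t₀ t with h2 | h2
    · exact hsA k t t' h2 htt
    · exact (duh_add_of_continuousOn (hu.trans ht) h2 h1 (hcc _ _ ht) (hsB k t t₀ ht.le h2 le_rfl)
        (hsA k t₀ t' le_rfl h1)).1
  · rcases le_total t' t₀ with h1 | h1
    · have e := (duh_add_of_continuousOn (hu.trans ht) htt h1 (hcc _ _ ht) (hsB k t t' ht.le htt h1)
        (hsB k t' t₀ (ht.le.trans htt) h1 le_rfl)).2
      rw [hleft k t ⟨ht.le, htt.trans h1⟩, hleft k t' ⟨ht.le.trans htt, h1⟩, e]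
      ring
    rcases le_total t₀ t with h2 | h2
    · rw [hAA k t h2, hAA k t' h1, hdA k t t' h2 htt]
      exact hI.inc k t t' (hTt.trans_le h2) htt
    · rw [(duh_add_of_continuousOn (hu.trans ht) h2 h1 (hcc _ _ ht) (hsB k t t₀ ht.le h2 le_rfl)
        (hsA k t₀ t' le_rfl h1)).2, hleft k t ⟨ht.le, h2⟩, hdA k t₀ t' le_rfl h1, hAA k t₀ le_rfl,
        hAA k t' h1, hI.inc k t₀ t' hTt h1]
      ring

/-! ### The `ℓ²` norm of local solutions -/

theorem conj_phi (l τ : ℝ) : (starRingEnd ℂ) (phi l τ) = phi (-l) τ := by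
  simp only [phi, map_mul, map_div₀, map_one, Complex.conj_ofReal, ← Complex.exp_conj, Complex.conj_I]
  congr 2
  push_cast
  ring

/-- The substitution exchanges k with j₁ and j₂ with j₃; this changes the sign of the phase shift,
as it does that of the resonance function. -/
theorem shift_swap (α : ℤ → ℂ) (k x y : ℤ) : shift α (k - x) (-x, y) = -shift α k (x, y) := by
  simp only [shift, phaseShift, sub_neg_eq_add, sub_add_cancel]
  rw [show k - x - y = k - x - y from rfl]
  ring

theorem conj_wgt (α : ℤ → ℂ) (k x y : ℤ) (τ : ℝ) :
    (starRingEnd ℂ) (wgt α k (x, y) τ) = wgt α (k - x) (-x, y) τ := by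
  simp only [wgt, conj_phi, shift_swap]

/-- The quadrilinear form. -/
def quad (α : ℤ → ℂ) (A : ℤ → ℝ → ℂ) (τ : ℝ) (i : ℤ × ℤ × ℤ) : ℂ :=
  if i.2.1 ≠ 0 ∧ i.2.2 ≠ 0 then (starRingEnd ℂ) (A i.1 τ) * trm (wgt α) A A A i.1 i.2 τ else 0

/-- The symmetry of the quadrilinear form. -/
def quadSwap : ℤ × ℤ × ℤ ≃ ℤ × ℤ × ℤ where
  toFun i := (i.1 - i.2.1, -i.2.1, i.2.2)
  invFun i := (i.1 - i.2.1, -i.2.1, i.2.2)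
  left_inv i := by simp
  right_inv i := by simp

theorem conj_quad (α : ℤ → ℂ) (A : ℤ → ℝ → ℂ) (τ : ℝ) (i : ℤ × ℤ × ℤ) :
    (starRingEnd ℂ) (quad α A τ i) = quad α A τ (quadSwap i) := by
  obtain ⟨k, x, y⟩ := i
  simp only [quad, quadSwap, Equiv.coe_fn_mk, neg_ne_zero]
  split_ifs with h
  · simp only [trm, map_mul, conj_wgt, ← ex_neg, Complex.conj_conj]
    have e1 : k - x - -x = k := by ring
    have e3 : -(4 * (-x * y)) = - -(4 * (x * y)) := by ring
    rw [e1, e3]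
    ring
  · simp

/-- Conjugation only permutes the terms. Without summability both sides of the argument have the
default value 0, so no convergence is required. -/
theorem tsum_quad_im (α : ℤ → ℂ) (A : ℤ → ℝ → ℂ) (τ : ℝ) : (∑' i, quad α A τ i).im = 0 := by
  rw [← Complex.conj_eq_iff_im, Complex.conj_tsum]
  simp only [conj_quad]
  exact quadSwap.tsum_eq (quad α A τ)

theorem conj_mul_slf_im (α : ℤ → ℂ) (A : ℤ → ℝ → ℂ) (k : ℤ) (τ : ℝ) :
    ((starRingEnd ℂ) (A k τ) * slf α A k τ).im = 0 := by
  rw [← Complex.conj_eq_iff_im]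
  have h : (starRingEnd ℂ) (wgt α k (0, 0) τ) = wgt α k (0, 0) τ := by
    simp only [wgt, shift_zero, conj_phi, neg_zero]
  simp only [slf, trm, map_mul, map_sub, h, Complex.conj_conj, mul_zero, neg_zero, ex_zero, map_one,
    sub_zero]
  ring

/-- The energy identity for solutions of the projected system. -/
theorem sum_norm_sq_eq {u v : ℝ} (hu : 0 < u) (huv : u ≤ v) {n : ℕ} {α A₀ : ℤ → ℂ} {c : ℂ}
    (hc : c.re = 0) {A : ℤ → ℝ → ℂ} (hcont : ∀ k, ContinuousOn (A k) (Icc u v))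
    (hA : ∀ k, ∀ t ∈ Icc u v,
      A k t = (Icc (-(n : ℤ)) n).indicator (fun k => A₀ k + c * duh α A k t v) k) :
    ∀ t ∈ Icc u v, ∑ k ∈ Finset.Icc (-(n : ℤ)) n, ‖A k t‖ ^ 2 =
      ∑ k ∈ Finset.Icc (-(n : ℤ)) n, ‖A₀ k‖ ^ 2 := by
  classical
  set K := Finset.Icc (-(n : ℤ)) n with hK
  -- For |k| ≤ n a non-zero term requires |k - x| ≤ n and |k - y| ≤ n, hence |x|, |y| ≤ 2n: all sums
  -- are finite.
  set F := (Finset.Icc (-(2 * n : ℤ)) (2 * n) ×ˢ Finset.Icc (-(2 * n : ℤ)) (2 * n)) with hF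
  have hA0 : ∀ k, ∀ t ∈ Icc u v, k ∉ K → A k t = 0 := fun k t ht hk => by
    rw [hA k t ht, indicator_of_notMem]
    simpa [hK] using hk
  have hA1 : ∀ k ∈ K, ∀ t ∈ Icc u v, A k t = A₀ k + c * duh α A k t v := fun k hk t ht => by
    rw [hA k t ht, indicator_of_mem]
    simpa [hK] using hk
  have hvan : ∀ k ∈ K, ∀ q : ℤ × ℤ, q ∉ F → ∀ τ ∈ Icc u v, trm (wgt α) A A A k q τ = 0 := by
    intro k hk q hq τ hτ
    have : k - q.1 ∉ K ∨ k - q.2 ∉ K := by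
      by_contra! hcon
      simp only [hK, Finset.mem_Icc] at hcon hk
      refine hq ?_
      simp only [hF, Finset.mem_product, Finset.mem_Icc]
      omega
    rcases this with h | h <;> simp [trm, hA0 _ τ hτ h]
  set G : ℤ → ℝ → ℂ := fun k τ =>
    ∑ q ∈ F.filter (fun q => q ∈ nrS), trm (wgt α) A A A k q τ - slf α A k τ with hG
  have hpos : ∀ t ∈ Icc u v, 0 < t := fun t ht => hu.trans_le ht.1
  have hGc : ∀ k, ContinuousOn (G k) (Icc u v) := fun k =>
    (continuousOn_finsetSum _ fun q _ =>
      continuousOn_trm (continuousOn_wgt α k q hpos) hcont hcont hcont).sub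
      (continuousOn_slf α hpos hcont k)
  have hduh : ∀ k ∈ K, ∀ t ∈ Icc u v, duh α A k t v = ∫ τ in t..v, G k τ := by
    intro k hk t ht
    have hsub : uIcc t v ⊆ Icc u v := by
      rw [uIcc_of_le ht.2]; exact Icc_subset_Icc ht.1 le_rfl
    have hc' : ∀ k, ContinuousOn (A k) (uIcc t v) := fun k => (hcont k).mono hsub
    have hv0 := hu.trans_le huv
    have h1 : nrT α A A A k t v = ∑ q ∈ F.filter (fun q => q ∈ nrS),
        ∫ τ in t..v, trm (wgt α) A A A k q τ := by
      unfold nrT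
      rw [tsum_subtype nrS (fun q => ∫ τ in t..v, trm (wgt α) A A A k q τ),
        tsum_eq_sum (s := F.filter (fun q => q ∈ nrS))]
      · refine Finset.sum_congr rfl fun q hq => indicator_of_mem ?_ _
        exact (Finset.mem_filter.1 hq).2
      · intro q hq
        by_cases hqn : q ∈ nrS
        · have hqF : q ∉ F := fun h => hq (Finset.mem_filter.2 ⟨h, hqn⟩)
          rw [indicator_of_mem hqn]
          refine (intervalIntegral.integral_congr (g := fun _ => 0) fun τ hτ => ?_).trans (by simp)
          exact hvan k hk q hqF τ (hsub hτ)
        · exact indicator_of_notMem hqn _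
    rw [duh, h1, hG, intervalIntegral.integral_sub, intervalIntegral.integral_finsetSum]
    · exact fun q _ => intervalIntegrable_trm α (hpos t ht) hv0 hc' hc' hc' k q
    · exact (continuousOn_finsetSum _ fun q _ => continuousOn_trm (continuousOn_wgt α k q
        fun t ht => hpos t (hsub ht)) hc' hc' hc').intervalIntegrable
    · exact intervalIntegrable_slf α (hpos t ht) hv0 hc' k
  have hclc : Continuous (clamp u v) := continuous_const.max (continuous_const.min continuous_id)
  have hGcl : ∀ k, Continuous fun τ => G k (clamp u v τ) := fun k =>
    (hGc k).comp_continuous hclc (clamp_mem huv)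
  -- Clamping the integrand extends it continuously to ℝ, so B is differentiable on both sides, also
  -- at u and v.
  set B : ℤ → ℝ → ℂ := fun k t => A₀ k + c * ∫ τ in t..v, G k (clamp u v τ) with hB
  have hBA : ∀ k ∈ K, ∀ t ∈ Icc u v, B k t = A k t := by
    intro k hk t ht
    rw [hA1 k hk t ht, hduh k hk t ht, hB]
    simp only
    congr 2
    refine intervalIntegral.integral_congr fun τ hτ => ?_
    rw [uIcc_of_le ht.2] at hτ
    simp only [clamp_of_mem (⟨ht.1.trans hτ.1, hτ.2⟩ : τ ∈ Icc u v)]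
  have hBd : ∀ k t, HasDerivAt (B k) (c * -G k (clamp u v t)) t := by
    intro k t
    refine HasDerivAt.const_add _ (HasDerivAt.const_mul _ ?_)
    exact intervalIntegral.integral_hasDerivAt_left ((hGcl k).intervalIntegrable _ _)
      ((hGcl k).stronglyMeasurableAtFilter _ _) (hGcl k).continuousAt
  have hEd : ∀ t ∈ Icc u v, HasDerivAt (fun t => ∑ k ∈ K, ‖B k t‖ ^ 2) 0 t := by
    intro t ht
    have h1 : HasDerivAt (fun t => ∑ k ∈ K, ‖B k t‖ ^ 2)
        (∑ k ∈ K, 2 * inner ℝ (B k t) (c * -G k (clamp u v t))) t :=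
      HasDerivAt.fun_sum fun k _ => (hBd k t).norm_sq
    refine h1.congr_deriv ?_
    -- The derivative of the energy is -2 Re(c(Q - S)), with Q the quadrilinear form and S the
    -- resonant sum. Both are real while c is imaginary.
    have h2 : ∑ k ∈ K, 2 * inner ℝ (B k t) (c * -G k (clamp u v t)) =
        -2 * (c * ((∑' i, quad α A t i) - ∑ k ∈ K, (starRingEnd ℂ) (A k t) * slf α A k t)).re := by
      have h3 : ∑' i, quad α A t i = ∑ k ∈ K, ∑ q ∈ F.filter (fun q => q ∈ nrS),
          (starRingEnd ℂ) (A k t) * trm (wgt α) A A A k q t := by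
        rw [tsum_eq_sum (s := K ×ˢ F), Finset.sum_product]
        · refine Finset.sum_congr rfl fun k _ => ?_
          rw [Finset.sum_filter]
          refine Finset.sum_congr rfl fun q _ => ?_
          by_cases hq : q.1 ≠ 0 ∧ q.2 ≠ 0
          · rw [quad, if_pos hq, if_pos (show q ∈ nrS from hq)]
          · rw [quad, if_neg hq, if_neg (show q ∉ nrS from hq)]
        · intro i hi
          unfold quad
          split_ifs with h
          · by_cases hk : i.1 ∈ K
            · rw [hvan i.1 hk i.2 (fun h => hi (Finset.mem_product.2 ⟨hk, h⟩)) t ht, mul_zero]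
            · rw [hA0 _ t ht hk, map_zero, zero_mul]
          · rfl
      rw [h3, ← Finset.sum_sub_distrib, Finset.mul_sum, Complex.re_sum, Finset.mul_sum]
      refine Finset.sum_congr rfl fun k hk => ?_
      have e : ∀ S z : ℂ, (c * -S * z).re = -(c * (z * S)).re := fun S z => by
        rw [← Complex.neg_re]; congr 1; ring
      rw [Complex.inner, clamp_of_mem ht, hBA k hk t ht, ← Finset.mul_sum, ← mul_sub]
      simp only [hG, e]
      ring
    rw [h2]
    have h4 : ((∑' i, quad α A t i) - ∑ k ∈ K, (starRingEnd ℂ) (A k t) * slf α A k t).im = 0 := by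
      rw [Complex.sub_im, tsum_quad_im, Complex.im_sum,
        Finset.sum_eq_zero fun k _ => conj_mul_slf_im α A k t, sub_zero]
    rw [Complex.mul_re, hc, h4]
    ring
  have hEc : ContinuousOn (fun t => ∑ k ∈ K, ‖B k t‖ ^ 2) (Icc u v) := fun t ht =>
    (hEd t ht).continuousAt.continuousWithinAt
  have hconst := constant_of_has_deriv_right_zero hEc fun t ht =>
    (hEd t ⟨ht.1, ht.2.le⟩).hasDerivWithinAt
  intro t ht
  have e1 := (hconst t ht).trans (hconst v ⟨huv, le_rfl⟩).symm
  have e2 : ∑ k ∈ K, ‖A k t‖ ^ 2 = ∑ k ∈ K, ‖B k t‖ ^ 2 :=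
    Finset.sum_congr rfl fun k hk => by rw [hBA k hk t ht]
  rw [e2, e1]
  refine Finset.sum_congr rfl fun k _ => ?_
  simp [hB]

/-- The `ℓ²` norm of local solutions is at most that of the data. -/
theorem exists_local_lpN_le {s q ε : ℝ} (H : Adm s 2 q ε) :
    ∃ C : ℝ≥0∞, C ≠ ⊤ ∧ ∀ {ν : ℕ} {u v : ℝ} {α A₀ : ℤ → ℂ} {M : ℝ≥0∞} {c : ℂ} {B : ℤ → ℝ → ℂ},
      0 < u → u ≤ v → winL ν ≤ u → v ≤ winR ν → c.re = 0 → ‖c‖ₑ ≤ 1 → (∀ k, ‖α k‖ ≤ 1) →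
      (lpN 2 fun k => ‖α k‖ₑ) ≤ M → (lpN 2 fun k => ‖A₀ k‖ₑ) ≤ M → M ≠ ⊤ →
      C * ENNReal.ofReal (oscB ε u v) * M ^ 2 ≤ 1 →
      RepOn s 2 B (Icc u v) (2 * lpN 2 fun k => ‖A₀ k‖ₑ) →
      (∀ k, ∀ t ∈ Icc u v, B k t = A₀ k + c * duh α B k t v) →
      ∀ t ∈ Icc u v, (lpN 2 fun k => ‖B k t‖ₑ) ≤ lpN 2 fun k => ‖A₀ k‖ₑ := by
  obtain ⟨C₁, hC₁, hex⟩ := exists_local H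
  obtain ⟨C₂, hC₂, hd⟩ := RepOn.exists_duh_sub H
  refine ⟨C₁ + 8 * C₂, by finiteness, ?_⟩
  intro ν u v α A₀ M c B hu huv hL hR hcre hc hα hαM hAM hM hsmall hB hBeq t ht
  obtain ⟨C₃, hC₃, hpt⟩ := (RepOn.gauge H (Icc u v)).pt
  set X := lpN 2 fun k => ‖A₀ k‖ₑ with hX
  have hXt : X ≠ ⊤ := ne_top_of_le_ne_top hM hAM
  have h2X : 2 * X ≤ 2 * M := by gcongr
  have hM2 : M ≤ 2 * M := by rw [two_mul]; exact le_self_add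
  have hsub : Icc u v ⊆ window ν := Icc_subset_Icc hL hR
  have hs1 : C₁ * ENNReal.ofReal (oscB ε u v) * M ^ 2 ≤ 1 :=
    le_trans (by gcongr; exact le_self_add) hsmall
  have hs2 : 8 * C₂ * ENNReal.ofReal (oscB ε u v) * M ^ 2 ≤ 1 :=
    le_trans (by gcongr; exact le_add_self) hsmall
  choose A hA hAeq using fun n : ℕ => hex (Icc (-(n : ℤ)) n) hu huv hL hR hc hα hαM hAM hM hs1
  obtain ⟨b, hb, hBb⟩ := id hB
  -- The norm of the modes of B outside the truncation; it tends to 0 since B has finite ℓ² norm in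
  -- k.
  set τ : ℕ → ℝ≥0∞ := fun n => lpN 2 fun k => (Icc (-(n : ℤ)) n)ᶜ.indicator (fun k => sN s 2 (b k)) k
    with hτ
  have hτle : ∀ n, τ n ≤ 2 * X := fun n => le_trans (lpN_mono two_pos fun k =>
    indicator_le_self' (fun _ _ => zero_le) k) hb
  have hτ0 : Tendsto τ atTop (𝓝 0) := by
    have hfin : ∑' k, sN s 2 (b k) ^ (2 : ℝ) ≠ ⊤ := by
      rw [← lpN_rpow two_pos]
      exact ENNReal.rpow_ne_top_of_nonneg (by norm_num) (ne_top_of_le_ne_top (by finiteness) hb)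
    have h1 := ENNReal.tendsto_tsum_compl_atTop_zero hfin
    have h2 : Tendsto (fun n : ℕ => Finset.Icc (-(n : ℤ)) n) atTop atTop := by
      refine tendsto_atTop_finset_of_monotone (fun m n h => ?_) fun k => ⟨k.natAbs, ?_⟩
      · intro k hk; simp only [Finset.mem_Icc] at hk ⊢; omega
      · simp only [Finset.mem_Icc]; omega
    have h3 := (ENNReal.continuous_rpow_const (y := 1 / 2)).tendsto 0 |>.comp (h1.comp h2)
    rw [ENNReal.zero_rpow_of_pos (by norm_num)] at h3
    refine h3.congr fun n => ?_
    simp only [Function.comp, hτ, lpN]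
    congr 1
    refine (tsum_subtype {k : ℤ | k ∉ Finset.Icc (-(n : ℤ)) n}
      (fun k => sN s 2 (b k) ^ (2 : ℝ))).trans (tsum_congr fun k => ?_)
    by_cases hk : k ∈ Icc (-(n : ℤ)) n
    · rw [indicator_of_notMem (by simpa using hk), indicator_of_notMem (by simpa using hk),
        ENNReal.zero_rpow_of_pos (by norm_num)]
    · rw [indicator_of_mem (by simpa using hk), indicator_of_mem (by simpa using hk)]
  -- Inside the truncation the local Lipschitz estimate halves the bound of B - A n; outside it the
  -- difference is B itself.
  have hhalf : ∀ n N, N ≤ 8 * X → RepOn s 2 (fun k t => B k t - A n k t) (Icc u v) N →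
      RepOn s 2 (fun k t => B k t - A n k t) (Icc u v) (N / 2 + τ n) := by
    classical
    intro n N hN hD
    have hNt : N ≠ ⊤ := ne_top_of_le_ne_top (by finiteness) hN
    have hτt : τ n ≠ ⊤ := ne_top_of_le_ne_top (by finiteness) (hτle n)
    have h1 := hd hu huv hL hR hα (hαM.trans hM2) (hB.mono Subset.rfl h2X)
      ((hA n).mono Subset.rfl h2X) hD (by finiteness) hNt
    have h2 : RepOn s 2 (fun k t => (Icc (-(n : ℤ)) n)ᶜ.indicator (fun k => B k t) k) (Icc u v)
        (τ n) := by
      refine ⟨fun k h => if k ∈ (Icc (-(n : ℤ)) n)ᶜ then b k h else 0,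
        lpN_mono two_pos fun k => ?_, fun k t ht => ?_⟩
      · by_cases hk : k ∈ (Icc (-(n : ℤ)) n)ᶜ
        · simp only [hk, if_true, indicator_of_mem]; exact le_rfl
        · simp only [hk, if_false]; simp [sN, lpN_zero]
      · beta_reduce
        by_cases hk : k ∈ (Icc (-(n : ℤ)) n)ᶜ
        · rw [indicator_of_mem hk, hBb k t ht]; simp only [ev, hk, if_true]
        · rw [indicator_of_notMem hk]; simp only [ev, hk, if_false, zero_mul, tsum_zero]
    have h3 : RepOn s 2 (fun k t => (Icc (-(n : ℤ)) n).indicator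
        (fun k => c * (duh α B k (clamp u v t) v - duh α (A n) k (clamp u v t) v)) k) (Icc u v)
        (N / 2) := by
      refine ((h1.const_mul H c).proj H _).mono hsub ?_
      rw [ENNReal.le_div_iff_mul_le (by simp) (by simp)]
      calc ‖c‖ₑ * (C₂ * ENNReal.ofReal (oscB ε u v) * ((2 * M) ^ 2 * N)) * 2
          ≤ 1 * (C₂ * ENNReal.ofReal (oscB ε u v) * ((2 * M) ^ 2 * N)) * 2 := by gcongr
        _ = 8 * C₂ * ENNReal.ofReal (oscB ε u v) * M ^ 2 * N := by ring
        _ ≤ 1 * N := by gcongr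
        _ = N := one_mul N
    refine (h3.add H h2 (by finiteness) hτt).congr fun k t ht => ?_
    rw [hAeq n k t ht, clamp_of_mem ht]
    by_cases hk : k ∈ Icc (-(n : ℤ)) n
    · rw [indicator_of_mem hk, indicator_of_mem hk, indicator_of_notMem (not_not.2 hk)]
      nth_rewrite 1 [hBeq k t ht]
      ring
    · rw [indicator_of_notMem hk, indicator_of_notMem hk, indicator_of_mem hk]
      ring
  -- The map N ↦ N/2 + τ n has fixed point 2τ n, so iteration brings the bound down to that value.
  have hiter : ∀ n j, RepOn s 2 (fun k t => B k t - A n k t) (Icc u v)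
      (4 * X / 2 ^ j + 2 * τ n) := by
    intro n j
    induction j with
    | zero =>
      refine (hB.sub H (hA n) (by finiteness) (by finiteness)).mono Subset.rfl ?_
      rw [← hX, pow_zero, div_one, ← add_mul]
      norm_num
    | succ j ih =>
      have h1 : 4 * X / 2 ^ j ≤ 4 * X :=
        ENNReal.div_le_of_le_mul (le_mul_of_one_le_right' (one_le_pow₀ (by norm_num)))
      refine (hhalf n _ ?_ ih).mono Subset.rfl (le_of_eq ?_)
      · calc 4 * X / 2 ^ j + 2 * τ n ≤ 4 * X + 2 * (2 * X) := by gcongr; exact hτle n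
          _ = 8 * X := by ring
      · rw [div_two_pow_succ, ENNReal.add_div, mul_div_assoc 2, mul_comm 2 (τ n / 2),
          ENNReal.div_mul_cancel (by simp) (by simp), add_assoc, two_mul]
  have hlim : ∀ k, Tendsto (fun n => A n k t) atTop (𝓝 (B k t)) := by
    intro k
    have h1 : ∀ n, ‖B k t - A n k t‖ₑ ≤ C₃ * (2 * τ n) := fun n => by
      have h2 : Tendsto (fun j : ℕ => C₃ * (4 * X / 2 ^ j + 2 * τ n)) atTop
          (𝓝 (C₃ * (0 + 2 * τ n))) :=
        ENNReal.Tendsto.const_mul ((tendsto_div_two_pow (by finiteness)).add tendsto_const_nhds)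
          (Or.inr hC₃)
      rw [zero_add] at h2
      exact ge_of_tendsto' h2 fun j => hpt (hiter n j) k t ht
    have h3 : Tendsto (fun n => C₃ * (2 * τ n)) atTop (𝓝 (C₃ * (2 * 0))) :=
      ENNReal.Tendsto.const_mul (ENNReal.Tendsto.const_mul hτ0 (Or.inr (by simp))) (Or.inr hC₃)
    rw [mul_zero, mul_zero] at h3
    have h4 := tendsto_of_tendsto_of_tendsto_of_le_of_le tendsto_const_nhds h3 (fun _ => zero_le) h1
    rw [tendsto_iff_edist_tendsto_0]
    refine h4.congr fun n => ?_
    rw [edist_comm, edist_eq_enorm_sub]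
  have hsq : ∀ z : ℂ, ‖z‖ₑ ^ (2 : ℝ) = ENNReal.ofReal (‖z‖ ^ 2) := fun z => by
    rw [ENNReal.ofReal_pow (norm_nonneg _), ofReal_norm]
    exact ENNReal.rpow_ofNat _ 2
  rw [lpN_le_iff two_pos, ENNReal.tsum_eq_iSup_sum]
  refine iSup_le fun S => ?_
  have h1 : Tendsto (fun n => ∑ k ∈ S, ‖A n k t‖ₑ ^ (2 : ℝ)) atTop
      (𝓝 (∑ k ∈ S, ‖B k t‖ₑ ^ (2 : ℝ))) :=
    tendsto_finsetSum _ fun k _ =>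
      ((ENNReal.continuous_rpow_const.comp continuous_enorm).tendsto _).comp (hlim k)
  refine le_of_tendsto' h1 fun n => ?_
  have hAc : ∀ k, ContinuousOn (A n k) (Icc u v) := (hA n).continuousOn H (by finiteness)
  have h2 := sum_norm_sq_eq hu huv hcre hAc (hAeq n) t ht
  calc ∑ k ∈ S, ‖A n k t‖ₑ ^ (2 : ℝ)
      ≤ ∑ k ∈ Finset.Icc (-(n : ℤ)) n, ‖A n k t‖ₑ ^ (2 : ℝ) := by
        rw [← Finset.sum_filter_add_sum_filter_not S (fun k => k ∈ Finset.Icc (-(n : ℤ)) n),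
          Finset.sum_eq_zero (s := S.filter fun k => k ∉ Finset.Icc (-(n : ℤ)) n), add_zero]
        · exact Finset.sum_le_sum_of_subset fun k hk => (Finset.mem_filter.1 hk).2
        · intro k hk
          have hk' := (Finset.mem_filter.1 hk).2
          rw [hAeq n k t ht, indicator_of_notMem (by simpa using hk')]
          simp
    _ = ∑ k ∈ Finset.Icc (-(n : ℤ)) n, ‖A₀ k‖ₑ ^ (2 : ℝ) := by
        simp only [hsq]
        rw [← ENNReal.ofReal_sum_of_nonneg fun _ _ => by positivity, h2,
          ENNReal.ofReal_sum_of_nonneg fun _ _ => by positivity]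
    _ ≤ X ^ (2 : ℝ) := by
        rw [hX, lpN_rpow two_pos]
        exact ENNReal.sum_le_tsum _

/-! ### Integrals over full windows -/

/-- The decay rate on the window of index `ν`. -/
def dk (ν : ℕ) : ℝ≥0∞ := ((ν : ℝ≥0∞) + 1)⁻¹

theorem dk_le_one (ν : ℕ) : dk ν ≤ 1 := ENNReal.inv_le_one.2 le_add_self

theorem dk_ne_top (ν : ℕ) : dk ν ≠ ⊤ := ne_top_of_le_ne_top ENNReal.one_ne_top (dk_le_one ν)

theorem dk_anti {m n : ℕ} (h : m ≤ n) : dk n ≤ dk m := by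
  unfold dk
  gcongr

theorem dk_eq (ν : ℕ) : dk ν = ENNReal.ofReal (1 / (ν + 1)) := by
  rw [dk, one_div, ENNReal.ofReal_inv_of_pos (by positivity),
    ENNReal.ofReal_add (by positivity) (by positivity), ENNReal.ofReal_natCast, ENNReal.ofReal_one]

theorem ofReal_div_le_dk {μ : ℕ} (hμ : 1 ≤ μ) {x : ℝ} (hx : 0 ≤ x) :
    ENNReal.ofReal (x / μ) ≤ ENNReal.ofReal (2 * x) * dk μ := by
  rw [dk_eq, ← ENNReal.ofReal_mul (by positivity)]
  refine ENNReal.ofReal_le_ofReal ?_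
  have h1 : (1 : ℝ) ≤ μ := by exact_mod_cast hμ
  rw [mul_one_div, div_le_div_iff₀ (by linarith) (by linarith)]
  nlinarith

theorem winL_pos {μ : ℕ} (hμ : 1 ≤ μ) : 0 < winL μ := by
  have h1 : (1 : ℝ) ≤ μ := by exact_mod_cast hμ
  have := Real.pi_pos
  unfold winL; positivity

/-- For u = πμ and v - u = 2π the first base is 2/μ and the second at most (2 + 4 + 2)/μ; the
exponents ε and 1 - ε add up to one. -/
theorem oscB_window_le {ε : ℝ} (hε : 0 < ε) (hε1 : ε < 1) {μ : ℕ} (hμ : 1 ≤ μ) :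
    oscB ε (winL μ) (winR μ) ≤ 8 / μ := by
  have h1 : (1 : ℝ) ≤ μ := by exact_mod_cast hμ
  have hpi := Real.pi_gt_three
  have hpi0 := Real.pi_pos
  have e0 : winR μ - winL μ = 2 * Real.pi := by rw [winR_eq]; ring
  have e1 : (winR μ - winL μ) / winL μ = 2 / μ := by
    rw [e0, winL]; field_simp
  have e2 : 6 / winL μ ≤ 2 / μ := by
    rw [winL, div_le_div_iff₀ (by positivity) (by positivity)]
    nlinarith
  have e3 : 6 * (winR μ - winL μ) / winL μ ^ 2 ≤ 4 / μ := by
    rw [e0, winL, div_le_div_iff₀ (by positivity) (by positivity)]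
    have : 0 < (μ : ℝ) := by linarith
    have h2 : Real.pi * 3 ≤ Real.pi * Real.pi := by gcongr
    have h3 : (μ : ℝ) ≤ (μ : ℝ) ^ 2 := by nlinarith
    calc 6 * (2 * Real.pi) * (μ : ℝ) = 4 * (Real.pi * 3) * μ := by ring
      _ ≤ 4 * (Real.pi * Real.pi) * (μ : ℝ) ^ 2 := by gcongr
      _ = 4 * (Real.pi * μ) ^ 2 := by ring
  have hw : 0 ≤ winR μ - winL μ := by rw [e0]; positivity
  have hL := winL_pos hμ
  have h8 : (0 : ℝ) < 8 / μ := by positivity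
  have hε2 : 0 ≤ 1 - ε := by linarith
  have b1 : (winR μ - winL μ) / winL μ ≤ 8 / μ := by rw [e1]; gcongr; norm_num
  have b2 : 6 / winL μ + 6 * (winR μ - winL μ) / winL μ ^ 2 + (winR μ - winL μ) / winL μ
      ≤ 8 / μ := by
    have e4 : (8 : ℝ) / μ = 2 / μ + 4 / μ + 2 / μ := by ring
    rw [e1]; linarith
  calc oscB ε (winL μ) (winR μ) ≤ (8 / μ) ^ ε * (8 / μ) ^ (1 - ε) := by
        unfold oscB
        exact mul_le_mul (Real.rpow_le_rpow (by positivity) b1 hε.le)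
          (Real.rpow_le_rpow (by positivity) b2 hε2) (by positivity) (by positivity)
    _ = 8 / μ := by rw [← Real.rpow_add h8]; simp

theorem norm_phi_sub_le {l u v t t' : ℝ} (hl : |l| ≤ 1) (hu : 0 < u) (ht : t ∈ Icc u v)
    (ht' : t' ∈ Icc u v) : ‖phi l t' - phi l t‖ ≤ 2 / u ^ 2 * ‖t' - t‖ := by
  refine Convex.norm_image_sub_le_of_norm_hasDerivWithin_le (s := Icc u v)
    (fun x hx => (hasDerivAt_phi l (hu.trans_le hx.1)).hasDerivWithinAt) (fun x hx => ?_)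
    (convex_Icc u v) ht ht'
  have hx0 := hu.trans_le hx.1
  rw [norm_mul, norm_mul, norm_phi l hx0, norm_div, norm_one, Complex.norm_real,
    Real.norm_of_nonneg hx0.le]
  have h2 : ‖-1 + Complex.I * (l : ℂ)‖ ≤ 2 := by
    refine (norm_add_le _ _).trans ?_
    rw [norm_neg, norm_one, norm_mul, Complex.norm_I, one_mul, Complex.norm_real, Real.norm_eq_abs]
    linarith
  have h3 : 1 / x ≤ 1 / u := one_div_le_one_div_of_le hu hx.1
  calc 1 / x * (‖-1 + Complex.I * (l : ℂ)‖ * (1 / x)) ≤ 1 / u * (2 * (1 / u)) := by gcongr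
    _ = 2 / u ^ 2 := by field_simp

theorem ex_periodic (n : ℤ) (t : ℝ) : ex (4 * n) (t + 2 * Real.pi) = ex (4 * n) t := by
  unfold ex
  rw [Complex.exp_eq_exp_iff_exists_int]
  refine ⟨2 * n, ?_⟩
  push_cast
  ring

/-- Modes of index 4n have period 2π, the length of the window. The boundary terms of the
integration by parts therefore combine to φ(b) - φ(a) = O(1/μ²). This gains 1/μ over the general
bound and makes the terms with three constants summable over the windows. -/
theorem norm_integral_phi_window_le {ε l : ℝ} (hε : 0 < ε) (hl : |l| ≤ 1) {μ : ℕ} (hμ : 1 ≤ μ) {n : ℤ}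
    (hn : n ≠ 0) : ‖∫ τ in winL μ..winR μ, phi l τ * ex (4 * n) τ‖ ≤
      9 / (μ : ℝ) ^ 2 * w (4 * n) ^ (-1 + ε) := by
  have hL := winL_pos hμ
  have hLR := winL_le_winR μ
  have hn4 : (4 * n : ℤ) ≠ 0 := by omega
  have h1 := norm_integral_phi_parts hl hL (⟨le_rfl, hLR⟩ : winL μ ∈ Icc (winL μ) (winR μ))
    (⟨hLR, le_rfl⟩ : winR μ ∈ Icc (winL μ) (winR μ)) hn4
  have e1 : ex (4 * n) (winR μ) = ex (4 * n) (winL μ) := by rw [winR_eq, ex_periodic]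
  rw [e1, ← sub_mul, norm_mul, norm_ex_primitive] at h1
  have h2 := norm_phi_sub_le hl hL (⟨le_rfl, hLR⟩ : winL μ ∈ Icc (winL μ) (winR μ))
    (⟨hLR, le_rfl⟩ : winR μ ∈ Icc (winL μ) (winR μ))
  have e2 : winR μ - winL μ = 2 * Real.pi := by rw [winR_eq]; ring
  have hpi := Real.pi_gt_three
  have hpi0 := Real.pi_pos
  have hμ1 : (1 : ℝ) ≤ μ := by exact_mod_cast hμ
  rw [e2, Real.norm_of_nonneg (by positivity)] at h2
  rw [e2] at h1
  have h3 : 2 / winL μ ^ 2 * (2 * Real.pi) ≤ 3 / 2 / (μ : ℝ) ^ 2 := by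
    rw [winL, div_mul_eq_mul_div, div_le_div_iff₀ (by positivity) (by positivity)]
    have : 8 * 3 ≤ 8 * Real.pi := by linarith
    have h5 : 0 ≤ Real.pi * (μ : ℝ) ^ 2 := by positivity
    nlinarith
  have hw := w_pos (4 * n)
  have h4 : 0 < |((4 * n : ℤ) : ℝ)| := by
    rw [abs_pos]; exact_mod_cast hn4
  have h5 : 2 / |((4 * n : ℤ) : ℝ)| ≤ 3 / w (4 * n) := by
    rw [div_le_div_iff₀ h4 hw]; linarith [w_le_abs hn4]
  have h6 : (w (4 * n))⁻¹ ≤ w (4 * n) ^ (-1 + ε) := by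
    rw [← Real.rpow_neg_one]
    exact Real.rpow_le_rpow_of_exponent_le (one_le_w _) (by linarith)
  calc ‖∫ τ in winL μ..winR μ, phi l τ * ex (4 * n) τ‖
      ≤ ‖phi l (winR μ) - phi l (winL μ)‖ * (2 / |((4 * n : ℤ) : ℝ)|) +
        2 / |((4 * n : ℤ) : ℝ)| * (2 * (2 * Real.pi) / winL μ ^ 2) := h1
    _ ≤ 3 / 2 / (μ : ℝ) ^ 2 * (3 / w (4 * n)) + 3 / w (4 * n) * (3 / 2 / (μ : ℝ) ^ 2) := by
        have : 2 * (2 * Real.pi) / winL μ ^ 2 = 2 / winL μ ^ 2 * (2 * Real.pi) := by ring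
        rw [this]
        have := h2.trans h3
        gcongr
    _ = 9 / (μ : ℝ) ^ 2 * (w (4 * n))⁻¹ := by ring
    _ ≤ _ := by gcongr

/-- The absolute sum of the non-resonant integrals over a window. -/
def absT (α : ℤ → ℂ) (f g h : ℤ → ℝ → ℂ) (μ : ℕ) (k : ℤ) : ℝ≥0∞ :=
  ∑' q : nrS, ‖∫ τ in winL μ..winR μ, trm (wgt α) f g h k q τ‖ₑ

theorem continuousOn_repOn {s p q ε : ℝ} (H : Adm s p q ε) {f : ℤ → ℝ → ℂ} {μ : ℕ} {N : ℝ≥0∞}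
    (hf : RepOn s p f (window μ) N) (hN : N ≠ ⊤) (k : ℤ) :
    ContinuousOn (f k) (uIcc (winL μ) (winR μ)) := by
  rw [uIcc_of_le (winL_le_winR μ)]
  exact hf.continuousOn H hN k

theorem absT_congr {α : ℤ → ℂ} {f g h f' g' h' : ℤ → ℝ → ℂ} {μ : ℕ}
    (hf : ∀ k, ∀ τ ∈ window μ, f k τ = f' k τ) (hg : ∀ k, ∀ τ ∈ window μ, g k τ = g' k τ)
    (hh : ∀ k, ∀ τ ∈ window μ, h k τ = h' k τ) (k : ℤ) :
    absT α f g h μ k = absT α f' g' h' μ k := by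
  unfold absT
  refine tsum_congr fun q => ?_
  congr 1
  refine intervalIntegral.integral_congr fun τ hτ => ?_
  rw [uIcc_of_le (winL_le_winR μ)] at hτ
  exact trm_congr (fun k => hf k τ hτ) (fun k => hg k τ hτ) (fun k => hh k τ hτ) _ _

/-- The absolute sums over full windows. -/
theorem RepOn.exists_absT {s p q ε : ℝ} (H : Adm s p q ε) :
    ∃ C : ℝ≥0∞, C ≠ ⊤ ∧ ∀ {μ : ℕ} {α : ℤ → ℂ} {f g h : ℤ → ℝ → ℂ} {X Y Z : ℝ≥0∞}, 1 ≤ μ →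
      (∀ k, ‖α k‖ ≤ 1) → RepOn s p f (window μ) X → RepOn s p g (window μ) Y →
      RepOn s p h (window μ) Z → X ≠ ⊤ → Y ≠ ⊤ → Z ≠ ⊤ →
      lpN p (absT α f g h μ) ≤ C * dk μ * (X * Y * Z) := by
  obtain ⟨C₁, hC₁, hF⟩ := tsum_trm_le H
  obtain ⟨C₂, hC₂, hL⟩ := lpN_lev_le H
  refine ⟨C₁ * ENNReal.ofReal (2 * 8) * C₂, by finiteness, ?_⟩
  intro μ α f g h X Y Z hμ hα ⟨a, ha, hfa⟩ ⟨b, hb, hgb⟩ ⟨c, hc, hhc⟩ hX hY hZ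
  have hLR := winL_le_winR μ
  have hL0 := winL_pos hμ
  have h1 : ∀ k, absT α f g h μ k ≤
      C₁ * ENNReal.ofReal (oscB ε (winL μ) (winR μ)) * lev ε p nrS a b c k := fun k => by
    rw [absT_congr hfa hgb hhc k]
    refine hF nrS (wgt α) _ k _ _ (oscB_nonneg hL0 hLR) (fun q _ => ?_) a b c
      (sN_ne_top H.p_pos (ne_top_of_le_ne_top hX ha)) (sN_ne_top H.p_pos (ne_top_of_le_ne_top hY hb))
      (sN_ne_top H.p_pos (ne_top_of_le_ne_top hZ hc)) (fun q _ h => Or.inr ?_)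
    · exact (continuousOn_wgt α k q fun t ht =>
        (lt_min hL0 (hL0.trans_le hLR)).trans_le ht.1).intervalIntegrable
    · exact norm_integral_phi_le H.pos H.eps_lt_one (abs_shift_le hα k q) hL0 ⟨le_rfl, hLR⟩
        ⟨hLR, le_rfl⟩ _
  calc lpN p (absT α f g h μ)
      ≤ lpN p fun k => C₁ * ENNReal.ofReal (oscB ε (winL μ) (winR μ)) * lev ε p nrS a b c k :=
        lpN_mono H.p_pos h1
    _ = C₁ * ENNReal.ofReal (oscB ε (winL μ) (winR μ)) * lpN p (lev ε p nrS a b c) :=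
        lpN_const_mul H.p_pos _ _
    _ ≤ C₁ * (ENNReal.ofReal (2 * 8) * dk μ) * (C₂ * (X * Y * Z)) := by
        gcongr
        · exact (ENNReal.ofReal_le_ofReal (oscB_window_le H.pos H.eps_lt_one hμ)).trans
            (ofReal_div_le_dk hμ (by norm_num))
        · exact (hL nrS nrS_subset_pairs a b c).trans (by gcongr)
    _ = _ := by ring

/-- The absolute sums over full windows for constants. -/
theorem exists_absT_const {s p q ε : ℝ} (H : Adm s p q ε) :
    ∃ C : ℝ≥0∞, C ≠ ⊤ ∧ ∀ {μ : ℕ} {α c₁ c₂ c₃ : ℤ → ℂ} {X Y Z : ℝ≥0∞}, 1 ≤ μ →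
      (∀ k, ‖α k‖ ≤ 1) → (lpN p fun k => ‖c₁ k‖ₑ) ≤ X → (lpN p fun k => ‖c₂ k‖ₑ) ≤ Y →
      (lpN p fun k => ‖c₃ k‖ₑ) ≤ Z → X ≠ ⊤ → Y ≠ ⊤ → Z ≠ ⊤ →
      lpN p (absT α (fun k _ => c₁ k) (fun k _ => c₂ k) (fun k _ => c₃ k) μ) ≤
        C * dk μ ^ 2 * (X * Y * Z) := by
  obtain ⟨C₁, hC₁, hF⟩ := tsum_trm_le H
  obtain ⟨C₂, hC₂, hL⟩ := lpN_lev_le H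
  refine ⟨C₁ * ENNReal.ofReal (2 * 3) ^ 2 * C₂, by finiteness, ?_⟩
  intro μ α c₁ c₂ c₃ X Y Z hμ hα ha hb hc hX hY hZ
  rw [← nE_cst (s := s) H.p_pos] at ha hb hc
  have hLR := winL_le_winR μ
  have hL0 := winL_pos hμ
  have hμ1 : (1 : ℝ) ≤ μ := by exact_mod_cast hμ
  have h1 : ∀ k, absT α (fun k _ => c₁ k) (fun k _ => c₂ k) (fun k _ => c₃ k) μ k ≤
      C₁ * ENNReal.ofReal (9 / (μ : ℝ) ^ 2) * lev ε p nrS (cst c₁) (cst c₂) (cst c₃) k := fun k => by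
    rw [absT_congr (fun k t _ => (ev_cst c₁ k t).symm) (fun k t _ => (ev_cst c₂ k t).symm)
      (fun k t _ => (ev_cst c₃ k t).symm) k]
    refine hF nrS (wgt α) _ k _ _ (by positivity) (fun q _ => ?_) _ _ _
      (sN_ne_top H.p_pos (ne_top_of_le_ne_top hX ha)) (sN_ne_top H.p_pos (ne_top_of_le_ne_top hY hb))
      (sN_ne_top H.p_pos (ne_top_of_le_ne_top hZ hc)) (fun q hq h => ?_)
    · exact (continuousOn_wgt α k q fun t ht =>
        (lt_min hL0 (hL0.trans_le hLR)).trans_le ht.1).intervalIntegrable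
    · obtain ⟨x, y⟩ := q
      obtain ⟨h1, h2, h3⟩ := h
      -- Constants have only the mode 0, so the sole non-zero amplitude has frequency -4xy, which is
      -- non-zero on `nrS`.
      by_cases hz : h1 = 0 ∧ h2 = 0 ∧ h3 = 0
      · right
        obtain ⟨rfl, rfl, rfl⟩ := hz
        have e : freq ((x, y), (0, 0, 0)) = 4 * (-(x * y)) := by simp only [freq]; ring
        rw [e]
        exact norm_integral_phi_window_le H.pos (abs_shift_le hα k (x, y)) hμ
          (neg_ne_zero.2 (mul_ne_zero hq.1 hq.2))
      · left
        simp only [zt, cst]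
        by_cases e1 : h1 = 0
        · by_cases e2 : h2 = 0
          · have e3 : h3 ≠ 0 := fun e3 => hz ⟨e1, e2, e3⟩
            simp [e3]
          · simp [e2]
        · simp [e1]
  have h9 : ENNReal.ofReal (9 / (μ : ℝ) ^ 2) ≤ (ENNReal.ofReal (2 * 3) * dk μ) ^ 2 := by
    have : (9 : ℝ) / (μ : ℝ) ^ 2 = (3 / (μ : ℝ)) ^ 2 := by ring
    rw [this, ENNReal.ofReal_pow (by positivity)]
    gcongr
    exact ofReal_div_le_dk hμ (by norm_num)
  calc lpN p (absT α (fun k _ => c₁ k) (fun k _ => c₂ k) (fun k _ => c₃ k) μ)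
      ≤ lpN p fun k => C₁ * ENNReal.ofReal (9 / (μ : ℝ) ^ 2) *
          lev ε p nrS (cst c₁) (cst c₂) (cst c₃) k := lpN_mono H.p_pos h1
    _ = C₁ * ENNReal.ofReal (9 / (μ : ℝ) ^ 2) * lpN p (lev ε p nrS (cst c₁) (cst c₂) (cst c₃)) :=
        lpN_const_mul H.p_pos _ _
    _ ≤ C₁ * (ENNReal.ofReal (2 * 3) * dk μ) ^ 2 * (C₂ * (X * Y * Z)) := by
        gcongr
        exact (hL nrS nrS_subset_pairs _ _ _).trans (by gcongr)
    _ = _ := by ring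

/-! ### Constants plus small remainders -/

/-- On `S` the family `f` is the sum of constants of norm at most `X` and a remainder of norm at
most `Y`. -/
def SplitOn (s p : ℝ) (f : ℤ → ℝ → ℂ) (S : Set ℝ) (X Y : ℝ≥0∞) : Prop :=
  ∃ (c : ℤ → ℂ) (g : ℤ → ℝ → ℂ), (lpN p fun k => ‖c k‖ₑ) ≤ X ∧ RepOn s p g S Y ∧
    ∀ k, ∀ t ∈ S, f k t = c k + g k t

theorem SplitOn.repOn {s p q ε : ℝ} (H : Adm s p q ε) {f : ℤ → ℝ → ℂ} {S : Set ℝ} {X Y : ℝ≥0∞}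
    (h : SplitOn s p f S X Y) (hX : X ≠ ⊤) (hY : Y ≠ ⊤) : RepOn s p f S (X + Y) := by
  obtain ⟨c, g, hc, hg, hf⟩ := h
  exact (((RepOn.const H c S).mono Subset.rfl hc).add H hg hX hY).congr hf

theorem absT_add_le₁ {α : ℤ → ℂ} {f f' g h : ℤ → ℝ → ℂ} {μ : ℕ} (hμ : 1 ≤ μ)
    (hf : ∀ k, ContinuousOn (f k) (uIcc (winL μ) (winR μ)))
    (hf' : ∀ k, ContinuousOn (f' k) (uIcc (winL μ) (winR μ)))
    (hg : ∀ k, ContinuousOn (g k) (uIcc (winL μ) (winR μ)))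
    (hh : ∀ k, ContinuousOn (h k) (uIcc (winL μ) (winR μ))) (k : ℤ) :
    absT α (fun k t => f k t + f' k t) g h μ k ≤ absT α f g h μ k + absT α f' g h μ k := by
  have h1 := winL_pos hμ
  have h2 := h1.trans_le (winL_le_winR μ)
  unfold absT
  rw [← ENNReal.tsum_add]
  refine ENNReal.tsum_le_tsum fun q => ?_
  have e : ∀ τ, trm (wgt α) (fun k t => f k t + f' k t) g h k q τ =
      trm (wgt α) f g h k q τ + trm (wgt α) f' g h k q τ := fun τ => by
    simp only [trm]; ring
  simp only [e]
  rw [intervalIntegral.integral_add (intervalIntegrable_trm α h1 h2 hf hg hh k q)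
    (intervalIntegrable_trm α h1 h2 hf' hg hh k q)]
  exact enorm_add_le _ _

theorem absT_add_le₂ {α : ℤ → ℂ} {f g g' h : ℤ → ℝ → ℂ} {μ : ℕ} (hμ : 1 ≤ μ)
    (hf : ∀ k, ContinuousOn (f k) (uIcc (winL μ) (winR μ)))
    (hg : ∀ k, ContinuousOn (g k) (uIcc (winL μ) (winR μ)))
    (hg' : ∀ k, ContinuousOn (g' k) (uIcc (winL μ) (winR μ)))
    (hh : ∀ k, ContinuousOn (h k) (uIcc (winL μ) (winR μ))) (k : ℤ) :
    absT α f (fun k t => g k t + g' k t) h μ k ≤ absT α f g h μ k + absT α f g' h μ k := by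
  have h1 := winL_pos hμ
  have h2 := h1.trans_le (winL_le_winR μ)
  unfold absT
  rw [← ENNReal.tsum_add]
  refine ENNReal.tsum_le_tsum fun q => ?_
  have e : ∀ τ, trm (wgt α) f (fun k t => g k t + g' k t) h k q τ =
      trm (wgt α) f g h k q τ + trm (wgt α) f g' h k q τ := fun τ => by
    simp only [trm, map_add]; ring
  simp only [e]
  rw [intervalIntegral.integral_add (intervalIntegrable_trm α h1 h2 hf hg hh k q)
    (intervalIntegrable_trm α h1 h2 hf hg' hh k q)]
  exact enorm_add_le _ _

theorem absT_add_le₃ {α : ℤ → ℂ} {f g h h' : ℤ → ℝ → ℂ} {μ : ℕ} (hμ : 1 ≤ μ)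
    (hf : ∀ k, ContinuousOn (f k) (uIcc (winL μ) (winR μ)))
    (hg : ∀ k, ContinuousOn (g k) (uIcc (winL μ) (winR μ)))
    (hh : ∀ k, ContinuousOn (h k) (uIcc (winL μ) (winR μ)))
    (hh' : ∀ k, ContinuousOn (h' k) (uIcc (winL μ) (winR μ))) (k : ℤ) :
    absT α f g (fun k t => h k t + h' k t) μ k ≤ absT α f g h μ k + absT α f g h' μ k := by
  have h1 := winL_pos hμ
  have h2 := h1.trans_le (winL_le_winR μ)
  unfold absT
  rw [← ENNReal.tsum_add]
  refine ENNReal.tsum_le_tsum fun q => ?_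
  have e : ∀ τ, trm (wgt α) f g (fun k t => h k t + h' k t) k q τ =
      trm (wgt α) f g h k q τ + trm (wgt α) f g h' k q τ := fun τ => by
    simp only [trm]; ring
  simp only [e]
  rw [intervalIntegral.integral_add (intervalIntegrable_trm α h1 h2 hf hg hh k q)
    (intervalIntegrable_trm α h1 h2 hf hg hh' k q)]
  exact enorm_add_le _ _

/-- The absolute sums over full windows for constants plus remainders. -/
theorem SplitOn.exists_absT {s p q ε : ℝ} (H : Adm s p q ε) :
    ∃ C : ℝ≥0∞, C ≠ ⊤ ∧ ∀ {μ : ℕ} {α : ℤ → ℂ} {f g h : ℤ → ℝ → ℂ} {X₁ X₂ X₃ Y₁ Y₂ Y₃ : ℝ≥0∞},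
      1 ≤ μ → (∀ k, ‖α k‖ ≤ 1) → SplitOn s p f (window μ) X₁ Y₁ → SplitOn s p g (window μ) X₂ Y₂ →
      SplitOn s p h (window μ) X₃ Y₃ → X₁ ≠ ⊤ → X₂ ≠ ⊤ → X₃ ≠ ⊤ → Y₁ ≠ ⊤ → Y₂ ≠ ⊤ → Y₃ ≠ ⊤ →
      lpN p (absT α f g h μ) ≤ C * dk μ * (Y₁ * (X₂ + Y₂) * (X₃ + Y₃) + X₁ * Y₂ * (X₃ + Y₃) +
        X₁ * X₂ * Y₃ + dk μ * (X₁ * X₂ * X₃)) := by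
  obtain ⟨C₁, hC₁, hA⟩ := RepOn.exists_absT H
  obtain ⟨C₂, hC₂, hB⟩ := exists_absT_const H
  refine ⟨C₁ + C₂, by finiteness, ?_⟩
  intro μ α f g h X₁ X₂ X₃ Y₁ Y₂ Y₃ hμ hα hf hg hh hX₁ hX₂ hX₃ hY₁ hY₂ hY₃
  have rg := hg.repOn H hX₂ hY₂
  have rh := hh.repOn H hX₃ hY₃
  obtain ⟨c₁, f', hc₁, hf', hff⟩ := hf
  obtain ⟨c₂, g', hc₂, hg', hgg⟩ := hg
  obtain ⟨c₃, h', hc₃, hh', hhh⟩ := hh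
  have n2 : X₂ + Y₂ ≠ ⊤ := by finiteness
  have n3 : X₃ + Y₃ ≠ ⊤ := by finiteness
  have rc₁ := (RepOn.const H c₁ (window μ)).mono Subset.rfl hc₁
  have rc₂ := (RepOn.const H c₂ (window μ)).mono Subset.rfl hc₂
  have rc₃ := (RepOn.const H c₃ (window μ)).mono Subset.rfl hc₃
  have k1 := continuousOn_repOn H rc₁ hX₁
  have k2 := continuousOn_repOn H rc₂ hX₂
  have k3 := continuousOn_repOn H rc₃ hX₃
  have l1 := continuousOn_repOn H hf' hY₁
  have l2 := continuousOn_repOn H hg' hY₂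
  have l3 := continuousOn_repOn H hh' hY₃
  have lg := continuousOn_repOn H rg n2
  have lh := continuousOn_repOn H rh n3
  -- The constants are split off one factor at a time; only the term with three constants enjoys the
  -- bound with the square of `dk`.
  have h1 : ∀ k, absT α f g h μ k ≤ absT α (fun k _ => c₁ k) (fun k _ => c₂ k) (fun k _ => c₃ k) μ k +
      absT α (fun k _ => c₁ k) (fun k _ => c₂ k) h' μ k + absT α (fun k _ => c₁ k) g' h μ k +
      absT α f' g h μ k := fun k => by
    calc absT α f g h μ k = absT α (fun k t => c₁ k + f' k t) g h μ k :=
          absT_congr hff (fun _ _ _ => rfl) (fun _ _ _ => rfl) k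
      _ ≤ absT α (fun k _ => c₁ k) g h μ k + absT α f' g h μ k := absT_add_le₁ hμ k1 l1 lg lh k
      _ = absT α (fun k _ => c₁ k) (fun k t => c₂ k + g' k t) h μ k + absT α f' g h μ k := by
          rw [absT_congr (fun _ _ _ => rfl) hgg (fun _ _ _ => rfl) k]
      _ ≤ absT α (fun k _ => c₁ k) (fun k _ => c₂ k) h μ k + absT α (fun k _ => c₁ k) g' h μ k +
          absT α f' g h μ k := by gcongr; exact absT_add_le₂ hμ k1 k2 l2 lh k
      _ = absT α (fun k _ => c₁ k) (fun k _ => c₂ k) (fun k t => c₃ k + h' k t) μ k +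
          absT α (fun k _ => c₁ k) g' h μ k + absT α f' g h μ k := by
          congr 2
          exact absT_congr (fun _ _ _ => rfl) (fun _ _ _ => rfl) hhh k
      _ ≤ _ := by gcongr; exact absT_add_le₃ hμ k1 k2 k3 l3 k
  have b1 := hB hμ hα hc₁ hc₂ hc₃ hX₁ hX₂ hX₃
  have b2 := hA hμ hα rc₁ rc₂ hh' hX₁ hX₂ hY₃
  have b3 := hA hμ hα rc₁ hg' rh hX₁ hY₂ n3
  have b4 := hA hμ hα hf' rg rh hY₁ n2 n3
  calc lpN p (absT α f g h μ) ≤ _ := lpN_mono H.p_pos h1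
    _ ≤ lpN p (absT α (fun k _ => c₁ k) (fun k _ => c₂ k) (fun k _ => c₃ k) μ) +
        lpN p (absT α (fun k _ => c₁ k) (fun k _ => c₂ k) h' μ) +
        lpN p (absT α (fun k _ => c₁ k) g' h μ) + lpN p (absT α f' g h μ) := by
        refine (lpN_add_le H.one_le_p _ _).trans ?_
        gcongr
        refine (lpN_add_le H.one_le_p _ _).trans ?_
        gcongr
        exact lpN_add_le H.one_le_p _ _
    _ ≤ (C₁ + C₂) * dk μ ^ 2 * (X₁ * X₂ * X₃) + (C₁ + C₂) * dk μ * (X₁ * X₂ * Y₃) +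
        (C₁ + C₂) * dk μ * (X₁ * Y₂ * (X₃ + Y₃)) +
        (C₁ + C₂) * dk μ * (Y₁ * (X₂ + Y₂) * (X₃ + Y₃)) := by
        gcongr
        · exact b1.trans (by gcongr; exact le_add_self)
        · exact b2.trans (by gcongr; exact le_self_add)
        · exact b3.trans (by gcongr; exact le_self_add)
        · exact b4.trans (by gcongr; exact le_self_add)
    _ = _ := by ring

/-! ### Improper integrals as sums over windows -/

theorem winL_add_two (μ : ℕ) : winL (μ + 2) = winR μ := by
  unfold winL winR; push_cast; ring

theorem winL_mono {m n : ℕ} (h : m ≤ n) : winL m ≤ winL n := by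
  have := Real.pi_pos
  have : (m : ℝ) ≤ n := by exact_mod_cast h
  unfold winL; gcongr

theorem winR_mono {m n : ℕ} (h : m ≤ n) : winR m ≤ winR n := by
  have := Real.pi_pos
  have : (m : ℝ) ≤ n := by exact_mod_cast h
  unfold winR; gcongr

theorem winL_step (ν n : ℕ) : winL (ν + 2 * (n + 1)) = winR (ν + 2 * n) := winL_add_two _

theorem winR_add (ν n : ℕ) : winR (ν + 2 * n) = winR ν + n * (2 * Real.pi) := by
  unfold winR; push_cast; ring

theorem exists_window_ge {ν : ℕ} {τ : ℝ} (h : winR ν ≤ τ) :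
    ∃ n : ℕ, τ ∈ window (ν + 2 * (n + 1)) ∧ n = ⌊(τ - winR ν) / (2 * Real.pi)⌋₊ := by
  have hpi := Real.two_pi_pos
  refine ⟨_, ?_, rfl⟩
  rw [window_eq]
  have h1 := Nat.floor_le (a := (τ - winR ν) / (2 * Real.pi)) (div_nonneg (by linarith) hpi.le)
  have h2 := Nat.lt_floor_add_one ((τ - winR ν) / (2 * Real.pi))
  rw [le_div_iff₀ hpi] at h1
  rw [div_lt_iff₀ hpi] at h2
  refine ⟨?_, ?_⟩
  · rw [winL_step, winR_add]; linarith
  · rw [winR_add]; push_cast; linarith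

/-- The improper integral, when it exists. -/
def impInt (f : ℝ → ℂ) (t : ℝ) : ℂ := limUnder atTop fun b => ∫ τ in t..b, f τ

theorem HasImproperIntegral.impInt_eq {f : ℝ → ℂ} {t : ℝ} {J : ℂ} (h : HasImproperIntegral f t J) :
    impInt f t = J := h.2.limUnder_eq

/-- The windows ν, ν + 2, ν + 4, … tile the half-line, the step 2 being due to the overlap of
neighbours. Integrals up to their right ends are partial sums of the series; a general upper limit b
lies within 2π of such an end, where |f| ≤ B/τ costs only O(1/b). -/
theorem hasImproperIntegral_of_windows {f : ℝ → ℂ} {t B : ℝ} {ν : ℕ} (hν : t ≤ winR ν) (hB0 : 0 ≤ B)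
    (hf : ContinuousOn f (Ici t)) (hB : ∀ τ, winR ν ≤ τ → ‖f τ‖ ≤ B / τ)
    (hs : Summable fun n : ℕ => ∫ τ in winL (ν + 2 * (n + 1))..winR (ν + 2 * (n + 1)), f τ) :
    HasImproperIntegral f t ((∫ τ in t..winR ν, f τ) +
      ∑' n : ℕ, ∫ τ in winL (ν + 2 * (n + 1))..winR (ν + 2 * (n + 1)), f τ) := by
  have hint : ∀ x y, t ≤ x → t ≤ y → IntervalIntegrable f volume x y := fun x y hx hy =>
    (hf.mono fun z hz => (le_min hx hy).trans hz.1).intervalIntegrable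
  refine ⟨fun b hb => hint t b le_rfl hb, ?_⟩
  have hpi := Real.two_pi_pos
  have hνn : ∀ n : ℕ, t ≤ winR (ν + 2 * n) := fun n => hν.trans (winR_mono (by omega))
  have h1 : ∀ n : ℕ, ∫ τ in t..winR (ν + 2 * n), f τ = (∫ τ in t..winR ν, f τ) +
      ∑ m ∈ Finset.range n, ∫ τ in winL (ν + 2 * (m + 1))..winR (ν + 2 * (m + 1)), f τ := fun n => by
    induction n with
    | zero => simp
    | succ n ih =>
      rw [Finset.sum_range_succ, ← add_assoc, ← ih, winL_step,
        intervalIntegral.integral_add_adjacent_intervals (hint _ _ le_rfl (hνn n))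
        (hint _ _ (hνn n) (hνn (n + 1)))]
  have h2 : Tendsto (fun n : ℕ => ∫ τ in t..winR (ν + 2 * n), f τ) atTop (𝓝 ((∫ τ in t..winR ν, f τ) +
      ∑' n : ℕ, ∫ τ in winL (ν + 2 * (n + 1))..winR (ν + 2 * (n + 1)), f τ)) := by
    simp only [h1]
    exact tendsto_const_nhds.add hs.hasSum.tendsto_sum_nat
  have hN : Tendsto (fun b : ℝ => ⌊(b - winR ν) / (2 * Real.pi)⌋₊) atTop atTop :=
    tendsto_nat_floor_atTop.comp ((tendsto_atTop_add_const_right atTop (-winR ν)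
      tendsto_id).atTop_div_const hpi)
  have h3 : Tendsto (fun b : ℝ => (∫ τ in t..b, f τ) -
      ∫ τ in t..winR (ν + 2 * ⌊(b - winR ν) / (2 * Real.pi)⌋₊), f τ) atTop (𝓝 0) := by
    have h4 : Tendsto (fun b : ℝ => B / (b - 2 * Real.pi) * (2 * Real.pi)) atTop (𝓝 0) := by
      have := (tendsto_const_nhds (x := B)).div_atTop
        (tendsto_atTop_add_const_right atTop (-(2 * Real.pi)) tendsto_id)
      simpa [sub_eq_add_neg] using this.mul_const (2 * Real.pi)
    refine squeeze_zero_norm' ?_ h4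
    filter_upwards [eventually_ge_atTop (winR ν), eventually_gt_atTop (2 * Real.pi)] with b hb hb'
    obtain ⟨n, hn, hn'⟩ := exists_window_ge hb
    rw [← hn']
    rw [window_eq, winL_step] at hn
    have hbR : winR (ν + 2 * n) ≥ b - 2 * Real.pi := by
      have := hn.2
      rw [winR_add] at this ⊢
      push_cast at this
      linarith
    rw [← intervalIntegral.integral_add_adjacent_intervals (hint _ _ le_rfl (hνn n))
      (hint _ _ (hνn n) (hν.trans hb)), add_sub_cancel_left]
    refine (intervalIntegral.norm_integral_le_of_norm_le_const (C := B / (b - 2 * Real.pi))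
      fun τ hτ => ?_).trans ?_
    · rw [uIoc_of_le hn.1] at hτ
      refine (hB τ ((winR_mono (by omega)).trans hτ.1.le)).trans ?_
      have : 0 < b - 2 * Real.pi := by linarith
      have : b - 2 * Real.pi ≤ τ := hbR.le.trans hτ.1.le
      gcongr
    · have : 0 < b - 2 * Real.pi := by linarith
      have : |b - winR (ν + 2 * n)| ≤ 2 * Real.pi := by
        rw [abs_of_nonneg (by linarith [hn.1])]; linarith
      gcongr
  have h5 := h3.add (h2.comp hN)
  simpa using h5

theorem dk_le_of_mem {μ : ℕ} {τ : ℝ} (hτ0 : 0 < τ) (hτ : τ ∈ window μ) :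
    dk μ ≤ ENNReal.ofReal (2 * Real.pi / τ) := by
  rw [dk_eq]
  refine ENNReal.ofReal_le_ofReal ?_
  rw [div_le_div_iff₀ (by positivity) hτ0]
  have h := hτ.2
  have := Real.pi_pos
  have : 0 ≤ Real.pi * μ := by positivity
  linarith

/-- Telescoping. -/
theorem tsum_dk_sq_le (ν : ℕ) : ∑' n : ℕ, dk (ν + 2 * (n + 1)) ^ 2 ≤ dk ν := by
  -- This is 1/x² + 1/x ≤ 1/(x - 1) with x = μ + 2.
  have h1 : ∀ μ m : ℕ, μ + 1 ≤ m → dk m ^ 2 + dk (μ + 1) ≤ dk μ := fun μ m hm => by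
    calc dk m ^ 2 + dk (μ + 1) ≤ dk (μ + 1) ^ 2 + dk (μ + 1) := by
          gcongr; exact dk_anti hm
      _ ≤ dk μ := by
        rw [dk_eq, dk_eq, ← ENNReal.ofReal_pow (by positivity), ← ENNReal.ofReal_add (by positivity)
          (by positivity)]
        refine ENNReal.ofReal_le_ofReal ?_
        push_cast
        have : (0 : ℝ) ≤ μ := by positivity
        rw [div_pow, div_add_div _ _ (by positivity) (by positivity), div_le_div_iff₀ (by positivity)
          (by positivity)]
        have h0 : (0 : ℝ) ≤ (μ : ℝ) ^ 2 := by positivity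
        nlinarith
  refine ENNReal.tsum_le_of_sum_range_le fun n => ?_
  have h2 : ∀ n, ∑ m ∈ Finset.range n, dk (ν + 2 * (m + 1)) ^ 2 + dk (ν + n) ≤ dk ν := fun n => by
    induction n with
    | zero => simp
    | succ n ih =>
      rw [Finset.sum_range_succ, add_assoc]
      refine le_trans ?_ ih
      gcongr
      exact h1 (ν + n) _ (by omega)
  exact le_self_add.trans (h2 n)

/-! ### The Duhamel term on half-lines -/

/-- The Duhamel term over `[t, ∞)`. -/
def fullduh (α : ℤ → ℂ) (A : ℤ → ℝ → ℂ) (k : ℤ) (t : ℝ) : ℂ :=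
  ∑' q : nrS, impInt (trm (wgt α) A A A k q) t - impInt (slf α A k) t

/-- Convergence of all integrals and sums over `[t, ∞)`. -/
structure ConvAt (α : ℤ → ℂ) (A : ℤ → ℝ → ℂ) (k : ℤ) (t : ℝ) : Prop where
  trm : ∀ q : nrS, HasImproperIntegral (trm (wgt α) A A A k q) t (impInt (trm (wgt α) A A A k q) t)
  summable : Summable fun q : nrS => impInt (DeltaNLS.trm (wgt α) A A A k q) t
  slf : HasImproperIntegral (slf α A k) t (impInt (slf α A k) t)

theorem isSolution_of_convAt {σ T : ℝ} {α : ℤ → ℂ} {R : ℤ → ℝ → ℂ}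
    (hc : ∀ k t, T < t → ConvAt α (fun k t => R k t + α k) k t)
    (h : ∀ k t, T < t → R k t = sgnC σ * fullduh α (fun k t => R k t + α k) k t) :
    IsSolution σ α T R :=
  isSolution_iff.2 fun k t ht =>
    ⟨_, _, _, (hc k t ht).trm, (hc k t ht).summable.hasSum, (hc k t ht).slf, h k t ht⟩

theorem IsSolution.eq_fullduh {σ T : ℝ} {α : ℤ → ℂ} {R : ℤ → ℝ → ℂ} (h : IsSolution σ α T R) {k : ℤ}
    {t : ℝ} (ht : T < t) : R k t = sgnC σ * fullduh α (fun k t => R k t + α k) k t := by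
  obtain ⟨J, S, D, h1, h2, h3, h4⟩ := isSolution_iff.1 h k t ht
  rw [h4, fullduh, tsum_congr fun q => (h1 q).impInt_eq, h2.tsum_eq, h3.impInt_eq]

/-- The resonant part is diagonal in k, so it is controlled by sup bounds; this is why smallness of
α in ℓ^∞ rather than ℓ^p suffices near infinity. -/
theorem norm_slf_sub_le {α : ℤ → ℂ} {A A' : ℤ → ℝ → ℂ} {k : ℤ} {τ κ : ℝ} (hτ : 0 < τ)
    (hα : ‖α k‖ ≤ κ) (hA : ‖A k τ‖ ≤ κ) (hA' : ‖A' k τ‖ ≤ κ) :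
    ‖slf α A k τ - slf α A' k τ‖ ≤ 1 / τ * (4 * κ ^ 2) * ‖A k τ - A' k τ‖ := by
  have hκ : 0 ≤ κ := (norm_nonneg _).trans hα
  have h0 : ∀ f g h : ℤ → ℝ → ℂ, ‖trm (wgt α) f g h k (0, 0) τ‖ = 1 / τ * (‖f k τ‖ * ‖g k τ‖ * ‖h k τ‖) :=
    fun f g h => by
      simp only [trm, wgt, sub_zero, norm_mul, norm_phi _ hτ, norm_ex, mul_one, RCLike.norm_conj]
  rw [slf_diff]
  refine (norm_sub_le _ _).trans ((add_le_add ((norm_add_le _ _).trans (add_le_add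
    (norm_add_le _ _) le_rfl)) le_rfl).trans ?_)
  simp only [h0]
  set d := ‖A k τ - A' k τ‖
  have e : 1 / τ * (4 * κ ^ 2) * d = 1 / τ * (d * κ * κ) + 1 / τ * (κ * d * κ) + 1 / τ * (κ * κ * d) +
      1 / τ * (κ * κ * d) := by ring
  rw [e]
  have : 0 ≤ d := norm_nonneg _
  gcongr

theorem slf_const (α : ℤ → ℂ) (k : ℤ) (τ : ℝ) : slf α (fun k _ => α k) k τ = 0 := sub_self _

/-- Convergence of the Duhamel term and its decomposition into windows. -/
theorem convAt_of_windows {α : ℤ → ℂ} {A : ℤ → ℝ → ℂ} {k : ℤ} {t κ B : ℝ} {ν : ℕ} (ht : 0 < t)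
    (hν : t ≤ winR ν) (hA : ∀ k, ContinuousOn (A k) (Ici t))
    (hs : Summable fun q : nrS => ∫ τ in t..winR ν, trm (wgt α) A A A k q τ)
    (hκ : ∀ k τ, winR ν ≤ τ → ‖A k τ‖ ≤ κ) (hB : ∀ τ, winR ν ≤ τ → ‖slf α A k τ‖ ≤ B / τ ^ 2)
    (habs : ∑' n : ℕ, absT α A A A (ν + 2 * (n + 1)) k ≠ ⊤) :
    ConvAt α A k t ∧ (Summable fun n : ℕ =>
        duh α A k (winL (ν + 2 * (n + 1))) (winR (ν + 2 * (n + 1)))) ∧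
      fullduh α A k t = duh α A k t (winR ν) +
        ∑' n : ℕ, duh α A k (winL (ν + 2 * (n + 1))) (winR (ν + 2 * (n + 1))) := by
  have hpi := Real.two_pi_pos
  have hR0 : 0 < winR ν := ht.trans_le hν
  have hκ0 : 0 ≤ κ := (norm_nonneg _).trans (hκ 0 _ le_rfl)
  have hpos : ∀ x ∈ Ici t, 0 < x := fun x hx => ht.trans_le hx
  -- the double family
  have hdouble : Summable fun i : ℕ × nrS =>
      ∫ τ in winL (ν + 2 * (i.1 + 1))..winR (ν + 2 * (i.1 + 1)), trm (wgt α) A A A k i.2 τ := by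
    refine Summable.of_norm ?_
    rw [← tsum_enorm_ne_top_iff_summable_norm, ENNReal.tsum_prod' (f := fun i : ℕ × nrS =>
      ‖∫ τ in winL (ν + 2 * (i.1 + 1))..winR (ν + 2 * (i.1 + 1)), trm (wgt α) A A A k i.2 τ‖ₑ)]
    exact habs
  -- The integrand is only O(1/τ), so each integral converges merely conditionally, but its pieces
  -- over windows are absolutely summable, even jointly in q.
  have hq : ∀ q : nrS, HasImproperIntegral (trm (wgt α) A A A k q) t ((∫ τ in t..winR ν,
      trm (wgt α) A A A k q τ) + ∑' n : ℕ, ∫ τ in winL (ν + 2 * (n + 1))..winR (ν + 2 * (n + 1)),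
        trm (wgt α) A A A k q τ) := fun q => by
    refine hasImproperIntegral_of_windows hν (B := κ ^ 3) (by positivity)
      (continuousOn_trm (continuousOn_wgt α k q hpos) hA hA hA) (fun τ hτ => ?_)
      (hdouble.prod_symm.prod_factor q)
    have hτ0 : 0 < τ := hR0.trans_le hτ
    simp only [trm, wgt, norm_mul, norm_phi _ hτ0, norm_ex, mul_one, RCLike.norm_conj]
    calc _ ≤ 1 / τ * (κ * κ * κ) := by
          gcongr <;> exact hκ _ _ hτ
      _ = κ ^ 3 / τ := by ring
  have hB0 : 0 ≤ B := by
    have h := (norm_nonneg _).trans (hB _ le_rfl)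
    by_contra hneg
    exact absurd h (not_le.2 (div_neg_of_neg_of_pos (not_le.1 hneg) (by positivity)))
  have hslf : Summable fun n : ℕ => ∫ τ in winL (ν + 2 * (n + 1))..winR (ν + 2 * (n + 1)),
      slf α A k τ := by
    refine Summable.of_norm_bounded (g := fun n : ℕ => B * (2 * Real.pi) * (1 / ((n : ℝ) + 1) ^ 2)) ?_
      fun n => ?_
    · have := (summable_nat_add_iff 1).2 (Real.summable_one_div_nat_pow.2 one_lt_two)
      simp only [Nat.cast_add, Nat.cast_one] at this
      exact this.mul_left _
    · have hL : (n : ℝ) + 1 ≤ winL (ν + 2 * (n + 1)) := by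
        unfold winL
        have := Real.pi_gt_three
        push_cast
        nlinarith [(Nat.cast_nonneg ν : (0 : ℝ) ≤ ν), (Nat.cast_nonneg n : (0 : ℝ) ≤ n)]
      have hLR := winL_le_winR (ν + 2 * (n + 1))
      refine (intervalIntegral.norm_integral_le_of_norm_le_const (C := B / ((n : ℝ) + 1) ^ 2)
        fun τ hτ => ?_).trans (le_of_eq ?_)
      · rw [uIoc_of_le hLR] at hτ
        refine (hB τ ?_).trans ?_
        · refine le_trans ?_ hτ.1.le
          rw [winL_step]; exact winR_mono (by omega)
        · have : (n : ℝ) + 1 ≤ τ := hL.trans hτ.1.le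
          gcongr
      · rw [winR_eq, add_sub_cancel_left, abs_of_pos hpi]; ring
  have hD := hasImproperIntegral_of_windows hν (B := B / winR ν) (by positivity)
    (continuousOn_slf α hpos hA k) (fun τ hτ => (hB τ hτ).trans (by
      have hτ0 : 0 < τ := hR0.trans_le hτ
      rw [div_div, sq]
      gcongr)) hslf
  have hS2 : Summable fun q : nrS => ∑' n : ℕ, ∫ τ in winL (ν + 2 * (n + 1))..winR (ν + 2 * (n + 1)),
      trm (wgt α) A A A k q τ := hdouble.prod_symm.prod
  have hN2 : Summable fun n : ℕ => nrT α A A A k (winL (ν + 2 * (n + 1))) (winR (ν + 2 * (n + 1))) :=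
    hdouble.prod
  have hcomm : ∑' q : nrS, ∑' n : ℕ, ∫ τ in winL (ν + 2 * (n + 1))..winR (ν + 2 * (n + 1)),
      trm (wgt α) A A A k q τ = ∑' n : ℕ, nrT α A A A k (winL (ν + 2 * (n + 1)))
        (winR (ν + 2 * (n + 1))) :=
    (hdouble.tsum_comm (f := fun n (q : nrS) =>
      ∫ τ in winL (ν + 2 * (n + 1))..winR (ν + 2 * (n + 1)), trm (wgt α) A A A k q τ))
  have hi : ∀ q : nrS, impInt (trm (wgt α) A A A k q) t = (∫ τ in t..winR ν,
      trm (wgt α) A A A k q τ) + ∑' n : ℕ, ∫ τ in winL (ν + 2 * (n + 1))..winR (ν + 2 * (n + 1)),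
        trm (wgt α) A A A k q τ := fun q => (hq q).impInt_eq
  refine ⟨⟨fun q => by rw [hi]; exact hq q, ?_, by rw [hD.impInt_eq]; exact hD⟩, hN2.sub hslf, ?_⟩
  · simp only [hi]; exact hs.add hS2
  · rw [fullduh, hD.impInt_eq]
    simp only [hi]
    rw [hs.tsum_add hS2, hcomm]
    unfold duh
    rw [hN2.tsum_sub hslf]
    unfold nrT
    ring

/-! ### Envelopes, and the algebra of constants plus remainders. -/

theorem norm_le_toReal {z : ℂ} {X : ℝ≥0∞} (h : ‖z‖ₑ ≤ X) (hX : X ≠ ⊤) : ‖z‖ ≤ X.toReal := by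
  rw [← ofReal_norm] at h
  exact (ENNReal.ofReal_le_iff_le_toReal hX).1 h

theorem enorm_le_one_of_norm_le {z : ℂ} (h : ‖z‖ ≤ 1) : ‖z‖ₑ ≤ 1 := by
  rw [← ofReal_norm]; exact ENNReal.ofReal_le_one.2 h

/-- Represented families have `ℓᵖ` envelopes. -/
theorem RepOn.exists_envelope {s p q ε : ℝ} (H : Adm s p q ε) :
    ∃ C : ℝ≥0∞, C ≠ ⊤ ∧ 1 ≤ C ∧ ∀ {f : ℤ → ℝ → ℂ} {S : Set ℝ} {N : ℝ≥0∞}, RepOn s p f S N →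
      ∃ e : ℤ → ℝ≥0∞, lpN p e ≤ C * N ∧ ∀ k, ∀ t ∈ S, ‖f k t‖ₑ ≤ e k := by
  obtain ⟨C, hC, hCa⟩ := enorm_ev_le H
  refine ⟨C + 1, by finiteness, le_add_self, fun {f S N} ⟨a, ha, hf⟩ => ?_⟩
  refine ⟨fun k => C * sN s p (a k), ?_, fun k t ht => by rw [hf k t ht]; exact hCa a k t⟩
  calc (lpN p fun k => C * sN s p (a k)) = C * nE s p a := lpN_const_mul H.p_pos _ _
    _ ≤ (C + 1) * N := by gcongr; exact le_self_add

theorem SplitOn.mono {s p : ℝ} {f : ℤ → ℝ → ℂ} {S S' : Set ℝ} {X X' Y Y' : ℝ≥0∞}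
    (h : SplitOn s p f S X Y) (hS : S' ⊆ S) (hX : X ≤ X') (hY : Y ≤ Y') : SplitOn s p f S' X' Y' := by
  obtain ⟨c, g, hc, hg, hf⟩ := h
  exact ⟨c, g, hc.trans hX, hg.mono hS hY, fun k t ht => hf k t (hS ht)⟩

theorem SplitOn.congr {s p : ℝ} {f g : ℤ → ℝ → ℂ} {S : Set ℝ} {X Y : ℝ≥0∞}
    (h : SplitOn s p f S X Y) (hfg : ∀ k, ∀ t ∈ S, g k t = f k t) : SplitOn s p g S X Y := by
  obtain ⟨c, g, hc, hg, hf⟩ := h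
  exact ⟨c, g, hc, hg, fun k t ht => (hfg k t ht).trans (hf k t ht)⟩

theorem SplitOn.zero {s p q ε : ℝ} (H : Adm s p q ε) (S : Set ℝ) :
    SplitOn s p (fun _ _ => 0) S 0 0 :=
  ⟨fun _ => 0, fun _ _ => 0, by simp [lpN_zero H.p_pos], RepOn.zero H S, by simp⟩

theorem SplitOn.of_repOn {s p q ε : ℝ} (H : Adm s p q ε) {f : ℤ → ℝ → ℂ} {S : Set ℝ} {Y : ℝ≥0∞}
    (h : RepOn s p f S Y) : SplitOn s p f S 0 Y :=
  ⟨fun _ => 0, f, by simp [lpN_zero H.p_pos], h, by simp⟩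

theorem SplitOn.const {s p q ε : ℝ} (H : Adm s p q ε) (c : ℤ → ℂ) (S : Set ℝ) :
    SplitOn s p (fun k _ => c k) S (lpN p fun k => ‖c k‖ₑ) 0 :=
  ⟨c, fun _ _ => 0, le_rfl, RepOn.zero H S, by simp⟩

theorem SplitOn.add {s p q ε : ℝ} (H : Adm s p q ε) {f g : ℤ → ℝ → ℂ} {S : Set ℝ}
    {X X' Y Y' : ℝ≥0∞} (hf : SplitOn s p f S X Y) (hg : SplitOn s p g S X' Y') (hY : Y ≠ ⊤)
    (hY' : Y' ≠ ⊤) : SplitOn s p (fun k t => f k t + g k t) S (X + X') (Y + Y') := by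
  obtain ⟨c, u, hc, hu, hf⟩ := hf
  obtain ⟨d, v, hd, hv, hg⟩ := hg
  refine ⟨fun k => c k + d k, fun k t => u k t + v k t, ?_, hu.add H hv hY hY', fun k t ht => ?_⟩
  · exact ((lpN_mono H.p_pos fun k => enorm_add_le _ _).trans (lpN_add_le H.one_le_p _ _)).trans
      (add_le_add hc hd)
  · beta_reduce
    rw [hf k t ht, hg k t ht]; ring

theorem SplitOn.const_mul {s p q ε : ℝ} (H : Adm s p q ε) {f : ℤ → ℝ → ℂ} {S : Set ℝ}
    {X Y : ℝ≥0∞} (hf : SplitOn s p f S X Y) (z : ℂ) :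
    SplitOn s p (fun k t => z * f k t) S (‖z‖ₑ * X) (‖z‖ₑ * Y) := by
  obtain ⟨c, u, hc, hu, hf⟩ := hf
  refine ⟨fun k => z * c k, fun k t => z * u k t, ?_, hu.const_mul H z, fun k t ht => ?_⟩
  · simp only [enorm_mul]
    rw [lpN_const_mul H.p_pos]
    gcongr
  · beta_reduce
    rw [hf k t ht]; ring

theorem SplitOn.tsum {s p q ε : ℝ} (H : Adm s p q ε) {f : ℕ → ℤ → ℝ → ℂ} {S : Set ℝ}
    {X Y : ℕ → ℝ≥0∞} (hf : ∀ n, SplitOn s p (f n) S (X n) (Y n)) (hX : ∑' n, X n ≠ ⊤)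
    (hY : ∑' n, Y n ≠ ⊤) : SplitOn s p (fun k t => ∑' n, f n k t) S (∑' n, X n) (∑' n, Y n) := by
  choose c g hc hg hfg using hf
  obtain ⟨C, hC, -, hpt⟩ := RepOn.exists_lpN_le H
  refine ⟨fun k => ∑' n, c n k, fun k t => ∑' n, g n k t, ?_, RepOn.tsum H hg hY, fun k t ht => ?_⟩
  · calc (lpN p fun k => ‖∑' n, c n k‖ₑ) ≤ lpN p fun k => ∑' n, ‖c n k‖ₑ :=
          lpN_mono H.p_pos fun k => enorm_tsum_le_tsum_enorm
      _ ≤ ∑' n, lpN p fun k => ‖c n k‖ₑ := lpN_tsum_le H.one_le_p _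
      _ ≤ _ := ENNReal.tsum_le_tsum hc
  · have h1 : Summable fun n => c n k := by
      refine Summable.of_norm ?_
      rw [← tsum_enorm_ne_top_iff_summable_norm]
      exact ne_top_of_le_ne_top hX (ENNReal.tsum_le_tsum fun n =>
        (enorm_le_lpN H.p_pos (c n) k).trans (hc n))
    have h2 : Summable fun n => g n k t := by
      refine Summable.of_norm ?_
      rw [← tsum_enorm_ne_top_iff_summable_norm]
      refine ne_top_of_le_ne_top (ENNReal.mul_ne_top hC hY) ?_
      rw [← ENNReal.tsum_mul_left]
      exact ENNReal.tsum_le_tsum fun n =>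
        (enorm_le_lpN H.p_pos (fun k => g n k t) k).trans (hpt (hg n) t ht)
    simp only [hfg _ k t ht]
    exact h1.tsum_add h2

/-- Convergence of the Duhamel term of functions which decay to `α`. -/
theorem exists_convAt {s p q ε : ℝ} (H : Adm s p q ε) {ν : ℕ} {t : ℝ} {α : ℤ → ℂ} {A : ℤ → ℝ → ℂ}
    {M N : ℝ≥0∞} (ht : 0 < t) (hL : winL ν ≤ t) (hR : t ≤ winR ν) (hα : ∀ k, ‖α k‖ ≤ 1)
    (hαp : (lpN p fun k => ‖α k‖ₑ) ≠ ⊤) (hA : ∀ k, ContinuousOn (A k) (Ici t)) (hM : M ≠ ⊤)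
    (hN : N ≠ ⊤) (h1 : RepOn s p A (Icc t (winR ν)) M)
    (h2 : ∀ n : ℕ, RepOn s p (fun k t => A k t - α k) (window (ν + 2 * (n + 1)))
      (N * dk (ν + 2 * (n + 1)))) (k : ℤ) :
    ConvAt α A k t ∧ (Summable fun n : ℕ =>
        duh α A k (winL (ν + 2 * (n + 1))) (winR (ν + 2 * (n + 1)))) ∧
      fullduh α A k t = duh α A k t (winR ν) +
        ∑' n : ℕ, duh α A k (winL (ν + 2 * (n + 1))) (winR (ν + 2 * (n + 1))) := by
  obtain ⟨C, hC, -, hpt⟩ := RepOn.exists_lpN_le H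
  obtain ⟨C₂, hC₂, hS⟩ := SplitOn.exists_absT H
  set a := lpN p fun k => ‖α k‖ₑ with ha
  set L := (C * N).toReal with hLdef
  have hL0 : 0 ≤ L := ENNReal.toReal_nonneg
  have hCN : C * N ≠ ⊤ := by finiteness
  have hR0 : 0 < winR ν := ht.trans_le hR
  -- On the window of index μ the difference A - α is O(1/μ), that is O(1/τ) at time τ; the resonant
  -- integrand is then O(1/τ²).
  have hd : ∀ k τ, winR ν ≤ τ → ‖A k τ - α k‖ ≤ L * (2 * Real.pi / τ) ∧ ‖A k τ - α k‖ ≤ L := by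
    intro k τ hτ
    obtain ⟨n, hn, -⟩ := exists_window_ge hτ
    have hτ0 := hR0.trans_le hτ
    have b1 : ‖A k τ - α k‖ₑ ≤ C * N * dk (ν + 2 * (n + 1)) := by
      rw [mul_assoc]
      exact (enorm_le_lpN H.p_pos (fun k => A k τ - α k) k).trans (hpt (h2 n) τ hn)
    constructor
    · have b2 := b1.trans (mul_le_mul_right (dk_le_of_mem hτ0 hn) _)
      have := norm_le_toReal b2 (by finiteness)
      rwa [ENNReal.toReal_mul, ENNReal.toReal_ofReal (by have := Real.pi_pos; positivity)] at this
    · exact norm_le_toReal (b1.trans (mul_le_of_le_one_right' (dk_le_one _))) hCN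
  have hκ : ∀ k τ, winR ν ≤ τ → ‖A k τ‖ ≤ 1 + L := fun k τ hτ => by
    calc ‖A k τ‖ = ‖α k + (A k τ - α k)‖ := by congr 1; ring
      _ ≤ _ := (norm_add_le _ _).trans (add_le_add (hα k) (hd k τ hτ).2)
  have hα' : ∀ k, ‖α k‖ ≤ 1 + L := fun k => (hα k).trans (by linarith)
  refine convAt_of_windows ht hR hA (RepOn.summable_trm H ht hR hL le_rfl hα h1 hM k) hκ
    (B := 4 * (1 + L) ^ 2 * (L * (2 * Real.pi))) (fun τ hτ => ?_) ?_
  · have hτ0 := hR0.trans_le hτ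
    have h3 := norm_slf_sub_le (A' := fun k _ => α k) hτ0 (hα' k) (hκ k τ hτ) (hα' k)
    rw [slf_const, sub_zero] at h3
    refine h3.trans ?_
    calc _ ≤ 1 / τ * (4 * (1 + L) ^ 2) * (L * (2 * Real.pi / τ)) := by
          gcongr; exact (hd k τ hτ).1
      _ = _ := by field_simp
  -- With constant part α and remainder O(`dk μ`) every contribution carries `dk μ ^ 2`, and these
  -- squares are summable.
  · set Z := N * (a + N) * (a + N) + a * N * (a + N) + a * a * N + a * a * a with hZ
    have hb : ∀ n : ℕ, absT α A A A (ν + 2 * (n + 1)) k ≤ C₂ * Z * dk (ν + 2 * (n + 1)) ^ 2 := by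
      intro n
      set μ := ν + 2 * (n + 1) with hμ
      have hsp : SplitOn s p A (window μ) a (N * dk μ) :=
        ⟨α, fun k t => A k t - α k, le_rfl, h2 n, fun k t _ => by ring⟩
      have hNd : N * dk μ ≠ ⊤ := ENNReal.mul_ne_top hN (dk_ne_top _)
      refine (le_lpN H.p_pos _ k).trans ((hS (by omega) hα hsp hsp hsp hαp hαp hαp hNd hNd hNd).trans ?_)
      have hd1 : N * dk μ ≤ N := mul_le_of_le_one_right' (dk_le_one _)
      calc _ ≤ C₂ * dk μ * (N * dk μ * (a + N) * (a + N) + a * (N * dk μ) * (a + N) +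
              a * a * (N * dk μ) + dk μ * (a * a * a)) := by gcongr
        _ = _ := by rw [hZ]; ring
    refine ne_top_of_le_ne_top ?_ (ENNReal.tsum_le_tsum hb)
    rw [ENNReal.tsum_mul_left]
    refine ENNReal.mul_ne_top ?_ (ne_top_of_le_ne_top (dk_ne_top ν) (tsum_dk_sq_le ν))
    finiteness

/-- Lipschitz estimate for the Duhamel term over a full window. -/
theorem exists_window_sub {s p q ε : ℝ} (H : Adm s p q ε) :
    ∃ C : ℝ≥0∞, C ≠ ⊤ ∧ ∀ {μ : ℕ} {α : ℤ → ℂ} {A A' : ℤ → ℝ → ℂ} {a Y X₁ Y₁ M κ : ℝ≥0∞}, 1 ≤ μ →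
      (∀ k, ‖α k‖ ≤ 1) → SplitOn s p A (window μ) a Y → SplitOn s p A' (window μ) a Y →
      SplitOn s p (fun k t => A k t - A' k t) (window μ) X₁ Y₁ → a + Y ≤ M → M ≠ ⊤ → X₁ ≠ ⊤ →
      Y₁ ≠ ⊤ → κ ≠ ⊤ → (∀ k, ‖α k‖ₑ ≤ κ) → (∀ k, ∀ τ ∈ window μ, ‖A k τ‖ₑ ≤ κ) →
      (∀ k, ∀ τ ∈ window μ, ‖A' k τ‖ₑ ≤ κ) →
      (lpN p fun k => ‖duh α A k (winL μ) (winR μ) - duh α A' k (winL μ) (winR μ)‖ₑ) ≤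
        C * dk μ * (Y₁ * M ^ 2 + X₁ * Y * M + dk μ * X₁ * M ^ 2 + κ ^ 2 * (X₁ + Y₁)) := by
  obtain ⟨C, hC, hS⟩ := SplitOn.exists_absT H
  obtain ⟨C', hC', hC'1, henv⟩ := RepOn.exists_envelope H
  refine ⟨9 * C + 16 * C', by finiteness, ?_⟩
  intro μ α A A' a Y X₁ Y₁ M κ hμ hα hA hA' hD hM hMt hX₁ hY₁ hκt hκα hκ hκ'
  have haM : a ≤ M := le_self_add.trans hM
  have hYM : Y ≤ M := le_add_self.trans hM
  have hat := ne_top_of_le_ne_top hMt haM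
  have hYt := ne_top_of_le_ne_top hMt hYM
  have hL0 := winL_pos hμ
  have hLR := winL_le_winR μ
  have hR0 := hL0.trans_le hLR
  have cA := continuousOn_repOn H (hA.repOn H hat hYt) (by finiteness)
  have cA' := continuousOn_repOn H (hA'.repOn H hat hYt) (by finiteness)
  have cD : ∀ k, ContinuousOn (fun t => A k t - A' k t) (uIcc (winL μ) (winR μ)) := fun k =>
    (cA k).sub (cA' k)
  -- The three non-resonant contributions: the remainder of the difference, its constant part
  -- against a remainder, and its constant part against constants, which has the extra factor `dk
  -- μ`.
  set Z := Y₁ * M ^ 2 + X₁ * Y * M + dk μ * X₁ * M ^ 2 with hZ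
  have hdt := dk_ne_top μ
  -- Each of the next three bounds is padded with non-negative terms up to the same multiple of Z.
  have t1 : lpN p (absT α (fun k t => A k t - A' k t) A A μ) ≤ 3 * (C * dk μ * Z) := by
    refine (hS hμ hα hD hA hA hX₁ hat hat hY₁ hYt hYt).trans ?_
    calc _ ≤ C * dk μ * (Y₁ * M * M + X₁ * Y * M + X₁ * M * Y + dk μ * (X₁ * M * M)) := by gcongr
      _ ≤ C * dk μ * (Y₁ * M * M + X₁ * Y * M + X₁ * M * Y + dk μ * (X₁ * M * M)) +
          C * dk μ * (2 * (Y₁ * M * M) + X₁ * Y * M + 2 * (dk μ * (X₁ * M * M))) := le_self_add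
      _ = _ := by rw [hZ]; ring
  have t2 : lpN p (absT α A' (fun k t => A k t - A' k t) A μ) ≤ 3 * (C * dk μ * Z) := by
    refine (hS hμ hα hA' hD hA hat hX₁ hat hYt hY₁ hYt).trans ?_
    calc _ = C * dk μ * (Y * Y₁ * (a + Y) + Y * X₁ * (a + Y) + a * Y₁ * (a + Y) + a * X₁ * Y +
            dk μ * (a * X₁ * a)) := by ring
      _ ≤ C * dk μ * (M * Y₁ * M + Y * X₁ * M + M * Y₁ * M + M * X₁ * Y + dk μ * (M * X₁ * M)) := by
          gcongr
      _ ≤ C * dk μ * (M * Y₁ * M + Y * X₁ * M + M * Y₁ * M + M * X₁ * Y + dk μ * (M * X₁ * M)) +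
          C * dk μ * (Y₁ * M * M + X₁ * Y * M + 2 * (dk μ * (X₁ * M * M))) := le_self_add
      _ = _ := by rw [hZ]; ring
  have t3 : lpN p (absT α A' A' (fun k t => A k t - A' k t) μ) ≤ 3 * (C * dk μ * Z) := by
    refine (hS hμ hα hA' hA' hD hat hat hX₁ hYt hYt hY₁).trans ?_
    calc _ = C * dk μ * (Y * (a + Y) * X₁ + Y * (a + Y) * Y₁ + a * Y * X₁ + a * Y * Y₁ + a * a * Y₁ +
            dk μ * (a * a * X₁)) := by ring
      _ ≤ C * dk μ * (Y * M * X₁ + M * M * Y₁ + M * Y * X₁ + M * M * Y₁ + M * M * Y₁ +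
            dk μ * (M * M * X₁)) := by gcongr
      _ ≤ C * dk μ * (Y * M * X₁ + M * M * Y₁ + M * Y * X₁ + M * M * Y₁ + M * M * Y₁ +
            dk μ * (M * M * X₁)) +
          C * dk μ * (X₁ * Y * M + 2 * (dk μ * (X₁ * M * M))) := le_self_add
      _ = _ := by rw [hZ]; ring
  have hZt : 3 * (C * dk μ * Z) ≠ ⊤ := by rw [hZ]; finiteness
  have hsm : ∀ {f g h : ℤ → ℝ → ℂ} {B : ℝ≥0∞}, lpN p (absT α f g h μ) ≤ B → B ≠ ⊤ → ∀ k,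
      Summable fun q : nrS => ∫ τ in winL μ..winR μ, trm (wgt α) f g h k q τ := fun hB hBt k => by
    refine Summable.of_norm ?_
    rw [← tsum_enorm_ne_top_iff_summable_norm]
    exact ne_top_of_le_ne_top hBt ((le_lpN H.p_pos _ k).trans hB)
  have hdM : dk μ * M ≠ ⊤ := by finiteness
  have s4 := hsm (hS hμ hα hA hA hA hat hat hat hYt hYt hYt) (by finiteness)
  have s5 := hsm (hS hμ hα hA' hA' hA' hat hat hat hYt hYt hYt) (by finiteness)
  obtain ⟨c, g, hc, hg, hcg⟩ := hD
  obtain ⟨e, he, hge⟩ := henv hg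
  have hek : ∀ k, ‖c k‖ₑ + e k ≠ ⊤ := fun k => by
    have e1 : ‖c k‖ₑ ≠ ⊤ := enorm_ne_top
    have e2 : e k ≠ ⊤ := ne_top_of_le_ne_top (by finiteness) ((le_lpN H.p_pos e k).trans he)
    finiteness
  -- The length 2π, the factor 1/(πμ) and the four terms of size κ² give 8κ²/μ. The envelope e makes
  -- the bound uniform in time before the ℓ^p norm in k is taken.
  have hslf : ∀ k, ‖(∫ τ in winL μ..winR μ, slf α A k τ) - ∫ τ in winL μ..winR μ, slf α A' k τ‖ₑ ≤
      16 * dk μ * κ ^ 2 * (‖c k‖ₑ + e k) := fun k => by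
    have hpi := Real.two_pi_pos
    have hμ0 : (0 : ℝ) < μ := by exact_mod_cast hμ
    have hb : ‖(∫ τ in winL μ..winR μ, slf α A k τ) - ∫ τ in winL μ..winR μ, slf α A' k τ‖ ≤
        8 / μ * κ.toReal ^ 2 * (‖c k‖ₑ + e k).toReal := by
      rw [← intervalIntegral.integral_sub (intervalIntegrable_slf α hL0 hR0 cA k)
        (intervalIntegrable_slf α hL0 hR0 cA' k)]
      refine (intervalIntegral.norm_integral_le_of_norm_le_const
        (C := 1 / winL μ * (4 * κ.toReal ^ 2) * (‖c k‖ₑ + e k).toReal) fun τ hτ => ?_).trans (le_of_eq ?_)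
      · rw [uIoc_of_le hLR] at hτ
        have hτw : τ ∈ window μ := ⟨hτ.1.le, hτ.2⟩
        have hLτ : winL μ ≤ τ := hτ.1.le
        have hDk : ‖A k τ - A' k τ‖ ≤ (‖c k‖ₑ + e k).toReal := by
          refine norm_le_toReal ?_ (hek k)
          rw [show A k τ - A' k τ = c k + g k τ from hcg k τ hτw]
          exact (enorm_add_le _ _).trans (add_le_add le_rfl (hge k τ hτw))
        refine (norm_slf_sub_le (hL0.trans_le hLτ) (norm_le_toReal (hκα k) hκt)
          (norm_le_toReal (hκ k τ hτw) hκt) (norm_le_toReal (hκ' k τ hτw) hκt)).trans ?_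
        gcongr
      · rw [winR_eq, add_sub_cancel_left, abs_of_pos hpi, winL]
        field_simp
        ring
    rw [← ofReal_norm]
    calc ENNReal.ofReal ‖(∫ τ in winL μ..winR μ, slf α A k τ) - ∫ τ in winL μ..winR μ, slf α A' k τ‖
        ≤ ENNReal.ofReal (8 / μ * κ.toReal ^ 2 * (‖c k‖ₑ + e k).toReal) :=
          ENNReal.ofReal_le_ofReal hb
      _ = ENNReal.ofReal (8 / μ) * κ ^ 2 * (‖c k‖ₑ + e k) := by
          rw [ENNReal.ofReal_mul (by positivity), ENNReal.ofReal_mul (by positivity),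
            ENNReal.ofReal_toReal (hek k), ENNReal.ofReal_pow ENNReal.toReal_nonneg,
            ENNReal.ofReal_toReal hκt]
      _ ≤ ENNReal.ofReal (2 * 8) * dk μ * κ ^ 2 * (‖c k‖ₑ + e k) := by
          gcongr; exact ofReal_div_le_dk hμ (by norm_num)
      _ = _ := by norm_num
  have hpt : ∀ k, ‖duh α A k (winL μ) (winR μ) - duh α A' k (winL μ) (winR μ)‖ₑ ≤
      absT α (fun k t => A k t - A' k t) A A μ k + absT α A' (fun k t => A k t - A' k t) A μ k +
      absT α A' A' (fun k t => A k t - A' k t) μ k + 16 * dk μ * κ ^ 2 * (‖c k‖ₑ + e k) := fun k => by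
    rw [duh_sub_duh hL0 hR0 cA cA' k (hsm t1 hZt k) (hsm t2 hZt k) (hsm t3 hZt k) (s4 k) (s5 k),
      ← integral_slf_diff α hL0 hR0 cA cA' k]
    refine enorm_sub_le.trans (add_le_add ?_ (hslf k))
    refine (enorm_add_le _ _).trans (add_le_add ((enorm_add_le _ _).trans (add_le_add ?_ ?_)) ?_) <;>
    exact enorm_tsum_le_tsum_enorm
  have hce : (lpN p fun k => ‖c k‖ₑ + e k) ≤ C' * (X₁ + Y₁) := by
    refine (lpN_add_le H.one_le_p _ _).trans ?_
    calc _ ≤ X₁ + C' * Y₁ := add_le_add hc he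
      _ ≤ C' * X₁ + C' * Y₁ := by gcongr; exact le_mul_of_one_le_left' hC'1
      _ = _ := by ring
  calc _ ≤ _ := lpN_mono H.p_pos hpt
    _ ≤ lpN p (absT α (fun k t => A k t - A' k t) A A μ) +
        lpN p (absT α A' (fun k t => A k t - A' k t) A μ) +
        lpN p (absT α A' A' (fun k t => A k t - A' k t) μ) +
        lpN p fun k => 16 * dk μ * κ ^ 2 * (‖c k‖ₑ + e k) := by
        refine (lpN_add_le H.one_le_p _ _).trans ?_
        gcongr
        refine (lpN_add_le H.one_le_p _ _).trans ?_
        gcongr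
        exact lpN_add_le H.one_le_p _ _
    _ ≤ 3 * (C * dk μ * Z) + 3 * (C * dk μ * Z) + 3 * (C * dk μ * Z) +
        16 * dk μ * κ ^ 2 * (C' * (X₁ + Y₁)) := by
        rw [lpN_const_mul H.p_pos]
        gcongr
    _ ≤ 3 * (C * dk μ * Z) + 3 * (C * dk μ * Z) + 3 * (C * dk μ * Z) +
        16 * dk μ * κ ^ 2 * (C' * (X₁ + Y₁)) + (9 * C * dk μ * (κ ^ 2 * (X₁ + Y₁)) +
        16 * C' * dk μ * Z) := le_self_add
    _ = _ := by ring

/-! ### Decaying families near infinity -/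

/-- On the windows of index `ν ≥ ν₁` the family is the sum of constants and a remainder of relative
size `ρ`, both decaying in `ν`. -/
def TailRep (s p : ℝ) (ρ : ℝ≥0∞) (ν₁ : ℕ) (N : ℝ≥0∞) (f : ℤ → ℝ → ℂ) : Prop :=
  ∀ ν, ν₁ ≤ ν → SplitOn s p f (window ν) (N * dk ν) (ρ * (N * dk ν))

theorem exists_window_ge_index {ν₁ : ℕ} {t : ℝ} (h : winL ν₁ ≤ t) :
    ∃ ν, ν₁ ≤ ν ∧ winL ν ≤ t ∧ t < winR ν := by
  have hpi := Real.pi_pos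
  have ht : 0 ≤ t := le_trans (by unfold winL; positivity) h
  have h1 := Nat.floor_le (a := t / Real.pi) (by positivity)
  have h2 := Nat.lt_floor_add_one (t / Real.pi)
  rw [le_div_iff₀ hpi] at h1
  rw [div_lt_iff₀ hpi] at h2
  rcases le_total ν₁ ⌊t / Real.pi⌋₊ with h3 | h3
  · exact ⟨_, h3, by unfold winL; linarith, by unfold winR; linarith⟩
  · refine ⟨ν₁, le_rfl, h, ?_⟩
    have h4 : ((⌊t / Real.pi⌋₊ : ℕ) : ℝ) ≤ ν₁ := by exact_mod_cast h3
    unfold winR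
    nlinarith

theorem window_subset_Ici {ν₁ ν : ℕ} (h : ν₁ ≤ ν) : window ν ⊆ Ici (winL ν₁) := fun _ ht =>
  (winL_mono h).trans ht.1

namespace TailRep

variable {s p q ε : ℝ} {ρ N : ℝ≥0∞} {ν₁ : ℕ} {f : ℤ → ℝ → ℂ}

theorem mono {N' : ℝ≥0∞} (h : TailRep s p ρ ν₁ N f) (hN : N ≤ N') : TailRep s p ρ ν₁ N' f :=
  fun ν hν => (h ν hν).mono Subset.rfl (by gcongr) (by gcongr)

theorem repOn (H : Adm s p q ε) (hρ : ρ ≤ 1) (hN : N ≠ ⊤) (h : TailRep s p ρ ν₁ N f) {ν : ℕ}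
    (hν : ν₁ ≤ ν) : RepOn s p f (window ν) (2 * N * dk ν) := by
  have hd := dk_ne_top ν
  have hρt := ne_top_of_le_ne_top ENNReal.one_ne_top hρ
  refine ((h ν hν).repOn H (by finiteness) (by finiteness)).mono Subset.rfl ?_
  calc N * dk ν + ρ * (N * dk ν) ≤ N * dk ν + 1 * (N * dk ν) := by gcongr
    _ = _ := by ring

theorem gauge (H : Adm s p q ε) (hρ : ρ ≤ 1) (ν₁ : ℕ) :
    Gauge (Ici (winL ν₁)) (TailRep s p ρ ν₁) where
  mono h hN := h.mono hN
  congr h hfg ν hν := (h ν hν).congr fun k t ht => hfg k t (window_subset_Ici hν ht)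
  zero ν _ := by simpa using SplitOn.zero H (window ν)
  add hf hg hN hN' ν hν := by
    have hd := dk_ne_top ν
    have hρt := ne_top_of_le_ne_top ENNReal.one_ne_top hρ
    have := (hf ν hν).add H (hg ν hν) (by finiteness) (by finiteness)
    rwa [← mul_add, ← add_mul] at this
  tsum {N f} hf hN ν hν := by
    have hd := dk_ne_top ν
    have hρt := ne_top_of_le_ne_top ENNReal.one_ne_top hρ
    have := SplitOn.tsum H (fun n => hf n ν hν)
      (by rw [ENNReal.tsum_mul_right]; finiteness)
      (by rw [ENNReal.tsum_mul_left, ENNReal.tsum_mul_right]; finiteness)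
    rwa [ENNReal.tsum_mul_left, ENNReal.tsum_mul_right] at this
  pt := by
    obtain ⟨C, hC, -, hpt⟩ := RepOn.exists_lpN_le H
    refine ⟨C * 2 + 1, by finiteness, fun {N f} hf k t ht => ?_⟩
    rcases eq_or_ne N ⊤ with rfl | hN
    · rw [ENNReal.mul_top (by simp)]; exact le_top
    obtain ⟨ν, hν, h1, h2⟩ := exists_window_ge_index ht
    refine (enorm_le_lpN H.p_pos (fun k => f k t) k).trans
      ((hpt (hf.repOn H hρ hN hν) t ⟨h1, h2.le⟩).trans ?_)
    calc C * (2 * N * dk ν) ≤ C * (2 * N * 1) := by gcongr; exact dk_le_one ν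
      _ ≤ C * (2 * N * 1) + N := le_self_add
      _ = _ := by ring

/-- Because of the overlap, every later time is interior to an admissible window unless it lies in
the first one, where continuity relative to the half-line is enough. -/
theorem continuousOn (H : Adm s p q ε) (hρ : ρ ≤ 1) (hN : N ≠ ⊤) (h : TailRep s p ρ ν₁ N f) (k : ℤ) :
    ContinuousOn (f k) (Ici (winL ν₁)) := by
  have hc : ∀ ν, ν₁ ≤ ν → ContinuousOn (f k) (window ν) := fun ν hν =>
    (h.repOn H hρ hN hν).continuousOn H (ENNReal.mul_ne_top (by finiteness) (dk_ne_top ν)) k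
  intro t ht
  obtain ⟨ν, hν, h1, h2⟩ := exists_window_ge_index ht
  rcases eq_or_lt_of_le hν with rfl | hν'
  · refine (hc ν₁ le_rfl t ⟨h1, h2.le⟩).mono_of_mem_nhdsWithin ?_
    filter_upwards [self_mem_nhdsWithin, mem_nhdsWithin_of_mem_nhds (Iio_mem_nhds h2)] with x hx hx'
    exact ⟨hx, le_of_lt hx'⟩
  · obtain ⟨μ, rfl⟩ : ∃ μ, ν = μ + 1 := ⟨ν - 1, by omega⟩
    have h3 : winL μ < t := lt_of_lt_of_le (by unfold winL; push_cast; nlinarith [Real.pi_pos]) h1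
    have h4 : winL (μ + 1) < winR μ := by unfold winL winR; push_cast; nlinarith [Real.pi_pos]
    rcases lt_or_ge t (winR μ) with h5 | h5
    · exact ((hc μ (by omega)).continuousAt (Icc_mem_nhds h3 h5)).continuousWithinAt
    · exact ((hc (μ + 1) (by omega)).continuousAt
        (Icc_mem_nhds (h4.trans_le h5) h2)).continuousWithinAt

/-- The Duhamel term of a decaying family. -/
theorem convAt (H : Adm s p q ε) (hρ : ρ ≤ 1) (hN : N ≠ ⊤) (h : TailRep s p ρ ν₁ N f)
    (hν₁ : 1 ≤ ν₁) {α : ℤ → ℂ} (hα : ∀ k, ‖α k‖ ≤ 1) (hαp : (lpN p fun k => ‖α k‖ₑ) ≠ ⊤) {ν : ℕ}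
    (hν : ν₁ ≤ ν) {t : ℝ} (ht : t ∈ window ν) (k : ℤ) :
    ConvAt α (fun k t => f k t + α k) k t ∧ (Summable fun n : ℕ =>
        duh α (fun k t => f k t + α k) k (winL (ν + 2 * (n + 1))) (winR (ν + 2 * (n + 1)))) ∧
      fullduh α (fun k t => f k t + α k) k t = duh α (fun k t => f k t + α k) k t (winR ν) +
        ∑' n : ℕ, duh α (fun k t => f k t + α k) k (winL (ν + 2 * (n + 1)))
          (winR (ν + 2 * (n + 1))) := by
  have hd := dk_ne_top ν
  have hL0 := winL_pos (hν₁.trans hν)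
  refine exists_convAt H (M := 2 * N * dk ν + lpN p fun k => ‖α k‖ₑ) (N := 2 * N)
    (hL0.trans_le ht.1) ht.1 ht.2 hα hαp (fun k => ?_) (by finiteness) (by finiteness) ?_
    (fun n => ?_) k
  · exact ((h.continuousOn H hρ hN k).mono (Ici_subset_Ici.2 ((winL_mono hν).trans ht.1))).add
      continuousOn_const
  · exact ((h.repOn H hρ hN hν).mono (Icc_subset_Icc ht.1 le_rfl) le_rfl).add H
      (RepOn.const H α _) (by finiteness) hαp
  · exact (h.repOn H hρ hN (by omega : ν₁ ≤ ν + 2 * (n + 1))).congr fun k t _ => add_sub_cancel_right _ _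

/-- Contraction estimate for the Duhamel term of decaying families. -/
theorem exists_fullduh_sub (H : Adm s p q ε) : ∃ C : ℝ≥0∞, C ≠ ⊤ ∧
    ∀ {α : ℤ → ℂ} {ν₁ : ℕ} {ρ X N a δ M : ℝ≥0∞} {r r' : ℤ → ℝ → ℂ} {c : ℂ}, 1 ≤ ν₁ →
      (∀ k, ‖α k‖ ≤ 1) → (∀ k, ‖α k‖ₑ ≤ δ) → (lpN p fun k => ‖α k‖ₑ) ≤ a → a ≠ ⊤ → ρ ≤ 1 →
      X ≠ ⊤ → N ≠ ⊤ → δ ≠ ⊤ → ‖c‖ₑ ≤ 1 → TailRep s p ρ ν₁ X r → TailRep s p ρ ν₁ X r' →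
      TailRep s p ρ ν₁ N (fun k t => r k t - r' k t) → a + 2 * X * dk ν₁ ≤ M → M ≠ ⊤ →
      C * (M ^ 2 * dk ν₁) ≤ ρ →
      C * (ρ * M ^ 2 + X * dk ν₁ * M + dk ν₁ * M ^ 2 + (δ + X * dk ν₁) ^ 2) ≤ 1 →
      TailRep s p ρ ν₁ (N / 2) (fun k t => c * fullduh α (fun k t => r k t + α k) k t -
        c * fullduh α (fun k t => r' k t + α k) k t) := by
  obtain ⟨C₁, hC₁, hwin⟩ := exists_window_sub H
  obtain ⟨C₂, hC₂, hin⟩ := RepOn.exists_duh_sub H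
  obtain ⟨C₃, hC₃, hC₃1, hpt⟩ := RepOn.exists_lpN_le H
  -- 64 = 16 · 2 · 2: the oscillation constant of a window, the factor 2 in `TailRep.repOn`, and the
  -- halving. The other summand is twice the constant of θ.
  refine ⟨64 * C₂ + 16 * C₁ * C₃ ^ 2, by finiteness, ?_⟩
  intro α ν₁ ρ X N a δ M r r' c hν₁ hα hαδ hαa hat hρ hX hN hδ hc hr hr' hrr hM hMt hsm1 hsm2
  have hαp := ne_top_of_le_ne_top hat hαa
  have hρt := ne_top_of_le_ne_top ENNReal.one_ne_top hρ
  set A : ℤ → ℝ → ℂ := fun k t => r k t + α k with hA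
  set A' : ℤ → ℝ → ℂ := fun k t => r' k t + α k with hA'
  have hAA : ∀ k t, A k t - A' k t = r k t - r' k t := fun k t => by simp only [hA, hA']; ring
  have hdle : ∀ {μ}, ν₁ ≤ μ → dk μ ≤ dk ν₁ := fun h => dk_anti h
  -- single windows
  set θ := C₁ * C₃ ^ 2 * 8 * (ρ * M ^ 2 + X * dk ν₁ * M + dk ν₁ * M ^ 2 + (δ + X * dk ν₁) ^ 2) with hθ
  have hθ1 : θ ≤ 2⁻¹ := by
    rw [ENNReal.le_inv_iff_mul_le]
    refine le_trans ?_ hsm2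
    calc θ * 2 = 16 * C₁ * C₃ ^ 2 * (ρ * M ^ 2 + X * dk ν₁ * M + dk ν₁ * M ^ 2 +
          (δ + X * dk ν₁) ^ 2) := by rw [hθ]; ring
      _ ≤ _ := by gcongr; exact le_add_self
  have hW : ∀ μ, ν₁ ≤ μ → (lpN p fun k => ‖duh α A k (winL μ) (winR μ) -
      duh α A' k (winL μ) (winR μ)‖ₑ) ≤ θ * N * dk μ ^ 2 := by
    intro μ hμ
    have hdt := dk_ne_top μ
    have hdt₁ := dk_ne_top ν₁
    have hsp : ∀ {f : ℤ → ℝ → ℂ}, TailRep s p ρ ν₁ X f →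
        SplitOn s p (fun k t => f k t + α k) (window μ) (X * dk μ + a) (X * dk μ) := fun hf => by
      refine ((hf μ hμ).add H (SplitOn.const H α _) (by finiteness) (by simp)).mono Subset.rfl
        (by gcongr) ?_
      rw [add_zero]
      exact mul_le_of_le_one_left' hρ
    have hκ : ∀ {f : ℤ → ℝ → ℂ}, TailRep s p ρ ν₁ X f → ∀ k, ∀ τ ∈ window μ,
        ‖f k τ + α k‖ₑ ≤ 2 * C₃ * (δ + X * dk ν₁) := fun {f} hf k τ hτ => by
      have h1 := (enorm_le_lpN H.p_pos (fun k => f k τ) k).trans (hpt (hf.repOn H hρ hX hμ) τ hτ)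
      calc ‖f k τ + α k‖ₑ ≤ C₃ * (2 * X * dk μ) + δ := (enorm_add_le _ _).trans (add_le_add h1 (hαδ k))
        _ ≤ C₃ * (2 * X * dk ν₁) + C₃ * δ := by
            gcongr
            · exact hdle hμ
            · exact le_mul_of_one_le_left' hC₃1
        _ ≤ C₃ * (2 * X * dk ν₁) + C₃ * δ + C₃ * δ := le_self_add
        _ = _ := by ring
    refine (hwin (hν₁.trans hμ) hα (hsp hr) (hsp hr') ((hrr μ hμ).congr fun k t _ => hAA k t)
      (M := M) (κ := 2 * C₃ * (δ + X * dk ν₁)) ?_ hMt (by finiteness) (by finiteness)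
      (by finiteness) (fun k => ?_) (hκ hr) (hκ hr')).trans ?_
    · refine le_trans ?_ hM
      calc X * dk μ + a + X * dk μ = a + 2 * X * dk μ := by ring
        _ ≤ _ := by gcongr; exact hdle hμ
    · calc ‖α k‖ₑ ≤ δ + X * dk ν₁ := (hαδ k).trans le_self_add
        _ ≤ C₃ * (δ + X * dk ν₁) := le_mul_of_one_le_left' hC₃1
        _ ≤ C₃ * (δ + X * dk ν₁) + C₃ * (δ + X * dk ν₁) := le_self_add
        _ = _ := by ring
    · calc _ ≤ C₁ * dk μ * (ρ * (N * dk μ) * M ^ 2 + N * dk μ * (X * dk ν₁) * M +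
            dk ν₁ * (N * dk μ) * M ^ 2 + (2 * C₃ * (δ + X * dk ν₁)) ^ 2 * (N * dk μ + 1 * (N * dk μ))) := by
            gcongr
            · exact hdle hμ
            · exact hdle hμ
        _ = N * dk μ ^ 2 * (C₁ * (1 * (ρ * M ^ 2 + X * dk ν₁ * M + dk ν₁ * M ^ 2)) +
              C₁ * C₃ ^ 2 * 8 * (δ + X * dk ν₁) ^ 2) := by ring
        _ ≤ N * dk μ ^ 2 * (C₁ * (C₃ ^ 2 * 8 * (ρ * M ^ 2 + X * dk ν₁ * M + dk ν₁ * M ^ 2)) +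
              C₁ * C₃ ^ 2 * 8 * (δ + X * dk ν₁) ^ 2) := by
            gcongr
            exact one_le_mul (one_le_pow₀ hC₃1) (by norm_num)
        _ = _ := by rw [hθ]; ring
  intro ν hν
  have hdt := dk_ne_top ν
  have hν0 : 1 ≤ ν := hν₁.trans hν
  have hL0 := winL_pos hν0
  have hLR := winL_le_winR ν
  have hrepA : ∀ {f : ℤ → ℝ → ℂ}, TailRep s p ρ ν₁ X f →
      RepOn s p (fun k t => f k t + α k) (window ν) M := fun hf => by
    refine ((hf.repOn H hρ hX hν).add H (RepOn.const H α _) (by finiteness) hαp).mono Subset.rfl ?_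
    refine le_trans ?_ hM
    rw [add_comm]
    gcongr
    exact hdle hν
  have haM : a ≤ M := le_self_add.trans hM
  have g0 := hin hL0 hLR le_rfl le_rfl hα (hαa.trans haM) (hrepA hr) (hrepA hr')
    ((hrr.repOn H hρ hN hν).congr fun k t _ => hAA k t) hMt (by finiteness)
  -- For t in the window ν, the windows ν + 2, ν + 4, … contribute a constant, while the rest of the
  -- window ν supplies the remainder. The former is small through θ, the latter through the extra
  -- `dk ν` against ρ.
  refine ⟨fun k => c * ∑' n : ℕ, (duh α A k (winL (ν + 2 * (n + 1))) (winR (ν + 2 * (n + 1))) -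
    duh α A' k (winL (ν + 2 * (n + 1))) (winR (ν + 2 * (n + 1)))),
    fun k t => c * (duh α A k (clamp (winL ν) (winR ν) t) (winR ν) -
      duh α A' k (clamp (winL ν) (winR ν) t) (winR ν)), ?_, ?_, fun k t ht => ?_⟩
  · simp only [enorm_mul]
    rw [lpN_const_mul H.p_pos]
    calc _ ≤ 1 * ∑' n : ℕ, θ * N * dk (ν + 2 * (n + 1)) ^ 2 := by
          gcongr
          refine (lpN_mono H.p_pos fun k => enorm_tsum_le_tsum_enorm).trans
            ((lpN_tsum_le H.one_le_p _).trans ?_)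
          exact ENNReal.tsum_le_tsum fun n => hW _ (by omega)
      _ ≤ 1 * (2⁻¹ * N * dk ν) := by
          rw [ENNReal.tsum_mul_left]
          gcongr
          exact tsum_dk_sq_le ν
      _ = N / 2 * dk ν := by rw [one_mul, ENNReal.div_eq_inv_mul]
  · refine (g0.const_mul H c).mono Subset.rfl ?_
    have e : ρ * (N / 2 * dk ν) = ρ * (N * dk ν) / 2 := by
      rw [ENNReal.div_eq_inv_mul, ENNReal.div_eq_inv_mul]; ring
    rw [e, ENNReal.le_div_iff_mul_le (by simp) (by simp)]
    have hosc : ENNReal.ofReal (oscB ε (winL ν) (winR ν)) ≤ ENNReal.ofReal (2 * 8) * dk ν :=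
      (ENNReal.ofReal_le_ofReal (oscB_window_le H.pos H.eps_lt_one hν0)).trans
        (ofReal_div_le_dk hν0 (by norm_num))
    have h16 : ENNReal.ofReal (2 * 8) = 16 := by norm_num
    rw [h16] at hosc
    calc _ ≤ 1 * (C₂ * (16 * dk ν₁) * (M ^ 2 * (2 * N * dk ν))) * 2 := by
          gcongr
          exact hosc.trans (by gcongr; exact hdle hν)
      _ = 64 * C₂ * (M ^ 2 * dk ν₁) * (N * dk ν) := by ring
      _ ≤ ρ * (N * dk ν) := by
          gcongr
          refine le_trans ?_ hsm1
          gcongr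
          exact le_self_add
  · obtain ⟨-, s1, e1⟩ := hr.convAt H hρ hX hν₁ hα hαp hν ht k
    obtain ⟨-, s2, e2⟩ := hr'.convAt H hρ hX hν₁ hα hαp hν ht k
    rw [← hA] at e1 s1
    rw [← hA'] at e2 s2
    beta_reduce
    rw [e1, e2, s1.tsum_sub s2, show clamp (winL ν) (winR ν) t = t from clamp_of_mem ht]
    ring

/-- The Duhamel term of the asymptotic state. -/
theorem exists_fullduh_zero (H : Adm s p q ε) : ∃ C : ℝ≥0∞, C ≠ ⊤ ∧
    ∀ {α : ℤ → ℂ} {ν₁ : ℕ} {ρ a X : ℝ≥0∞} {c : ℂ}, 1 ≤ ν₁ → (∀ k, ‖α k‖ ≤ 1) →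
      (lpN p fun k => ‖α k‖ₑ) ≤ a → a ≠ ⊤ → ρ ≤ 1 → ‖c‖ₑ ≤ 1 → C * a ^ 3 ≤ ρ * X →
      TailRep s p ρ ν₁ X (fun k t => c * fullduh α (fun k _ => 0 + α k) k t) := by
  obtain ⟨C₁, hC₁, hwin⟩ := SplitOn.exists_absT H
  obtain ⟨C₂, hC₂, hin⟩ := RepOn.exists_duh H
  refine ⟨C₁ + 16 * C₂, by finiteness, ?_⟩
  intro α ν₁ ρ a X c hν₁ hα hαa hat hρ hc hsm ν hν
  have hαp := ne_top_of_le_ne_top hat hαa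
  have hν0 : 1 ≤ ν := hν₁.trans hν
  have hL0 := winL_pos hν0
  have hLR := winL_le_winR ν
  have hz : TailRep s p ρ ν₁ 0 (fun _ _ => 0) := (TailRep.gauge H hρ ν₁).zero
  simp only [zero_add]
  have hW : ∀ μ, ν₁ ≤ μ → (lpN p fun k => ‖duh α (fun k _ => α k) k (winL μ) (winR μ)‖ₑ) ≤
      C₁ * a ^ 3 * dk μ ^ 2 := fun μ hμ => by
    have hsp := (SplitOn.const H α (window μ)).mono Subset.rfl hαa le_rfl
    have h1 := hwin (hν₁.trans hμ) hα hsp hsp hsp hat hat hat (by simp) (by simp) (by simp)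
    refine le_trans (lpN_mono H.p_pos fun k => ?_) (h1.trans (le_of_eq (by ring)))
    simp only [duh, slf_const, intervalIntegral.integral_zero, sub_zero]
    exact enorm_tsum_le_tsum_enorm
  have g0 := hin hL0 hLR le_rfl le_rfl hα hαa ((RepOn.const H α (Icc (winL ν) (winR ν))).mono
    Subset.rfl hαa) le_rfl hat
  -- The same splitting. For A = α the resonant part vanishes, and the later windows contain only
  -- terms with three constants.
  refine ⟨fun k => c * ∑' n : ℕ, duh α (fun k _ => α k) k (winL (ν + 2 * (n + 1)))
    (winR (ν + 2 * (n + 1))), fun k t => c * duh α (fun k _ => α k) k (clamp (winL ν) (winR ν) t)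
      (winR ν), ?_, ?_, fun k t ht => ?_⟩
  · simp only [enorm_mul]
    rw [lpN_const_mul H.p_pos]
    calc _ ≤ 1 * ∑' n : ℕ, C₁ * a ^ 3 * dk (ν + 2 * (n + 1)) ^ 2 := by
          gcongr
          refine (lpN_mono H.p_pos fun k => enorm_tsum_le_tsum_enorm).trans
            ((lpN_tsum_le H.one_le_p _).trans ?_)
          exact ENNReal.tsum_le_tsum fun n => hW _ (by omega)
      _ ≤ 1 * ((C₁ + 16 * C₂) * a ^ 3 * dk ν) := by
          rw [ENNReal.tsum_mul_left]
          gcongr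
          · exact le_self_add
          · exact tsum_dk_sq_le ν
      _ ≤ X * dk ν := by
          rw [one_mul]
          exact mul_le_mul_left (hsm.trans (mul_le_of_le_one_left' hρ)) _
  · refine (g0.const_mul H c).mono Subset.rfl ?_
    have hosc : ENNReal.ofReal (oscB ε (winL ν) (winR ν)) ≤ ENNReal.ofReal (2 * 8) * dk ν :=
      (ENNReal.ofReal_le_ofReal (oscB_window_le H.pos H.eps_lt_one hν0)).trans
        (ofReal_div_le_dk hν0 (by norm_num))
    have h16 : ENNReal.ofReal (2 * 8) = 16 := by norm_num
    rw [h16] at hosc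
    calc _ ≤ 1 * (C₂ * (16 * dk ν) * (a ^ 2 * a)) := by gcongr
      _ = 16 * C₂ * a ^ 3 * dk ν := by ring
      _ ≤ (C₁ + 16 * C₂) * a ^ 3 * dk ν := by gcongr; exact le_add_self
      _ ≤ ρ * X * dk ν := mul_le_mul_left hsm _
      _ = _ := by ring
  · have h := (hz.convAt H hρ (by simp) hν₁ hα hαp hν ht k).2.2
    simp only [zero_add] at h
    beta_reduce
    rw [h, show clamp (winL ν) (winR ν) t = t from clamp_of_mem ht]
    ring

end TailRep

/-! ### Solutions near infinity -/

theorem exists_ofReal_mul_le {Z y : ℝ≥0∞} (hZ : Z ≠ ⊤) (hy : y ≠ 0) :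
    ∃ x : ℝ, 0 < x ∧ x ≤ 1 ∧ Z * ENNReal.ofReal x ≤ y := by
  have h1 : Tendsto (fun x : ℝ => Z * ENNReal.ofReal x) (𝓝[>] 0) (𝓝 0) := by
    have h2 : Tendsto (fun x : ℝ => ENNReal.ofReal x) (𝓝[>] 0) (𝓝 0) := by
      have := (ENNReal.continuous_ofReal.tendsto 0).mono_left (nhdsWithin_le_nhds (s := Ioi (0 : ℝ)))
      rwa [ENNReal.ofReal_zero] at this
    simpa using ENNReal.Tendsto.const_mul h2 (Or.inr hZ)
  have h3 := (h1.eventually (gt_mem_nhds (pos_iff_ne_zero.2 hy))).and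
    (Ioc_mem_nhdsGT (zero_lt_one' ℝ))
  obtain ⟨x, hx, hx'⟩ := h3.exists
  exact ⟨x, hx'.1, hx'.2, hx.le⟩

theorem exists_mul_dk_le {Z y : ℝ≥0∞} (hZ : Z ≠ ⊤) (hy : y ≠ 0) (n₀ : ℕ) :
    ∃ ν : ℕ, n₀ ≤ ν ∧ 1 ≤ ν ∧ Z * dk ν ≤ y := by
  have h1 : Tendsto dk atTop (𝓝 0) := by
    have h2 := (tendsto_add_atTop_iff_nat 1).2 ENNReal.tendsto_inv_nat_nhds_zero
    refine h2.congr fun n => ?_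
    simp [dk]
  have h3 : Tendsto (fun ν => Z * dk ν) atTop (𝓝 0) := by
    simpa using ENNReal.Tendsto.const_mul h1 (Or.inr hZ)
  obtain ⟨ν, ⟨h4, h5⟩, h6⟩ := (((h3.eventually (gt_mem_nhds (pos_iff_ne_zero.2 hy))).and
    (eventually_ge_atTop n₀)).and (eventually_ge_atTop 1)).exists
  exact ⟨ν, h5, h6, h4.le⟩

/-- The choice of the parameters in the contraction estimate. -/
theorem exists_contraction_params {C : ℝ≥0∞} (hC : C ≠ ⊤) : ∃ δ : ℝ, 0 < δ ∧ δ ≤ 1 ∧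
    ∀ a : ℝ≥0∞, a ≠ ⊤ → ∃ ρ : ℝ≥0∞, ρ ≠ 0 ∧ ρ ≤ 1 ∧ ∀ X : ℝ≥0∞, X ≠ ⊤ → ∀ n₀ : ℕ, ∃ ν₁ : ℕ,
      n₀ ≤ ν₁ ∧ 1 ≤ ν₁ ∧ a + 2 * X * dk ν₁ ≤ a + 1 ∧ C * ((a + 1) ^ 2 * dk ν₁) ≤ ρ ∧
      C * (ρ * (a + 1) ^ 2 + X * dk ν₁ * (a + 1) + dk ν₁ * (a + 1) ^ 2 +
        (ENNReal.ofReal δ + X * dk ν₁) ^ 2) ≤ 1 := by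
  -- The order of choice matters: δ depends on C alone, ρ on the size a, and ν₁ on all of these and
  -- on X. Each of the four terms of the contraction constant receives 1/4.
  obtain ⟨δ, hδ, hδ1, hδC⟩ := exists_ofReal_mul_le (Z := 4 * C) (y := 4⁻¹) (by finiteness) (by simp)
  refine ⟨δ, hδ, hδ1, fun a ha => ?_⟩
  obtain ⟨x, hx, hx1, hxC⟩ := exists_ofReal_mul_le (Z := C * (a + 1) ^ 2) (y := 4⁻¹)
    (by finiteness) (by simp)
  refine ⟨ENNReal.ofReal x, by simpa using hx, ENNReal.ofReal_le_one.2 hx1, fun X hX n₀ => ?_⟩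
  obtain ⟨ν, h1, h2, h3⟩ := exists_mul_dk_le
    (Z := 2 * X + C * (a + 1) ^ 2 + C * X * (a + 1) + X)
    (y := min (ENNReal.ofReal x) (min 4⁻¹ (ENNReal.ofReal δ)))
    (by finiteness) (by simp [hx, hδ]) n₀
  have k1 : 2 * X * dk ν ≤ 4⁻¹ := by
    refine le_trans ?_ (h3.trans ((min_le_right _ _).trans (min_le_left _ _)))
    gcongr
    exact le_add_right (le_add_right le_self_add)
  have k2 : C * (a + 1) ^ 2 * dk ν ≤ min (ENNReal.ofReal x) (min 4⁻¹ (ENNReal.ofReal δ)) := by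
    refine le_trans ?_ h3
    gcongr
    exact le_add_right (le_add_right le_add_self)
  have k3 : C * X * (a + 1) * dk ν ≤ 4⁻¹ := by
    refine le_trans ?_ (h3.trans ((min_le_right _ _).trans (min_le_left _ _)))
    gcongr
    exact le_add_right le_add_self
  have k4 : X * dk ν ≤ ENNReal.ofReal δ := by
    refine le_trans ?_ (h3.trans ((min_le_right _ _).trans (min_le_right _ _)))
    gcongr
    exact le_add_self
  refine ⟨ν, h1, h2, ?_, ?_, ?_⟩
  · gcongr
    exact k1.trans (by rw [ENNReal.inv_le_one]; norm_num)
  · rw [← mul_assoc]; exact k2.trans (min_le_left _ _)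
  · have k5 : C * (ENNReal.ofReal δ + X * dk ν) ^ 2 ≤ 4⁻¹ := by
      refine le_trans ?_ hδC
      calc C * (ENNReal.ofReal δ + X * dk ν) ^ 2 ≤ C * (ENNReal.ofReal δ + ENNReal.ofReal δ) ^ 2 := by
            gcongr
        _ = 4 * C * ENNReal.ofReal δ * ENNReal.ofReal δ := by ring
        _ ≤ 4 * C * ENNReal.ofReal δ * 1 := by
            gcongr; exact ENNReal.ofReal_le_one.2 hδ1
        _ = _ := mul_one _
    calc _ = C * (a + 1) ^ 2 * ENNReal.ofReal x + C * X * (a + 1) * dk ν + C * (a + 1) ^ 2 * dk ν +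
          C * (ENNReal.ofReal δ + X * dk ν) ^ 2 := by ring
      _ ≤ 4⁻¹ + 4⁻¹ + 4⁻¹ + 4⁻¹ := by
          gcongr
          exact k2.trans ((min_le_right _ _).trans (min_le_left _ _))
      _ = 4 * 4⁻¹ := by ring
      _ = 1 := ENNReal.mul_inv_cancel (by simp) (by simp)

theorem enorm_sgnC_le {σ : ℝ} (hσ : σ = 1 ∨ σ = -1) : ‖sgnC σ‖ₑ ≤ 1 := by
  refine enorm_le_one_of_norm_le ?_
  have hpi := Real.pi_gt_three
  have h1 : ‖(σ : ℂ)‖ = 1 := by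
    rcases hσ with rfl | rfl <;> simp
  rw [sgnC, norm_mul, h1, one_mul, norm_div, Complex.norm_I, norm_mul, Complex.norm_real,
    Real.norm_of_nonneg Real.pi_pos.le, Complex.norm_ofNat, div_le_one (by positivity)]
  linarith

theorem sgnC_re (σ : ℝ) : (sgnC σ).re = 0 := by
  have : sgnC σ = ((σ / (8 * Real.pi) : ℝ) : ℂ) * Complex.I := by
    rw [sgnC]; push_cast; ring
  rw [this, Complex.re_ofReal_mul, Complex.I_re, mul_zero]

theorem enorm_le_ofReal {z : ℂ} {x : ℝ} (h : ‖z‖ ≤ x) : ‖z‖ₑ ≤ ENNReal.ofReal x := by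
  rw [← ofReal_norm]; exact ENNReal.ofReal_le_ofReal h

theorem TailRep.good {s p q ε : ℝ} (H : Adm s p q ε) {ρ N : ℝ≥0∞} (hρ : ρ ≤ 1) (hN : N ≠ ⊤) {ν₁ : ℕ}
    {f : ℤ → ℝ → ℂ} (h : TailRep s p ρ ν₁ N f) : Good s p (winL ν₁) f := by
  refine ⟨2 * N, by finiteness, fun ν => ?_⟩
  rw [div_eq_mul_inv]
  change RepOn s p f _ (2 * N * dk ν)
  rcases le_or_gt ν₁ ν with h1 | h1
  · exact (h.repOn H hρ hN h1).mono inter_subset_left le_rfl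
  -- The window just before ν₁ meets the half-line only inside the window ν₁; the earlier ones do
  -- not meet it.
  rcases eq_or_lt_of_le (Nat.succ_le_of_lt h1) with h2 | h2
  · refine (h.repOn H hρ hN le_rfl).mono (fun t ht => ⟨le_of_lt ht.2, ht.1.2.trans (winR_mono h1.le)⟩) ?_
    gcongr
    exact dk_anti h1.le
  · refine ((RepOn.zero H _).congr fun k t ht => ?_).mono Subset.rfl zero_le
    have h3 : winR ν ≤ winL ν₁ := by rw [← winL_add_two]; exact winL_mono h2
    exact absurd (show t ≤ winR ν from ht.1.2) (not_le.2 (h3.trans_lt ht.2))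

/-- The whole function is taken as remainder, with constant part 0, so ρX has to absorb N; X may be
large, since ν₁ is chosen after it. -/
theorem Good.tailRep {s p q ε T : ℝ} (H : Adm s p q ε) {R : ℤ → ℝ → ℂ} (h : Good s p T R) :
    ∃ N : ℝ≥0∞, N ≠ ⊤ ∧ ∀ {ρ X : ℝ≥0∞} {ν₁ : ℕ}, N ≤ ρ * X → T < winL ν₁ → TailRep s p ρ ν₁ X R := by
  obtain ⟨N, hN, h⟩ := h
  refine ⟨N, hN, fun {ρ X ν₁} hX hT ν hν => ?_⟩
  refine SplitOn.mono (SplitOn.of_repOn H ((h ν).mono (S' := window ν) (fun t ht => ⟨ht, ?_⟩) le_rfl))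
    Subset.rfl zero_le ?_
  · exact hT.trans_le (window_subset_Ici hν ht)
  · rw [div_eq_mul_inv, ← mul_assoc]
    exact mul_le_mul_left hX _

/-- Existence and uniqueness near infinity. -/
theorem exists_tail {s p q ε : ℝ} (H : Adm s p q ε) : ∃ δ : ℝ, 0 < δ ∧ δ ≤ 1 ∧
    (∀ a : ℝ≥0∞, a ≠ ⊤ → ∃ (ν₁ : ℕ) (C : ℝ≥0∞), 1 ≤ ν₁ ∧ C ≠ ⊤ ∧ ∀ {σ : ℝ} {α : ℤ → ℂ},
      (σ = 1 ∨ σ = -1) → (∀ k, ‖α k‖ ≤ δ) → (lpN p fun k => ‖α k‖ₑ) ≤ a →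
      ∃ R, IsSolution σ α (winL ν₁) R ∧ Good s p (winL ν₁) R ∧
        ∀ t, winL ν₁ < t → (lpN p fun k => ‖R k t‖ₑ) ≤ C * lpN p fun k => ‖α k‖ₑ) ∧
    (∀ {σ T : ℝ} {α : ℤ → ℂ} {R R' : ℤ → ℝ → ℂ}, (σ = 1 ∨ σ = -1) → 0 ≤ T → (∀ k, ‖α k‖ ≤ δ) →
      (lpN p fun k => ‖α k‖ₑ) ≠ ⊤ → IsSolution σ α T R → IsSolution σ α T R' → Good s p T R →
      Good s p T R' → ∀ k t, T < t → R k t = R' k t) := by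
  obtain ⟨C, hC, hsub⟩ := TailRep.exists_fullduh_sub H
  obtain ⟨C₀, hC₀, hzero⟩ := TailRep.exists_fullduh_zero H
  obtain ⟨C₃, hC₃, -, hpt⟩ := RepOn.exists_lpN_le H
  obtain ⟨δ, hδ, hδ1, hpar⟩ := exists_contraction_params hC
  refine ⟨δ, hδ, hδ1, fun a ha => ?_, ?_⟩
  · obtain ⟨ρ, hρ0, hρ, hpar⟩ := hpar a ha
    -- The radius K‖α‖ is linear in the norm of α, which yields the linear bound for R. The
    -- parameters are chosen for the larger radius K · a, so that ν₁ depends on a only.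
    set K := 2 * C₀ * a ^ 2 / ρ with hK
    have hKt : K ≠ ⊤ := ENNReal.div_ne_top (by finiteness) hρ0
    have hρt := ne_top_of_le_ne_top ENNReal.one_ne_top hρ
    obtain ⟨ν₁, -, hν₁, p1, p2, p3⟩ := hpar (K * a) (by finiteness) 0
    refine ⟨ν₁, C₃ * (2 * K), hν₁, by finiteness, fun {σ α} hσ hα hαa => ?_⟩
    set b := lpN p fun k => ‖α k‖ₑ with hb
    have hbt := ne_top_of_le_ne_top ha hαa
    have hX : K * b ≠ ⊤ := by finiteness
    have hXle : K * b ≤ K * a := by gcongr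
    have hα1 : ∀ k, ‖α k‖ ≤ 1 := fun k => (hα k).trans hδ1
    have h0 : TailRep s p ρ ν₁ (K * b / 2) (fun k t => sgnC σ * fullduh α (fun k _ => 0 + α k) k t) := by
      refine hzero hν₁ hα1 le_rfl hbt hρ (enorm_sgnC_le hσ) ?_
      calc C₀ * b ^ 3 = C₀ * b ^ 2 * b := by ring
        _ ≤ C₀ * a ^ 2 * b := by gcongr
        _ = ρ * (C₀ * a ^ 2 / ρ) * b := by rw [ENNReal.mul_div_cancel hρ0 hρt]
        _ = ρ * (K * b / 2) := by
            rw [hK]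
            simp only [div_eq_mul_inv]
            rw [show 2 * C₀ * a ^ 2 * ρ⁻¹ * b * 2⁻¹ = C₀ * a ^ 2 * ρ⁻¹ * b * (2 * 2⁻¹) by ring,
              ENNReal.mul_inv_cancel (by simp) (by simp)]
            ring
    obtain ⟨r, hr, hfix⟩ := (TailRep.gauge H hρ ν₁).exists_fixedPoint
      (Φ := fun r k t => sgnC σ * fullduh α (fun k t => r k t + α k) k t) hX h0
      fun r r' N hr hr' hN hrr => by
        refine hsub hν₁ hα1 (fun k => enorm_le_ofReal (hα k)) hαa ha hρ (X := K * a)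
          (by finiteness) (ne_top_of_le_ne_top hX hN) (by simp) (enorm_sgnC_le hσ) (hr.mono hXle)
          (hr'.mono hXle) hrr p1 (by finiteness) p2 p3
    refine ⟨r, isSolution_of_convAt (fun k t ht => ?_) (fun k t ht => hfix k t (le_of_lt ht)),
      hr.good H hρ hX, fun t ht => ?_⟩
    · obtain ⟨ν, hν, h1, h2⟩ := exists_window_ge_index (le_of_lt ht)
      exact (hr.convAt H hρ hX hν₁ hα1 hbt hν ⟨h1, h2.le⟩ k).1
    · obtain ⟨ν, hν, h1, h2⟩ := exists_window_ge_index (le_of_lt ht)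
      refine (hpt (hr.repOn H hρ hX hν) t ⟨h1, h2.le⟩).trans ?_
      calc C₃ * (2 * (K * b) * dk ν) ≤ C₃ * (2 * (K * b) * 1) := by gcongr; exact dk_le_one ν
        _ = _ := by ring
  · intro σ T α R R' hσ hT hα hαp hS hS' hG hG'
    obtain ⟨ρ, hρ0, hρ, hpar⟩ := hpar _ hαp
    obtain ⟨N, hN, hR⟩ := hG.tailRep H
    obtain ⟨N', hN', hR'⟩ := hG'.tailRep H
    have hρt := ne_top_of_le_ne_top ENNReal.one_ne_top hρ
    -- Large enough for both solutions to fit into the class with parameter ρ.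
    set X := N / ρ + N' / ρ with hX
    have hXt : X ≠ ⊤ := ENNReal.add_ne_top.2 ⟨ENNReal.div_ne_top hN hρ0, ENNReal.div_ne_top hN' hρ0⟩
    obtain ⟨n₀, hn₀⟩ := exists_nat_gt T
    obtain ⟨ν₁, hn, hν₁, p1, p2, p3⟩ := hpar X hXt n₀
    have hα1 : ∀ k, ‖α k‖ ≤ 1 := fun k => (hα k).trans hδ1
    have hTL : T < winL ν₁ := by
      have h1 : (n₀ : ℝ) ≤ ν₁ := by exact_mod_cast hn
      have := Real.pi_gt_three
      unfold winL
      nlinarith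
    have hNX : N ≤ ρ * X := by
      rw [hX, mul_add, ENNReal.mul_div_cancel hρ0 hρt]; exact le_self_add
    have hNX' : N' ≤ ρ * X := by
      rw [hX, mul_add, ENNReal.mul_div_cancel hρ0 hρt, ENNReal.mul_div_cancel hρ0 hρt]
      exact le_add_self
    have t1 := hR hNX hTL
    have t2 := hR' hNX' hTL
    have hP := TailRep.gauge (s := s) (p := p) H hρ ν₁
    have t3 : TailRep s p ρ ν₁ (X + X) (fun k t => R k t - R' k t) := by
      refine hP.congr (hP.add t1 (g := fun k t => -1 * R' k t) (fun ν hν => ?_) hXt hXt)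
        fun k t _ => by ring
      simpa using (t2 ν hν).const_mul H (-1)
    have hz := hP.eq_zero (X := X + X) (by finiteness) t3 fun M hM hd => by
      refine hP.congr (hsub hν₁ hα1 (fun k => enorm_le_ofReal (hα k)) le_rfl hαp hρ hXt
        (ne_top_of_le_ne_top (by finiteness) hM) (by simp) (enorm_sgnC_le hσ) t1 t2 hd p1
        (by finiteness) p2 p3) fun k t ht => ?_
      have ht' := hTL.trans_le ht
      rw [← hS.eq_fullduh ht', ← hS'.eq_fullduh ht']
    -- The contraction yields equality only from the window ν₁ on; local uniqueness brings it back
    -- to all of (T, ∞).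
    have hkey := backward_unique (t₁ := winL ν₁) H hT hα1 hαp (enorm_sgnC_le hσ)
      (hS.incSol H hT hG) (hS'.incSol H hT hG') (by simpa using hG) (by simpa using hG')
      fun k t ht => by
        have := hz k t ht
        rw [sub_eq_zero.1 this]
    exact fun k t ht => by simpa using hkey k t ht

/-! ### Solutions of the integrated system solve the integral system -/

theorem Good.tendsto {s p q ε T : ℝ} (H : Adm s p q ε) {α : ℤ → ℂ} {A : ℤ → ℝ → ℂ}
    (hG : Good s p T (fun k t => A k t - α k)) {ν : ℕ} (hν : T < winR ν) (k : ℤ) :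
    Tendsto (fun n : ℕ => A k (winR (ν + 2 * n))) atTop (𝓝 (α k)) := by
  obtain ⟨N, hN, h⟩ := hG
  obtain ⟨C, hC, -, hpt⟩ := RepOn.exists_lpN_le H
  rw [tendsto_iff_edist_tendsto_0]
  have h1 : Tendsto (fun n : ℕ => C * N * (n : ℝ≥0∞)⁻¹) atTop (𝓝 0) := by
    simpa using ENNReal.Tendsto.const_mul ENNReal.tendsto_inv_nat_nhds_zero
      (Or.inr (by finiteness : C * N ≠ ⊤))
  refine tendsto_of_tendsto_of_tendsto_of_le_of_le tendsto_const_nhds h1 (fun _ => zero_le)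
    fun n => ?_
  have h2 : winR (ν + 2 * n) ∈ window (ν + 2 * n) ∩ Ioi T :=
    ⟨⟨winL_le_winR _, le_rfl⟩, hν.trans_le (winR_mono (by omega))⟩
  beta_reduce
  rw [edist_eq_enorm_sub]
  refine (enorm_le_lpN H.p_pos (fun k => A k (winR (ν + 2 * n)) - α k) k).trans
    ((hpt (h _) _ h2).trans ?_)
  rw [div_eq_mul_inv, ← mul_assoc]
  gcongr
  push_cast
  calc (n : ℝ≥0∞) ≤ n + (ν + n + 1) := le_self_add
    _ = _ := by ring

/-- The increments over the tiling windows telescope and A tends to α along their ends. The limit is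
the system on the half-line, whose convergence comes from `exists_convAt`. -/
theorem IncSol.isSolution {s p q ε σ T : ℝ} (H : Adm s p q ε) (hT : 0 ≤ T) {α : ℤ → ℂ}
    (hα : ∀ k, ‖α k‖ ≤ 1) (hαp : (lpN p fun k => ‖α k‖ₑ) ≠ ⊤) {A : ℤ → ℝ → ℂ}
    (hI : IncSol (sgnC σ) α T A) (hG : Good s p T (fun k t => A k t - α k)) :
    IsSolution σ α T (fun k t => A k t - α k) := by
  have key : ∀ k t, T < t → ConvAt α A k t ∧ A k t - α k = sgnC σ * fullduh α A k t := by
    intro k t ht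
    have ht0 := hT.trans_lt ht
    obtain ⟨ν, hL, hR⟩ := exists_window_mem ht0
    obtain ⟨M, hM, hrep⟩ := hG.repOn_Icc H hαp
    have hlim := hG.tendsto H (ht.trans hR) k
    obtain ⟨N, hN, hw⟩ := hG
    have hsub : ∀ n : ℕ, window (ν + 2 * (n + 1)) ⊆ Ioi T := fun n x hx => by
      refine (ht.trans hR).trans_le (le_trans ?_ hx.1)
      change winR ν ≤ winL _
      rw [winL_step]
      exact winR_mono (by omega)
    obtain ⟨hc, hs, he⟩ := exists_convAt H ht0 hL.le hR.le hα hαp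
      (fun k => (hI.cont k).mono fun x hx => ht.trans_le hx) hM hN (hrep ht hL.le le_rfl)
      (fun n => (hw (ν + 2 * (n + 1))).mono (fun x hx => ⟨hx, hsub n hx⟩)
        (by rw [div_eq_mul_inv]; rfl)) k
    refine ⟨hc, ?_⟩
    have h1 : ∀ n : ℕ, A k t = A k (winR (ν + 2 * n)) + sgnC σ * (duh α A k t (winR ν) +
        ∑ m ∈ Finset.range n, duh α A k (winL (ν + 2 * (m + 1))) (winR (ν + 2 * (m + 1)))) := by
      intro n
      induction n with
      | zero => simpa using hI.inc k t (winR ν) ht hR.le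
      | succ n ih =>
        have h2 := hI.inc k (winL (ν + 2 * (n + 1))) (winR (ν + 2 * (n + 1)))
          (by rw [winL_step]; exact (ht.trans hR).trans_le (winR_mono (by omega)))
          (winL_le_winR _)
        rw [Finset.sum_range_succ, ih]
        rw [show A k (winR (ν + 2 * n)) = A k (winL (ν + 2 * (n + 1))) by rw [winL_step], h2]
        ring
    have h2 := hlim.add (((tendsto_const_nhds (x := duh α A k t (winR ν))).add
      hs.hasSum.tendsto_sum_nat).const_mul (sgnC σ))
    rw [← he] at h2
    have h3 := tendsto_nhds_unique (tendsto_const_nhds.congr h1) h2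
    rw [h3]; ring
  have e : (fun (k : ℤ) (t : ℝ) => A k t - α k + α k) = A := by
    funext k t; ring
  refine isSolution_of_convAt (fun k t ht => ?_) fun k t ht => ?_
  · simp only [e]; exact (key k t ht).1
  · simp only [e]; exact (key k t ht).2

/-! ### Continuation to small times -/

/-- Local solutions grow by at most the factor `G`. -/
def StepBound (s p ε : ℝ) (c : ℂ) (C G : ℝ≥0∞) : Prop :=
  ∀ {ν : ℕ} {u v : ℝ} {α A₀ : ℤ → ℂ} {M : ℝ≥0∞} {B : ℤ → ℝ → ℂ}, 0 < u → u ≤ v → winL ν ≤ u →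
    v ≤ winR ν → (∀ k, ‖α k‖ ≤ 1) → (lpN p fun k => ‖α k‖ₑ) ≤ M → (lpN p fun k => ‖A₀ k‖ₑ) ≤ M →
    M ≠ ⊤ → C * ENNReal.ofReal (oscB ε u v) * M ^ 2 ≤ 1 →
    RepOn s p B (Icc u v) (2 * lpN p fun k => ‖A₀ k‖ₑ) →
    (∀ k, ∀ t ∈ Icc u v, B k t = A₀ k + c * duh α B k t v) →
    ∀ t ∈ Icc u v, (lpN p fun k => ‖B k t‖ₑ) ≤ G * lpN p fun k => ‖A₀ k‖ₑ

/-- The representation by norm 2‖A₀‖ already bounds the pointwise ℓ^p norms, so C = 0 is possible;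
the growth factor exceeds one. -/
theorem exists_stepBound {s p q ε : ℝ} (H : Adm s p q ε) (c : ℂ) :
    ∃ C G : ℝ≥0∞, C ≠ ⊤ ∧ G ≠ ⊤ ∧ 1 ≤ G ∧ StepBound s p ε c C G := by
  obtain ⟨C, hC, hC1, hpt⟩ := RepOn.exists_lpN_le H
  refine ⟨0, C * 2, by simp, by finiteness, hC1.trans (le_mul_of_one_le_right' (by norm_num)), ?_⟩
  intro ν u v α A₀ M B _ _ _ _ _ _ _ _ _ hB _ t ht
  rw [mul_assoc]
  exact hpt hB t ht

/-- Conservation of the ℓ² norm: growth factor 1, hence no loss however many steps are made. -/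
theorem exists_stepBound_two {s q ε : ℝ} (H : Adm s 2 q ε) {c : ℂ} (hc : ‖c‖ₑ ≤ 1)
    (hre : c.re = 0) : ∃ C : ℝ≥0∞, C ≠ ⊤ ∧ StepBound s 2 ε c C 1 := by
  obtain ⟨C, hC, h⟩ := exists_local_lpN_le H
  refine ⟨C, hC, ?_⟩
  intro ν u v α A₀ M B h1 h2 h3 h4 h5 h6 h7 h8 h9 h10 h11 t ht
  rw [one_mul]
  exact h h1 h2 h3 h4 hre hc h5 h6 h7 h8 h9 h10 h11 t ht

/-- Continuation of solutions to times below `T`. -/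
theorem exists_continuation {s p q ε : ℝ} (H : Adm s p q ε) {c : ℂ} (hc : ‖c‖ₑ ≤ 1) {C G : ℝ≥0∞}
    (hC : C ≠ ⊤) (hG1 : 1 ≤ G) (hstep : StepBound s p ε c C G) {T t₀ : ℝ} (hT : 0 < T) (hTt : T ≤ t₀)
    {M : ℝ≥0∞} (hM : M ≠ ⊤) : ∃ n : ℕ, ∀ {T₁ : ℝ} {α : ℤ → ℂ} {A : ℤ → ℝ → ℂ} {L : ℝ≥0∞}, T₁ < t₀ →
      (∀ k, ‖α k‖ ≤ 1) → (lpN p fun k => ‖α k‖ₑ) ≤ M → IncSol c α T₁ A →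
      Good s p T₁ (fun k t => A k t - α k) → (lpN p fun k => ‖A k t₀‖ₑ) ≤ L → G ^ n * L ≤ M →
      ∃ (T' : ℝ) (A' : ℤ → ℝ → ℂ), 0 < T' ∧ T' < T ∧ IncSol c α T' A' ∧
        Good s p T' (fun k t => A' k t - α k) := by
  obtain ⟨C₁, hC₁, hloc⟩ := exists_local H
  obtain ⟨η₀, hη₀, hη₁, hsh⟩ := exists_short H.pos H.eps_lt_one (τ₀ := T / 4) (by positivity)
    (X := (C + C₁) * M ^ 2) (by finiteness)
  -- The bound T/4 keeps all steps at times at least T/4, where one η works throughout.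
  set η := min η₀ (T / 4) with hη
  have hη0 : 0 < η := by positivity
  have hηT : η ≤ T / 4 := min_le_right _ _
  have hηη : η ≤ η₀ := min_le_left _ _
  have step : ∀ {T₁ t : ℝ} {α : ℤ → ℂ} {A : ℤ → ℝ → ℂ} {L : ℝ≥0∞}, T / 4 + η ≤ t → T₁ < t →
      (∀ k, ‖α k‖ ≤ 1) → (lpN p fun k => ‖α k‖ₑ) ≤ M → IncSol c α T₁ A →
      Good s p T₁ (fun k t => A k t - α k) → (lpN p fun k => ‖A k t‖ₑ) ≤ L → L ≤ M →
      ∃ A' : ℤ → ℝ → ℂ, IncSol c α (t - η) A' ∧ Good s p (t - η) (fun k t => A' k t - α k) ∧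
        -- The new base point lies only η/2 to the left, since the glued solution is known on the
        -- open half-line (t - η, ∞).
        (lpN p fun k => ‖A' k (t - η / 2)‖ₑ) ≤ G * L := by
    intro T₁ t α A L ht hT₁ hα hαM hI hGd hAL hLM
    have hu : 0 < t - η := by linarith
    have hut : t - η ≤ t := by linarith
    obtain ⟨ν, hL, hR⟩ := exists_window_of_short (v := t) hu (by linarith)
    have hsm := hsh (t - η) t (by linarith) hut (by linarith)
    have hosc : (C + C₁) * ENNReal.ofReal (oscB ε (t - η) t) * M ^ 2 ≤ 1 := by
      rw [mul_right_comm]; exact hsm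
    obtain ⟨B, hB, hBeq⟩ := hloc (A₀ := fun k => A k t) (c := c) univ hu hut hL hR hc hα hαM
      (hAL.trans hLM) hM (le_trans (by gcongr; exact le_add_self) hosc)
    have hBeq' : ∀ k, ∀ x ∈ Icc (t - η) t, B k x = A k t + c * duh α B k x t := fun k x hx => by
      rw [hBeq k x hx, indicator_of_mem (mem_univ k)]
    have hLt := ne_top_of_le_ne_top hM (hAL.trans hLM)
    obtain ⟨A', h1, h2, -, h4⟩ := IncSol.glue H hu hut hT₁ hL hR hα (ne_top_of_le_ne_top hM hαM) hI hGd
      (M := 2 * lpN p fun k => ‖A k t‖ₑ) (by finiteness) hB hBeq'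
    have hmid : t - η / 2 ∈ Icc (t - η) t := ⟨by linarith, by linarith⟩
    refine ⟨A', h1, h2, ?_⟩
    have h5 := hstep hu hut hL hR hα hαM (hAL.trans hLM) hM
      (le_trans (by gcongr; exact le_self_add) hosc) hB hBeq' _ hmid
    simp only [h4 _ _ hmid]
    exact h5.trans (by gcongr)
  have ht0 : T / 4 + η ≤ t₀ := by linarith
  -- After n half-steps the base point lies in [T/4 + η, T/4 + 3η/2); a last step ends in [T/4, T/4
  -- + η/2), below T. This n does not depend on α.
  set n := ⌊(t₀ - (T / 4 + η)) / (η / 2)⌋₊ with hn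
  have hn1 := Nat.floor_le (a := (t₀ - (T / 4 + η)) / (η / 2))
    (div_nonneg (by linarith) (by positivity))
  have hn2 := Nat.lt_floor_add_one ((t₀ - (T / 4 + η)) / (η / 2))
  rw [← hn, le_div_iff₀ (by positivity)] at hn1
  rw [← hn, div_lt_iff₀ (by positivity)] at hn2
  refine ⟨n, fun {T₁ α A L} hT₁ hα hαM hI hGd hAL hLM => ?_⟩
  have key : ∀ m : ℕ, m ≤ n → ∃ (T₂ : ℝ) (A' : ℤ → ℝ → ℂ), T₂ < t₀ - m * (η / 2) ∧ IncSol c α T₂ A' ∧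
      Good s p T₂ (fun k t => A' k t - α k) ∧
      (lpN p fun k => ‖A' k (t₀ - m * (η / 2))‖ₑ) ≤ G ^ m * L := by
    intro m
    induction m with
    | zero => intro _; exact ⟨T₁, A, by simpa using hT₁, hI, hGd, by simpa using hAL⟩
    | succ m ih =>
      intro hm
      obtain ⟨T₂, A', h1, h2, h3, h4⟩ := ih (by omega)
      have hmn : (m : ℝ) * (η / 2) ≤ n * (η / 2) := by
        gcongr; omega
      obtain ⟨A'', h5, h6, h7⟩ := step (t := t₀ - m * (η / 2)) (by linarith) h1 hα hαM h2 h3 h4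
        (le_trans (by gcongr; omega) hLM)
      have e : t₀ - ((m + 1 : ℕ) : ℝ) * (η / 2) = t₀ - m * (η / 2) - η / 2 := by push_cast; ring
      refine ⟨_, A'', ?_, h5, h6, ?_⟩
      · rw [e]; linarith
      · rw [e, pow_succ', mul_assoc]; exact h7
  obtain ⟨T₂, A', h1, h2, h3, h4⟩ := key n le_rfl
  obtain ⟨A'', h5, h6, -⟩ := step (t := t₀ - n * (η / 2)) (by linarith) h1 hα hαM h2 h3 h4 hLM
  exact ⟨_, A'', by linarith, by linarith, h5, h6⟩

/-! ### Changing the representative -/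

theorem HasImproperIntegral.congr {f g : ℝ → ℂ} {t : ℝ} {J : ℂ} (h : HasImproperIntegral f t J)
    (hfg : ∀ τ, t ≤ τ → g τ = f τ) : HasImproperIntegral g t J := by
  have h1 : ∀ b, t ≤ b → EqOn f g (uIcc t b) := fun b hb τ hτ => by
    rw [uIcc_of_le hb] at hτ
    exact (hfg τ hτ.1).symm
  refine ⟨fun b hb => (h.1 b hb).congr fun τ hτ => h1 b hb (uIoc_subset_uIcc hτ),
    h.2.congr' ?_⟩
  filter_upwards [eventually_ge_atTop t] with b hb
  exact intervalIntegral.integral_congr (h1 b hb)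

theorem IsSolution.congr {σ T : ℝ} {α : ℤ → ℂ} {R R' : ℤ → ℝ → ℂ} (h : IsSolution σ α T R)
    (hR : ∀ k t, T < t → R' k t = R k t) : IsSolution σ α T R' := by
  intro k t ht
  obtain ⟨J, S, D, h1, h2, h3, h4⟩ := h k t ht
  refine ⟨J, S, D, fun j => (h1 j).congr fun τ hτ => ?_, h2, h3.congr fun τ hτ => ?_, ?_⟩
  · simp only [cubicTerm, hR _ τ (ht.trans_le hτ)]
  · simp only [selfTerm, hR _ τ (ht.trans_le hτ)]
  · rw [hR k t ht, h4]

theorem IsSolution.mono {σ T T' : ℝ} {α : ℤ → ℂ} {R : ℤ → ℝ → ℂ} (h : IsSolution σ α T R)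
    (hT : T ≤ T') : IsSolution σ α T' R := fun k t ht => h k t (hT.trans_lt ht)

theorem MemX.congr {s p T : ℝ} {R R' : ℤ → ℝ → ℂ} (h : MemX s p T R)
    (hR : ∀ k t, T < t → R' k t = R k t) : MemX s p T R' := by
  have e : ∀ (Q : ℤ → ℝ → ℂ), (∀ k, EqOn (Q k) (R' k) (Ioi T)) ↔ ∀ k, EqOn (Q k) (R k) (Ioi T) :=
    fun Q => forall_congr' fun k =>
      ⟨fun hQ t ht => (hQ ht).trans (hR k t ht), fun hQ t ht => (hQ ht).trans (hR k t ht).symm⟩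
  unfold MemX xNormOn at h ⊢
  simpa only [e] using h

/-! ### The main statements -/

theorem lpN_enorm_eq {p : ℝ} {P : ℝ≥0∞} (hP : P.toReal = p) (hp : 0 < p) (α : lp (fun _ : ℤ => ℂ) P) :
    (lpN p fun k => ‖α k‖ₑ) = ENNReal.ofReal ‖α‖ := by
  have h1 : Summable fun k => ‖α k‖ ^ p := by
    have := (lp.memℓp α).summable (by rw [hP]; exact hp)
    rwa [hP] at this
  rw [lp.norm_eq_tsum_rpow (by rw [hP]; exact hp), hP, lpN,
    ← ENNReal.ofReal_rpow_of_nonneg (tsum_nonneg fun k => by positivity) (by positivity),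
    ENNReal.ofReal_tsum_of_nonneg (fun k => by positivity) h1]
  congr 1
  refine tsum_congr fun k => ?_
  rw [← ofReal_norm, ENNReal.ofReal_rpow_of_nonneg (norm_nonneg _) hp.le]

/-- The entries are bounded by the norm of α, so the real supremum is genuine and not the default 0
of an unbounded family. -/
theorem norm_le_of_iSup_lt {P : ℝ≥0∞} (hP : P ≠ 0) (α : lp (fun _ : ℤ => ℂ) P) {δ : ℝ}
    (h : (⨆ k : ℤ, ‖α k‖) < δ) (k : ℤ) : ‖α k‖ ≤ δ := by
  have hb : BddAbove (range fun k : ℤ => ‖α k‖) :=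
    ⟨‖α‖, by rintro _ ⟨k, rfl⟩; exact lp.norm_apply_le_norm hP α k⟩
  exact (le_ciSup hb k).trans h.le

/-- Existence and uniqueness on `(T, ∞)`. -/
def WellPosed (s p σ T : ℝ) (α : ℤ → ℂ) : Prop :=
  ∃ R : ℤ → ℝ → ℂ, MemX s p T R ∧ IsSolution σ α T R ∧
    ∀ R' : ℤ → ℝ → ℂ, MemX s p T R' → IsSolution σ α T R' → ∀ k, EqOn (R' k) (R k) (Ioi T)

/-- For small data ν₁ is fixed with a = 1, then the number n of continuation steps, and only then
the size of α. For large T the solution near infinity is enough and nothing is continued. -/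
theorem exists_wellPosed {s p q ε : ℝ} (H : Adm s p q ε) {σ : ℝ} (hσ : σ = 1 ∨ σ = -1) :
    (∀ T : ℝ, 0 < T → ∃ δ : ℝ, 0 < δ ∧ ∀ α : ℤ → ℂ, (lpN p fun k => ‖α k‖ₑ) ≤ ENNReal.ofReal δ →
      WellPosed s p σ T α) ∧
    (∃ δ : ℝ, 0 < δ ∧ ∀ a : ℝ≥0∞, a ≠ ⊤ → ∃ T₀ : ℝ, 0 < T₀ ∧ ∀ T : ℝ, T₀ ≤ T → ∀ α : ℤ → ℂ,
      (lpN p fun k => ‖α k‖ₑ) ≤ a → (∀ k, ‖α k‖ ≤ δ) → WellPosed s p σ T α) := by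
  obtain ⟨δ, hδ, hδ1, hex, huniq⟩ := exists_tail H
  have hcσ := enorm_sgnC_le hσ
  -- a solution on a larger half-line suffices
  have main : ∀ {T T' : ℝ} {α : ℤ → ℂ} {A : ℤ → ℝ → ℂ}, 0 < T' → T' < T → (∀ k, ‖α k‖ ≤ δ) →
      (lpN p fun k => ‖α k‖ₑ) ≠ ⊤ → IncSol (sgnC σ) α T' A → Good s p T' (fun k t => A k t - α k) →
      WellPosed s p σ T α := by
    intro T T' α A hT' hT hα hαp hI hG
    have hα1 : ∀ k, ‖α k‖ ≤ 1 := fun k => (hα k).trans hδ1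
    have hT0 : 0 ≤ T := (hT'.trans hT).le
    have hS := (hI.isSolution H hT'.le hα1 hαp hG).mono hT.le
    refine ⟨fun k t => A k t - α k, hG.memX H hT'.le hT hα1 hαp (c := sgnC σ) (by simpa using hI), hS,
      fun R' hX' hS' k t ht => ?_⟩
    exact huniq hσ hT0 hα hαp hS' hS (hS'.good H hT0 hα1 hαp hX') (hG.mono hT.le) k t ht
  refine ⟨fun T hT => ?_, δ, hδ, fun a ha => ?_⟩
  · obtain ⟨ν₁, C, hν₁, hC, hsol⟩ := hex 1 ENNReal.one_ne_top
    obtain ⟨C', G, hC', hG, hG1, hstep⟩ := exists_stepBound H (sgnC σ)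
    have hL0 := winL_pos hν₁
    obtain ⟨n, hcont⟩ := exists_continuation H hcσ hC' hG1 hstep hT (t₀ := winL ν₁ + T) (by linarith)
      ENNReal.one_ne_top
    -- x keeps the norm below 1 through n steps of growth G, starting from at most (C + 1)‖α‖.
    obtain ⟨x, hx, hx1, hxC⟩ := exists_ofReal_mul_le (Z := G ^ n * (C + 1)) (y := 1)
      (by finiteness) one_ne_zero
    refine ⟨min δ x, lt_min hδ hx, fun α hα => ?_⟩
    have hαx : (lpN p fun k => ‖α k‖ₑ) ≤ ENNReal.ofReal x :=
      hα.trans (ENNReal.ofReal_le_ofReal (min_le_right _ _))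
    have hαt : (lpN p fun k => ‖α k‖ₑ) ≠ ⊤ := ne_top_of_le_ne_top (by simp) hα
    have hαδ : ∀ k, ‖α k‖ ≤ δ := fun k => by
      have := ((enorm_le_lpN H.p_pos α k).trans hα).trans
        (ENNReal.ofReal_le_ofReal (min_le_left _ _))
      rw [← ofReal_norm] at this
      exact (ENNReal.ofReal_le_ofReal_iff hδ.le).1 this
    have hα1 : ∀ k, ‖α k‖ ≤ 1 := fun k => (hαδ k).trans hδ1
    have hαle1 : (lpN p fun k => ‖α k‖ₑ) ≤ 1 := hαx.trans (ENNReal.ofReal_le_one.2 hx1)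
    obtain ⟨R, hS, hGd, hR⟩ := hsol hσ hαδ hαle1
    have hL : (lpN p fun k => ‖R k (winL ν₁ + T) + α k‖ₑ) ≤ (C + 1) * lpN p fun k => ‖α k‖ₑ := by
      refine (lpN_mono H.p_pos fun k => enorm_add_le _ _).trans
        ((lpN_add_le H.one_le_p _ _).trans ?_)
      rw [add_mul, one_mul]
      gcongr
      exact hR _ (by linarith)
    have hM : G ^ n * ((C + 1) * lpN p fun k => ‖α k‖ₑ) ≤ 1 := by
      rw [← mul_assoc]
      exact le_trans (by gcongr) hxC
    obtain ⟨T', A', h1, h2, h3, h4⟩ := hcont (A := fun k t => R k t + α k)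
      (by linarith : winL ν₁ < winL ν₁ + T) hα1 hαle1 (hS.incSol H hL0.le hGd) (by simpa using hGd)
      hL hM
    exact main h1 h2 hαδ hαt h3 h4
  · obtain ⟨ν₁, C, hν₁, hC, hsol⟩ := hex a ha
    have hL0 := winL_pos hν₁
    refine ⟨winL ν₁ + 1, by linarith, fun T hT α hαa hα => ?_⟩
    obtain ⟨R, hS, hGd, -⟩ := hsol hσ hα hαa
    exact main hL0 (by linarith) hα (ne_top_of_le_ne_top ha hαa) (hS.incSol H hL0.le hGd)
      (by simpa using hGd)

/-- With growth factor 1 the bound (C + 1)‖α‖ is never exceeded, so every T > 0 is reached without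
smallness in ℓ². The solutions Q T agree on common domains by uniqueness, and t ↦ Q (t/2) t glues
them on (0, ∞). -/
theorem exists_wellPosed_two {s q ε : ℝ} (H : Adm s 2 q ε) {σ : ℝ} (hσ : σ = 1 ∨ σ = -1) :
    ∃ δ : ℝ, 0 < δ ∧ ∀ α : ℤ → ℂ, (lpN 2 fun k => ‖α k‖ₑ) ≠ ⊤ → (∀ k, ‖α k‖ ≤ δ) →
      ∃ R : ℤ → ℝ → ℂ, (∀ T : ℝ, 0 < T → MemX s 2 T R) ∧ IsSolution σ α 0 R ∧
        ∀ R' : ℤ → ℝ → ℂ, (∀ T : ℝ, 0 < T → MemX s 2 T R') → IsSolution σ α 0 R' →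
          ∀ k, EqOn (R' k) (R k) (Ioi 0) := by
  obtain ⟨δ, hδ, hδ1, hex, huniq⟩ := exists_tail H
  have hcσ := enorm_sgnC_le hσ
  refine ⟨δ, hδ, fun α hαt hα => ?_⟩
  have hα1 : ∀ k, ‖α k‖ ≤ 1 := fun k => (hα k).trans hδ1
  obtain ⟨ν₁, C, hν₁, hC, hsol⟩ := hex _ hαt
  obtain ⟨R₀, hS₀, hG₀, hR₀⟩ := hsol hσ hα le_rfl
  obtain ⟨C', hC', hstep⟩ := exists_stepBound_two H hcσ (sgnC_re σ)
  have hL0 := winL_pos hν₁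
  have hsolT : ∀ T : ℝ, 0 < T → ∃ R : ℤ → ℝ → ℂ, MemX s 2 T R ∧ IsSolution σ α T R ∧ Good s 2 T R := by
    intro T hT
    obtain ⟨n, hcont⟩ := exists_continuation H hcσ hC' le_rfl hstep hT (t₀ := winL ν₁ + T)
      (by linarith) (M := (C + 1) * lpN 2 fun k => ‖α k‖ₑ) (by finiteness)
    have hL : (lpN 2 fun k => ‖R₀ k (winL ν₁ + T) + α k‖ₑ) ≤ (C + 1) * lpN 2 fun k => ‖α k‖ₑ := by
      refine (lpN_mono H.p_pos fun k => enorm_add_le _ _).trans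
        ((lpN_add_le H.one_le_p _ _).trans ?_)
      rw [add_mul, one_mul]
      gcongr
      exact hR₀ _ (by linarith)
    obtain ⟨T', A, h1, h2, h3, h4⟩ := hcont (A := fun k t => R₀ k t + α k)
      (by linarith : winL ν₁ < winL ν₁ + T) hα1 (le_mul_of_one_le_left' le_add_self)
      (hS₀.incSol H hL0.le hG₀) (by simpa using hG₀) hL (by rw [one_pow, one_mul])
    exact ⟨fun k t => A k t - α k, h4.memX H h1.le h2 hα1 hαt (c := sgnC σ) (by simpa using h3),
      (h3.isSolution H h1.le hα1 hαt h4).mono h2.le, h4.mono h2.le⟩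
  choose! Q hQX hQS hQG using hsolT
  have hQQ : ∀ T T', 0 < T → 0 < T' → ∀ k t, T < t → T' < t → Q T k t = Q T' k t := by
    intro T T' hT hT' k t ht ht'
    exact huniq hσ (hT.le.trans (le_max_left T T')) hα hαt ((hQS T hT).mono (le_max_left _ _))
      ((hQS T' hT').mono (le_max_right _ _)) ((hQG T hT).mono (le_max_left _ _))
      ((hQG T' hT').mono (le_max_right _ _)) k t (max_lt ht ht')
  have hR : ∀ T, 0 < T → ∀ k t, T < t → Q (t / 2) k t = Q T k t := fun T hT k t ht =>
    hQQ _ _ (by linarith) hT k t (by linarith) ht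
  refine ⟨fun k t => Q (t / 2) k t, fun T hT => (hQX T hT).congr (hR T hT), fun k t ht => ?_,
    fun R' hX' hS' k t ht => ?_⟩
  · have ht2 : 0 < t / 2 := half_pos ht
    exact (hQS _ ht2).congr (hR _ ht2) k t (by linarith)
  · have ht0 : (0 : ℝ) < t := ht
    have ht2 : 0 < t / 2 := half_pos ht0
    have hS'' := hS'.mono ht2.le
    exact huniq hσ ht2.le hα hαt hS'' (hQS _ ht2) (hS''.good H ht2.le hα1 hαt (hX' _ ht2))
      (hQG _ ht2) k t (by linarith)

end DeltaNLS
end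

theorem theorem1 (σ : ℝ) (hσ : σ = 1 ∨ σ = -1) :
    (∀ p s : ℝ, 1 < p → max (1 / p) (1 - 1 / p) < s → s < 1 →
      (∀ T : ℝ, 0 < T → ∃ δ : ℝ, 0 < δ ∧
        ∀ α : lp (fun _ : ℤ => ℂ) (ENNReal.ofReal p), ‖α‖ < δ →
          ∃ R : ℤ → ℝ → ℂ, DeltaNLS.MemX s p T R ∧ DeltaNLS.IsSolution σ α T R ∧
            ∀ R' : ℤ → ℝ → ℂ, DeltaNLS.MemX s p T R' → DeltaNLS.IsSolution σ α T R' →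
              ∀ k, EqOn (R' k) (R k) (Ioi T)) ∧
      (∃ δ : ℝ, 0 < δ ∧ ∀ A : ℝ, ∃ T₀ : ℝ, 0 < T₀ ∧ ∀ T : ℝ, T₀ ≤ T →
        ∀ α : lp (fun _ : ℤ => ℂ) (ENNReal.ofReal p), ‖α‖ ≤ A → (⨆ k : ℤ, ‖α k‖) < δ →
          ∃ R : ℤ → ℝ → ℂ, DeltaNLS.MemX s p T R ∧ DeltaNLS.IsSolution σ α T R ∧
            ∀ R' : ℤ → ℝ → ℂ, DeltaNLS.MemX s p T R' → DeltaNLS.IsSolution σ α T R' →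
              ∀ k, EqOn (R' k) (R k) (Ioi T))) ∧
    (∀ s : ℝ, 1 / 2 < s → s < 1 → ∃ δ : ℝ, 0 < δ ∧
      ∀ α : lp (fun _ : ℤ => ℂ) 2, (⨆ k : ℤ, ‖α k‖) < δ →
        ∃ R : ℤ → ℝ → ℂ, (∀ T : ℝ, 0 < T → DeltaNLS.MemX s 2 T R) ∧
          DeltaNLS.IsSolution σ α 0 R ∧
          ∀ R' : ℤ → ℝ → ℂ, (∀ T : ℝ, 0 < T → DeltaNLS.MemX s 2 T R') →
            DeltaNLS.IsSolution σ α 0 R' → ∀ k, EqOn (R' k) (R k) (Ioi 0)) := by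
  refine ⟨fun p s hp h1 h2 => ?_, fun s h1 h2 => ?_⟩
  · obtain ⟨q, ε, H⟩ := DeltaNLS.exists_adm hp h1 h2
    have hp0 : 0 < p := zero_lt_one.trans hp
    have hP : (ENNReal.ofReal p).toReal = p := ENNReal.toReal_ofReal hp0.le
    obtain ⟨hsmall, δ, hδ, hlarge⟩ := DeltaNLS.exists_wellPosed H hσ
    refine ⟨fun T hT => ?_, δ, hδ, fun A => ?_⟩
    · obtain ⟨δ', hδ', h⟩ := hsmall T hT
      refine ⟨δ', hδ', fun α hα => h α ?_⟩
      rw [DeltaNLS.lpN_enorm_eq hP hp0]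
      exact ENNReal.ofReal_le_ofReal hα.le
    -- For negative A, `ENNReal.ofReal A` is 0, which is harmless since no α has norm at most A.
    · obtain ⟨T₀, hT₀, h⟩ := hlarge (ENNReal.ofReal A) (by simp)
      refine ⟨T₀, hT₀, fun T hT α hα hsup => h T hT α ?_ ?_⟩
      · rw [DeltaNLS.lpN_enorm_eq hP hp0]
        exact ENNReal.ofReal_le_ofReal hα
      · exact DeltaNLS.norm_le_of_iSup_lt (by simpa using hp0) α hsup
  · obtain ⟨q, ε, H⟩ := DeltaNLS.exists_adm (p := 2) one_lt_two (by norm_num; linarith) h2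
    obtain ⟨δ, hδ, h⟩ := DeltaNLS.exists_wellPosed_two H hσ
    refine ⟨δ, hδ, fun α hα => h α ?_ (DeltaNLS.norm_le_of_iSup_lt two_ne_zero α hα)⟩
    rw [DeltaNLS.lpN_enorm_eq (by simp) two_pos]
    simp
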